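/- Let $k$ be an algebraically closed field and let $X=\overline M_{0,6}$ over $k$, realized as the closure of $M_{0,6}$ in the product of the lines $\overline M_{0,4}\simeq\mathbb P^1$ under all cross-ratios. For $S\subset\{1,\dots,6\}$ with $|S|\in\{2,3\}$ let $D_S$ be the boundary divisor of curves with a node $\nu$ separating the marks in $S$ from the others; so $D_{ij}\simeq\overline M_{0,5}$, with marks $\nu$ and the four marks other than $i,j$, and $D_{ijk}\simeq\overline M_{0,4}\times\overline M_{0,4}\simeq\mathbb P^1\times\mathbb P^1$, with marks $i,j,k,\nu$ on the first factor and $\nu$ and the other three marks on the second. Let $\Sigma=\{D_{ij},D_{ijk}\}$ be the set of all boundary divisors. For a projective variety $V$ let $\mathrm N_1(V)$ be the real vector space of one-cycles modulo numerical equivalence and let $\mathrm{NM}_1(V)\subset \mathrm N_1(V)$ be the dual of the closed cone of effective divisors, i.e. the set of classes $\gamma$ with $\gamma\cdot D\ge 0$ for all effective Cartier divisors $D$. Let $\mathrm{NM}_1(\Sigma,X)\subset \mathrm N_1(X)$ be the convex cone generated by the images of the cones $\mathrm{NM}_1(D)$, $D\in\Sigma$. For distinct $i,j,k\in\{1,\dots,6\}$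 consider the following classes in $\mathrm N_1(X)$: $A_{ij}$, the class of a general fibre of the map $\phi_\nu\colon D_{ij}\simeq\overline M_{0,5}\to\overline M_{0,4}$ forgetting $\nu$; $A_{ij;k}$, the class of a general fibre of the map $\phi_k\colon D_{ij}\to\overline M_{0,4}$ forgetting $k$; $C_{ij}$ and $C_{ij;k}$, the classes of the pull-back of a general line under the blow-downs $\beta_\nu\colon D_{ij}\to\mathbb P^2$ and $\beta_k\colon D_{ij}\to\mathbb P^2$, where $\beta_p$ puts the mark $p$ at infinity and records the differences of the other four points up to scaling; and $B_{ijk}$, the class of a general fibre of the projection of $D_{ijk}$ to the line $\overline M_{0,4}$ with marks $i,j,k,\nu$. (A fibre is general if it lies over a point of $M_{0,4}$; a line is general if it contains none of the four points blown up.) Then these classes are independent of the choice of the general fibre or line, and: 1. $\mathrm{NM}_1(\Sigma,X)$ is generated, as a convex cone, by the classes $A_{ij}$, $A_{ij;k}$ and $B_{ijk}$. 2. The classes $C_{ij}$ and $C_{ij;k}$ are redundant: for all distinct $i,j,k$, $$C_{ij}=A_{ij;k}+B_{ijk},\qquad C_{ij;k}=A_{ij}+B_{ijk}.$$ 3. Let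 $L$ be the pull-back of the hyperplane class under the blow-down $\beta_6\colon X\to\mathbb P^3$, $(t_1,\dots,t_5,t_6=\infty)\mapsto(t_5-t_1:t_5-t_2:t_5-t_3:t_5-t_4)$, and let $E_i=D_{i6}$ $(1\le i\le 5)$ and $E_{ij}=D_{ij6}$ $(1\le i<j\le 5)$ be its exceptional divisors. The intersection numbers of $A_{ij}$, $A_{ij;k}$, $B_{ijk}$ with the sixteen divisors $L,E_i,E_{ij}$ (the coordinates by which the classes are tabulated) are as follows (with $D_S=D_{S^c}$ if $|S|=3$, and zero for all divisors $D_S$ not listed). Put $\{i,j,k,l,a,b\}=\{1,\dots,6\}$. - $A_{ij}$: $-2$ on $D_{ij}$ and $1$ on $D_{ijm}$ for all $m\ne i,j$; on $L$ it is $0$ if $6\in\{i,j\}$ and $1$ otherwise. - $A_{ij;k}$: $-1$ on $D_{ij}$, and $1$ on $D_{ijk}$, $D_{kl}$, $D_{ka}$ and $D_{kb}$; on $L$ it is $2$ if $k=6$, $0$ if $6\in\{i,j\}$, and $1$ otherwise. - $B_{ijk}$: $-1$ on $D_{ijk}$, and $1$ on $D_{la}$, $D_{lb}$ and $D_{ab}$;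 on $L$ it is $1$ if $6\in\{l,a,b\}$ and $0$ otherwise. -/

import Mathlib

open AlgebraicGeometry CategoryTheory

universe u

/-!
# Cones of curves on closed subvarieties, and the moduli space of stable six-pointed rational curves

All varieties below are closed integral subvarieties of one ambient scheme `P` (later a projective
space over an algebraically closed field).  Such a subvariety `V` is recorded by its generic point
`δ`, so that `V = closure {δ}` with its reduced structure.  Its points are the specializations `x`
of `δ`, its function field is the residue field `κ(δ)`, and its local ring at `x` is the image of
`𝒪_{P,x}` in `κ(δ)`.
-/

namespace M06

noncomputable section

section Subvarieties

variable {P : Scheme.{u}}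

/-- The points of the subvariety `V = closure {δ}`. -/
abbrev Pts (δ : P) : Type u := {x : P // δ ⤳ x}

/-- The generic point of `V`, as a point of `V`. -/
def Pts.generic (δ : P) : Pts δ := ⟨δ, specializes_rfl⟩

/-- The homomorphism `𝒪_{P,x} → κ(δ)`, for a point `x` of `V = closure {δ}`. -/
def toFunctionField {δ : P} (x : Pts δ) : P.presheaf.stalk x.1 →+* P.residueField δ :=
  (P.presheaf.stalkSpecializes x.2 ≫ P.residue δ).hom

/-- The local ring `𝒪_{V,x}`, as a subring of the function field `κ(δ)` of `V`. -/
def localRing {δ : P} (x : Pts δ) : Subring (P.residueField δ) := (toFunctionField x).range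

/-- The rational function `g` on `V` is a unit of `𝒪_{V,x}`. -/
def IsUnitAt {δ : P} (x : Pts δ) (g : P.residueField δ) : Prop :=
  g ≠ 0 ∧ g ∈ localRing x ∧ g⁻¹ ∈ localRing x

/-- The rational function `g` on `V` is regular at `x` and vanishes there, that is, it lies in the
maximal ideal of `𝒪_{V,x}`. -/
def VanishesAt {δ : P} (x : Pts δ) (g : P.residueField δ) : Prop :=
  ∃ s ∈ IsLocalRing.maximalIdeal (P.presheaf.stalk x.1), toFunctionField x s = g

open Classical in
/-- The value at `η` in the residue field `κ(η)` of a rational function `g` on `V` which is regular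
at the point `η` (and `0` if `g` is not regular at `η`). -/
def valueAt {δ : P} (η : Pts δ) (g : P.residueField δ) : P.residueField η.1 :=
  if h : ∃ s, toFunctionField η s = g then (P.residue η.1).hom h.choose else 0

/-- A Cartier divisor on the integral variety `V`, given by local equations: a nonzero rational
function `eqn x` for each point `x`, such that `eqn x` is also a local equation at all points of a
neighbourhood of `x`. -/
structure CartierDivisor (δ : P) where
  eqn : Pts δ → (P.residueField δ)ˣ
  compatible : ∀ x : Pts δ, ∃ U : P.Opens, x.1 ∈ U ∧
    ∀ y : Pts δ, y.1 ∈ U → IsUnitAt y ((eqn x / eqn y : (P.residueField δ)ˣ) : P.residueField δ)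

/-- A Cartier divisor is effective if its local equations are regular. -/
def CartierDivisor.IsEffective {δ : P} (D : CartierDivisor δ) : Prop :=
  ∀ x : Pts δ, (D.eqn x : P.residueField δ) ∈ localRing x

/-- `D` is the Cartier divisor defined by the ideal of the closed subset `Z` (with its reduced
structure): at each point `x` of `V` the ideal of the regular functions at `x` that vanish along
`Z` is generated by the local equation of `D`. -/
def CartierDivisor.IsDivisorOf {δ : P} (D : CartierDivisor δ) (Z : Set (Pts δ)) : Prop :=
  ∀ (x : Pts δ) (g : P.residueField δ),
    (g ∈ localRing x ∧ ∀ y ∈ Z, y.1 ⤳ x.1 → VanishesAt y g) ↔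
      ∃ h ∈ localRing x, g = h * (D.eqn x : P.residueField δ)

/-- The point `η` is the generic point of an integral closed curve: its closure is
one-dimensional, that is, `η` is not closed and all its proper specializations are closed. -/
def IsCurvePoint (η : P) : Prop :=
  ¬ IsClosed {η} ∧ ∀ z : P, η ⤳ z → z ≠ η → IsClosed {z}

/-- The integral closed curves `C = closure {η}` contained in `V`. -/
abbrev Curve (δ : P) : Type u := {η : Pts δ // IsCurvePoint η.1}

open Classical in
/-- The order of an element `g = a / b` of a field at a one-dimensional local domain `R` with that
field of fractions: `length (R / a) - length (R / b)`. -/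
def ordAt {K : Type u} [Field K] (R : Subring K) (g : K) : ℤ :=
  if h : ∃ ab : R × R, ab.1 ≠ 0 ∧ ab.2 ≠ 0 ∧ g * (ab.2 : K) = (ab.1 : K) then
    ((Ring.ord R h.choose.1).toNat : ℤ) - ((Ring.ord R h.choose.2).toNat : ℤ)
  else 0

/-- A point of the curve `C ⊆ V` as a point of `V`. -/
def Curve.incl {δ : P} (C : Curve δ) (z : Pts C.1.1) : Pts δ := ⟨z.1, C.1.2.trans z.2⟩

/-- The intersection number `D · C` of a Cartier divisor on `V` with an integral curve `C ⊆ V`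
with generic point `η`.  After division by the local equation of `D` at `η` the local equations of
`D` are units at `η`; they restrict to local equations on `C` of a divisor whose line bundle is
`𝒪(D)|_C`, and `D · C` is the degree of that divisor.  (The schemes in question are of finite type
over an algebraically closed field, so that closed points have degree one.) -/
def CartierDivisor.degOn {δ : P} (D : CartierDivisor δ) (C : Curve δ) : ℤ :=
  ∑ᶠ z : {z : Pts C.1.1 // z.1 ≠ C.1.1},
    ordAt (localRing z.1)
      (valueAt C.1 ((D.eqn (C.incl z.1) / D.eqn C.1 : (P.residueField δ)ˣ) : P.residueField δ))

/-- One-cycles on `V` with real coefficients. -/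
abbrev Cycle (δ : P) : Type u := Curve δ →₀ ℝ

/-- The intersection number of a Cartier divisor with one-cycles. -/
def CartierDivisor.degCycle {δ : P} (D : CartierDivisor δ) : Cycle δ →ₗ[ℝ] ℝ :=
  Finsupp.linearCombination ℝ fun C => (D.degOn C : ℝ)

/-- The numerically trivial one-cycles. -/
def numTrivial (δ : P) : Submodule ℝ (Cycle δ) :=
  ⨅ D : CartierDivisor δ, LinearMap.ker D.degCycle

/-- `N₁(V) ⊗ ℝ`: one-cycles with real coefficients modulo numerical equivalence. -/
abbrev N1 (δ : P) : Type u := Cycle δ ⧸ numTrivial δ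

/-- The class of a one-cycle. -/
def cls {δ : P} : Cycle δ →ₗ[ℝ] N1 δ := (numTrivial δ).mkQ

/-- The intersection pairing of a Cartier divisor with classes of one-cycles. -/
def CartierDivisor.pairing {δ : P} (D : CartierDivisor δ) : N1 δ →ₗ[ℝ] ℝ :=
  (numTrivial δ).liftQ D.degCycle (iInf_le _ D)

/-- The cone `NM₁(V)`, dual to the closed cone generated by the effective divisors: the classes
that are non-negative on every effective divisor. -/
def NM1 (δ : P) : PointedCone ℝ (N1 δ) where
  carrier := {γ | ∀ D : CartierDivisor δ, D.IsEffective → 0 ≤ D.pairing γ}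
  add_mem' := fun ha hb D hD => by
    rw [map_add]
    exact add_nonneg (ha D hD) (hb D hD)
  zero_mem' := fun D _ => by rw [map_zero]
  smul_mem' := fun c γ hγ D hD => by
    have h : c • γ = (c : ℝ) • γ := rfl
    rw [h, map_smul]
    exact mul_nonneg c.2 (hγ D hD)

/-- A curve in the subvariety `W = closure {δ}` of `V = closure {ξ}`, as a curve in `V`. -/
def Curve.push {ξ : P} (δ : Pts ξ) (C : Curve δ.1) : Curve ξ :=
  ⟨⟨C.1.1, δ.2.trans C.1.2⟩, C.2⟩

/-- The push-forward of one-cycles from the subvariety `W = closure {δ}` to `V`. -/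
def pushCycle {ξ : P} (δ : Pts ξ) : Cycle δ.1 →ₗ[ℝ] Cycle ξ :=
  Finsupp.lmapDomain ℝ ℝ (Curve.push δ)

/-- The image of the cone `NM₁(W)` in `N₁(V)`, for the subvariety `W = closure {δ}` of `V`. -/
def imageNM1 {ξ : P} (δ : Pts ξ) : Set (N1 ξ) :=
  {γ | ∃ c : Cycle δ.1, cls c ∈ NM1 δ.1 ∧ γ = cls (pushCycle δ c)}

/-- `NM₁(Σ, V)`: the convex cone in `N₁(V)` generated by the images of the cones `NM₁(W)` for all
the integral closed subvarieties `W ⊆ V` whose underlying set belongs to `Σ`. -/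
def relNM1 (ξ : P) (Sigma : Set (Set (Pts ξ))) : PointedCone ℝ (N1 ξ) :=
  PointedCone.hull ℝ {γ | ∃ δ : Pts ξ, {x : Pts ξ | δ.1 ⤳ x.1} ∈ Sigma ∧ γ ∈ imageNM1 δ}

/-- The class of the one-cycle `∑ C`, over all curves `C` whose generic point lies in `Z`.  For a
one-dimensional closed subset `Z` these are its one-dimensional irreducible components. -/
def classOf {ξ : P} (Z : Set (Pts ξ)) : N1 ξ :=
  cls (∑ᶠ C : {C : Curve ξ // C.1 ∈ Z}, Finsupp.single C.1 (1 : ℝ))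

end Subvarieties

/-!
### The space `M̄_{0,6}`

The marks are the elements of `Fin 6`, written `1, 2, 3, 4, 5, 6` (where `6 = 0` in `Fin 6`).
For distinct points `t₁, …, t₆` of the line and an ordered quadruple `v` of distinct marks there is
the cross-ratio `(t_{v0} - t_{v1}) (t_{v2} - t_{v3}) / ((t_{v0} - t_{v2}) (t_{v1} - t_{v3}))`.
All the cross-ratios together embed `M_{0,6}` in a product of projective lines `M̄_{0,4}`, and
`M̄_{0,6}` is the closure of the image.  The product of lines is placed in a projective space by the
Segre embedding.
-/

section Moduli

attribute [local instance] MvPolynomial.gradedAlgebra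

/-- The ordered quadruples of distinct marks. -/
abbrev Quad : Type := Fin 4 ↪ Fin 6

/-- The homogeneous coordinates of the Segre embedding of the product of the lines indexed by
`Quad`: a choice of one of the two homogeneous coordinates in every factor. -/
abbrev SegreIdx : Type := Quad → Bool

variable (k : Type u) [Field k]

/-- The projective space over `k` with homogeneous coordinates indexed by `SegreIdx`. -/
abbrev SegreSpace : Scheme.{u} := Proj (MvPolynomial.homogeneousSubmodule SegreIdx k)

/-- The numerator of the cross-ratio of a quadruple, in `k[t₁, …, t₆]`. -/
def crossNum (v : Quad) : MvPolynomial (Fin 6) k :=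
  (MvPolynomial.X (v 0) - MvPolynomial.X (v 1)) * (MvPolynomial.X (v 2) - MvPolynomial.X (v 3))

/-- The denominator of the cross-ratio of a quadruple, in `k[t₁, …, t₆]`. -/
def crossDen (v : Quad) : MvPolynomial (Fin 6) k :=
  (MvPolynomial.X (v 0) - MvPolynomial.X (v 2)) * (MvPolynomial.X (v 1) - MvPolynomial.X (v 3))

/-- The pull-back of a homogeneous coordinate of the projective space to `k[t₁, …, t₆]`. -/
def segreCoord (s : SegreIdx) : MvPolynomial (Fin 6) k :=
  ∏ v : Quad, if s v then crossNum k v else crossDen k v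

/-- The homomorphism of coordinate rings given by all the cross-ratios. -/
def segreHom : MvPolynomial SegreIdx k →ₐ[k] MvPolynomial (Fin 6) k :=
  MvPolynomial.aeval (segreCoord k)

lemma crossNum_ne_zero (v : Quad) : crossNum k v ≠ 0 := by
  have h : ∀ i j : Fin 4, i ≠ j →
      (MvPolynomial.X (v i) - MvPolynomial.X (v j) : MvPolynomial (Fin 6) k) ≠ 0 := by
    intro i j hij h
    exact hij (v.injective (MvPolynomial.X_injective (sub_eq_zero.mp h)))
  exact mul_ne_zero (h 0 1 (by decide)) (h 2 3 (by decide))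

lemma crossDen_ne_zero (v : Quad) : crossDen k v ≠ 0 := by
  have h : ∀ i j : Fin 4, i ≠ j →
      (MvPolynomial.X (v i) - MvPolynomial.X (v j) : MvPolynomial (Fin 6) k) ≠ 0 := by
    intro i j hij h
    exact hij (v.injective (MvPolynomial.X_injective (sub_eq_zero.mp h)))
  exact mul_ne_zero (h 0 2 (by decide)) (h 1 3 (by decide))

lemma segreCoord_ne_zero (s : SegreIdx) : segreCoord k s ≠ 0 := by
  refine Finset.prod_ne_zero_iff.mpr fun v _ => ?_
  split_ifs
  · exact crossNum_ne_zero k v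
  · exact crossDen_ne_zero k v

lemma segreCoord_isHomogeneous (s : SegreIdx) :
    (segreCoord k s).IsHomogeneous (∑ _v : Quad, 2) := by
  refine MvPolynomial.IsHomogeneous.prod _ _ _ fun v _ => ?_
  have h : ∀ i j : Fin 6,
      (MvPolynomial.X i - MvPolynomial.X j : MvPolynomial (Fin 6) k).IsHomogeneous 1 :=
    fun i j => (MvPolynomial.isHomogeneous_X k i).sub (MvPolynomial.isHomogeneous_X k j)
  split_ifs
  · exact (h _ _).mul (h _ _)
  · exact (h _ _).mul (h _ _)

lemma segreDegree_pos : 0 < ∑ _v : Quad, 2 :=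
  Finset.sum_pos (fun _ _ => two_pos) ⟨Fin.castLEEmb (by decide), Finset.mem_univ _⟩

lemma ker_segreHom_isHomogeneous :
    (RingHom.ker (segreHom k)).IsHomogeneous (MvPolynomial.homogeneousSubmodule SegreIdx k) := by
  intro n p hp
  have hdec : (DirectSum.decompose (MvPolynomial.homogeneousSubmodule SegreIdx k) p n :
      MvPolynomial SegreIdx k) = MvPolynomial.homogeneousComponent n p :=
    MvPolynomial.decomposition.decompose'_apply p n
  rw [hdec]
  change segreHom k (MvPolynomial.homogeneousComponent n p) = 0
  replace hp : segreHom k p = 0 := hp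
  have hcomp : ∀ m, MvPolynomial.IsHomogeneous
      (segreHom k (MvPolynomial.homogeneousComponent m p)) ((∑ _v : Quad, 2) * m) := fun m =>
    (MvPolynomial.homogeneousComponent_isHomogeneous m p).aeval _ (segreCoord_isHomogeneous k)
  by_cases hn : n ∈ Finset.range (p.totalDegree + 1)
  · have hsum := congrArg (fun q => MvPolynomial.homogeneousComponent ((∑ _v : Quad, 2) * n)
      (segreHom k q)) (MvPolynomial.sum_homogeneousComponent p)
    simp only [map_sum, hp, map_zero] at hsum
    rw [Finset.sum_eq_single n] at hsum
    · rwa [MvPolynomial.homogeneousComponent_eq_self (hcomp n)] at hsum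
    · intro m _ hmn
      rw [MvPolynomial.homogeneousComponent_of_mem (hcomp m), if_neg]
      intro h
      exact hmn (Nat.eq_of_mul_eq_mul_left segreDegree_pos h).symm
    · intro h
      exact absurd hn h
  · rw [MvPolynomial.homogeneousComponent_eq_zero, map_zero]
    simpa using hn

lemma X_notMem_ker (s : SegreIdx) : MvPolynomial.X s ∉ RingHom.ker (segreHom k) := by
  intro h
  have h' : segreHom k (MvPolynomial.X s) = 0 := h
  rw [segreHom, MvPolynomial.aeval_X] at h'
  exact segreCoord_ne_zero k s h'

/-- The generic point of `M̄_{0,6}` in the projective space: the homogeneous prime ideal of the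
polynomials which vanish on the image of `M_{0,6}`.  So `M̄_{0,6} = closure {Mbar06 k}`. -/
def Mbar06 : SegreSpace k where
  asHomogeneousIdeal := ⟨RingHom.ker (segreHom k), ker_segreHom_isHomogeneous k⟩
  isPrime := RingHom.ker_isPrime (segreHom k)
  not_irrelevant_le := fun h => by
    refine X_notMem_ker k (fun _ => true) (h ?_)
    rw [HomogeneousIdeal.mem_irrelevant_iff, GradedRing.proj_apply]
    have hdec : (DirectSum.decompose (MvPolynomial.homogeneousSubmodule SegreIdx k)
        (MvPolynomial.X (fun _ => true)) 0 : MvPolynomial SegreIdx k) =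
        MvPolynomial.homogeneousComponent 0 (MvPolynomial.X (fun _ => true)) :=
      MvPolynomial.decomposition.decompose'_apply _ 0
    rw [hdec, MvPolynomial.homogeneousComponent_zero]
    simp

/-- The field of rational functions on `M̄_{0,6}`. -/
abbrev RatFun : Type u := (SegreSpace k).residueField (Mbar06 k)

/-- The points of `M̄_{0,6}`. -/
abbrev MPts : Type u := Pts (Mbar06 k)

/-- The ratio `X_s / X_t` of two homogeneous coordinates, as a rational function on `M̄_{0,6}`. -/
def coordRatio (s t : SegreIdx) : RatFun k :=
  ((SegreSpace k).residue (Mbar06 k)).hom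
    ((Proj.stalkIso (MvPolynomial.homogeneousSubmodule SegreIdx k) (Mbar06 k)).inv.hom
      (HomogeneousLocalization.mk
        { deg := 1
          num := ⟨MvPolynomial.X s, MvPolynomial.isHomogeneous_X k s⟩
          den := ⟨MvPolynomial.X t, MvPolynomial.isHomogeneous_X k t⟩
          den_mem := X_notMem_ker k t }))

open Classical in
/-- The cross-ratio `(t_{v0} - t_{v1}) (t_{v2} - t_{v3}) / ((t_{v0} - t_{v2}) (t_{v1} - t_{v3}))`
of four distinct marks, as a rational function on `M̄_{0,6}`. -/
def crossRatio (v : Fin 4 → Fin 6) : RatFun k :=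
  if hv : Function.Injective v then
    coordRatio k (fun w => decide (w = ⟨v, hv⟩)) (fun _ => false)
  else 0

/-- A constant, as a rational function on `M̄_{0,6}`. -/
def const : k →+* RatFun k :=
  haveI := (Mbar06 k).isPrime
  ((SegreSpace k).residue (Mbar06 k)).hom.comp
    ((Proj.stalkIso (MvPolynomial.homogeneousSubmodule SegreIdx k) (Mbar06 k)).inv.hom.comp
      ((HomogeneousLocalization.fromZeroRingHom (MvPolynomial.homogeneousSubmodule SegreIdx k)
        (Mbar06 k).asHomogeneousIdeal.toIdeal.primeCompl).comp
          (algebraMap k (MvPolynomial.homogeneousSubmodule SegreIdx k 0))))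

/-- The boundary divisor `D_S`: the stable curves with a node that separates the marks in `S` from
the other marks, that is, the points where each cross-ratio of two marks `i, j` in `S` and two
marks outside `S` takes the value `0` that it has when `t_i = t_j`. -/
def boundary (S : Finset (Fin 6)) : Set (MPts k) :=
  {x | ∀ v : Fin 4 → Fin 6, Function.Injective v → v 0 ∈ S → v 1 ∈ S → v 2 ∉ S → v 3 ∉ S →
    VanishesAt x (crossRatio k v)}

/-- The set `Σ` of all the boundary divisors `D_{ij}` and `D_{ijk}`. -/
def boundaryDivisors : Set (Set (MPts k)) :=
  {Z | ∃ S : Finset (Fin 6), (S.card = 2 ∨ S.card = 3) ∧ Z = boundary k S}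

/-- The class of the part of `Z` where the cross-ratio of `v` has the value `c`. -/
def fibreClass (Z : Set (MPts k)) (v : Fin 4 → Fin 6) (c : k) : N1 (Mbar06 k) :=
  classOf {x | x ∈ Z ∧ VanishesAt x (crossRatio k v - const k c)}

/-- The class of the pull-back of a line.  For five points `p, q, r₁, r₂, r₃` of a projective line
put `p` at infinity; then `((q - r₁) : (q - r₂) : (q - r₃))` is the blow-down `β_p` of `M̄_{0,5}` to
the plane.  The line is `a y₁ + b y₂ + c y₃ = 0`, in terms of the affine coordinates `y₁ / y₃` and
`y₂ / y₃`, which are cross-ratios. -/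
def lineClass (Z : Set (MPts k)) (p q r₁ r₂ r₃ : Fin 6) (a b c : k) : N1 (Mbar06 k) :=
  classOf {x | x ∈ Z ∧ crossRatio k ![q, r₁, r₃, p] ∈ localRing x ∧
    crossRatio k ![q, r₂, r₃, p] ∈ localRing x ∧
    VanishesAt x (const k a * crossRatio k ![q, r₁, r₃, p] +
      const k b * crossRatio k ![q, r₂, r₃, p] + const k c)}

/-- The families of classes `A_{ij}`, `A_{ij;k}`, `B_{ijk}`, `C_{ij}`, `C_{ij;k}` of curves in
`M̄_{0,6}`, as functions of their ordered indices. -/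
structure BoundaryClasses where
  A : Fin 6 → Fin 6 → N1 (Mbar06 k)
  A' : Fin 6 → Fin 6 → Fin 6 → N1 (Mbar06 k)
  B : Fin 6 → Fin 6 → Fin 6 → N1 (Mbar06 k)
  C : Fin 6 → Fin 6 → N1 (Mbar06 k)
  C' : Fin 6 → Fin 6 → Fin 6 → N1 (Mbar06 k)

/-- The geometric description of the classes.  The divisor `D_{ij}` is a copy of `M̄_{0,5}` with
marks `l, m, a, b` and the node `ν`, and a cross-ratio on it that involves `ν` is the restriction
of the cross-ratio with `i` or `j` in place of `ν`.  Likewise `D_{ijl}` is the product of the lines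
`M̄_{0,4}` with marks `i, j, l, ν` and `m, a, b, ν`.  On `D_{ij}`:
* `A_{ij}` is the class of the general fibres of the map that forgets `ν`;
* `A_{ij;l}` is the class of the general fibres of the map that forgets `l`;
* `C_{ij}` is the class of the pull-backs of general lines under the blow-down `β_ν`;
* `C_{ij;l}` is the class of the pull-backs of general lines under the blow-down `β_l`.
On `D_{ijl}`, `B_{ijl}` is the class of the general fibres of the projection to the line with marks
`i, j, l, ν`.  Here a fibre is general if the cross-ratio is neither `0` nor `1` nor infinite, and a
line is general if it contains none of the four points blown up. -/
structure BoundaryClasses.IsGeometric (c : BoundaryClasses k) : Prop where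
  A_eq : ∀ i j l m a b : Fin 6, [i, j, l, m, a, b].Nodup → ∀ t : k, t ≠ 0 → t ≠ 1 →
    c.A i j = fibreClass k (boundary k {i, j}) ![l, m, a, b] t
  A'_eq : ∀ i j l m a b : Fin 6, [i, j, l, m, a, b].Nodup → ∀ t : k, t ≠ 0 → t ≠ 1 →
    ∀ ν ∈ ({i, j} : Finset (Fin 6)),
      c.A' i j l = fibreClass k (boundary k {i, j}) ![ν, m, a, b] t
  B_eq : ∀ i j l m a b : Fin 6, [i, j, l, m, a, b].Nodup → ∀ t : k, t ≠ 0 → t ≠ 1 →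
    c.B i j l = fibreClass k (boundary k {i, j, l}) ![i, j, l, m] t
  C_eq : ∀ i j l m a b : Fin 6, [i, j, l, m, a, b].Nodup →
    ∀ r s t : k, r ≠ 0 → s ≠ 0 → t ≠ 0 → r + s + t ≠ 0 → ∀ ν ∈ ({i, j} : Finset (Fin 6)),
      c.C i j = lineClass k (boundary k {i, j}) ν l m a b r s t
  C'_eq : ∀ i j l m a b : Fin 6, [i, j, l, m, a, b].Nodup →
    ∀ r s t : k, r ≠ 0 → s ≠ 0 → t ≠ 0 → r + s + t ≠ 0 → ∀ ν ∈ ({i, j} : Finset (Fin 6)),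
      c.C' i j l = lineClass k (boundary k {i, j}) l ν m a b r s t

/-- The ratio `z_i / z_m` (`i, m ≤ 4`) of the coordinates of the map `β₆ : M̄_{0,6} → ℙ³` that sends
six points of the line, with the sixth at infinity, to
`(t₅ - t₁ : t₅ - t₂ : t₅ - t₃ : t₅ - t₄)`. -/
def zRatio (i m : Fin 6) : RatFun k := if i = m then 1 else crossRatio k ![5, i, m, 6]

variable {k}

/-- `L` is the pull-back under `β₆` of the hyperplane `z₄ = 0`: at each point `x`, where some
coordinate `z_m` generates the others, the local equation of `L` is `z₄ / z_m`. -/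
def IsHyperplanePullback (L : CartierDivisor (Mbar06 k)) : Prop :=
  ∀ x : MPts k, ∃ m ∈ ({1, 2, 3, 4} : Finset (Fin 6)),
    (∀ i ∈ ({1, 2, 3, 4} : Finset (Fin 6)), zRatio k i m ∈ localRing x) ∧
    IsUnitAt x ((L.eqn x : RatFun k) / zRatio k 4 m)

/-- The divisors `L, E₁, …, E₅, E₁₂, E₁₃, …, E₄₅`, where `E_i = D_{i6}` and `E_{ij} = D_{ij6}` are
the exceptional divisors of `β₆` over the points `p_i` and the lines `ℓ_{ij}`. -/
def basisDivisors (L : CartierDivisor (Mbar06 k))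
    (E : Finset (Fin 6) → CartierDivisor (Mbar06 k)) : Fin 16 → CartierDivisor (Mbar06 k) :=
  ![L, E {1, 6}, E {2, 6}, E {3, 6}, E {4, 6}, E {5, 6},
    E {1, 2, 6}, E {1, 3, 6}, E {1, 4, 6}, E {1, 5, 6}, E {2, 3, 6},
    E {2, 4, 6}, E {2, 5, 6}, E {3, 4, 6}, E {3, 5, 6}, E {4, 5, 6}]

end Moduli

/-!
### The tables

Each row lists the indices of a class and its coordinates with respect to the basis of one-cycles
dual to `L, E₁, …, E₅, E₁₂, E₁₃, …, E₄₅`, that is, its intersection numbers with these divisors.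
-/

/-- The classes `A_{ij}`. -/
def tableA : List (Fin 6 × Fin 6 × (Fin 16 → ℤ)) := [
  (4, 5, ![1,0,0,0,0,0,1,1,0,0,1,0,0,0,0,1]),
  (1, 2, ![1,0,0,0,0,0,1,0,0,0,0,0,0,1,1,1]),
  (1, 3, ![1,0,0,0,0,0,0,1,0,0,0,1,1,0,0,1]),
  (1, 4, ![1,0,0,0,0,0,0,0,1,0,1,0,1,0,1,0]),
  (1, 5, ![1,0,0,0,0,0,0,0,0,1,1,1,0,1,0,0]),
  (1, 6, ![0,-2,0,0,0,0,1,1,1,1,0,0,0,0,0,0]),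
  (2, 3, ![1,0,0,0,0,0,0,0,1,1,1,0,0,0,0,1]),
  (2, 4, ![1,0,0,0,0,0,0,1,0,1,0,1,0,0,1,0]),
  (2, 5, ![1,0,0,0,0,0,0,1,1,0,0,0,1,1,0,0]),
  (2, 6, ![0,0,-2,0,0,0,1,0,0,0,1,1,1,0,0,0]),
  (3, 4, ![1,0,0,0,0,0,1,0,0,1,0,0,1,1,0,0]),
  (3, 5, ![1,0,0,0,0,0,1,0,1,0,0,1,0,0,1,0]),
  (3, 6, ![0,0,0,-2,0,0,0,1,0,0,1,0,0,1,1,0]),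
  (4, 6, ![0,0,0,0,-2,0,0,0,1,0,0,1,0,1,0,1]),
  (5, 6, ![0,0,0,0,0,-2,0,0,0,1,0,0,1,0,1,1])]

/-- The classes `A_{ij;l}`. -/
def tableA' : List (Fin 6 × Fin 6 × Fin 6 × (Fin 16 → ℤ)) := [
  (4, 5, 1, ![1,1,0,0,0,0,0,0,0,0,1,0,0,0,0,0]),
  (4, 5, 2, ![1,0,1,0,0,0,0,1,0,0,0,0,0,0,0,0]),
  (4, 5, 3, ![1,0,0,1,0,0,1,0,0,0,0,0,0,0,0,0]),
  (4, 5, 6, ![2,1,1,1,0,0,0,0,0,0,0,0,0,0,0,1]),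
  (1, 2, 3, ![1,0,0,1,0,0,0,0,0,0,0,0,0,0,0,1]),
  (1, 2, 4, ![1,0,0,0,1,0,0,0,0,0,0,0,0,0,1,0]),
  (1, 2, 5, ![1,0,0,0,0,1,0,0,0,0,0,0,0,1,0,0]),
  (1, 2, 6, ![2,0,0,1,1,1,1,0,0,0,0,0,0,0,0,0]),
  (1, 3, 2, ![1,0,1,0,0,0,0,0,0,0,0,0,0,0,0,1]),
  (1, 3, 4, ![1,0,0,0,1,0,0,0,0,0,0,0,1,0,0,0]),
  (1, 3, 5, ![1,0,0,0,0,1,0,0,0,0,0,1,0,0,0,0]),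
  (1, 3, 6, ![2,0,1,0,1,1,0,1,0,0,0,0,0,0,0,0]),
  (1, 4, 2, ![1,0,1,0,0,0,0,0,0,0,0,0,0,0,1,0]),
  (1, 4, 3, ![1,0,0,1,0,0,0,0,0,0,0,0,1,0,0,0]),
  (1, 4, 5, ![1,0,0,0,0,1,0,0,0,0,1,0,0,0,0,0]),
  (1, 4, 6, ![2,0,1,1,0,1,0,0,1,0,0,0,0,0,0,0]),
  (1, 5, 2, ![1,0,1,0,0,0,0,0,0,0,0,0,0,1,0,0]),
  (1, 5, 3, ![1,0,0,1,0,0,0,0,0,0,0,1,0,0,0,0]),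
  (1, 5, 4, ![1,0,0,0,1,0,0,0,0,0,1,0,0,0,0,0]),
  (1, 5, 6, ![2,0,1,1,1,0,0,0,0,1,0,0,0,0,0,0]),
  (1, 6, 2, ![0,-1,0,0,0,0,1,0,0,0,0,0,0,0,0,0]),
  (1, 6, 3, ![0,-1,0,0,0,0,0,1,0,0,0,0,0,0,0,0]),
  (1, 6, 4, ![0,-1,0,0,0,0,0,0,1,0,0,0,0,0,0,0]),
  (1, 6, 5, ![0,-1,0,0,0,0,0,0,0,1,0,0,0,0,0,0]),
  (2, 3, 1, ![1,1,0,0,0,0,0,0,0,0,0,0,0,0,0,1]),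
  (2, 3, 4, ![1,0,0,0,1,0,0,0,0,1,0,0,0,0,0,0]),
  (2, 3, 5, ![1,0,0,0,0,1,0,0,1,0,0,0,0,0,0,0]),
  (2, 3, 6, ![2,1,0,0,1,1,0,0,0,0,1,0,0,0,0,0]),
  (2, 4, 1, ![1,1,0,0,0,0,0,0,0,0,0,0,0,0,1,0]),
  (2, 4, 3, ![1,0,0,1,0,0,0,0,0,1,0,0,0,0,0,0]),
  (2, 4, 5, ![1,0,0,0,0,1,0,1,0,0,0,0,0,0,0,0]),
  (2, 4, 6, ![2,1,0,1,0,1,0,0,0,0,0,1,0,0,0,0]),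
  (2, 5, 1, ![1,1,0,0,0,0,0,0,0,0,0,0,0,1,0,0]),
  (2, 5, 3, ![1,0,0,1,0,0,0,0,1,0,0,0,0,0,0,0]),
  (2, 5, 4, ![1,0,0,0,1,0,0,1,0,0,0,0,0,0,0,0]),
  (2, 5, 6, ![2,1,0,1,1,0,0,0,0,0,0,0,1,0,0,0]),
  (2, 6, 1, ![0,0,-1,0,0,0,1,0,0,0,0,0,0,0,0,0]),
  (2, 6, 3, ![0,0,-1,0,0,0,0,0,0,0,1,0,0,0,0,0]),
  (2, 6, 4, ![0,0,-1,0,0,0,0,0,0,0,0,1,0,0,0,0]),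
  (2, 6, 5, ![0,0,-1,0,0,0,0,0,0,0,0,0,1,0,0,0]),
  (3, 4, 1, ![1,1,0,0,0,0,0,0,0,0,0,0,1,0,0,0]),
  (3, 4, 2, ![1,0,1,0,0,0,0,0,0,1,0,0,0,0,0,0]),
  (3, 4, 5, ![1,0,0,0,0,1,1,0,0,0,0,0,0,0,0,0]),
  (3, 4, 6, ![2,1,1,0,0,1,0,0,0,0,0,0,0,1,0,0]),
  (3, 5, 1, ![1,1,0,0,0,0,0,0,0,0,0,1,0,0,0,0]),
  (3, 5, 2, ![1,0,1,0,0,0,0,0,1,0,0,0,0,0,0,0]),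
  (3, 5, 4, ![1,0,0,0,1,0,1,0,0,0,0,0,0,0,0,0]),
  (3, 5, 6, ![2,1,1,0,1,0,0,0,0,0,0,0,0,0,1,0]),
  (3, 6, 1, ![0,0,0,-1,0,0,0,1,0,0,0,0,0,0,0,0]),
  (3, 6, 2, ![0,0,0,-1,0,0,0,0,0,0,1,0,0,0,0,0]),
  (3, 6, 4, ![0,0,0,-1,0,0,0,0,0,0,0,0,0,1,0,0]),
  (3, 6, 5, ![0,0,0,-1,0,0,0,0,0,0,0,0,0,0,1,0]),
  (4, 6, 1, ![0,0,0,0,-1,0,0,0,1,0,0,0,0,0,0,0]),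
  (4, 6, 2, ![0,0,0,0,-1,0,0,0,0,0,0,1,0,0,0,0]),
  (4, 6, 3, ![0,0,0,0,-1,0,0,0,0,0,0,0,0,1,0,0]),
  (4, 6, 5, ![0,0,0,0,-1,0,0,0,0,0,0,0,0,0,0,1]),
  (5, 6, 1, ![0,0,0,0,0,-1,0,0,0,1,0,0,0,0,0,0]),
  (5, 6, 2, ![0,0,0,0,0,-1,0,0,0,0,0,0,1,0,0,0]),
  (5, 6, 3, ![0,0,0,0,0,-1,0,0,0,0,0,0,0,0,1,0]),
  (5, 6, 4, ![0,0,0,0,0,-1,0,0,0,0,0,0,0,0,0,1])]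

/-- The classes `B_{ijl}`. -/
def tableB : List (Fin 6 × Fin 6 × Fin 6 × (Fin 16 → ℤ)) := [
  (1, 2, 6, ![0,0,0,0,0,0,-1,0,0,0,0,0,0,0,0,0]),
  (1, 3, 6, ![0,0,0,0,0,0,0,-1,0,0,0,0,0,0,0,0]),
  (1, 4, 6, ![0,0,0,0,0,0,0,0,-1,0,0,0,0,0,0,0]),
  (1, 5, 6, ![0,0,0,0,0,0,0,0,0,-1,0,0,0,0,0,0]),
  (2, 3, 6, ![0,0,0,0,0,0,0,0,0,0,-1,0,0,0,0,0]),
  (2, 4, 6, ![0,0,0,0,0,0,0,0,0,0,0,-1,0,0,0,0]),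
  (2, 5, 6, ![0,0,0,0,0,0,0,0,0,0,0,0,-1,0,0,0]),
  (3, 4, 6, ![0,0,0,0,0,0,0,0,0,0,0,0,0,-1,0,0]),
  (3, 5, 6, ![0,0,0,0,0,0,0,0,0,0,0,0,0,0,-1,0]),
  (4, 5, 6, ![0,0,0,0,0,0,0,0,0,0,0,0,0,0,0,-1]),
  (1, 2, 3, ![1,0,0,0,1,1,0,0,0,0,0,0,0,0,0,-1]),
  (1, 2, 4, ![1,0,0,1,0,1,0,0,0,0,0,0,0,0,-1,0]),
  (1, 2, 5, ![1,0,0,1,1,0,0,0,0,0,0,0,0,-1,0,0]),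
  (1, 3, 4, ![1,0,1,0,0,1,0,0,0,0,0,0,-1,0,0,0]),
  (1, 3, 5, ![1,0,1,0,1,0,0,0,0,0,0,-1,0,0,0,0]),
  (1, 4, 5, ![1,0,1,1,0,0,0,0,0,0,-1,0,0,0,0,0]),
  (2, 3, 4, ![1,1,0,0,0,1,0,0,0,-1,0,0,0,0,0,0]),
  (2, 3, 5, ![1,1,0,0,1,0,0,0,-1,0,0,0,0,0,0,0]),
  (2, 4, 5, ![1,1,0,1,0,0,0,-1,0,0,0,0,0,0,0,0]),
  (3, 4, 5, ![1,1,1,0,0,0,-1,0,0,0,0,0,0,0,0,0])]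

end

end M06

open M06

namespace M06
noncomputable section
open MvPolynomial
open Module (finrank)
open Ideal (span span_le mem_span_singleton mem_span_singleton' mem_span_singleton_self)
open IsLocalRing (maximalIdeal mem_maximalIdeal)
open Finset (sum_congr prod_ne_zero_iff prod_congr mem_insert prod_mul_distrib
  prod_div_distrib mem_singleton mem_filter mem_compl)

attribute [local instance] MvPolynomial.gradedAlgebra

notation "CR" => crossRatio _

notation "Loc" => localRing

notation "cst" => algebraMap _ _

notation "Inj" => Function.Injective

notation "Poly" => MvPolynomial

notation "Forms" => homogeneousSubmodule

notation "Tup" => Fin 4 → Fin 6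

notation "Marks" => Finset (Fin 6)

section ProjectiveSpace

variable {σ : Type} {k : Type u} [Field k]

/-- The projective space with homogeneous coordinates indexed by `σ`. -/
abbrev PS (σ : Type) (k : Type u) [Field k] : Scheme.{u} := Proj (Forms σ k)

notation "RF" => Scheme.residueField (PS _ _)

/-- The homogeneous prime ideal of a point. -/
def idl (x : PS σ k) : Ideal (Poly σ k) := x.asHomogeneousIdeal.toIdeal

instance (x : PS σ k) : (idl x).IsPrime := x.isPrime

/-- The germ of a quotient of two forms of the same degree. -/
def frac (x : PS σ k) {n : ℕ} {a b : Poly σ k} (ha : a.IsHomogeneous n)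
    (hb : b.IsHomogeneous n) (hbx : b ∉ idl x) : (PS σ k).presheaf.stalk x :=
  (Proj.stalkIso (Forms σ k) x).inv.hom
    (HomogeneousLocalization.mk ⟨n, ⟨a, ha⟩, ⟨b, hb⟩, hbx⟩)

lemma specializes_iff {x y : PS σ k} : x ⤳ y ↔ idl x ≤ idl y := by
  have h := ProjectiveSpectrum.le_iff_mem_closure (𝒜 := Forms σ k) x y
  have h2 : x ⤳ y ↔ y ∈ closure ({x} : Set (PS σ k)) := specializes_iff_mem_closure
  rw [h2]
  exact h.symm

lemma point_ext {x y : PS σ k} (h : idl x = idl y) : x = y :=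
  ProjectiveSpectrum.ext (HomogeneousIdeal.ext h)

lemma exists_frac (x : PS σ k) (g : (PS σ k).presheaf.stalk x) :
    ∃ (n : ℕ) (a b : Poly σ k) (ha : a.IsHomogeneous n) (hb : b.IsHomogeneous n)
      (hbx : b ∉ idl x), g = frac x ha hb hbx := by
  have ⟨⟨n, a, b, hb⟩, h⟩ := HomogeneousLocalization.mk_surjective
    ((Proj.stalkIso (Forms σ k) x).hom.hom g)
  refine ⟨n, a.1, b.1, a.2, b.2, hb, ?_⟩
  have := congrArg (Proj.stalkIso (Forms σ k) x).inv.hom h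
  unfold frac
  refine Eq.trans ?_ this.symm
  simp

lemma frac_specializes {x y : PS σ k} (h : y ⤳ x) {n : ℕ} {a b : Poly σ k}
    (ha : a.IsHomogeneous n) (hb : b.IsHomogeneous n) (hbx : b ∉ idl x) (hby : b ∉ idl y) :
    ((PS σ k).presheaf.stalkSpecializes h).hom (frac x ha hb hbx) = frac y ha hb hby := by
  have e1 := ConcreteCategory.congr_hom (TopCat.Presheaf.germ_stalkSpecializes
    (PS σ k).presheaf (U := ProjectiveSpectrum.basicOpen (Forms σ k) b)
      (show x ∈ _ from hbx) h) (sectionInBasicOpen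
        (Forms σ k) x ⟨n, ⟨a, ha⟩, ⟨b, hb⟩, hbx⟩)
  exact e1

/-- The stalk at `x` embeds in the localization of the polynomial ring at `x`. -/
def toLoc (x : PS σ k) : (PS σ k).presheaf.stalk x →+* Localization.AtPrime (idl x) :=
  (algebraMap (HomogeneousLocalization.AtPrime (Forms σ k) (idl x))
    (Localization.AtPrime (idl x))).comp
      (Proj.stalkIso (Forms σ k) x).hom.hom

lemma toLoc_injective (x : PS σ k) : Inj (toLoc x) := by
  intro g h hgh
  have h1 := HomogeneousLocalization.val_injective _ hgh
  exact (Proj.stalkIso (Forms σ k) x).commRingCatIsoToRingEquiv.injective h1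

lemma toLoc_frac (x : PS σ k) {n : ℕ} {a b : Poly σ k} (ha : a.IsHomogeneous n)
    (hb : b.IsHomogeneous n) (hbx : b ∉ idl x) :
    toLoc x (frac x ha hb hbx) * algebraMap _ _ b = algebraMap _ _ a := by
  have : toLoc x (frac x ha hb hbx) = Localization.mk a ⟨b, hbx⟩ := by
    exact congrArg HomogeneousLocalization.val
      ((Proj.stalkIso (Forms σ k) x).commRingCatIsoToRingEquiv.apply_symm_apply
        (HomogeneousLocalization.mk ⟨n, ⟨a, ha⟩, ⟨b, hb⟩, hbx⟩))
  rw [this, Localization.mk_eq_mk']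
  exact IsLocalization.mk'_spec _ _ _

lemma isUnit_toLoc {x : PS σ k} {b : Poly σ k} (hbx : b ∉ idl x) :
    IsUnit (algebraMap _ (Localization.AtPrime (idl x)) b) :=
  IsLocalization.map_units (M := (idl x).primeCompl) _ ⟨b, hbx⟩

lemma toLoc_frac_eq_iff (x : PS σ k) {n : ℕ} {a b : Poly σ k} (ha : a.IsHomogeneous n)
    (hb : b.IsHomogeneous n) (hbx : b ∉ idl x) (g : (PS σ k).presheaf.stalk x) :
    g = frac x ha hb hbx ↔ toLoc x g * algebraMap _ _ b = algebraMap _ _ a := by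
  rw [← (toLoc_injective x).eq_iff, ← toLoc_frac x ha hb hbx, (isUnit_toLoc hbx).mul_left_inj]

/-- The constants in the stalk at `x`. -/
def cstStalk (x : PS σ k) : k →+* (PS σ k).presheaf.stalk x :=
  (Proj.stalkIso (Forms σ k) x).inv.hom.comp
    ((HomogeneousLocalization.fromZeroRingHom (Forms σ k)
        (idl x).primeCompl).comp (algebraMap k (Forms σ k 0)))

lemma toLoc_cstStalk (x : PS σ k) (c : k) :
    toLoc x (cstStalk x c) = algebraMap _ _ (C c : Poly σ k) := by
  have h : cstStalk x c = frac x (isHomogeneous_C σ c) (isHomogeneous_one σ k)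
      (fun h => (inferInstance : (idl x).IsPrime).one_notMem h) := rfl
  have := toLoc_frac x (isHomogeneous_C σ c) (isHomogeneous_one σ k)
      (fun h => (inferInstance : (idl x).IsPrime).one_notMem h)
  rw [← h] at this
  simpa using this

/-- Linear forms. -/
abbrev Lin (l : Poly σ k) : Prop := Fact (l.IsHomogeneous 1)

instance (t : σ) : Lin (X t : Poly σ k) := ⟨isHomogeneous_X k t⟩

variable {l l' : Poly σ k} [hl : Lin l] [hl' : Lin l']

/-- Dehomogenization with respect to the linear form `l`, with values in the stalk at `x`. -/
def dehomStalk (x : PS σ k) (hx : l ∉ idl x) : Poly σ k →+* (PS σ k).presheaf.stalk x :=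
  eval₂Hom (cstStalk x) (fun t => frac x (isHomogeneous_X k t) hl.out hx)

lemma dehomStalk_of_isHomogeneous (x : PS σ k)
    (hx : l ∉ idl x) {n : ℕ} {a : Poly σ k} (ha : a.IsHomogeneous n)
    (hln : (l ^ n).IsHomogeneous n) (hxn : l ^ n ∉ idl x) :
    dehomStalk x hx a = frac x ha hln hxn := by
  rw [toLoc_frac_eq_iff]
  simp only [dehomStalk, coe_eval₂Hom, eval₂_eq, map_sum, map_mul, map_prod, map_pow,
    toLoc_cstStalk, Finset.sum_mul]
  conv_rhs => rw [a.as_sum, map_sum]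
  refine sum_congr rfl fun d hd => ?_
  have hdn : ∑ i ∈ d.support, d i = n := by
    have := ha (mem_support_iff.mp hd)
    rwa [Finsupp.weight_apply, Finsupp.sum, sum_congr rfl (g := fun i => d i)] at this
    intro i _
    simp
  rw [monomial_eq, map_mul, Finsupp.prod, map_prod, mul_assoc]
  congr 1
  rw [← hdn, ← Finset.prod_pow_eq_pow_sum, ← prod_mul_distrib]
  refine prod_congr rfl fun i _ => ?_
  rw [← mul_pow, toLoc_frac, map_pow]

lemma isUnit_frac_iff (x : PS σ k) {n : ℕ} {a b : Poly σ k} (ha : a.IsHomogeneous n)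
    (hb : b.IsHomogeneous n) (hbx : b ∉ idl x) : IsUnit (frac x ha hb hbx) ↔ a ∉ idl x := by
  constructor
  · intro h hax
    have h1 := (h.map (toLoc x)).mul (isUnit_toLoc hbx)
    rw [toLoc_frac] at h1
    exact (IsLocalization.AtPrime.isUnit_to_map_iff (Localization.AtPrime (idl x)) (idl x) a).mp
      h1 hax
  · intro h
    refine IsUnit.of_mul_eq_one (frac x hb ha h) ?_
    apply toLoc_injective
    rw [map_mul, map_one, ← (isUnit_toLoc hbx).mul_left_inj, mul_right_comm, toLoc_frac, mul_comm,
      toLoc_frac, one_mul]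

instance (x : PS σ k) : Algebra k (RF x) := (((PS σ k).residue x).hom.comp (cstStalk x)).toAlgebra

lemma residue_eq_zero_iff (x : PS σ k) (s : (PS σ k).presheaf.stalk x) :
    ((PS σ k).residue x).hom s = 0 ↔ ¬ IsUnit s := by
  have := IsLocalRing.residue_eq_zero_iff s
  rw [mem_maximalIdeal, mem_nonunits_iff] at this
  exact this

/-- Dehomogenization with respect to the linear form `l`, with values in the residue field. -/
def dehom (x : PS σ k) (hx : l ∉ idl x) : Poly σ k →ₐ[k] RF x where
  toRingHom := ((PS σ k).residue x).hom.comp (dehomStalk x hx)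
  commutes' c := by
    change ((PS σ k).residue x).hom (dehomStalk x hx (C c)) = _
    rw [dehomStalk, coe_eval₂Hom, eval₂_C]
    rfl

lemma dehom_apply (x : PS σ k) (hx : l ∉ idl x) (a : Poly σ k) :
    dehom x hx a = ((PS σ k).residue x).hom (dehomStalk x hx a) := rfl

omit hl in
lemma pow_notMem {x : PS σ k} (hx : l ∉ idl x) (n : ℕ) : l ^ n ∉ idl x :=
  fun h => hx ((inferInstance : (idl x).IsPrime).mem_of_pow_mem n h)

lemma lin_pow (n : ℕ) : (l ^ n).IsHomogeneous n := by simpa using hl.out.pow n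

lemma dehom_eq_zero_iff (x : PS σ k)
    (hx : l ∉ idl x) {n : ℕ} {a : Poly σ k} (ha : a.IsHomogeneous n) :
    dehom x hx a = 0 ↔ a ∈ idl x := by
  rw [dehom_apply, residue_eq_zero_iff, dehomStalk_of_isHomogeneous x hx ha
    (lin_pow n) (pow_notMem hx n), isUnit_frac_iff, not_not]

lemma dehom_self (x : PS σ k) (hx : l ∉ idl x) : dehom x hx l = 1 := by
  rw [dehom_apply, ← map_one ((PS σ k).residue x).hom]
  congr 1
  symm
  rw [dehomStalk_of_isHomogeneous x hx hl.out (lin_pow 1) (pow_notMem hx 1), toLoc_frac_eq_iff]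
  simp

variable (l) in
lemma exists_homogenization (a : Poly σ k) : ∃ (n : ℕ) (b : Poly σ k), b.IsHomogeneous n ∧
      ∀ (I : Ideal (Poly σ k)), l - 1 ∈ I → a - b ∈ I := by
  refine ⟨a.totalDegree, ∑ i ∈ Finset.range (a.totalDegree + 1),
    homogeneousComponent i a * l ^ (a.totalDegree - i), ?_, ?_⟩
  · refine MvPolynomial.IsHomogeneous.sum _ _ _ fun i hi => ?_
    have := (homogeneousComponent_isHomogeneous i a).mul (lin_pow (l := l) (a.totalDegree - i))
    rwa [Nat.add_sub_cancel' (Finset.mem_range_succ_iff.mp hi)] at this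
  · intro I hI
    have h0 := sum_homogeneousComponent a
    suffices h : ∑ i ∈ Finset.range (a.totalDegree + 1), homogeneousComponent i a -
        ∑ i ∈ Finset.range (a.totalDegree + 1),
          homogeneousComponent i a * l ^ (a.totalDegree - i) ∈ I by rwa [h0] at h
    rw [← Finset.sum_sub_distrib]
    refine Ideal.sum_mem _ fun i _ => ?_
    have h : l ^ (a.totalDegree - i) - 1 ∈ I := by
      have ⟨c, hc⟩ := sub_one_dvd_pow_sub_one l (a.totalDegree - i)
      rw [hc]
      exact I.mul_mem_right _ hI
    have := I.mul_mem_left (-homogeneousComponent i a) h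
    convert this using 1
    ring

variable (l) in
lemma exists_homogenization_dehom (a : Poly σ k) : ∃ (n : ℕ) (b : Poly σ k), b.IsHomogeneous n ∧
      ∀ (x : PS σ k) (hx : l ∉ idl x), dehom x hx a = dehom x hx b := by
  have ⟨n, b, hb, h⟩ := exists_homogenization l a
  refine ⟨n, b, hb, fun x hx => ?_⟩
  have := h (RingHom.ker (dehom x hx)) (by
    rw [RingHom.mem_ker, map_sub, map_one, dehom_self, sub_self])
  rw [RingHom.mem_ker, map_sub] at this
  exact sub_eq_zero.mp this

lemma _root_.Specializes.notMem {x y : PS σ k} (h : x ⤳ y) {a : Poly σ k} (ha : a ∉ idl y) :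
    a ∉ idl x := fun h' => ha (specializes_iff.mp h h')

lemma isUnit_dehomStalk_iff (x : PS σ k) (hx : l ∉ idl x) (a : Poly σ k) :
    IsUnit (dehomStalk x hx a) ↔ dehom x hx a ≠ 0 := by
  rw [dehom_apply, Ne, residue_eq_zero_iff, not_not]

lemma toFunctionField_dehomStalk {δ : PS σ k} (x : Pts δ) (hx : l ∉ idl x.1) (a : Poly σ k) :
    toFunctionField x (dehomStalk x.1 hx a) =
      dehom δ (x.2.notMem hx) a := by
  have h : (toFunctionField x).comp (dehomStalk x.1 hx) =
      (dehom δ (x.2.notMem hx)).toRingHom := by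
    apply MvPolynomial.ringHom_ext
    · intro c
      have : ((PS σ k).presheaf.stalkSpecializes x.2).hom (cstStalk x.1 c) = cstStalk δ c :=
        frac_specializes x.2 (isHomogeneous_C σ c) (isHomogeneous_one σ k)
          (fun h => (inferInstance : (idl x.1).IsPrime).one_notMem h)
          (fun h => (inferInstance : (idl δ).IsPrime).one_notMem h)
      simp only [RingHom.comp_apply, dehomStalk, coe_eval₂Hom, eval₂_C, toFunctionField,
        CommRingCat.hom_comp, this]
      exact ((dehom δ (x.2.notMem hx)).commutes c).symm
    · intro t
      simp only [RingHom.comp_apply, dehomStalk, coe_eval₂Hom, eval₂_X, toFunctionField,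
        CommRingCat.hom_comp]
      rw [frac_specializes x.2 _ _ _ (x.2.notMem hx)]
      change _ = ((PS σ k).residue δ).hom (dehomStalk δ _ (X t))
      rw [dehomStalk, coe_eval₂Hom, eval₂_X]
  exact RingHom.congr_fun h a

lemma exists_stalk_eq (x : PS σ k) (hx : l ∉ idl x) (s : (PS σ k).presheaf.stalk x) :
    ∃ a b, dehom x hx b ≠ 0 ∧ s * dehomStalk x hx b = dehomStalk x hx a := by
  obtain ⟨n, a, b, ha, hb, hbx, rfl⟩ := exists_frac x s
  refine ⟨a, b, (dehom_eq_zero_iff x hx hb).not.mpr hbx, ?_⟩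
  rw [dehomStalk_of_isHomogeneous x hx ha (lin_pow n) (pow_notMem hx n),
    toLoc_frac_eq_iff, map_mul, mul_assoc, dehomStalk_of_isHomogeneous x hx hb
    (lin_pow n) (pow_notMem hx n), toLoc_frac, toLoc_frac]

lemma exists_stalk_eq' (x : PS σ k) (hx : l ∉ idl x) (a b : Poly σ k) (hb : dehom x hx b ≠ 0) :
    ∃ s, s * dehomStalk x hx b = dehomStalk x hx a := by
  have ⟨u, hu⟩ := (isUnit_dehomStalk_iff x hx b).mpr hb
  refine ⟨dehomStalk x hx a * (u⁻¹ : (_)ˣ), ?_⟩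
  rw [← hu]
  simp

lemma exists_dehom_eq (x : PS σ k) (hx : l ∉ idl x) (g : RF x) :
    ∃ a b, dehom x hx b ≠ 0 ∧ g * dehom x hx b = dehom x hx a := by
  obtain ⟨s, rfl⟩ := (PS σ k).residue_surjective x g
  have ⟨a, b, hb, h⟩ := exists_stalk_eq x hx s
  exact ⟨a, b, hb, by simpa [dehom_apply] using congrArg ((PS σ k).residue x).hom h⟩

section Points

variable {δ : PS σ k} (x : Pts δ)
    (hx : l ∉ idl x.1)

include hx in
lemma dehom_eq_zero_of (a : Poly σ k) (h : dehom δ (x.2.notMem hx) a = 0) : dehom x.1 hx a = 0 := by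
  have ⟨n, b, hb, hab⟩ := exists_homogenization_dehom l a
  rw [hab, dehom_eq_zero_iff _ _ hb] at h
  rw [hab, dehom_eq_zero_iff _ _ hb]
  exact specializes_iff.mp x.2 h

lemma mem_localRing_iff (g : RF δ) : g ∈ Loc x ↔ ∃ a b, dehom x.1 hx b ≠ 0 ∧
      g * dehom δ (x.2.notMem hx) b =
        dehom δ (x.2.notMem hx) a := by
  constructor
  · rintro ⟨s, rfl⟩
    have ⟨a, b, hb, h⟩ := exists_stalk_eq x.1 hx s
    refine ⟨a, b, hb, ?_⟩
    simpa only [map_mul, toFunctionField_dehomStalk] using congrArg (toFunctionField x) h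
  · rintro ⟨a, b, hb, h⟩
    have ⟨s, hs⟩ := exists_stalk_eq' x.1 hx a b hb
    refine ⟨s, mul_right_cancel₀ (b := dehom δ (x.2.notMem hx) b) ?_ ?_⟩
    · exact fun h' => hb (dehom_eq_zero_of x hx b h')
    · rw [h, ← toFunctionField_dehomStalk x hx, ← map_mul, hs, toFunctionField_dehomStalk]

lemma vanishesAt_iff (g : RF δ) : VanishesAt x g ↔ ∃ a b, dehom x.1 hx b ≠ 0 ∧ dehom x.1 hx a = 0 ∧
      g * dehom δ (x.2.notMem hx) b =
        dehom δ (x.2.notMem hx) a := by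
  constructor
  · rintro ⟨s, hs, rfl⟩
    have ⟨a, b, hb, h⟩ := exists_stalk_eq x.1 hx s
    refine ⟨a, b, hb, ?_, ?_⟩
    · rw [mem_maximalIdeal, mem_nonunits_iff, ← residue_eq_zero_iff] at hs
      rw [dehom_apply, ← h, map_mul, hs, zero_mul]
    · simpa only [map_mul, toFunctionField_dehomStalk] using congrArg (toFunctionField x) h
  · rintro ⟨a, b, hb, ha, h⟩
    have ⟨s, hs⟩ := exists_stalk_eq' x.1 hx a b hb
    refine ⟨s, ?_, mul_right_cancel₀ (b := dehom δ (x.2.notMem hx) b) ?_ ?_⟩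
    · rw [mem_maximalIdeal, mem_nonunits_iff, ← residue_eq_zero_iff]
      refine (mul_eq_zero.mp (?_ : _ * dehom x.1 hx b = 0)).resolve_right hb
      rw [dehom_apply, ← map_mul, hs]
      exact ha
    · exact fun h' => hb (dehom_eq_zero_of x hx b h')
    · rw [h, ← toFunctionField_dehomStalk x hx, ← map_mul, hs, toFunctionField_dehomStalk]

lemma valueAt_eq (g : RF δ) (a b : Poly σ k)
    (hb : dehom x.1 hx b ≠ 0) (h : g * dehom δ (x.2.notMem hx) b =
        dehom δ (x.2.notMem hx) a) :
    valueAt x g * dehom x.1 hx b = dehom x.1 hx a := by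
  have hg : ∃ s, toFunctionField x s = g := (mem_localRing_iff x hx g).mpr ⟨a, b, hb, h⟩
  rw [valueAt, dif_pos hg]
  have h1 := hg.choose_spec
  set s := hg.choose
  have ⟨c, d, hd, hs⟩ := exists_stalk_eq x.1 hx s
  have h2 := congrArg (toFunctionField x) hs
  rw [map_mul, toFunctionField_dehomStalk, toFunctionField_dehomStalk, h1] at h2
  have h3 : dehom δ (x.2.notMem hx) (a * d - c * b) = 0 := by
    rw [map_sub, map_mul, map_mul, ← h, ← h2]
    ring
  have h4 := dehom_eq_zero_of x hx _ h3
  have h5 := congrArg ((PS σ k).residue x.1).hom hs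
  rw [map_mul, ← dehom_apply, ← dehom_apply] at h5
  apply mul_right_cancel₀ hd
  rw [map_sub, map_mul, map_mul, sub_eq_zero] at h4
  rw [h4, ← h5]
  ring

end Points

/-- Every prime ideal of the affine chart `l = 1` is a point. -/
lemma exists_point (l : Poly σ k) [hl : Lin l]
    (Q : Ideal (Poly σ k)) [hQ : Q.IsPrime] (hlQ : l - 1 ∈ Q) :
    ∃ (x : PS σ k) (hx : l ∉ idl x), ∀ a, dehom x hx a = 0 ↔ a ∈ Q := by
  have hl' : l ∉ Q := fun h => hQ.one_notMem (by simpa using Q.sub_mem h hlQ)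
  have hmem : ∀ {n : ℕ} {a : Poly σ k}, a.IsHomogeneous n →
      (a ∈ (Q.homogeneousCore (Forms σ k)).toIdeal ↔ a ∈ Q) := fun {n a} ha =>
    ⟨fun h => Ideal.toIdeal_homogeneousCore_le _ _ h,
      fun h => Ideal.mem_homogeneousCore_of_homogeneous_of_mem ⟨n, ha⟩ h⟩
  let x : PS σ k :=
    { asHomogeneousIdeal := Q.homogeneousCore (Forms σ k)
      isPrime := hQ.homogeneousCore (𝒜 := Forms σ k)
      not_irrelevant_le := fun h => hl' ((hmem hl.out).mp
        (h (HomogeneousIdeal.mem_irrelevant_of_mem _ one_pos hl.out))) }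
  have hx : l ∉ idl x := fun h => hl' ((hmem hl.out).mp h)
  refine ⟨x, hx, fun a => ?_⟩
  have ⟨n, b, hb, h⟩ := exists_homogenization l a
  have h1 := h (RingHom.ker (dehom x hx)) (by
    rw [RingHom.mem_ker, map_sub, map_one, dehom_self, sub_self])
  rw [RingHom.mem_ker, map_sub, sub_eq_zero] at h1
  rw [h1, dehom_eq_zero_iff _ _ hb]
  refine (hmem hb).trans ⟨fun h' => ?_, fun h' => ?_⟩
  · simpa using Q.add_mem (h Q hlQ) h'
  · simpa using Q.sub_mem h' (h Q hlQ)

lemma exists_X_notMem (x : PS σ k) : ∃ t, (X t : Poly σ k) ∉ idl x := by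
  by_contra! h
  refine x.not_irrelevant_le fun a ha => ?_
  rw [HomogeneousIdeal.mem_irrelevant_iff, GradedRing.proj_apply] at ha
  have hdec : (DirectSum.decompose (Forms σ k) a 0 : Poly σ k) =
      homogeneousComponent 0 a := decomposition.decompose'_apply a 0
  rw [hdec, homogeneousComponent_zero, C_eq_zero] at ha
  change a ∈ idl x
  rw [a.as_sum]
  refine Ideal.sum_mem _ fun d hd => ?_
  have hd0 : d ≠ 0 := by rintro rfl; exact mem_support_iff.mp hd ha
  have ⟨t, ht⟩ := Finsupp.ne_iff.mp hd0
  have hdvd : (X t : Poly σ k) ∣ monomial d (coeff d a) := by rw [X_dvd_monomial]; exact Or.inr ht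
  have ⟨c, hc⟩ := hdvd
  rw [hc]
  exact Ideal.mul_mem_right _ _ (h t)

lemma dehom_change (x : PS σ k) (hx : l ∉ idl x) (hx' : l' ∉ idl x) {n : ℕ}
    {a : Poly σ k} (ha : a.IsHomogeneous n) :
    dehom x hx a = dehom x hx' a * dehom x hx l' ^ n := by
  simp only [dehom_apply, ← map_pow, ← map_mul]
  congr 1
  symm
  rw [dehomStalk_of_isHomogeneous x hx ha (lin_pow n) (pow_notMem hx n),
    toLoc_frac_eq_iff, map_mul, dehomStalk_of_isHomogeneous x hx' ha
    (lin_pow n) (pow_notMem hx' n), map_pow (dehomStalk x hx),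
    dehomStalk_of_isHomogeneous x hx hl'.out (lin_pow 1) (pow_notMem hx 1),
    map_pow, map_pow, mul_assoc, ← mul_pow]
  have := toLoc_frac x hl'.out (lin_pow 1) (pow_notMem hx 1)
  rw [map_pow, pow_one (algebraMap (Poly σ k) (Localization.AtPrime (idl x)) l)] at this
  rw [this, ← map_pow, toLoc_frac]

lemma specializes_iff_dehom {x y : PS σ k} (hx : l ∉ idl x) (hy : l ∉ idl y) :
    x ⤳ y ↔ ∀ a, dehom x hx a = 0 → dehom y hy a = 0 := by
  refine ⟨fun h a ha => dehom_eq_zero_of ⟨y, h⟩ hy a ha, fun h => ?_⟩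
  rw [specializes_iff]
  intro a ha
  change a ∈ x.asHomogeneousIdeal.toIdeal at ha
  change a ∈ y.asHomogeneousIdeal.toIdeal
  have hc : ∀ i, homogeneousComponent i a ∈ x.asHomogeneousIdeal.toIdeal := fun i => by
    have := x.asHomogeneousIdeal.2 i ha
    rwa [show (DirectSum.decompose (Forms σ k) a i : Poly σ k) =
      homogeneousComponent i a from decomposition.decompose'_apply a i] at this
  have h0 := sum_homogeneousComponent a
  rw [← h0]
  refine Ideal.sum_mem _ fun i _ => ?_
  exact (dehom_eq_zero_iff y hy (homogeneousComponent_isHomogeneous i a)).mp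
    (h _ ((dehom_eq_zero_iff x hx (homogeneousComponent_isHomogeneous i a)).mpr (hc i)))

lemma vanishesAt_iff_mem {δ : PS σ k} (x : Pts δ) (g : RF δ) :
    VanishesAt x g ↔ g ∈ Loc x ∧ ¬ IsUnitAt x g := by
  have ⟨t, hx⟩ := exists_X_notMem x.1
  rw [vanishesAt_iff x hx, mem_localRing_iff x hx]
  constructor
  · rintro ⟨a, b, hb, ha, h⟩
    refine ⟨⟨a, b, hb, h⟩, fun h' => ?_⟩
    have ⟨c, d, hd, hcd⟩ := (mem_localRing_iff x hx _).mp h'.2.2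
    have : dehom δ (x.2.notMem hx) (b * d - c * a) = 0 := by
      rw [map_sub, map_mul, map_mul, ← h, ← hcd]
      field_simp [h'.1]
      ring
    have := dehom_eq_zero_of x hx _ this
    rw [map_sub, map_mul, map_mul, ha, mul_zero, sub_zero] at this
    exact (mul_ne_zero hb hd) this
  · rintro ⟨⟨a, b, hb, h⟩, h'⟩
    refine ⟨a, b, hb, ?_, h⟩
    by_contra ha
    have ha' : dehom δ (x.2.notMem hx) a ≠ 0 := fun h0 => ha (dehom_eq_zero_of x hx _ h0)
    have hg : g ≠ 0 := by
      rintro rfl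
      rw [zero_mul] at h
      exact ha' h.symm
    refine h' ⟨hg, (mem_localRing_iff x hx _).mpr ⟨a, b, hb, h⟩,
      (mem_localRing_iff x hx _).mpr ⟨b, a, ha, ?_⟩⟩
    rw [← h]
    field_simp

lemma cst_mem {δ : PS σ k} (x : Pts δ) (c : k) : algebraMap k (RF δ) c ∈ Loc x := by
  have ⟨t, hx⟩ := exists_X_notMem x.1
  refine (mem_localRing_iff x hx _).mpr ⟨C c, 1, by simp, ?_⟩
  rw [map_one, mul_one]
  exact ((dehom δ (x.2.notMem hx)).commutes c).symm

section Value

variable {δ : PS σ k} (x : Pts δ)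

lemma dehom_mem_localRing (hx : l ∉ idl x.1) (a : Poly σ k) : dehom δ (x.2.notMem hx) a ∈ Loc x :=
  (mem_localRing_iff x hx _).mpr ⟨a, 1, by simp, by simp⟩

lemma valueAt_dehom (hx : l ∉ idl x.1) (a : Poly σ k) :
    valueAt x (dehom δ (x.2.notMem hx) a) = dehom x.1 hx a := by
  simpa using valueAt_eq x hx _ a 1 (by simp) (by simp)

lemma valueAt_mul {g h : RF δ} (hg : g ∈ Loc x) (hh : h ∈ Loc x) :
    valueAt x (g * h) = valueAt x g * valueAt x h := by
  have ⟨t, hx⟩ := exists_X_notMem x.1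
  have ⟨a, b, hb, h1⟩ := (mem_localRing_iff x hx _).mp hg
  have ⟨c, d, hd, h2⟩ := (mem_localRing_iff x hx _).mp hh
  have h3 := valueAt_eq x hx _ a b hb h1
  have h4 := valueAt_eq x hx _ c d hd h2
  have h5 := valueAt_eq x hx (g * h) (a * c) (b * d) (by rw [map_mul]; exact mul_ne_zero hb hd)
    (by rw [map_mul, map_mul, ← h1, ← h2]; ring)
  apply mul_right_cancel₀ (mul_ne_zero hb hd)
  rw [← map_mul, h5, map_mul, map_mul, ← h3, ← h4]
  ring

lemma valueAt_add {g h : RF δ} (hg : g ∈ Loc x) (hh : h ∈ Loc x) :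
    valueAt x (g + h) = valueAt x g + valueAt x h := by
  have ⟨t, hx⟩ := exists_X_notMem x.1
  have ⟨a, b, hb, h1⟩ := (mem_localRing_iff x hx _).mp hg
  have ⟨c, d, hd, h2⟩ := (mem_localRing_iff x hx _).mp hh
  have h3 := valueAt_eq x hx _ a b hb h1
  have h4 := valueAt_eq x hx _ c d hd h2
  have h5 := valueAt_eq x hx (g + h) (a * d + c * b) (b * d)
    (by rw [map_mul]; exact mul_ne_zero hb hd)
    (by rw [map_mul, map_add, map_mul, map_mul, ← h1, ← h2]; ring)
  apply mul_right_cancel₀ (mul_ne_zero hb hd)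
  rw [← map_mul, h5, map_mul, map_add, map_mul, map_mul, ← h3, ← h4]
  ring

lemma valueAt_algebraMap (c : k) : valueAt x (algebraMap k (RF δ) c) = cst c := by
  have ⟨t, hx⟩ := exists_X_notMem x.1
  have := valueAt_dehom x hx (C c)
  rwa [show dehom δ (x.2.notMem hx) (C c) = cst c from
    AlgHom.commutes _ c, show dehom x.1 hx (C c) = cst c from
    AlgHom.commutes _ c] at this

lemma valueAt_eq_zero_iff {g : RF δ} (hg : g ∈ Loc x) : valueAt x g = 0 ↔ VanishesAt x g := by
  have ⟨t, hx⟩ := exists_X_notMem x.1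
  rw [vanishesAt_iff x hx]
  constructor
  · intro h
    have ⟨a, b, hb, h1⟩ := (mem_localRing_iff x hx _).mp hg
    have h3 := valueAt_eq x hx _ a b hb h1
    rw [h, zero_mul] at h3
    exact ⟨a, b, hb, h3.symm, h1⟩
  · rintro ⟨a, b, hb, ha, h1⟩
    have h3 := valueAt_eq x hx _ a b hb h1
    rw [ha] at h3
    exact (mul_eq_zero.mp h3).resolve_right hb

/-- The value at `x` as a homomorphism of the local ring to the residue field. -/
def valHom : Loc x →+* RF x.1 where
  toFun g := valueAt x g.1
  map_one' := by simpa using valueAt_algebraMap x 1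
  map_zero' := by simpa using valueAt_algebraMap x 0
  map_mul' g h := valueAt_mul x g.2 h.2
  map_add' g h := valueAt_add x g.2 h.2

lemma valHom_surjective : Function.Surjective (valHom x) := by
  intro g
  have ⟨t, hx⟩ := exists_X_notMem x.1
  have ⟨a, b, hb, h⟩ := exists_dehom_eq x.1 hx g
  have hb' : dehom δ (x.2.notMem hx) b ≠ 0 := fun h0 => hb (dehom_eq_zero_of x hx _ h0)
  have h1 : dehom δ (x.2.notMem hx) a /
      dehom δ (x.2.notMem hx) b *
      dehom δ (x.2.notMem hx) b =
      dehom δ (x.2.notMem hx) a := by field_simp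
  refine ⟨⟨_, (mem_localRing_iff x hx _).mpr ⟨a, b, hb, h1⟩⟩, mul_right_cancel₀ hb ?_⟩
  rw [h]
  exact valueAt_eq x hx _ a b hb h1

/-- A point of `closure {y}` as a point of `V`, for a point `y` of `V`. -/
abbrev Pts.incl {δ : PS σ k} (y : Pts δ) (z : Pts y.1) : Pts δ := ⟨z.1, y.2.trans z.2⟩

lemma localRing_incl_le (y : Pts δ) (z : Pts y.1) : Loc (y.incl z) ≤ Loc y := by
  have ⟨t, hz⟩ := exists_X_notMem z.1
  intro g hg
  have ⟨a, b, hb, h⟩ := (mem_localRing_iff (y.incl z) hz g).mp hg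
  exact (mem_localRing_iff y (z.2.notMem hz) g).mpr
    ⟨a, b, fun h0 => hb (dehom_eq_zero_of z hz _ h0), h⟩

lemma mem_localRing_sub_iff (y : Pts δ) (z : Pts y.1) (g : RF y.1) :
    g ∈ Loc z ↔ ∃ h ∈ Loc (y.incl z), valueAt y h = g := by
  have ⟨t, hz⟩ := exists_X_notMem z.1
  have hy := z.2.notMem hz
  constructor
  · intro hg
    have ⟨a, b, hb, h⟩ := (mem_localRing_iff z hz g).mp hg
    have hb1 : dehom y.1 hy b ≠ 0 := fun h0 => hb (dehom_eq_zero_of z hz _ h0)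
    have hb2 : dehom δ (y.2.notMem hy) b ≠ 0 := fun h0 => hb1 (dehom_eq_zero_of y hy _ h0)
    have h1 := div_mul_cancel₀ (dehom δ (y.2.notMem hy) a) hb2
    refine ⟨_, (mem_localRing_iff (y.incl z) hz _).mpr ⟨a, b, hb, h1⟩, mul_right_cancel₀ hb1 ?_⟩
    rw [h]
    exact valueAt_eq y hy _ a b hb1 h1
  · rintro ⟨g', hg', rfl⟩
    have ⟨a, b, hb, h⟩ := (mem_localRing_iff (y.incl z) hz g').mp hg'
    refine (mem_localRing_iff z hz _).mpr ⟨a, b, hb, ?_⟩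
    exact valueAt_eq y hy _ a b
      (fun h0 => hb (dehom_eq_zero_of z hz _ h0)) h

lemma valueAt_valueAt (y : Pts δ) (z : Pts y.1) {g : RF δ}
    (hg : g ∈ Loc (y.incl z)) : valueAt z (valueAt y g) = valueAt (y.incl z) g := by
  have ⟨t, hz⟩ := exists_X_notMem z.1
  have hy := z.2.notMem hz
  have ⟨a, b, hb, h⟩ := (mem_localRing_iff (y.incl z) hz g).mp hg
  have h1 := valueAt_eq y hy _ a b
      (fun h0 => hb (dehom_eq_zero_of z hz _ h0)) h
  have h2 := valueAt_eq z hz _ a b hb h1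
  have h3 : valueAt (y.incl z) g * dehom z.1 hz b = dehom z.1 hz a :=
    valueAt_eq (y.incl z) hz _ a b hb h
  have h4 := h2.trans h3.symm
  exact mul_right_cancel₀ (M₀ := RF z.1) hb h4

end Value

end ProjectiveSpace

section LocAt

variable {A K : Type*} [CommRing A] [Field K]

/-- The image in `K` of the localization of `A` at the prime ideal `q`. -/
def locAt (φ : A →+* K) (q : Ideal A) [hq : q.IsPrime] : Subring K where
  carrier := {g | ∃ a b, b ∉ q ∧ φ b ≠ 0 ∧ g * φ b = φ a}
  mul_mem' := by
    rintro g h ⟨a, b, hb, hb', hg⟩ ⟨c, d, hd, hd', hh⟩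
    refine ⟨a * c, b * d, fun h => (hq.mem_or_mem h).elim hb hd, ?_, ?_⟩
    · rw [map_mul]; exact mul_ne_zero hb' hd'
    · rw [map_mul, map_mul, ← hg, ← hh]; ring
  one_mem' := ⟨1, 1, hq.one_notMem, by simp, by simp⟩
  add_mem' := by
    rintro g h ⟨a, b, hb, hb', hg⟩ ⟨c, d, hd, hd', hh⟩
    refine ⟨a * d + c * b, b * d, fun h => (hq.mem_or_mem h).elim hb hd, ?_, ?_⟩
    · rw [map_mul]; exact mul_ne_zero hb' hd'
    · rw [map_mul, map_add, map_mul, map_mul, ← hg, ← hh]; ring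
  zero_mem' := ⟨0, 1, hq.one_notMem, by simp, by simp⟩
  neg_mem' := by rintro g ⟨a, b, hb, hb', hg⟩; exact ⟨-a, b, hb, hb', by rw [map_neg, ← hg]; ring⟩

lemma mem_locAt {φ : A →+* K} {q : Ideal A} [q.IsPrime] {g : K} :
    g ∈ locAt φ q ↔ ∃ a b, b ∉ q ∧ φ b ≠ 0 ∧ g * φ b = φ a := Iff.rfl

lemma locAt_anti {φ : A →+* K} {p q : Ideal A} [p.IsPrime] [q.IsPrime] (h : p ≤ q) :
    locAt φ q ≤ locAt φ p := fun _ ⟨a, b, hb, h'⟩ => ⟨a, b, fun hm => hb (h hm), h'⟩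

lemma map_mem_locAt (φ : A →+* K) (q : Ideal A) [hq : q.IsPrime] (a : A) : φ a ∈ locAt φ q :=
  ⟨a, 1, hq.one_notMem, by simp, by simp⟩

lemma inv_map_mem_locAt {φ : A →+* K} {q : Ideal A} [q.IsPrime] (hφ : RingHom.ker φ ≤ q) {a : A}
    (ha : a ∉ q) : (φ a)⁻¹ ∈ locAt φ q := by
  have : φ a ≠ 0 := fun h => ha (hφ h)
  exact ⟨1, a, ha, this, by rw [inv_mul_cancel₀ this, map_one]⟩

lemma inv_map_mem_locAt_iff {φ : A →+* K} {q : Ideal A} [q.IsPrime] (hφ : RingHom.ker φ ≤ q)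
    {a : A} (ha0 : φ a ≠ 0) : (φ a)⁻¹ ∈ locAt φ q ↔ a ∉ q := by
  refine ⟨?_, inv_map_mem_locAt hφ⟩
  rintro ⟨c, d, hd, hd', h⟩ ha
  have h1 : φ (d - c * a) = 0 := by
    rw [map_sub, map_mul, ← h]
    field_simp
    ring
  have := q.add_mem (hφ h1) (q.mul_mem_left c ha)
  rw [sub_add_cancel] at this
  exact hd this

lemma isLocalRing_locAt {φ : A →+* K} {q : Ideal A} [q.IsPrime] (hφ : RingHom.ker φ ≤ q) :
    IsLocalRing (locAt φ q) := by
  have key : ∀ g : locAt φ q, (g : K) ≠ 0 → (g : K)⁻¹ ∈ locAt φ q → IsUnit g := fun g h0 h =>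
    IsUnit.of_mul_eq_one ⟨_, h⟩ (Subtype.ext (mul_inv_cancel₀ h0))
  refine IsLocalRing.of_isUnit_or_isUnit_one_sub_self ?_
  rintro ⟨g, a, b, hb, hb', hg⟩
  by_cases ha : a ∈ q
  · right
    have hba : b - a ∉ q := fun h => hb (by simpa using q.add_mem h ha)
    have hba' : φ (b - a) ≠ 0 := fun h => hba (hφ h)
    have h1 : (1 - g) * φ b = φ (b - a) := by rw [map_sub, ← hg]; ring
    have h2 : (1 - g) ≠ 0 := by
      intro h
      rw [h, zero_mul] at h1
      exact hba' h1.symm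
    refine key (1 - ⟨g, _⟩) h2 ⟨b, b - a, hba, hba', ?_⟩
    change (1 - g)⁻¹ * φ (b - a) = φ b
    rw [← h1]
    field_simp
  · left
    have ha' : φ a ≠ 0 := fun h => ha (hφ h)
    have h2 : g ≠ 0 := by
      rintro rfl
      rw [zero_mul] at hg
      exact ha' hg.symm
    refine key ⟨g, _⟩ h2 ⟨b, a, ha, ha', ?_⟩
    change g⁻¹ * φ a = φ b
    rw [← hg]
    field_simp

lemma isUnit_subring_iff {O : Subring K} (g : O) : IsUnit g ↔ (g : K) ≠ 0 ∧ (g : K)⁻¹ ∈ O := by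
  constructor
  · rintro ⟨u, rfl⟩
    have h : ((u : O) : K) * ((u⁻¹ : Oˣ) : O) = 1 := by
      rw [← Subring.coe_mul, Units.mul_inv, Subring.coe_one]
    refine ⟨left_ne_zero_of_mul_eq_one h, ?_⟩
    rw [← eq_inv_of_mul_eq_one_right h]
    exact ((u⁻¹ : Oˣ) : O).2
  · rintro ⟨h0, h⟩; exact IsUnit.of_mul_eq_one ⟨_, h⟩ (Subtype.ext (mul_inv_cancel₀ h0))

end LocAt

section ProjectiveSpace

variable {σ : Type} {k : Type u} [Field k] {δ : PS σ k}

/-- The subring `O` of the function field dominates the local ring at `x`. -/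
structure Dominates (x : Pts δ) (O : Subring (RF δ)) : Prop where
  le : Loc x ≤ O
  inv_mem : ∀ g ∈ Loc x, g⁻¹ ∈ O → g⁻¹ ∈ Loc x

lemma dominates_self (x : Pts δ) : Dominates x (Loc x) := ⟨le_rfl, fun _ _ h => h⟩

lemma exists_dominates (O : Subring (RF δ)) [IsLocalRing O] {t : σ}
    (ht : X t ∉ idl δ) (hO : ∀ s, dehom δ ht (X s) ∈ O)
    (hk : ∀ c, algebraMap k _ c ∈ O) : ∃ x : Pts δ, X t ∉ idl x.1 ∧ Dominates x O := by
  have hmem : ∀ a, dehom δ ht a ∈ O := by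
    intro a
    induction a using MvPolynomial.induction_on with
    | C c => exact (AlgHom.commutes (dehom δ ht) c) ▸ hk c
    | add a b ha hb => exact map_add (dehom δ ht) a b ▸ O.add_mem ha hb
    | mul_X a s ha => exact map_mul (dehom δ ht) a _ ▸ O.mul_mem ha (hO s)
  let φ : Poly σ k →+* O := (dehom δ ht).toRingHom.codRestrict O hmem
  have hφ : ∀ a, (φ a : RF δ) = dehom δ ht a := fun a => rfl
  let Q : Ideal (Poly σ k) := (maximalIdeal O).comap φ
  have hQ : Q.IsPrime := Ideal.comap_isPrime φ _
  have hQm : ∀ a, a ∉ Q ↔ dehom δ ht a ≠ 0 ∧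
      (dehom δ ht a)⁻¹ ∈ O := fun a => by
    rw [← hφ, ← isUnit_subring_iff, Ideal.mem_comap, mem_maximalIdeal, mem_nonunits_iff, not_not]
  have ⟨x, hx, hxQ⟩ := exists_point (X t) Q (by
    by_contra h
    refine ((hQm _).mp h).1 ?_
    rw [map_sub, map_one, dehom_self, sub_self])
  have hδx : δ ⤳ x := by
    rw [specializes_iff_dehom ht hx]
    intro a ha
    rw [hxQ]
    by_contra h
    exact ((hQm _).mp h).1 ha
  have hxQ' : ∀ a, dehom x hx a ≠ 0 → a ∉ Q := fun a h h' => h ((hxQ a).mpr h')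
  refine ⟨⟨x, hδx⟩, hx, fun g hg => ?_, fun g hg hg' => ?_⟩
  · have ⟨a, b, hb, h⟩ := (mem_localRing_iff ⟨x, hδx⟩ hx g).mp hg
    have hb1 := (hQm _).mp (hxQ' b hb)
    rw [← eq_mul_inv_iff_mul_eq₀ hb1.1] at h
    rw [h]
    exact O.mul_mem (hmem a) hb1.2
  · have ⟨a, b, hb, h⟩ := (mem_localRing_iff ⟨x, hδx⟩ hx g).mp hg
    have hb1 := (hQm _).mp (hxQ' b hb)
    by_cases hg0 : g = 0
    · rw [hg0, inv_zero]; exact zero_mem _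
    refine (mem_localRing_iff ⟨x, hδx⟩ hx _).mpr ⟨b, a, ?_, ?_⟩
    · intro ha
      rw [hxQ] at ha
      refine ((not_congr (hQm a)).mp (by simpa using ha)) ⟨?_, ?_⟩
      · rw [← h]; exact mul_ne_zero hg0 hb1.1
      · rw [← h, mul_inv]; exact O.mul_mem hg' hb1.2
    · rw [← h]; field_simp

lemma Dominates.vanishesAt_iff {x : Pts δ} {O : Subring (RF δ)}
    (h : Dominates x O) {g : RF δ} (hg : g ∈ Loc x) (hg0 : g ≠ 0) :
    VanishesAt x g ↔ g⁻¹ ∉ O := by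
  rw [vanishesAt_iff_mem]
  refine ⟨fun h' h'' => h'.2 ⟨hg0, hg, h.inv_mem g hg h''⟩, fun h' => ⟨hg, fun h'' =>
    h' (h.le h''.2.2)⟩⟩

lemma dehom_X_mul_dehom_X (x : PS σ k) {s t : σ} (hs : X s ∉ idl x) (ht : X t ∉ idl x) :
    dehom x hs (X t) * dehom x ht (X s) = 1 := by
  have := dehom_change x hs ht
    (isHomogeneous_X k s)
  rw [dehom_self, pow_one] at this
  rw [this, mul_comm]

lemma eq_of_specializes {x y : PS σ k} (h : x ⤳ y) (h' : y ⤳ x) : x = y :=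
  point_ext (le_antisymm (specializes_iff.mp h) (specializes_iff.mp h'))

lemma Dominates.eq {x y : Pts δ} {O : Subring (RF δ)}
    (hx : Dominates x O) (hy : Dominates y O) : x = y := by
  have ⟨s, hs⟩ := exists_X_notMem x.1
  have ⟨t, ht⟩ := exists_X_notMem y.1
  have hs' := x.2.notMem hs
  have ht' := y.2.notMem ht
  have h1 := dehom_mem_localRing x hs (X t)
  have h2 := dehom_mem_localRing y ht (X s)
  have h3 := eq_inv_of_mul_eq_one_right (dehom_X_mul_dehom_X δ hs' ht')
  have htx : X t ∉ idl x.1 := by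
    have h4 := hx.inv_mem _ h1 (h3 ▸ hy.le h2)
    intro h
    have h5 : VanishesAt x (dehom δ hs' (X t)) := by
      rw [← valueAt_eq_zero_iff x h1, valueAt_dehom x hs,
        dehom_eq_zero_iff _ _ (isHomogeneous_X k t)]
      exact h
    rw [vanishesAt_iff_mem] at h5
    exact h5.2 ⟨left_ne_zero_of_mul_eq_one (dehom_X_mul_dehom_X δ hs' ht'), h1, h4⟩
  have key : ∀ z : Pts δ, Dominates z O → ∀ htz : X t ∉ idl z.1, ∀ a,
      dehom z.1 htz a = 0 ↔ dehom δ ht' a = 0 ∨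
        (dehom δ ht' a)⁻¹ ∉ O := by
    intro z hz htz a
    have hm := dehom_mem_localRing z htz a
    by_cases h0 : dehom δ ht' a = 0
    · simp only [h0, true_or, iff_true]; exact dehom_eq_zero_of z htz a h0
    · rw [← hz.vanishesAt_iff hm h0, ← valueAt_eq_zero_iff z hm, valueAt_dehom z htz]; simp [h0]
  refine Subtype.ext (eq_of_specializes ?_ ?_)
  · rw [specializes_iff_dehom htx ht]
    intro a
    rw [key x hx htx, key y hy ht]
    exact id
  · rw [specializes_iff_dehom ht htx]
    intro a
    rw [key x hx htx, key y hy ht]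
    exact id

lemma eq_of_localRing_eq {x y : Pts δ} (h : Loc x = Loc y) : x = y :=
  (dominates_self x).eq (h ▸ dominates_self y)

lemma Dominates.localRing_eq {x : Pts δ} {O : Subring (RF δ)}
    (h : Dominates x O) (hO : ∀ g ∈ O, ∃ a ∈ Loc x, ∃ b ∈ Loc x, b ≠ 0 ∧ b⁻¹ ∈ O ∧
      g * b = a) : Loc x = O := by
  refine le_antisymm h.le fun g hg => ?_
  have ⟨a, ha, b, hb, hb0, hbO, hab⟩ := hO g hg
  rw [← eq_mul_inv_iff_mul_eq₀ hb0] at hab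
  rw [hab]
  exact (Loc x).mul_mem ha (h.inv_mem b hb hbO)

lemma specializes_of_localRing_le {x y : Pts δ} (h : Loc x ≤ Loc y)
    {t : σ} (hx : X t ∉ idl x.1) (hy : X t ∉ idl y.1) : y.1 ⤳ x.1 := by
  rw [specializes_iff_dehom hy hx]
  intro a ha
  have hmx := dehom_mem_localRing x hx a
  by_contra hax
  have h1 : ¬ VanishesAt x (dehom δ (x.2.notMem hx) a) := by
    rwa [← valueAt_eq_zero_iff x hmx, valueAt_dehom x hx]
  rw [vanishesAt_iff_mem, not_and_not_right] at h1
  have h2 := h1 hmx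
  have hmy := dehom_mem_localRing y hy a
  have h3 : VanishesAt y (dehom δ (x.2.notMem hx) a) := by
    rwa [← valueAt_eq_zero_iff y hmy, valueAt_dehom y hy]
  rw [vanishesAt_iff_mem] at h3
  exact h3.2 ⟨h2.1, h hmx, h h2.2.2⟩

lemma localRing_le_of_specializes {x y : Pts δ} (h : y.1 ⤳ x.1) : Loc x ≤ Loc y :=
  localRing_incl_le y (⟨x.1, h⟩ : Pts y.1)

lemma exists_X_of_valuation [Finite σ] (O : Subring (RF δ)) (hO : ∀ g, g ∈ O ∨ g⁻¹ ∈ O) :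
    ∃ (t : σ) (ht : X t ∉ idl δ), ∀ s, dehom δ ht (X s) ∈ O := by
  classical
  have := Fintype.ofFinite σ
  have key : ∀ T : Finset σ, (∃ t ∈ T, X t ∉ idl δ) → ∃ (t : σ) (ht : X t ∉ idl δ),
      ∀ s ∈ T, dehom δ ht (X s) ∈ O := by
    intro T
    induction T using Finset.induction_on with
    | empty => simp
    | insert r T hr ih =>
      intro hT
      by_cases hT' : ∃ t ∈ T, X t ∉ idl δ
      · have ⟨t, ht, h⟩ := ih hT'
        rcases hO (dehom δ ht (X r)) with h1 | h1
        · refine ⟨t, ht, fun s hs => ?_⟩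
          rcases mem_insert.mp hs with rfl | hs
          · exact h1
          · exact h s hs
        · by_cases hr0 : X r ∈ idl δ
          · refine ⟨t, ht, fun s hs => ?_⟩
            rcases mem_insert.mp hs with rfl | hs
            · rw [(dehom_eq_zero_iff δ ht (isHomogeneous_X k s)).mpr hr0]; exact zero_mem _
            · exact h s hs
          · refine ⟨r, hr0, fun s hs => ?_⟩
            rcases mem_insert.mp hs with rfl | hs
            · rw [dehom_self]; exact one_mem _
            · rw [dehom_change δ hr0 ht
                (isHomogeneous_X k s), pow_one]
              refine O.mul_mem (h s hs) ?_
              rwa [eq_inv_of_mul_eq_one_right (dehom_X_mul_dehom_X δ ht hr0)]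
      · have ⟨t, htT, ht⟩ := hT
        refine ⟨t, ht, fun s hs => ?_⟩
        rcases mem_insert.mp hs with rfl | hs
        · rcases mem_insert.mp htT with rfl | htT
          · rw [dehom_self]; exact one_mem _
          · exact absurd ⟨t, htT, ht⟩ hT'
        · rw [(dehom_eq_zero_iff δ ht (isHomogeneous_X k s)).mpr
            (by by_contra hs'; exact hT' ⟨s, hs, hs'⟩)]
          exact zero_mem _
  have ⟨t, ht⟩ := exists_X_notMem δ
  have ⟨t, ht, h⟩ := key Finset.univ ⟨t, Finset.mem_univ _, ht⟩
  exact ⟨t, ht, fun s => h s (Finset.mem_univ s)⟩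

lemma isLocalRing_of_valuation {K : Type*} [Field K] (O : Subring K)
    (hO : ∀ g, g ∈ O ∨ g⁻¹ ∈ O) : IsLocalRing O := by
  refine IsLocalRing.of_isUnit_or_isUnit_one_sub_self fun g => ?_
  rw [isUnit_subring_iff, isUnit_subring_iff]
  change _ ∨ ((1 - g : K) ≠ 0 ∧ (1 - g : K)⁻¹ ∈ O)
  by_cases h0 : (g : K) = 0
  · simp [h0, one_mem]
  by_cases h1 : (1 - g : K) = 0
  · have : (g : K) = 1 := by linear_combination -h1
    simp [this, one_mem]
  by_contra! h
  have h2 := h.1 h0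
  have h3 := h.2 h1
  rcases hO ((1 - g) / g) with h4 | h4
  · refine h2 ?_
    have := O.add_mem h4 O.one_mem
    convert this using 1
    field_simp
    ring
  · refine h3 ?_
    have := O.add_mem h4 O.one_mem
    convert this using 1
    field_simp
    ring

lemma exists_center [Finite σ] (O : Subring (RF δ))
    (hO : ∀ g, g ∈ O ∨ g⁻¹ ∈ O) (hk : ∀ c, algebraMap k _ c ∈ O) :
    ∃ x : Pts δ, Dominates x O := by
  have := isLocalRing_of_valuation O hO
  have ⟨t, ht, h⟩ := exists_X_of_valuation O hO
  have ⟨x, _, hx⟩ := exists_dominates O ht h hk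
  exact ⟨x, hx⟩

lemma exists_open_mem_localRing (x : Pts δ) {g : RF δ} (hg : g ∈ Loc x) :
    ∃ U : (PS σ k).Opens, x.1 ∈ U ∧ ∀ y : Pts δ, y.1 ∈ U → g ∈ Loc y := by
  obtain ⟨s, rfl⟩ := hg
  obtain ⟨n, a, b, ha, hb, hbx, rfl⟩ := exists_frac x.1 s
  refine ⟨ProjectiveSpectrum.basicOpen (Forms σ k) b, hbx, fun y hy => ?_⟩
  refine ⟨frac y.1 ha hb hy, ?_⟩
  have hbδ := x.2.notMem hbx
  simp only [toFunctionField, CommRingCat.hom_comp, RingHom.comp_apply,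
    frac_specializes x.2 ha hb hbx hbδ, frac_specializes y.2 ha hb hy hbδ]

lemma exists_form_of_mem_opens {x : PS σ k} {U : (PS σ k).Opens} (hx : x ∈ U) :
    ∃ (n : ℕ) (h : Poly σ k), h.IsHomogeneous n ∧ h ∉ idl x ∧
      ∀ y : PS σ k, h ∉ idl y → y ∈ U := by
  obtain ⟨V, ⟨f, rfl⟩, hxV, hVU⟩ :=
    (ProjectiveSpectrum.isTopologicalBasis_basic_opens (Forms σ k)).exists_subset_of_mem_open
      (show x ∈ (U : Set (PS σ k)) from hx) U.isOpen
  have hf : f ∉ idl x := hxV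
  have : ∃ i, homogeneousComponent i f ∉ idl x := by
    by_contra! h
    apply hf
    rw [← sum_homogeneousComponent f]
    exact Ideal.sum_mem _ fun i _ => h i
  have ⟨i, hi⟩ := this
  refine ⟨i, _, homogeneousComponent_isHomogeneous i f, hi, fun y hy => hVU ?_⟩
  intro hfy
  refine hy ?_
  have := y.asHomogeneousIdeal.2 i hfy
  rwa [show (DirectSum.decompose (Forms σ k) f i : Poly σ k) =
      homogeneousComponent i f from decomposition.decompose'_apply f i] at this

lemma isClosed_singleton_of_surjective {x : PS σ k}
    (h : Function.Surjective (algebraMap k (RF x))) :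
    IsClosed ({x} : Set (PS σ k)) := by
  have key : ∀ y, x ⤳ y → y = x := by
    intro y hxy
    have ⟨t, hy⟩ := exists_X_notMem y
    have hx := Specializes.notMem hxy hy
    refine eq_of_specializes ?_ hxy
    rw [specializes_iff_dehom hy hx]
    intro a ha
    have ⟨c, hc⟩ := h (dehom x hx a)
    have h1 : dehom x hx (a - C c) = 0 := by
      rw [map_sub, ← hc, sub_eq_zero]
      exact (AlgHom.commutes _ c).symm
    have h2 := dehom_eq_zero_of ⟨y, hxy⟩ hy _ h1
    rw [map_sub, ha, zero_sub, neg_eq_zero] at h2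
    have h3 : algebraMap k (RF y) c = 0 := by rw [← h2]; exact (AlgHom.commutes (dehom y hy) c).symm
    have h4 : c = 0 := by simpa using h3
    rw [← hc, h4, map_zero]
  rw [← closure_subset_iff_isClosed]
  intro y hy
  exact key y (specializes_iff_mem_closure.mpr hy)

lemma algebraMap_surjective_of_isClosed [Finite σ] [IsAlgClosed k] {x : PS σ k}
    (h : IsClosed ({x} : Set (PS σ k))) :
    Function.Surjective (algebraMap k (RF x)) := by
  have ⟨t, hx⟩ := exists_X_notMem x
  set φ := dehom x hx with hφ
  have ⟨M, hM, hle⟩ := Ideal.exists_le_maximal (RingHom.ker φ) (RingHom.ker_ne_top _)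
  have ⟨y, hy, hyM⟩ := exists_point (X t) M (hle (by
    rw [RingHom.mem_ker, map_sub, map_one, hφ, dehom_self, sub_self]))
  have hxy : x ⤳ y := by
    rw [specializes_iff_dehom hx hy]
    intro a ha
    exact (hyM a).mpr (hle ha)
  have hyx : y = x := by
    have : y ∈ closure {x} := specializes_iff_mem_closure.mp hxy
    rw [h.closure_eq] at this
    exact this
  subst hyx
  have hbij : Function.Surjective (algebraMap k (Poly σ k ⧸ M)) := by
    let := Ideal.Quotient.field M
    have : Module.Finite k (Poly σ k ⧸ M) := finite_of_finite_type_of_isJacobsonRing _ _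
    exact (IsAlgClosed.algebraMap_bijective_of_isIntegral (k := k)).2
  have key : ∀ a, ∃ c, φ a = algebraMap k _ c := by
    intro a
    have ⟨c, hc⟩ := hbij (Ideal.Quotient.mk M a)
    refine ⟨c, ?_⟩
    have : a - C c ∈ M := by rw [← Ideal.Quotient.eq_zero_iff_mem, map_sub, ← hc, sub_eq_zero]; rfl
    have := (hyM _).mpr this
    rw [map_sub, sub_eq_zero] at this
    rw [this]
    exact AlgHom.commutes _ c
  intro g
  have ⟨a, b, hb, h⟩ := exists_dehom_eq y hx g
  have ⟨c, hc⟩ := key a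
  have ⟨d, hd⟩ := key b
  refine ⟨c / d, ?_⟩
  rw [map_div₀, ← hc, ← hd, div_eq_iff hb, h]

end ProjectiveSpace

section Length

lemma isSimpleModule_of_residue {k R V : Type*} [Field k] [CommRing R] [IsLocalRing R]
    [Algebra k R] (hres : ∀ r : R, ∃ c : k, r - algebraMap k R c ∈ maximalIdeal R)
    [AddCommGroup V] [Module R V] [Module k V] [IsScalarTower k R V] [IsSimpleModule R V] :
    IsSimpleModule k V := by
  have hann : Module.annihilator R V = maximalIdeal R :=
    IsLocalRing.eq_maximalIdeal (IsSimpleModule.annihilator_isMaximal (R := R))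
  have h := (isSimpleModule_iff_toSpanSingleton_surjective (R := R) (M := V)).mp inferInstance
  refine (isSimpleModule_iff_toSpanSingleton_surjective (R := k) (M := V)).mpr
    ⟨h.1, fun x hx y => ?_⟩
  have ⟨r, hr⟩ := h.2 x hx y
  have ⟨c, hc⟩ := hres r
  refine ⟨c, ?_⟩
  rw [← hann, Module.mem_annihilator] at hc
  have := hc x
  rw [sub_smul, algebraMap_smul, sub_eq_zero] at this
  rw [LinearMap.toSpanSingleton_apply] at hr ⊢
  rw [← this, hr]

lemma length_eq_of_residue {k R : Type*} [Field k] [CommRing R] [IsLocalRing R]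
    [Algebra k R] (hres : ∀ r : R, ∃ c : k, r - algebraMap k R c ∈ maximalIdeal R)
    {V : Type*} [AddCommGroup V] [Module R V] (hV : IsFiniteLength R V) :
    ∀ [Module k V] [IsScalarTower k R V], Module.length R V = Module.length k V := by
  induction hV with
  | of_subsingleton =>
    intro _ _
    rw [Module.length_eq_zero, Module.length_eq_zero]
  | @of_simple_quotient V _ _ N hs hN ih =>
    intro _ _
    have h1 := Module.length_eq_add_of_exact N.subtype N.mkQ N.injective_subtype
      N.mkQ_surjective (LinearMap.exact_subtype_mkQ N)
    have h2 := Module.length_eq_add_of_exact (N.subtype.restrictScalars k)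
      (N.mkQ.restrictScalars k) N.injective_subtype
      N.mkQ_surjective (LinearMap.exact_subtype_mkQ N)
    have := isSimpleModule_of_residue (V := V ⧸ N) hres
    rw [h1, h2, ih, Module.length_eq_one R (V ⧸ N), Module.length_eq_one k (V ⧸ N)]

variable {k B : Type*} [Field k] [CommRing B] [Algebra k B]

lemma finrank_eq_sum_localization (A : Type*) [CommRing A] [Algebra k A] [Module.Finite k A]
    [Fintype (MaximalSpectrum A)] :
    finrank k A = ∑ M : MaximalSpectrum A, finrank k (Localization.AtPrime M.1) := by
  have : IsArtinianRing A := isArtinian_of_tower k inferInstance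
  have e := (MaximalSpectrum.toPiLocalizationEquiv A).restrictScalars k
  have hfin : ∀ M : MaximalSpectrum A, Module.Finite k (Localization.AtPrime M.1) := fun M =>
    Module.Finite.of_surjective ((LinearMap.proj M : (MaximalSpectrum.PiLocalization A) →ₗ[k]
      Localization.AtPrime M.1).comp e.toLinearMap)
      ((Function.surjective_eval M).comp e.surjective)
  rw [e.toLinearEquiv.finrank_eq, Module.finrank_pi_fintype]

lemma ord_eq_finrank_localization (α : B) [Module.Finite k (B ⧸ span {α})]
    (M : MaximalSpectrum (B ⧸ span {α})) (R : Type*) [CommRing R] [IsLocalRing R]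
    [Algebra k R] [Algebra B R] [IsScalarTower k B R]
    [hR : IsLocalization.AtPrime R (M.1.comap (Ideal.Quotient.mk (span {α})))]
    (hres : ∀ r : R, ∃ c : k, r - algebraMap k R c ∈ maximalIdeal R) :
    Ring.ord R (algebraMap B R α) = finrank k (Localization.AtPrime M.1) := by
  let f := Ideal.Quotient.mk (span {α})
  let I := span {algebraMap B R α}
  let ψ : B ⧸ span {α} →+* R ⧸ I := Ideal.Quotient.lift _
    ((Ideal.Quotient.mk I).comp (algebraMap B R)) (by
      intro a ha
      obtain ⟨c, rfl⟩ := mem_span_singleton'.mp ha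
      rw [RingHom.comp_apply, Ideal.Quotient.eq_zero_iff_mem, map_mul]
      exact I.mul_mem_left _ (mem_span_singleton_self _))
  let _ : Algebra (B ⧸ span {α}) (R ⧸ I) := ψ.toAlgebra
  have hloc := IsLocalization.of_surjective (M := (M.1.comap f).primeCompl) (S := R) f
    Ideal.Quotient.mk_surjective (Ideal.Quotient.mk I) Ideal.Quotient.mk_surjective (by
      ext; rfl) (by
      rw [Ideal.mk_ker, Ideal.mk_ker, Ideal.map_span, Set.image_singleton])
  have hM : (M.1.comap f).primeCompl.map f = M.1.primeCompl := by
    ext a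
    constructor
    · rintro ⟨b, hb, rfl⟩; exact hb
    · intro ha
      obtain ⟨b, rfl⟩ := Ideal.Quotient.mk_surjective a
      exact ⟨b, ha, rfl⟩
  rw [hM] at hloc
  have e := IsLocalization.algEquiv M.1.primeCompl (R ⧸ I) (Localization.AtPrime M.1)
  have : IsScalarTower k (B ⧸ span {α}) (R ⧸ I) := IsScalarTower.of_algebraMap_eq' (by
    ext c
    change algebraMap k (R ⧸ I) c = Ideal.Quotient.mk I (algebraMap B R (algebraMap k B c))
    rw [← IsScalarTower.algebraMap_apply]
    rfl)
  have ek := e.restrictScalars k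
  have : IsArtinianRing (B ⧸ span {α}) := isArtinian_of_tower k inferInstance
  have : Fintype (MaximalSpectrum (B ⧸ span {α})) := Fintype.ofFinite _
  have e2 := (MaximalSpectrum.toPiLocalizationEquiv (B ⧸ span {α})).restrictScalars k
  have hfin : Module.Finite k (Localization.AtPrime M.1) :=
    Module.Finite.of_surjective ((LinearMap.proj M :
      (MaximalSpectrum.PiLocalization (B ⧸ span {α})) →ₗ[k]
      Localization.AtPrime M.1).comp e2.toLinearMap)
      ((Function.surjective_eval M).comp e2.surjective)
  have hfin2 : Module.Finite k (R ⧸ I) := Module.Finite.equiv ek.symm.toLinearEquiv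
  have hlen : IsFiniteLength R (R ⧸ I) := isFiniteLength_iff_isNoetherian_isArtinian.mpr
    ⟨isNoetherian_of_tower k inferInstance, isArtinian_of_tower k inferInstance⟩
  rw [Ring.ord, length_eq_of_residue hres hlen, ← ek.toLinearEquiv.finrank_eq,
    Module.length_eq_finrank]

end Length

section Filtration

variable {k K : Type*} [Field k] [Field K] [Algebra k K]

/-- The dimension of `B / αB` for a filtered ring `B = ⋃ V n` with `V (n + d) = α V n + V (n + d - 1)`
for large `n`. -/
lemma finrank_quotient_of_filtration (V : ℕ → Submodule k K) [∀ n, Module.Finite k (V n)]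
    (hV : Monotone V) (α : K) (hα : α ≠ 0) (d m₀ : ℕ)
    (hmul : ∀ n, (V n).map (LinearMap.mulLeft k α) ≤ V (n + d))
    (hgen : ∀ n ≥ m₀, V (n + 1 + d) ≤ (V (n + 1)).map (LinearMap.mulLeft k α) ⊔ V (n + d)) :
    Module.Finite k (↥(⨆ n, V n) ⧸ ((⨆ n, V n).map (LinearMap.mulLeft k α)).submoduleOf
      (⨆ n, V n)) ∧ ∃ N, ∀ n ≥ N,
      finrank k (↥(⨆ n, V n) ⧸ ((⨆ n, V n).map (LinearMap.mulLeft k α)).submoduleOf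
      (⨆ n, V n)) + finrank k (V n) = finrank k (V (n + d)) := by
  set W : ℕ → Submodule k K := fun n => (V n).map (LinearMap.mulLeft k α) with hW
  have hinj : Inj (LinearMap.mulLeft k α) := mul_right_injective₀ hα
  have hWr : ∀ n, finrank k (W n) = finrank k (V n) := fun n =>
    (Submodule.equivMapOfInjective _ hinj (V n)).finrank_eq.symm
  have hWm : Monotone W := fun a b h => Submodule.map_mono (hV h)
  have hWfin : ∀ n, Module.Finite k (W n) := fun n => inferInstance
  set c : ℕ → ℕ := fun n => finrank k (V (n + d)) - finrank k (V n) with hc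
  have hle : ∀ n, finrank k (V n) ≤ finrank k (V (n + d)) := fun n =>
    Submodule.finrank_mono (hV (Nat.le_add_right _ _))
  have hstep : ∀ n ≥ m₀, finrank k (V (n + 1 + d)) + finrank k ↥(W (n + 1) ⊓ V (n + d))
      ≤ finrank k (V (n + 1)) + finrank k (V (n + d)) := by
    intro n hn
    rw [← hWr (n + 1), ← Submodule.finrank_sup_add_finrank_inf_eq (W (n + 1))]
    exact Nat.add_le_add_right (Submodule.finrank_mono (hgen n hn)) _
  have hWle : ∀ n, W n ≤ W (n + 1) ⊓ V (n + d) := fun n => le_inf (hWm (Nat.le_succ n)) (hmul n)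
  have hstep2 : ∀ n, finrank k (V n) ≤ finrank k ↥(W (n + 1) ⊓ V (n + d)) := fun n => by
    rw [← hWr]
    exact Submodule.finrank_mono (hWle n)
  have hanti : Antitone fun n => c (n + m₀) := antitone_nat_of_succ_le fun n => by
    have h1 := hstep (n + m₀) (Nat.le_add_left _ _)
    have h2 := hstep2 (n + m₀)
    have h3 := hle (n + m₀)
    have h4 := hle (n + m₀ + 1)
    simp only [hc]
    rw [show n + 1 + m₀ = n + m₀ + 1 by ring]
    omega
  have ⟨N, hN⟩ := WellFoundedGT.monotone_chain_condition (α := ℕᵒᵈ)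
    ⟨fun n => OrderDual.toDual (c (n + m₀)), fun a b h => hanti h⟩
  have hN' : ∀ n ≥ N, c (n + m₀) = c (N + m₀) := fun n hn => (hN n hn).symm
  set N₁ := N + m₀ with hN₁
  have heq : ∀ n ≥ N₁, W (n + 1) ⊓ V (n + d) = W n := by
    intro n hn
    symm
    apply Submodule.eq_of_le_of_finrank_le (hWle n)
    have h1 := hstep n (by omega)
    have h3 := hle n
    have h4 := hle (n + 1)
    have h5 := hN' (n - m₀) (by omega)
    have h6 := hN' (n + 1 - m₀) (by omega)
    rw [show n - m₀ + m₀ = n by omega] at h5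
    rw [show n + 1 - m₀ + m₀ = n + 1 by omega] at h6
    simp only [hc] at h5 h6
    rw [hWr]
    omega
  have heq2 : ∀ n ≥ N₁, ∀ j, W (n + j) ⊓ V (n + d) ≤ W n := by
    intro n hn j
    induction j with
    | zero => exact inf_le_left
    | succ j ih =>
      refine le_trans ?_ ih
      refine le_inf ?_ inf_le_right
      have := heq (n + j) (by omega)
      rw [← this]
      exact le_inf inf_le_left (inf_le_right.trans (hV (by omega)))
  have hWsup : (⨆ n, V n).map (LinearMap.mulLeft k α) = ⨆ n, W n := Submodule.map_iSup _ _
  have hinf : ∀ n ≥ N₁, V (n + d) ⊓ (⨆ n, W n) = W n := by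
    intro n hn
    apply le_antisymm
    · rintro v ⟨h1, h2⟩
      have ⟨m, hm⟩ := (Submodule.mem_iSup_of_directed _ hWm.directed_le).mp h2
      exact heq2 n hn m ⟨hWm (Nat.le_add_left m n) hm, h1⟩
    · exact le_inf (hmul n) (le_iSup W n)
  have hsup : ∀ n ≥ N₁, V (n + d) ⊔ (⨆ n, W n) = ⨆ n, V n := by
    intro n hn
    apply le_antisymm
    · refine sup_le (le_iSup V _) (iSup_le fun m => (hmul m).trans (le_iSup V _))
    · have key : ∀ j, V (n + d + j) ≤ V (n + d) ⊔ (⨆ n, W n) := by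
        intro j
        induction j with
        | zero => exact le_sup_left
        | succ j ih =>
          rw [show n + d + (j + 1) = (n + j) + 1 + d by ring]
          refine (hgen (n + j) (by omega)).trans (sup_le ?_ ?_)
          · exact (le_iSup W _).trans le_sup_right
          · rw [show n + j + d = n + d + j by ring]
            exact ih
      exact iSup_le fun m => (hV (show m ≤ n + d + m by omega)).trans (key m)
  rw [hWsup]
  have e : ∀ n ≥ N₁, Nonempty ((↥(V (n + d)) ⧸ (W n).submoduleOf (V (n + d))) ≃ₗ[k]
      (↥(⨆ n, V n) ⧸ (⨆ n, W n).submoduleOf (⨆ n, V n))) := by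
    intro n hn
    have := LinearMap.quotientInfEquivSupQuotient (V (n + d)) (⨆ n, W n)
    rw [← Submodule.comap_inf, hinf n hn, hsup n hn] at this
    exact ⟨this⟩
  constructor
  · have ⟨e₁⟩ := e N₁ le_rfl; exact Module.Finite.equiv e₁
  · refine ⟨N₁, fun n hn => ?_⟩
    have ⟨e₁⟩ := e n hn
    rw [← e₁.finrank_eq, ← hWr n]
    have h1 := Submodule.finrank_quotient_add_finrank ((W n).submoduleOf (V (n + d)))
    rw [← h1, (Submodule.submoduleOfEquivOfLe (hmul n)).finrank_eq]

end Filtration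

section ProjectiveSpace

variable {σ : Type} {k : Type u} [Field k]

lemma eq_or_isClosed_of_isCurvePoint {η : PS σ k} (hη : IsCurvePoint η) (z : Pts η) :
    z.1 = η ∨ IsClosed ({z.1} : Set (PS σ k)) := by
  by_cases h : z.1 = η
  · exact Or.inl h
  · exact Or.inr (hη.2 z.1 z.2 h)

lemma eq_of_isClosed {x y : PS σ k} (hx : IsClosed ({x} : Set (PS σ k))) (h : x ⤳ y) : y = x := by
  have : y ∈ closure {x} := specializes_iff_mem_closure.mp h
  rwa [hx.closure_eq] at this

lemma finite_zeros [Finite σ] {η : PS σ k} (hη : IsCurvePoint η) {d : ℕ} {a : Poly σ k}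
    (ha : a.IsHomogeneous d) (haη : a ∉ idl η) : {z : Pts η | a ∈ idl z.1}.Finite := by
  classical
  have hunion : {z : Pts η | a ∈ idl z.1} ⊆
      ⋃ t : σ, {z : Pts η | a ∈ idl z.1 ∧ X t ∉ idl z.1} := by
    intro z hz
    have ⟨t, ht⟩ := exists_X_notMem z.1
    exact Set.mem_iUnion.mpr ⟨t, hz, ht⟩
  refine (Set.finite_iUnion fun t => ?_).subset hunion
  by_cases ht : X t ∈ idl η
  · convert Set.finite_empty
    ext z
    simp only [Set.mem_ofPred_eq, Set.mem_empty_iff_false, iff_false, not_and, not_not]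
    exact fun _ => specializes_iff.mp z.2 ht
  set J : Ideal (Poly σ k) := RingHom.ker (dehom η ht) ⊔ span {a} with hJ
  have hfin := Ideal.finite_minimalPrimes_of_isNoetherianRing (Poly σ k) J
  have hker : ∀ (z : Pts η) (hz : X t ∉ idl z.1), a ∈ idl z.1 →
      RingHom.ker (dehom z.1 hz) ∈ J.minimalPrimes := by
    intro z hz haz
    refine ⟨⟨RingHom.ker_isPrime _, sup_le ?_ ?_⟩, ?_⟩
    · intro b hb; exact dehom_eq_zero_of z hz b hb
    · rw [Ideal.span_singleton_le_iff_mem]; exact (dehom_eq_zero_iff z.1 hz ha).mpr haz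
    · rintro Q ⟨hQ, hJQ⟩ hQz
      have ⟨y, hy, hyQ⟩ := exists_point (X t) Q (hJQ (le_sup_left (a := RingHom.ker
        (dehom η ht)) (by
          rw [RingHom.mem_ker, map_sub, map_one, dehom_self, sub_self])))
      have hηy : η ⤳ y := by
        rw [specializes_iff_dehom ht hy]
        exact fun b hb => (hyQ b).mpr (hJQ (le_sup_left (a := RingHom.ker (dehom η ht)) hb))
      have hyz : y ⤳ z.1 := by
        rw [specializes_iff_dehom hy hz]
        exact fun b hb => hQz ((hyQ b).mp hb)
      have haQ : a ∈ Q := hJQ (le_sup_right (a := RingHom.ker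
          (dehom η ht)) (mem_span_singleton_self a))
      rcases eq_or_isClosed_of_isCurvePoint hη ⟨y, hηy⟩ with h | h
      · exfalso
        apply haη
        have := (dehom_eq_zero_iff y hy ha).mp ((hyQ a).mpr haQ)
        change y = η at h
        rwa [h] at this
      · have h1 := eq_of_isClosed h hyz
        intro b hb
        rw [← hyQ]
        subst h1
        exact hb
  refine Set.Finite.of_finite_image (f := fun z : Pts η =>
    if hz : X t ∉ idl z.1 then RingHom.ker (dehom z.1 hz) else ⊥)
    (hfin.subset ?_) ?_
  · rintro _ ⟨z, ⟨haz, hz⟩, rfl⟩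
    simp only [dif_pos hz]
    exact hker z hz haz
  · rintro z ⟨haz, hz⟩ w ⟨haw, hw⟩ h
    simp only [dif_pos hz, dif_pos hw] at h
    refine Subtype.ext (eq_of_specializes ?_ ?_)
    · rw [specializes_iff_dehom hz hw]; exact fun b hb => h.le hb
    · rw [specializes_iff_dehom hw hz]; exact fun b hb => h.ge hb

lemma exists_linear_form [Infinite k] {T : Set (PS σ k)} (hT : T.Finite) :
    ∃ l : Poly σ k, l.IsHomogeneous 1 ∧ ∀ x ∈ T, l ∉ idl x := by
  classical
  let s : Finset (Subspace k (Forms σ k 1)) := hT.toFinset.image fun x =>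
    ((idl x).restrictScalars k).submoduleOf (Forms σ k 1)
  have hs : ⊤ ∉ s := by
    intro h
    have ⟨x, _, hx⟩ := Finset.mem_image.mp h
    have ⟨t, ht⟩ := exists_X_notMem x
    have : (⟨X t, isHomogeneous_X k t⟩ : Forms σ k 1) ∈
        ((idl x).restrictScalars k).submoduleOf (Forms σ k 1) := hx ▸ trivial
    exact ht this
  have h := Subspace.biUnion_ne_univ_of_top_notMem hs
  have ⟨l, hl⟩ := (Set.ne_univ_iff_exists_notMem _).mp h
  refine ⟨l.1, l.2, fun x hx hlx => hl ?_⟩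
  exact Set.mem_biUnion (Finset.mem_image_of_mem _ (hT.mem_toFinset.mpr hx)) hlx

lemma isHomogeneous_component_mul_left {d n : ℕ} {a : Poly σ k} (ha : a.IsHomogeneous d)
    (u : Poly σ k) :
    homogeneousComponent (n + d) (u * a) = homogeneousComponent n u * a := by
  have h : ∀ m p, homogeneousComponent m p =
      (DirectSum.decompose (Forms σ k) p m : Poly σ k) :=
    fun m p => (decomposition.decompose'_apply p m).symm
  rw [h, h, mul_comm u, DirectSum.coe_decompose_mul_of_left_mem_of_le
    (Forms σ k) (show a ∈ Forms σ k d from ha)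
    (Nat.le_add_left d n), Nat.add_sub_cancel, mul_comm]

/-- If a form `a` and a linear form `l` have no common zero on `closure {η}`, then all forms of
large degree are combinations of `a` and `l` modulo the ideal of `η`. -/
lemma exists_combination [Finite σ] {η : PS σ k} {d : ℕ} {a l : Poly σ k}
    (ha : a.IsHomogeneous d) (hl : l.IsHomogeneous 1)
    (hal : ∀ z : Pts η, a ∈ idl z.1 → l ∉ idl z.1) :
    ∃ m₀, ∀ m ≥ m₀, ∀ f : Poly σ k, f.IsHomogeneous (m + 1 + d) →
      ∃ u v : Poly σ k, u.IsHomogeneous (m + 1) ∧ v.IsHomogeneous (m + d) ∧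
        f - (u * a + v * l) ∈ idl η := by
  set J : Ideal (Poly σ k) := idl η ⊔ span {a} ⊔ span {l} with hJ
  have hJh : J.IsHomogeneous (Forms σ k) := by
    refine Ideal.IsHomogeneous.sup (Ideal.IsHomogeneous.sup η.asHomogeneousIdeal.2 ?_) ?_
    · exact Ideal.homogeneous_span _ _ (by rintro _ rfl; exact ⟨d, ha⟩)
    · exact Ideal.homogeneous_span _ _ (by rintro _ rfl; exact ⟨1, hl⟩)
  have hrad : idealOfVars σ k ≤ J.radical := by
    rw [idealOfVars, span_le]
    rintro _ ⟨t, rfl⟩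
    by_contra ht
    rw [SetLike.mem_coe, Ideal.radical_eq_sInf, Ideal.mem_sInf] at ht
    push Not at ht
    have ⟨Q, ⟨hJQ, hQ⟩, htQ⟩ := ht
    have hmem : ∀ {n : ℕ} {a : Poly σ k}, a.IsHomogeneous n →
        (a ∈ (Q.homogeneousCore (Forms σ k)).toIdeal ↔ a ∈ Q) := fun {n a} ha =>
      ⟨fun h => Ideal.toIdeal_homogeneousCore_le _ _ h,
        fun h => Ideal.mem_homogeneousCore_of_homogeneous_of_mem ⟨n, ha⟩ h⟩
    let x : PS σ k :=
      { asHomogeneousIdeal := Q.homogeneousCore (Forms σ k)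
        isPrime := hQ.homogeneousCore (𝒜 := Forms σ k)
        not_irrelevant_le := fun h => htQ ((hmem (isHomogeneous_X k t)).mp
          (h (HomogeneousIdeal.mem_irrelevant_of_mem _ one_pos (isHomogeneous_X k t)))) }
    have hJx : J ≤ idl x := by
      rw [← hJh.toIdeal_homogeneousCore_eq_self]
      exact Ideal.homogeneousCore_mono _ hJQ
    have hηx : η ⤳ x := specializes_iff.mpr ((le_sup_left.trans le_sup_left).trans hJx)
    refine hal ⟨x, hηx⟩ (hJx ?_) (hJx ?_)
    · exact le_sup_left (b := span {l}) (le_sup_right (a := idl η)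
        (mem_span_singleton_self a))
    · exact le_sup_right (a := idl η ⊔ span {a}) (mem_span_singleton_self l)
  have ⟨N, hN⟩ := Ideal.exists_pow_le_of_le_radical_of_fg hrad (idealOfVars_fg σ k)
  refine ⟨N, fun m hm f hf => ?_⟩
  have hfJ : f ∈ J := by
    refine hN ((mem_pow_idealOfVars_iff N f).mpr fun x hx => ?_)
    have h1 := hf (mem_support_iff.mp hx)
    have h2 : x.degree = m + 1 + d := by
      rw [← h1, Finsupp.weight_apply, Finsupp.degree, Finsupp.sum]
      simp
      rfl
    omega
  obtain ⟨g, hg, v, hv, rfl⟩ := Submodule.mem_sup.mp hfJ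
  obtain ⟨w, hw, u, hu, rfl⟩ := Submodule.mem_sup.mp hg
  obtain ⟨u, rfl⟩ := mem_span_singleton'.mp hu
  obtain ⟨v, rfl⟩ := mem_span_singleton'.mp hv
  refine ⟨homogeneousComponent (m + 1) u, homogeneousComponent (m + d) v,
    homogeneousComponent_isHomogeneous _ _, homogeneousComponent_isHomogeneous _ _, ?_⟩
  have h1 := homogeneousComponent_eq_self hf
  rw [← h1, map_add, map_add, isHomogeneous_component_mul_left ha,
    show m + 1 + d = m + d + 1 by ring, isHomogeneous_component_mul_left hl]
  have h2 : homogeneousComponent (m + d + 1) w ∈ idl η := by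
    have := η.asHomogeneousIdeal.2 (m + d + 1) hw
    rwa [show (DirectSum.decompose (Forms σ k) w (m + d + 1) : Poly σ k) =
      homogeneousComponent (m + d + 1) w from decomposition.decompose'_apply w _] at this
  convert h2 using 1
  ring

instance (priority := low) isLocalRing_localRing {δ : PS σ k} (x : Pts δ) : IsLocalRing (Loc x) :=
  IsLocalRing.of_surjective' (toFunctionField x).rangeRestrict
    (toFunctionField x).rangeRestrict_surjective

instance algebraLocalRing {δ : PS σ k} (x : Pts δ) : Algebra k (Loc x) :=
  ((algebraMap k (RF δ)).codRestrict (Loc x)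
    (cst_mem x)).toAlgebra

lemma mem_maximalIdeal_localRing {δ : PS σ k} (x : Pts δ) (g : Loc x) :
    g ∈ maximalIdeal (Loc x) ↔ VanishesAt x (g : RF δ) := by
  rw [mem_maximalIdeal, mem_nonunits_iff, isUnit_subring_iff, vanishesAt_iff_mem]
  constructor
  · intro h; exact ⟨g.2, fun h' => h ⟨h'.1, h'.2.2⟩⟩
  · rintro ⟨h1, h2⟩ h; exact h2 ⟨h.1, g.2, h.2⟩

lemma exists_sub_mem_maximalIdeal [Finite σ] [IsAlgClosed k] {δ : PS σ k} (x : Pts δ)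
    (hx : IsClosed ({x.1} : Set (PS σ k))) (g : Loc x) :
    ∃ c : k, g - algebraMap k (Loc x) c ∈ maximalIdeal (Loc x) := by
  have ⟨c, hc⟩ := algebraMap_surjective_of_isClosed hx (valueAt x (g : RF δ))
  refine ⟨c, (mem_maximalIdeal_localRing x _).mpr ?_⟩
  have hmem : ((g - algebraMap k (Loc x) c : Loc x) : RF δ) ∈
    Loc x := (g - algebraMap k (Loc x) c).2
  rw [← valueAt_eq_zero_iff x hmem]
  have h1 : valueAt x ((g - algebraMap k (Loc x) c : Loc x) :
      RF δ) = valueAt x (g : RF δ) -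
        valueAt x (algebraMap k (RF δ) c) := map_sub (valHom x) g (algebraMap k (Loc x) c)
  rw [h1, valueAt_algebraMap, hc, sub_self]

end ProjectiveSpace

section Length

variable {k B : Type*} [Field k] [CommRing B] [Algebra k B]

lemma ord_ne_top_and_finrank_eq_sum (α : B) [Module.Finite k (B ⧸ span {α})] {ι : Type*}
    (f : ι → MaximalSpectrum (B ⧸ span {α})) (hf : Function.Bijective f)
    (R : ι → Type*) [∀ i, CommRing (R i)] [∀ i, IsLocalRing (R i)]
    [∀ i, Algebra k (R i)] [∀ i, Algebra B (R i)] [∀ i, IsScalarTower k B (R i)]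
    [∀ i, IsLocalization.AtPrime (R i) ((f i).1.comap (Ideal.Quotient.mk (span {α})))]
    (hres : ∀ i, ∀ r : R i, ∃ c : k, r - algebraMap k (R i) c ∈ maximalIdeal (R i)) :
    (∀ i, Ring.ord (R i) (algebraMap B (R i) α) ≠ ⊤) ∧
      ∀ [Fintype ι], finrank k (B ⧸ span {α}) =
        ∑ i, (Ring.ord (R i) (algebraMap B (R i) α)).toNat := by
  refine ⟨fun i => ?_, fun {_} => ?_⟩
  · rw [ord_eq_finrank_localization α (f i) (R i) (hres i)]; exact ENat.natCast_ne_top _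
  · have : Fintype (MaximalSpectrum (B ⧸ span {α})) := Fintype.ofEquiv _ (Equiv.ofBijective f hf)
    rw [finrank_eq_sum_localization]
    symm
    refine Fintype.sum_bijective f hf _ _ fun i => ?_
    rw [ord_eq_finrank_localization α (f i) (R i) (hres i), ENat.toNat_natCast]

end Length

section ProjectiveSpace

variable {σ : Type} {k : Type u} [Field k]

section CoordRing

variable {η : PS σ k} {l : Poly σ k} [hl : Lin l]

/-- The coordinate ring of the affine part `l ≠ 0` of `closure {η}`. -/
abbrev coordRing (hη : l ∉ idl η) : Subalgebra k (RF η) := (dehom η hη).range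

variable (z : Pts η) (hz : l ∉ idl z.1)

/-- The inclusion of the coordinate ring in a local ring. -/
def coordToLocal : coordRing (z.2.notMem hz) →ₐ[k] Loc z where
  toFun b := ⟨b.1, by
    obtain ⟨b, a, rfl⟩ := b
    exact dehom_mem_localRing z hz a⟩
  map_one' := rfl
  map_mul' _ _ := rfl
  map_zero' := rfl
  map_add' _ _ := rfl
  commutes' _ := rfl

/-- The ideal of a point in the coordinate ring. -/
abbrev pointIdeal : Ideal (coordRing (z.2.notMem hz)) :=
  (maximalIdeal (Loc z)).comap (coordToLocal z hz)

lemma dehom_mem_pointIdeal (a : Poly σ k) : (⟨dehom η (z.2.notMem hz) a, a, rfl⟩ :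
      coordRing (z.2.notMem hz)) ∈ pointIdeal z hz ↔
      dehom z.1 hz a = 0 := by
  rw [Ideal.mem_comap, mem_maximalIdeal_localRing]
  change VanishesAt z (dehom η (z.2.notMem hz) a) ↔ _
  have h := dehom_mem_localRing z hz a
  rw [← valueAt_eq_zero_iff z h, valueAt_dehom z hz]

instance algebraCoordToLocal (η : PS σ k) (z : Pts η) {l : Poly σ k}
    [hl : Lin l] [hz : Fact (l ∉ idl z.1)] :
    Algebra (coordRing (z.2.notMem hz.1)) (Loc z) := (coordToLocal z hz.1).toRingHom.toAlgebra

lemma isLocalization_coordRing [hz : Fact (l ∉ idl z.1)] :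
    IsLocalization.AtPrime (Loc z) (pointIdeal z hz.1) := by
  refine (isLocalization_iff _ _).mpr ⟨?_, ?_, ?_⟩
  · intro b; exact by_contra fun h => b.2 h
  · intro g
    have ⟨a, b, hb, h⟩ := (mem_localRing_iff z hz.1 (g : RF η)).mp g.2
    refine ⟨(⟨_, a, rfl⟩, ⟨⟨_, b, rfl⟩, fun h => hb ((dehom_mem_pointIdeal z hz.1 b).mp h)⟩), ?_⟩
    exact Subtype.ext h
  · intro x y h; exact ⟨1, congrArg _ (Subtype.ext (congrArg (fun g : Loc z => (g : RF η)) h))⟩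

lemma isMaximal_pointIdeal [Finite σ] [IsAlgClosed k] (hcl : IsClosed ({z.1} : Set (PS σ k))) :
    (pointIdeal z hz).IsMaximal := by
  have hsurj : Function.Surjective ((IsLocalRing.residue (Loc z)).comp
      (coordToLocal z hz).toRingHom) := by
    intro g
    obtain ⟨g, rfl⟩ := IsLocalRing.residue_surjective g
    have ⟨c, hc⟩ := exists_sub_mem_maximalIdeal z hcl g
    refine ⟨cst c, ?_⟩
    rw [← sub_eq_zero, ← neg_eq_zero, neg_sub]
    change IsLocalRing.residue _ g - IsLocalRing.residue _ (coordToLocal z hz (cst c))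
      = 0
    rw [AlgHom.commutes, ← map_sub, IsLocalRing.residue_eq_zero_iff]
    exact hc
  have := RingHom.ker_isMaximal_of_surjective _ hsurj
  rwa [← RingHom.comap_ker, IsLocalRing.ker_residue] at this

/-- The class of a form of degree `d` in the coordinate ring. -/
abbrev coordOf (hη : l ∉ idl η) (a : Poly σ k) : coordRing hη := ⟨dehom η hη a, a, rfl⟩

lemma coordOf_mem_pointIdeal {a : Poly σ k} {d : ℕ} (ha : a.IsHomogeneous d) :
    coordOf (z.2.notMem hz) a ∈ pointIdeal z hz ↔ a ∈ idl z.1 := by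
  rw [dehom_mem_pointIdeal, dehom_eq_zero_iff _ _ ha]

lemma pointIdeal_injective {z w : Pts η} (hz : l ∉ idl z.1) (hw : l ∉ idl w.1)
    (h : pointIdeal z hz = pointIdeal w hw) : z = w := by
  have key : ∀ a, dehom z.1 hz a = 0 ↔ dehom w.1 hw a = 0 := fun a => by
    rw [← dehom_mem_pointIdeal, h, dehom_mem_pointIdeal]
  refine Subtype.ext (eq_of_specializes ?_ ?_)
  · rw [specializes_iff_dehom hz hw]; exact fun b => (key b).mp
  · rw [specializes_iff_dehom hw hz]; exact fun b => (key b).mpr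

lemma exists_pointIdeal_eq (hη : l ∉ idl η) (Q : Ideal (coordRing hη)) [Q.IsPrime] :
    ∃ (z : Pts η) (hz : l ∉ idl z.1), pointIdeal z hz = Q := by
  let f : Poly σ k →+* coordRing hη := (dehom η hη).rangeRestrict.toRingHom
  have hf : ∀ a, f a = coordOf hη a := fun a => rfl
  have ⟨y, hy, h⟩ := exists_point l (Q.comap f) (by
    rw [Ideal.mem_comap]
    have : f (l - 1) = 0 := Subtype.ext (by
      change dehom η hη (l - 1) = 0
      rw [map_sub, map_one, dehom_self, sub_self])
    rw [this]
    exact Q.zero_mem)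
  have hηy : η ⤳ y := by
    rw [specializes_iff_dehom hη hy]
    intro b hb
    rw [h, Ideal.mem_comap, (Subtype.ext hb : f b = 0)]
    exact Q.zero_mem
  refine ⟨⟨y, hηy⟩, hy, ?_⟩
  ext ⟨_, b, rfl⟩
  exact (dehom_mem_pointIdeal ⟨y, hηy⟩ hy b).trans (h b)

variable (hη : IsCurvePoint η) {a : Poly σ k} {d : ℕ} (ha : a.IsHomogeneous d)
  (haη : a ∉ idl η) (hlη : l ∉ idl η) (hal : ∀ z : Pts η, a ∈ idl z.1 → l ∉ idl z.1)

include hη haη in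
lemma isClosed_of_mem {z : Pts η} (hz : a ∈ idl z.1) : IsClosed ({z.1} : Set (PS σ k)) :=
  (eq_or_isClosed_of_isCurvePoint hη z).resolve_left fun h => haη (h ▸ hz)

/-- The zeros of a form correspond to the maximal ideals of the quotient ring. -/
def zeroToMaximal [Finite σ] [IsAlgClosed k] (z : {z : Pts η // a ∈ idl z.1}) :
    MaximalSpectrum (coordRing hlη ⧸ span {coordOf hlη a}) :=
  ⟨(pointIdeal z.1 (hal z.1 z.2)).map (Ideal.Quotient.mk _), by
    have := isMaximal_pointIdeal z.1 (hal z.1 z.2) (isClosed_of_mem hη haη z.2)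
    refine Ideal.IsMaximal.map_of_surjective_of_ker_le Ideal.Quotient.mk_surjective ?_
    rw [Ideal.mk_ker, Ideal.span_singleton_le_iff_mem, coordOf_mem_pointIdeal z.1 _ ha]
    exact z.2⟩

lemma comap_zeroToMaximal [Finite σ] [IsAlgClosed k] (z : {z : Pts η // a ∈ idl z.1}) :
    (zeroToMaximal hη ha haη hlη hal z).1.comap (Ideal.Quotient.mk _) =
      pointIdeal z.1 (hal z.1 z.2) := by
  change Ideal.comap _ (Ideal.map _ _) = _
  rw [Ideal.comap_map_of_surjective _ Ideal.Quotient.mk_surjective, ← RingHom.ker_eq_comap_bot,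
    Ideal.mk_ker, sup_eq_left, Ideal.span_singleton_le_iff_mem, coordOf_mem_pointIdeal z.1 _ ha]
  exact z.2

lemma zeroToMaximal_bijective [Finite σ] [IsAlgClosed k] :
    Function.Bijective (zeroToMaximal hη ha haη hlη hal) := by
  constructor
  · intro z w h
    apply Subtype.ext
    apply pointIdeal_injective (hal z.1 z.2) (hal w.1 w.2)
    rw [← comap_zeroToMaximal hη ha haη hlη hal, h, comap_zeroToMaximal]
  · intro M
    have := M.2
    have ⟨z, hz, h⟩ := exists_pointIdeal_eq hlη (M.1.comap (Ideal.Quotient.mk _))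
    have haz : a ∈ idl z.1 := by
      rw [← coordOf_mem_pointIdeal z hz ha, h, Ideal.mem_comap,
        Ideal.Quotient.eq_zero_iff_mem.mpr (mem_span_singleton_self _)]
      exact M.1.zero_mem
    refine ⟨⟨z, haz⟩, ?_⟩
    apply MaximalSpectrum.ext
    apply Ideal.comap_injective_of_surjective _ Ideal.Quotient.mk_surjective
    rw [comap_zeroToMaximal, ← h]

/-- The pieces of the degree filtration of the coordinate ring. -/
def degPiece (n : ℕ) : Submodule k (RF η) := (Forms σ k n).map (dehom η hlη).toLinearMap

instance [Finite σ] (n : ℕ) : Module.Finite k (degPiece hlη n) := by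
  have := Module.Finite.iff_fg.mpr (homogeneousSubmodule_fg (σ := σ) (R := k) n)
  exact Module.Finite.map _ _

lemma degPiece_mono : Monotone (degPiece hlη) := by
  refine monotone_nat_of_le_succ fun n => ?_
  rintro _ ⟨a, ha, rfl⟩
  refine ⟨a * l, IsHomogeneous.mul ha hl.out, ?_⟩
  simp [dehom_self]

lemma iSup_degPiece : ⨆ n, degPiece hlη n = Subalgebra.toSubmodule (coordRing hlη) := by
  apply le_antisymm
  · refine iSup_le fun n => ?_
    rintro _ ⟨a, -, rfl⟩
    exact ⟨a, rfl⟩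
  · rintro _ ⟨a, rfl⟩
    have ⟨n, b, hb, h⟩ := exists_homogenization_dehom l a
    refine (le_iSup (degPiece hlη) n) ⟨b, hb, ?_⟩
    exact (h η hlη).symm

include ha haη hal in
lemma finrank_coordRing_quotient [Finite σ] :
    Module.Finite k (coordRing hlη ⧸ span {coordOf hlη a}) ∧ ∃ N, ∀ n ≥ N,
      finrank k (coordRing hlη ⧸ span {coordOf hlη a}) +
        finrank k (degPiece hlη n) = finrank k (degPiece hlη (n + d)) := by
  have hα : dehom η hlη a ≠ 0 := fun h => haη ((dehom_eq_zero_iff η hlη ha).mp h)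
  have ⟨m₀, hm₀⟩ := exists_combination ha hl.out hal
  have ⟨h1, h2⟩ := finrank_quotient_of_filtration (degPiece hlη) (degPiece_mono hlη)
    (dehom η hlη a) hα d m₀ (by
      intro n
      rintro _ ⟨_, ⟨b, hb, rfl⟩, rfl⟩
      refine ⟨a * b, ?_, ?_⟩
      · rw [add_comm]; exact IsHomogeneous.mul ha hb
      · simp) (by
      intro n hn
      rintro _ ⟨f, hf, rfl⟩
      have ⟨u, v, hu, hv, h⟩ := hm₀ n hn f hf
      refine Submodule.mem_sup.mpr ⟨_, ⟨_, ⟨u, hu, rfl⟩, rfl⟩, _, ⟨v, hv, rfl⟩, ?_⟩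
      have h0 : (f - (u * a + v * l)).IsHomogeneous (n + 1 + d) := by
        refine IsHomogeneous.sub hf (IsHomogeneous.add (IsHomogeneous.mul hu ha) ?_)
        rw [show n + 1 + d = n + d + 1 by ring]
        exact IsHomogeneous.mul hv hl.out
      have := (dehom_eq_zero_iff η hlη h0).mpr h
      rw [map_sub, map_add, map_mul, map_mul, dehom_self, mul_one, sub_eq_zero] at this
      simp only [LinearMap.mulLeft_apply, AlgHom.toLinearMap_apply]
      rw [this, mul_comm])
  have e : (↥(⨆ n, degPiece hlη n) ⧸ ((⨆ n, degPiece hlη n).map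
      (LinearMap.mulLeft k (dehom η hlη a))).submoduleOf (⨆ n, degPiece hlη n)) ≃ₗ[k]
      (coordRing hlη ⧸ span {coordOf hlη a}) := by
    refine (Submodule.Quotient.equiv _ ((span {coordOf hlη a}).restrictScalars k)
      (LinearEquiv.ofEq _ _ (iSup_degPiece hlη) : _ ≃ₗ[k] coordRing hlη) ?_).trans
      (Submodule.Quotient.restrictScalarsEquiv k _)
    ext b
    constructor
    · rintro ⟨c, hc, rfl⟩
      have ⟨c', hc', h⟩ := hc
      rw [SetLike.mem_coe, iSup_degPiece] at hc'
      refine mem_span_singleton'.mpr ⟨⟨c', hc'⟩, Subtype.ext ?_⟩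
      rw [mul_comm]
      exact h
    · intro hb
      have ⟨c, hc⟩ := mem_span_singleton'.mp hb
      have hb' : (b : RF η) ∈ ⨆ n, degPiece hlη n := by rw [iSup_degPiece]; exact b.2
      refine ⟨⟨b, hb'⟩, ⟨c.1, ?_, ?_⟩, rfl⟩
      · rw [SetLike.mem_coe, iSup_degPiece]; exact c.2
      · refine Eq.trans ?_ (congrArg Subtype.val hc); exact mul_comm _ _
  exact ⟨Module.Finite.equiv e, by rwa [e.finrank_eq] at h2⟩

/-- The class of a form in the local ring of a point. -/
abbrev localOf (z : Pts η) (hz : l ∉ idl z.1) (a : Poly σ k) : Loc z :=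
  ⟨dehom η (z.2.notMem hz) a, dehom_mem_localRing z hz a⟩

include hη ha haη hlη hal in
lemma ord_localOf [Finite σ] [IsAlgClosed k] : (∀ z : {z : Pts η // a ∈ idl z.1},
      Ring.ord (Loc z.1) (localOf z.1 (hal z.1 z.2) a) ≠ ⊤) ∧
    ∀ [Fintype {z : Pts η // a ∈ idl z.1}], ∃ N, ∀ n ≥ N, ∑ z : {z : Pts η // a ∈ idl z.1},
      (Ring.ord (Loc z.1) (localOf z.1 (hal z.1 z.2) a)).toNat +
        finrank k (degPiece hlη n) = finrank k (degPiece hlη (n + d)) := by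
  have ⟨h1, h2⟩ := finrank_coordRing_quotient ha haη hlη hal
  have hF : ∀ z : {z : Pts η // a ∈ idl z.1}, Fact (l ∉ idl z.1.1) := fun z => ⟨hal z.1 z.2⟩
  have : ∀ z : {z : Pts η // a ∈ idl z.1},
      IsScalarTower k (coordRing hlη) (Loc z.1) := fun z => IsScalarTower.of_algebraMap_eq' rfl
  have : ∀ z : {z : Pts η // a ∈ idl z.1}, IsLocalization.AtPrime (Loc z.1)
      ((zeroToMaximal hη ha haη hlη hal z).1.comap (Ideal.Quotient.mk _)) := by
    intro z
    have hloc := isLocalization_coordRing (l := l) z.1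
    convert hloc using 2
    exact comap_zeroToMaximal hη ha haη hlη hal z
  have key := ord_ne_top_and_finrank_eq_sum (k := k) (coordOf hlη a) _
    (zeroToMaximal_bijective hη ha haη hlη hal) (fun z => Loc z.1)
    (fun z => exists_sub_mem_maximalIdeal z.1 (isClosed_of_mem hη haη z.2))
  refine ⟨key.1, fun {_} => ?_⟩
  rw [key.2] at h2
  exact h2

end CoordRing
end ProjectiveSpace

section OrdAt

variable {K : Type*} [Field K] {R : Subring K}

/-- All nonzero elements of `R` have finite order, and `K` is the field of fractions of `R`. -/
structure HasFiniteOrders (R : Subring K) : Prop where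
  ord_ne_top : ∀ a : R, a ≠ 0 → Ring.ord R a ≠ ⊤
  exists_frac : ∀ g : K, ∃ a b : R, b ≠ 0 ∧ g * b = a

lemma HasFiniteOrders.toNat_ord_mul (hR : HasFiniteOrders R) {a b : R} (ha : a ≠ 0) (hb : b ≠ 0) :
    ((Ring.ord R (a * b)).toNat : ℤ) = (Ring.ord R a).toNat + (Ring.ord R b).toNat := by
  rw [Ring.ord_mul R (mem_nonZeroDivisors_of_ne_zero hb),
    ENat.toNat_add (hR.ord_ne_top a ha) (hR.ord_ne_top b hb), Nat.cast_add]

lemma HasFiniteOrders.ordAt_eq (hR : HasFiniteOrders R) {g : K} {a b : R} (ha : a ≠ 0)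
    (hb : b ≠ 0) (h : g * b = a) :
    ordAt R g = ((Ring.ord R a).toNat : ℤ) - (Ring.ord R b).toNat := by
  have hex : ∃ ab : R × R, ab.1 ≠ 0 ∧ ab.2 ≠ 0 ∧ g * (ab.2 : K) = (ab.1 : K) := ⟨(a, b), ha, hb, h⟩
  rw [ordAt, dif_pos hex]
  have ⟨h1, h2, h3⟩ := hex.choose_spec
  have h4 : hex.choose.1 * b = a * hex.choose.2 := Subtype.ext (by
    push_cast
    rw [← h3, ← h]
    ring)
  have h5 := hR.toNat_ord_mul h1 hb
  rw [h4, hR.toNat_ord_mul ha h2] at h5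
  omega

lemma HasFiniteOrders.exists_frac_ne (hR : HasFiniteOrders R) {g : K} (hg : g ≠ 0) :
    ∃ a b : R, a ≠ 0 ∧ b ≠ 0 ∧ g * b = a := by
  have ⟨a, b, hb, h⟩ := hR.exists_frac g
  refine ⟨a, b, ?_, hb, h⟩
  rintro rfl
  rcases mul_eq_zero.mp h with h | h
  · exact hg h
  · exact hb (Subtype.ext h)

lemma HasFiniteOrders.ordAt_mul (hR : HasFiniteOrders R) {g h : K} (hg : g ≠ 0) (hh : h ≠ 0) :
    ordAt R (g * h) = ordAt R g + ordAt R h := by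
  have ⟨a, b, ha, hb, hab⟩ := hR.exists_frac_ne hg
  have ⟨c, d, hc, hd, hcd⟩ := hR.exists_frac_ne hh
  rw [hR.ordAt_eq ha hb hab, hR.ordAt_eq hc hd hcd,
    hR.ordAt_eq (mul_ne_zero ha hc) (mul_ne_zero hb hd) (by
      push_cast
      rw [← hab, ← hcd]
      ring), hR.toNat_ord_mul ha hc, hR.toNat_ord_mul hb hd]
  ring

lemma HasFiniteOrders.ordAt_one (hR : HasFiniteOrders R) : ordAt R (1 : K) = 0 := by
  have h := hR.ordAt_mul (one_ne_zero (α := K)) one_ne_zero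
  rw [mul_one] at h
  omega

lemma HasFiniteOrders.ordAt_inv (hR : HasFiniteOrders R) {g : K} (hg : g ≠ 0) :
    ordAt R g⁻¹ = - ordAt R g := by
  have h := hR.ordAt_mul hg (inv_ne_zero hg)
  rw [mul_inv_cancel₀ hg, hR.ordAt_one] at h
  omega

lemma HasFiniteOrders.ordAt_coe (hR : HasFiniteOrders R) {a : R} (ha : a ≠ 0) :
    ordAt R (a : K) = (Ring.ord R a).toNat := by
  rw [hR.ordAt_eq (a := a) (b := 1) ha one_ne_zero (by simp), Ring.ord_one]
  simp

lemma HasFiniteOrders.ordAt_nonneg (hR : HasFiniteOrders R) {g : K} (hg : g ∈ R) (hg0 : g ≠ 0) :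
    0 ≤ ordAt R g := by
  rw [hR.ordAt_coe (a := ⟨g, hg⟩) (fun h => hg0 (congrArg Subtype.val h))]
  positivity

lemma HasFiniteOrders.ordAt_unit (hR : HasFiniteOrders R) {g : K} (hg0 : g ≠ 0) (hg : g ∈ R)
    (hg' : g⁻¹ ∈ R) : ordAt R g = 0 := by
  have h1 := hR.ordAt_nonneg hg hg0
  have h2 := hR.ordAt_nonneg hg' (inv_ne_zero hg0)
  rw [hR.ordAt_inv hg0] at h2
  omega

lemma HasFiniteOrders.ordAt_div (hR : HasFiniteOrders R) {g h : K} (hg : g ≠ 0) (hh : h ≠ 0) :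
    ordAt R (g / h) = ordAt R g - ordAt R h := by
  rw [div_eq_mul_inv, hR.ordAt_mul hg (inv_ne_zero hh), hR.ordAt_inv hh]
  ring

lemma HasFiniteOrders.ordAt_prod (hR : HasFiniteOrders R) {ι : Type*} (s : Finset ι) (g : ι → K)
    (hg : ∀ i ∈ s, g i ≠ 0) : ordAt R (∏ i ∈ s, g i) = ∑ i ∈ s, ordAt R (g i) := by
  classical
  induction s using Finset.induction_on with
  | empty => simpa using hR.ordAt_one
  | insert i s hi ih =>
    rw [Finset.prod_insert hi, Finset.sum_insert hi, hR.ordAt_mul (hg i (by simp))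
      (prod_ne_zero_iff.mpr fun j hj => hg j (by simp [hj])),
      ih fun j hj => hg j (by simp [hj])]

lemma HasFiniteOrders.ordAt_zpow (hR : HasFiniteOrders R) {g : K} (hg : g ≠ 0) (n : ℤ) :
    ordAt R (g ^ n) = n * ordAt R g := by
  have hpow : ∀ n : ℕ, ordAt R (g ^ n) = n * ordAt R g := by
    intro n
    induction n with
    | zero => simpa using hR.ordAt_one
    | succ n ih =>
      rw [pow_succ, hR.ordAt_mul (pow_ne_zero n hg) hg, ih]
      push_cast
      ring
  cases n with
  | ofNat n => simpa using hpow n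
  | negSucc n =>
    rw [zpow_negSucc, hR.ordAt_inv (pow_ne_zero _ hg), hpow, Int.negSucc_eq]
    push_cast
    ring

end OrdAt

section ProjectiveSpace

variable {σ : Type} {k : Type u} [Field k] [Finite σ] [IsAlgClosed k] {η : PS σ k}

omit [Finite σ] [IsAlgClosed k] in
lemma exists_forms {t : σ} (ht : X t ∉ idl η) (g : RF η) :
    ∃ (d : ℕ) (a b : Poly σ k), a.IsHomogeneous d ∧ b.IsHomogeneous d ∧ b ∉ idl η ∧
      ∀ (l : Poly σ k) [Lin l] (hlη : l ∉ idl η),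
        g * dehom η hlη b = dehom η hlη a := by
  have ⟨a, b, hb, h⟩ := exists_dehom_eq η ht g
  have ⟨m, a', ha', haa⟩ := exists_homogenization_dehom (X t) a
  have ⟨n, b', hb', hbb⟩ := exists_homogenization_dehom (X t) b
  have h1 : (a' * X t ^ n).IsHomogeneous (m + n) := IsHomogeneous.mul ha' (lin_pow n)
  have h2 : (b' * X t ^ m).IsHomogeneous (m + n) := by
    rw [add_comm]
    exact IsHomogeneous.mul hb' (lin_pow m)
  have e1 : dehom η ht (a' * X t ^ n) = dehom η ht a := by
    rw [map_mul, map_pow, dehom_self, one_pow, mul_one, haa]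
  have e2 : dehom η ht (b' * X t ^ m) = dehom η ht b := by
    rw [map_mul, map_pow, dehom_self, one_pow, mul_one, hbb]
  refine ⟨m + n, a' * X t ^ n, b' * X t ^ m, h1, h2, ?_, fun l hl hlη => ?_⟩
  · rwa [← dehom_eq_zero_iff η ht h2, e2]
  · rw [dehom_change η hlη ht h1,
      dehom_change η hlη ht h2, e1, e2, ← h]
    ring

omit [Finite σ] [IsAlgClosed k] in
lemma isUnitAt_dehom (z : Pts η) {l : Poly σ k} [hl : Lin l]
    (hz : l ∉ idl z.1) {d : ℕ} {a : Poly σ k} (ha : a.IsHomogeneous d) (haz : a ∉ idl z.1) :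
    IsUnitAt z (dehom η (z.2.notMem hz) a) := by
  have hm := dehom_mem_localRing z hz a
  have : ¬ VanishesAt z (dehom η (z.2.notMem hz) a) := by
    rw [← valueAt_eq_zero_iff z hm, valueAt_dehom z hz, dehom_eq_zero_iff z.1 hz ha]
    exact haz
  rw [vanishesAt_iff_mem, not_and_not_right] at this
  exact this hm

lemma hasFiniteOrders (hη : IsCurvePoint η) (z : Pts η) : HasFiniteOrders (Loc z) := by
  constructor
  · rintro ⟨g, hg⟩ hg0
    have ⟨t, ht⟩ := exists_X_notMem z.1
    have htη := z.2.notMem ht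
    have ⟨a', b', hb', h'⟩ := (mem_localRing_iff z ht g).mp hg
    have ⟨m, a, ha, haa⟩ := exists_homogenization_dehom (X t) a'
    have ⟨n, b, hb, hbb⟩ := exists_homogenization_dehom (X t) b'
    rw [haa, hbb] at h'
    rw [hbb, ne_eq, dehom_eq_zero_iff z.1 ht hb] at hb'
    have hbu := isUnitAt_dehom z ht hb hb'
    have haη : a ∉ idl η := by
      rw [← dehom_eq_zero_iff η htη ha, ← h']
      exact mul_ne_zero (fun h => hg0 (Subtype.ext h)) hbu.1
    have ⟨l, hl', hlz⟩ := exists_linear_form (k := k) (T := Subtype.val '' {z : Pts η | a ∈ idl z.1} ∪ {z.1, η})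
      (((finite_zeros hη ha haη).image _).union (by simp))
    have hl : Lin l := ⟨hl'⟩
    have hlz1 : l ∉ idl z.1 := hlz _ (by simp)
    have hlη : l ∉ idl η := hlz _ (by simp)
    have hal : ∀ z : Pts η, a ∈ idl z.1 → l ∉ idl z.1 := fun w hw => hlz _ (Or.inl ⟨w, hw, rfl⟩)
    have e1 := dehom_change η htη hlη ha
    have hlu := isUnitAt_dehom z ht hl' hlz1
    rw [e1] at h'
    set u := dehom η htη l
    set v := dehom η htη b
    have hu : u ^ m * v⁻¹ ∈ Loc z := mul_mem (pow_mem hlu.2.1 _) hbu.2.2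
    have huu : IsUnit (⟨u ^ m * v⁻¹, hu⟩ : Loc z) := by
      rw [isUnit_subring_iff]
      refine ⟨mul_ne_zero (pow_ne_zero _ hlu.1) (inv_ne_zero hbu.1), ?_⟩
      change (u ^ m * v⁻¹)⁻¹ ∈ _
      rw [mul_inv, ← inv_pow, inv_inv]
      exact mul_mem (pow_mem hlu.2.2 _) hbu.2.1
    have e2 : (⟨g, hg⟩ : Loc z) = localOf z hlz1 a * ⟨u ^ m * v⁻¹, hu⟩ := Subtype.ext (by
      change g = dehom η hlη a * (u ^ m * v⁻¹)
      rw [← mul_assoc, ← h', mul_inv_cancel_right₀ hbu.1])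
    rw [e2, Ring.ord_mul_of_isUnit_right huu]
    by_cases haz : a ∈ idl z.1
    · exact (ord_localOf hη ha haη hlη hal).1 ⟨z, haz⟩
    · rw [Ring.ord_of_isUnit]
      · simp
      · rw [isUnit_subring_iff]
        have := isUnitAt_dehom z hlz1 ha haz
        exact ⟨this.1, this.2.2⟩
  · intro g
    have ⟨t, ht⟩ := exists_X_notMem z.1
    have htη := z.2.notMem ht
    have ⟨a, b, hb, h⟩ := exists_dehom_eq η htη g
    exact ⟨localOf z ht a, localOf z ht b, fun h => hb (congrArg Subtype.val h), h⟩

/-- Finitely many points matter for the order of a rational function, and the sum of its orders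
is zero. -/
lemma exists_finset_ordAt (hη : IsCurvePoint η) {g : RF η} (hg : g ≠ 0) :
    {z : {z : Pts η // z.1 ≠ η} | ¬ IsUnitAt z.1 g}.Finite ∧
      ∑ᶠ z : {z : Pts η // z.1 ≠ η}, ordAt (Loc z.1) g = 0 := by
  classical
  have ⟨t, ht⟩ := exists_X_notMem η
  have ⟨d, a, b, ha, hb, hbη, h⟩ := exists_forms ht g
  have haη : a ∉ idl η := by
    rw [← dehom_eq_zero_iff η ht ha, ← h _ ht]
    exact mul_ne_zero hg (mt (dehom_eq_zero_iff η ht hb).mp hbη)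
  have hfa := finite_zeros hη ha haη
  have hfb := finite_zeros hη hb hbη
  have ⟨l, hl', hlz⟩ := exists_linear_form (k := k) (T := Subtype.val '' {z : Pts η | a ∈ idl z.1} ∪
    (Subtype.val '' {z : Pts η | b ∈ idl z.1} ∪ {η}))
    ((hfa.image _).union ((hfb.image _).union (by simp)))
  have hl : Lin l := ⟨hl'⟩
  have hlη : l ∉ idl η := hlz _ (by simp)
  have hal : ∀ z : Pts η, a ∈ idl z.1 → l ∉ idl z.1 := fun w hw => hlz _ (Or.inl ⟨w, hw, rfl⟩)
  have hbl : ∀ z : Pts η, b ∈ idl z.1 → l ∉ idl z.1 := fun w hw =>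
    hlz _ (Or.inr (Or.inl ⟨w, hw, rfl⟩))
  have hunit : ∀ z : Pts η, a ∉ idl z.1 → b ∉ idl z.1 → IsUnitAt z g := by
    intro z haz hbz
    have ⟨t, ht⟩ := exists_X_notMem z.1
    have h1 := isUnitAt_dehom z ht ha haz
    have h2 := isUnitAt_dehom z ht hb hbz
    have h3 := h _ (z.2.notMem ht)
    rw [← eq_mul_inv_iff_mul_eq₀ h2.1] at h3
    refine ⟨hg, ?_, ?_⟩
    · rw [h3]; exact mul_mem h1.2.1 h2.2.2
    · rw [h3, mul_inv, inv_inv]; exact mul_mem h1.2.2 h2.2.1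
  have key : ∀ (a : Poly σ k) (ha : a.IsHomogeneous d) (haη : a ∉ idl η)
      (hal : ∀ z : Pts η, a ∈ idl z.1 → l ∉ idl z.1),
      (Function.support fun z : {z : Pts η // z.1 ≠ η} => if a ∈ idl z.1.1 then
        ordAt (Loc z.1) (dehom η hlη a) else 0).Finite ∧
      ∃ N, ∀ n ≥ N, (∑ᶠ z : {z : Pts η // z.1 ≠ η}, if a ∈ idl z.1.1 then
        ordAt (Loc z.1) (dehom η hlη a) else 0) +
        (finrank k (degPiece hlη n) : ℤ) = finrank k (degPiece hlη (n + d)) := by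
    intro a ha haη hal
    have hfin := finite_zeros hη ha haη
    refine ⟨(hfin.preimage Subtype.val_injective.injOn).subset fun z hz => ?_, ?_⟩
    · by_contra haz
      exact hz (if_neg haz)
    have := hfin.fintype
    have : Fintype {z : Pts η // a ∈ idl z.1} := this
    have ⟨N, hN⟩ := (ord_localOf hη ha haη hlη hal).2
    refine ⟨N, fun n hn => ?_⟩
    rw [← hN n hn, Nat.cast_add, Nat.cast_sum]
    congr 1
    rw [finsum_subtype_eq_finsum_cond (f := fun z : Pts η => if a ∈ idl z.1 then
        ordAt (Loc z) (dehom η hlη a) else 0) (p := fun z => z.1 ≠ η)]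
    rw [← finsum_eq_sum_of_fintype]
    have e : ∀ z : {z : Pts η // a ∈ idl z.1},
        ((Ring.ord (Loc z.1) (localOf z.1 (hal z.1 z.2) a)).toNat : ℤ) =
        ordAt (Loc z.1) (dehom η hlη a) := by
      intro z
      rw [← (hasFiniteOrders hη z.1).ordAt_coe]
      exact fun h => (mt (dehom_eq_zero_iff η hlη ha).mp haη) (congrArg Subtype.val h)
    rw [finsum_congr e, finsum_subtype_eq_finsum_cond (f := fun z : Pts η =>
        ordAt (Loc z) (dehom η hlη a)) (p := fun z => a ∈ idl z.1)]
    refine finsum_congr fun z => ?_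
    by_cases haz : a ∈ idl z.1
    · have : z.1 ≠ η := fun h => haη (h ▸ haz); simp [haz, this]
    · simp [haz]
  have ⟨hsa, N₁, hN₁⟩ := key a ha haη hal
  have ⟨hsb, N₂, hN₂⟩ := key b hb hbη hbl
  refine ⟨((hfa.union hfb).preimage Subtype.val_injective.injOn).subset fun z hz => ?_, ?_⟩
  · by_contra h0
    simp only [Set.mem_preimage, Set.mem_union, Set.mem_ofPred_eq, not_or] at h0
    exact hz (hunit z.1 h0.1 h0.2)
  have h1 := hN₁ (max N₁ N₂) (le_max_left _ _)
  have h2 := hN₂ (max N₁ N₂) (le_max_right _ _)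
  have hαβ := h l hlη
  have hβ0 : dehom η hlη b ≠ 0 := mt (dehom_eq_zero_iff η hlη hb).mp hbη
  have hα0 : dehom η hlη a ≠ 0 := mt (dehom_eq_zero_iff η hlη ha).mp haη
  have h3 : ∀ z : {z : Pts η // z.1 ≠ η}, ordAt (Loc z.1) g =
      (if a ∈ idl z.1.1 then ordAt (Loc z.1) (dehom η hlη a) else 0) -
      (if b ∈ idl z.1.1 then ordAt (Loc z.1) (dehom η hlη b) else 0) := by
    intro z
    have hF := hasFiniteOrders hη z.1
    have h4 : ordAt (Loc z.1) g = ordAt (Loc z.1) (dehom η hlη a) -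
        ordAt (Loc z.1) (dehom η hlη b) := by
      rw [← hαβ, hF.ordAt_mul hg hβ0]
      ring
    by_cases haz : a ∈ idl z.1.1 <;> by_cases hbz : b ∈ idl z.1.1
    · rw [if_pos haz, if_pos hbz, h4]
    · have := isUnitAt_dehom z.1 (hal z.1 haz) hb hbz
      rw [if_pos haz, if_neg hbz, h4, hF.ordAt_unit this.1 this.2.1 this.2.2]
    · have := isUnitAt_dehom z.1 (hbl z.1 hbz) ha haz
      rw [if_neg haz, if_pos hbz, h4, hF.ordAt_unit this.1 this.2.1 this.2.2]
    · have := hunit z.1 haz hbz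
      rw [if_neg haz, if_neg hbz, hF.ordAt_unit this.1 this.2.1 this.2.2, sub_zero]
  rw [finsum_congr h3, finsum_sub_distrib hsa hsb]
  omega

end ProjectiveSpace

section ProjectiveSpace

variable {σ : Type} {k : Type u} [Field k] {δ : PS σ k}

lemma isUnitAt_one (x : Pts δ) : IsUnitAt x 1 :=
  ⟨one_ne_zero, one_mem _, by rw [inv_one]; exact one_mem _⟩

lemma IsUnitAt.mul {x : Pts δ} {g h : RF δ} (hg : IsUnitAt x g)
    (hh : IsUnitAt x h) : IsUnitAt x (g * h) :=
  ⟨mul_ne_zero hg.1 hh.1, mul_mem hg.2.1 hh.2.1, by rw [mul_inv]; exact mul_mem hg.2.2 hh.2.2⟩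

lemma IsUnitAt.inv {x : Pts δ} {g : RF δ} (hg : IsUnitAt x g) :
    IsUnitAt x g⁻¹ := ⟨inv_ne_zero hg.1, hg.2.2, by rw [inv_inv]; exact hg.2.1⟩

lemma IsUnitAt.div {x : Pts δ} {g h : RF δ} (hg : IsUnitAt x g)
    (hh : IsUnitAt x h) : IsUnitAt x (g / h) := by
  rw [div_eq_mul_inv]
  exact hg.mul hh.inv

lemma IsUnitAt.zpow {x : Pts δ} {g : RF δ} (hg : IsUnitAt x g) (n : ℤ) : IsUnitAt x (g ^ n) := by
  have h : ∀ n : ℕ, IsUnitAt x (g ^ n) := fun n => by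
    induction n with
    | zero => simpa using isUnitAt_one x
    | succ n ih => rw [pow_succ]; exact ih.mul hg
  cases n with
  | ofNat n => simpa using h n
  | negSucc n => rw [zpow_negSucc]; exact (h _).inv

lemma IsUnitAt.prod {x : Pts δ} {ι : Type*} (s : Finset ι) {g : ι → RF δ}
    (hg : ∀ i ∈ s, IsUnitAt x (g i)) : IsUnitAt x (∏ i ∈ s, g i) := by
  classical
  induction s using Finset.induction_on with
  | empty => simpa using isUnitAt_one x
  | insert i s hi ih =>
    rw [Finset.prod_insert hi]
    exact (hg i (by simp)).mul (ih fun j hj => hg j (by simp [hj]))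

lemma isUnitAt_algebraMap (x : Pts δ) {c : k} (hc : c ≠ 0) : IsUnitAt x (algebraMap k (RF δ) c) :=
  ⟨by simpa using hc, cst_mem x c, by rw [← map_inv₀]; exact cst_mem x _⟩

lemma IsUnitAt.of_specializes {x y : Pts δ} (h : y.1 ⤳ x.1) {g : RF δ}
    (hg : IsUnitAt x g) : IsUnitAt y g :=
  ⟨hg.1, localRing_le_of_specializes h hg.2.1, localRing_le_of_specializes h hg.2.2⟩

lemma isUnitAt_iff_valueAt {x : Pts δ} {g : RF δ} (hg : g ∈ Loc x) :
    IsUnitAt x g ↔ valueAt x g ≠ 0 := by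
  rw [ne_eq, valueAt_eq_zero_iff x hg, vanishesAt_iff_mem, not_and_not_right]
  exact ⟨fun h _ => h, fun h => h hg⟩

lemma IsUnitAt.valueAt_ne_zero {x : Pts δ} {g : RF δ} (hg : IsUnitAt x g) :
    valueAt x g ≠ 0 := (isUnitAt_iff_valueAt hg.2.1).mp hg

lemma valueAt_one (x : Pts δ) : valueAt x (1 : RF δ) = 1 := by simpa using valueAt_algebraMap x 1

lemma valueAt_zero (x : Pts δ) : valueAt x (0 : RF δ) = 0 := by simpa using valueAt_algebraMap x 0

lemma IsUnitAt.valueAt_inv {x : Pts δ} {g : RF δ} (hg : IsUnitAt x g) :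
    valueAt x g⁻¹ = (valueAt x g)⁻¹ := by
  have := valueAt_mul x hg.2.1 hg.2.2
  rw [mul_inv_cancel₀ hg.1, valueAt_one] at this
  exact (inv_eq_of_mul_eq_one_right this.symm).symm

lemma IsUnitAt.valueAt_div {x : Pts δ} {g h : RF δ} (hg : g ∈ Loc x)
    (hh : IsUnitAt x h) : valueAt x (g / h) = valueAt x g / valueAt x h := by
  rw [div_eq_mul_inv, valueAt_mul x hg hh.2.2, hh.valueAt_inv, div_eq_mul_inv]

lemma IsUnitAt.valueAt_zpow {x : Pts δ} {g : RF δ} (hg : IsUnitAt x g)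
    (n : ℤ) : valueAt x (g ^ n) = valueAt x g ^ n := by
  have h : ∀ n : ℕ, valueAt x (g ^ n) = valueAt x g ^ n := fun n => by
    induction n with
    | zero => simpa using valueAt_one x
    | succ n ih => rw [pow_succ, valueAt_mul x (pow_mem hg.2.1 n) hg.2.1, ih, pow_succ]
  cases n with
  | ofNat n => simpa using h n
  | negSucc n =>
    rw [zpow_negSucc, zpow_negSucc, ← h]
    have := (hg.zpow (n + 1 : ℕ)).valueAt_inv
    rwa [zpow_natCast] at this

lemma valueAt_prod {x : Pts δ} {ι : Type*} (s : Finset ι) {g : ι → RF δ}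
    (hg : ∀ i ∈ s, g i ∈ Loc x) : valueAt x (∏ i ∈ s, g i) = ∏ i ∈ s, valueAt x (g i) := by
  classical
  induction s using Finset.induction_on with
  | empty => simpa using valueAt_one x
  | insert i s hi ih =>
    rw [Finset.prod_insert hi, Finset.prod_insert hi, valueAt_mul x (hg i (by simp))
      (prod_mem fun j hj => hg j (by simp [hj])), ih fun j hj => hg j (by simp [hj])]

lemma IsUnitAt.restrict {y : Pts δ} {z : Pts y.1} {g : RF δ}
    (hg : IsUnitAt (y.incl z) g) : IsUnitAt z (valueAt y g) := by
  have hy : IsUnitAt y g := hg.of_specializes z.2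
  refine ⟨hy.valueAt_ne_zero, ?_, ?_⟩
  · exact (mem_localRing_sub_iff y z _).mpr ⟨g, hg.2.1, rfl⟩
  · exact (mem_localRing_sub_iff y z _).mpr ⟨g⁻¹, hg.2.2, hy.valueAt_inv⟩

lemma CartierDivisor.isUnitAt (D : CartierDivisor δ) {x y : Pts δ} (h : y.1 ⤳ x.1) :
    IsUnitAt y ((D.eqn x : RF δ) / D.eqn y) := by
  have ⟨U, hxU, hU⟩ := D.compatible x
  have := hU y (h.mem_open U.isOpen hxU)
  rwa [Units.val_div_eq_div_val] at this

lemma CartierDivisor.eqn_ne_zero (D : CartierDivisor δ) (x : Pts δ) :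
    (D.eqn x : RF δ) ≠ 0 := (D.eqn x).ne_zero

/-- The local equation of the restriction of `D` to the subvariety with generic point `y`. -/
def CartierDivisor.resEqn (D : CartierDivisor δ) (y : Pts δ) (z : Pts y.1) : RF y.1 :=
  valueAt y ((D.eqn (y.incl z) : RF δ) / D.eqn y)

lemma CartierDivisor.resEqn_ne_zero (D : CartierDivisor δ) (y : Pts δ) (z : Pts y.1) :
    D.resEqn y z ≠ 0 := (D.isUnitAt z.2).valueAt_ne_zero

lemma CartierDivisor.degOn_eq_resEqn (D : CartierDivisor δ) (F : Curve δ) :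
    D.degOn F = ∑ᶠ z : {z : Pts F.1.1 // z.1 ≠ F.1.1}, ordAt (Loc z.1)
      (D.resEqn F.1 z.1) := by
  refine finsum_congr fun z => ?_
  rw [Units.val_div_eq_div_val]
  rfl

/-- The restriction of a Cartier divisor to a subvariety, defined up to linear equivalence. -/
def CartierDivisor.restrict (D : CartierDivisor δ) (y : Pts δ) : CartierDivisor y.1 where
  eqn z := Units.mk0 (D.resEqn y z) (D.resEqn_ne_zero y z)
  compatible z := by
    have ⟨U, hzU, hU⟩ := D.compatible (y.incl z)
    refine ⟨U, hzU, fun w hw => ?_⟩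
    have h1 := hU (y.incl w) hw
    rw [Units.val_div_eq_div_val] at h1 ⊢
    change IsUnitAt w (D.resEqn y z / D.resEqn y w)
    have h2 := h1.restrict
    convert h2 using 1
    rw [resEqn, resEqn, ← (D.isUnitAt w.2).valueAt_div (D.isUnitAt z.2).2.1,
      div_div_div_cancel_right₀ (D.eqn_ne_zero y)]

lemma CartierDivisor.restrict_eqn (D : CartierDivisor δ) (y : Pts δ) (z : Pts y.1) :
    ((D.restrict y).eqn z : RF y.1) = D.resEqn y z := rfl

lemma CartierDivisor.degOn_restrict (D : CartierDivisor δ) (y : Pts δ) (F : Curve y.1) :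
    (D.restrict y).degOn F = D.degOn (Curve.push y F) := by
  rw [degOn_eq_resEqn, degOn_eq_resEqn]
  refine finsum_congr fun z => ?_
  congr 1
  change valueAt F.1 (D.resEqn y (F.1.incl z.1) / D.resEqn y F.1) = valueAt (y.incl F.1) _
  have h1 : IsUnitAt y ((D.eqn (y.incl (F.1.incl z.1)) : RF δ) / D.eqn y) :=
    D.isUnitAt (F.1.incl z.1).2
  have h2 : IsUnitAt y ((D.eqn (y.incl F.1) : RF δ) / D.eqn y) := D.isUnitAt F.1.2
  have h3 : IsUnitAt (y.incl F.1) ((D.eqn (y.incl (F.1.incl z.1)) : RF δ) /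
      D.eqn (y.incl F.1)) := D.isUnitAt z.1.2
  rw [resEqn, resEqn, ← h2.valueAt_div h1.2.1, div_div_div_cancel_right₀ (D.eqn_ne_zero y)]
  exact valueAt_valueAt y F.1 h3.2.1

variable [Finite σ] [IsAlgClosed k]

omit [IsAlgClosed k] in
/-- Properties that hold at the generic point of a curve hold at almost all its points. -/
lemma finite_notMem_opens {η : PS σ k} (hη : IsCurvePoint η) (U : (PS σ k).Opens) (hU : η ∈ U) :
    {z : {z : Pts η // z.1 ≠ η} | z.1.1 ∉ U}.Finite := by
  have ⟨n, h, hh, hhη, hhU⟩ := exists_form_of_mem_opens hU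
  refine ((finite_zeros hη hh hhη).preimage Subtype.val_injective.injOn).subset fun z hz => ?_
  by_contra h0
  exact hz (hhU z.1.1 h0)

lemma CartierDivisor.finite_support (D : CartierDivisor δ) (F : Curve δ) :
    (Function.support fun z : {z : Pts F.1.1 // z.1 ≠ F.1.1} => ordAt (Loc z.1)
      (D.resEqn F.1 z.1)).Finite := by
  have ⟨U, hηU, hU⟩ := D.compatible F.1
  refine (finite_notMem_opens F.2 U hηU).subset fun z hz hzU => hz ?_
  have h1 := (hU (F.1.incl z.1) hzU).inv.restrict
  rw [Units.val_div_eq_div_val, inv_div] at h1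
  exact (hasFiniteOrders F.2 z.1).ordAt_unit h1.1 h1.2.1 h1.2.2

lemma CartierDivisor.degOn_eq_sum (D : CartierDivisor δ) {ι : Type*} (s : Finset ι)
    (E : ι → CartierDivisor δ) (n : ι → ℤ) (g : RF δ)
    (h : ∀ x : Pts δ, IsUnitAt x ((D.eqn x : RF δ) /
      (g * ∏ i ∈ s, ((E i).eqn x : RF δ) ^ n i)))
    (F : Curve δ) : D.degOn F = ∑ i ∈ s, n i * (E i).degOn F := by
  have hg0 : g ≠ 0 := by rintro rfl; exact (h F.1).1 (by simp)
  have hne : ∀ i x, ((E i).eqn x : RF δ) ^ n i ≠ 0 := fun i x =>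
    zpow_ne_zero _ ((E i).eqn_ne_zero x)
  set w := ((D.eqn F.1 : RF δ) /
      (g * ∏ i ∈ s, ((E i).eqn F.1 : RF δ) ^ n i)) with hw
  have hkey : ∀ z : {z : Pts F.1.1 // z.1 ≠ F.1.1}, ordAt (Loc z.1) (D.resEqn F.1 z.1) =
      ∑ i ∈ s, n i * ordAt (Loc z.1) ((E i).resEqn F.1 z.1) +
        ordAt (Loc z.1) (valueAt F.1 w⁻¹) := by
    intro z
    have hF := hasFiniteOrders F.2 z.1
    have hu := (h (F.1.incl z.1))
    have hr := hu.restrict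
    have hu1 := hu.of_specializes z.1.2
    have hE : ∀ i, IsUnitAt F.1 (((E i).eqn (F.1.incl z.1) : RF δ) /
      (E i).eqn F.1) := fun i => (E i).isUnitAt z.1.2
    have hP : IsUnitAt F.1 (∏ i ∈ s, (((E i).eqn (F.1.incl z.1) : RF δ) /
      (E i).eqn F.1) ^ n i) := IsUnitAt.prod s fun i _ => (hE i).zpow _
    have hprod : D.resEqn F.1 z.1 = (∏ i ∈ s, (E i).resEqn F.1 z.1 ^ n i) * valueAt F.1 w⁻¹ *
        valueAt F.1 ((D.eqn (F.1.incl z.1) : RF δ) /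
      (g * ∏ i ∈ s, ((E i).eqn (F.1.incl z.1) : RF δ) ^ n i)) := by
      have e1 : ∏ i ∈ s, (E i).resEqn F.1 z.1 ^ n i = valueAt F.1 (∏ i ∈ s,
          (((E i).eqn (F.1.incl z.1) : RF δ) / (E i).eqn F.1) ^ n i) := by
        rw [valueAt_prod s fun i _ => ((hE i).zpow _).2.1]
        exact prod_congr rfl fun i _ => ((hE i).valueAt_zpow _).symm
      rw [e1, ← valueAt_mul F.1 hP.2.1 (h F.1).inv.2.1,
        ← valueAt_mul F.1 (hP.mul (h F.1).inv).2.1 hu1.2.1, resEqn]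
      congr 1
      rw [prod_congr rfl fun i _ => div_zpow _ _ _, prod_div_distrib]
      have h1 : ∏ i ∈ s, ((E i).eqn F.1 : RF δ) ^ n i ≠ 0 := prod_ne_zero_iff.mpr fun i _ => hne i _
      have h2 : ∏ i ∈ s, ((E i).eqn (F.1.incl z.1) : RF δ) ^ n i ≠ 0 :=
        prod_ne_zero_iff.mpr fun i _ => hne i _
      have h3 := D.eqn_ne_zero F.1
      field_simp
    have hn1 : ∀ i ∈ s, (E i).resEqn F.1 z.1 ^ n i ≠ 0 := fun i _ =>
      zpow_ne_zero _ ((E i).resEqn_ne_zero _ _)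
    have hn2 := (h F.1).inv.valueAt_ne_zero
    rw [hprod, hF.ordAt_mul (mul_ne_zero (prod_ne_zero_iff.mpr hn1) hn2) hr.1,
      hF.ordAt_unit hr.1 hr.2.1 hr.2.2, hF.ordAt_mul (prod_ne_zero_iff.mpr hn1) hn2,
      hF.ordAt_prod s _ hn1, add_zero]
    congr 1
    exact sum_congr rfl fun i _ => hF.ordAt_zpow ((E i).resEqn_ne_zero _ _) _
  have h0 := exists_finset_ordAt F.2 (h F.1).inv.valueAt_ne_zero
  have hsupp : (Function.support fun z : {z : Pts F.1.1 // z.1 ≠ F.1.1} =>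
      ordAt (Loc z.1) (valueAt F.1 w⁻¹)).Finite :=
    h0.1.subset fun z hz hzu => hz
      ((hasFiniteOrders F.2 z.1).ordAt_unit hzu.1 hzu.2.1 hzu.2.2)
  have hsi : ∀ i ∈ s, (Function.support fun z : {z : Pts F.1.1 // z.1 ≠ F.1.1} =>
      n i * ordAt (Loc z.1) ((E i).resEqn F.1 z.1)).Finite := fun i _ =>
    ((E i).finite_support F).subset fun z hz hz0 => hz (by
      change n i * _ = 0
      rw [show ordAt (Loc z.1) ((E i).resEqn F.1 z.1) = 0 from hz0, mul_zero])
  rw [degOn_eq_resEqn, finsum_congr hkey, finsum_add_distrib ?_ hsupp, h0.2, add_zero,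
    finsum_sum_comm s _ hsi]
  · refine sum_congr rfl fun i _ => ?_; rw [degOn_eq_resEqn, mul_finsum]
  · refine (s.finite_toSet.biUnion hsi).subset fun z hz => ?_
    by_contra h1
    simp only [Set.mem_iUnion, not_exists] at h1
    exact hz (Finset.sum_eq_zero fun i hi => of_not_not (h1 i hi))

omit [Finite σ] [IsAlgClosed k] in
lemma CartierDivisor.pairing_cls (D : CartierDivisor δ) (c : Cycle δ) :
    D.pairing (cls c) = D.degCycle c := rfl

omit [Finite σ] [IsAlgClosed k] in
lemma CartierDivisor.degCycle_single (D : CartierDivisor δ) (F : Curve δ) (r : ℝ) :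
    D.degCycle (Finsupp.single F r) = r * D.degOn F := by
  rw [degCycle, Finsupp.linearCombination_single, smul_eq_mul]

lemma CartierDivisor.degCycle_eq_sum (D : CartierDivisor δ) {ι : Type*} (s : Finset ι)
    (E : ι → CartierDivisor δ) (n : ι → ℤ) (g : RF δ)
    (h : ∀ x : Pts δ, IsUnitAt x ((D.eqn x : RF δ) /
      (g * ∏ i ∈ s, ((E i).eqn x : RF δ) ^ n i)))
    (c : Cycle δ) : D.degCycle c = ∑ i ∈ s, (n i : ℝ) * (E i).degCycle c := by
  induction c using Finsupp.induction_linear with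
  | zero => simp
  | add c d hc hd =>
    rw [map_add, hc, hd, ← Finset.sum_add_distrib]
    refine sum_congr rfl fun i _ => ?_
    rw [map_add]
    ring
  | single F r =>
    rw [degCycle_single, D.degOn_eq_sum s E n g h, Int.cast_sum, Finset.mul_sum]
    refine sum_congr rfl fun i _ => ?_
    rw [degCycle_single]
    push_cast
    ring

omit [Finite σ] [IsAlgClosed k] in
lemma CartierDivisor.degCycle_restrict (D : CartierDivisor δ) (y : Pts δ) (c : Cycle y.1) :
    (D.restrict y).degCycle c = D.degCycle (pushCycle y c) := by
  induction c using Finsupp.induction_linear with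
  | zero => simp
  | add c d hc hd => rw [map_add, hc, hd, map_add, map_add]
  | single F r =>
    rw [pushCycle, Finsupp.lmapDomain_apply, Finsupp.mapDomain_single, degCycle_single,
      degCycle_single, degOn_restrict]

omit [Finite σ] [IsAlgClosed k] in
lemma cls_eq_iff (c d : Cycle δ) :
    cls c = cls d ↔ ∀ D : CartierDivisor δ, D.degCycle c = D.degCycle d := by
  rw [cls, Submodule.mkQ_apply, Submodule.mkQ_apply, Submodule.Quotient.eq, numTrivial,
    Submodule.mem_iInf]
  refine forall_congr' fun D => ?_
  rw [LinearMap.mem_ker, map_sub, sub_eq_zero]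

omit [Finite σ] [IsAlgClosed k] in
lemma cls_mem_NM1_iff (c : Cycle δ) :
    cls c ∈ NM1 δ ↔ ∀ D : CartierDivisor δ, D.IsEffective → 0 ≤ D.degCycle c := Iff.rfl

/-- The product of a Cartier divisor with a principal divisor. -/
def CartierDivisor.mulPrincipal (D : CartierDivisor δ) (g : (RF δ)ˣ) : CartierDivisor δ where
  eqn x := D.eqn x * g
  compatible x := by
    have ⟨U, hx, hU⟩ := D.compatible x
    refine ⟨U, hx, fun y hy => ?_⟩
    rw [mul_div_mul_right_eq_div]
    exact hU y hy

lemma CartierDivisor.degCycle_mulPrincipal (D : CartierDivisor δ) (g : (RF δ)ˣ) (c : Cycle δ) :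
    (D.mulPrincipal g).degCycle c = D.degCycle c := by
  rw [degCycle_eq_sum (D.mulPrincipal g) (Finset.univ : Finset Unit) (fun _ => D) 1 g]
  · simp
  · intro x
    convert isUnitAt_one x using 1
    simp only [mulPrincipal, Units.val_mul, Finset.univ_unique, Pi.one_apply, zpow_one,
      Finset.prod_const, Finset.card_singleton, pow_one]
    rw [mul_comm, div_self]
    exact mul_ne_zero g.ne_zero (D.eqn_ne_zero x)

lemma degCycle_nonneg_of_mem_NM1 {c : Cycle δ} (hc : cls c ∈ NM1 δ) (D : CartierDivisor δ)
    (g : RF δ) (hg : g ≠ 0)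
    (h : ∀ x : Pts δ, (D.eqn x : RF δ) * g ∈ Loc x) :
    0 ≤ D.degCycle c := by
  rw [← D.degCycle_mulPrincipal (Units.mk0 g hg)]
  exact (cls_mem_NM1_iff c).mp hc _ h

end ProjectiveSpace

section CrossRatios

variable {k : Type u} [Field k]

/-- The value of the cross-ratio of four of the elements `s i` of a field. -/
def crossValue {E : Type*} [Field E] (s : Fin 6 → E) (v : Tup) : E :=
  ((s (v 0) - s (v 1)) * (s (v 2) - s (v 3))) / ((s (v 0) - s (v 2)) * (s (v 1) - s (v 3)))

section Specialization

variable {E : Type*} [Field E] [Algebra k E] (s : Fin 6 → E) (hs : Inj s)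

/-- The values of the coordinates at a point of `M_{0,6}`, divided by one of them. -/
def segreValue (k : Type u) [Field k] [Algebra k E] : Poly SegreIdx k →ₐ[k] E :=
  aeval fun i => ∏ v : Quad, if i v then crossValue s v else 1

include hs in
lemma aeval_crossDen_ne_zero : aeval s (∏ v : Quad, crossDen k v) ≠ 0 := by
  rw [map_prod, prod_ne_zero_iff]
  intro v _
  have h : ∀ i j : Fin 4, i ≠ j → s (v i) - s (v j) ≠ 0 := fun i j hij h =>
    hij (v.injective (hs (sub_eq_zero.mp h)))
  simp only [crossDen, map_mul, map_sub, aeval_X]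
  exact mul_ne_zero (h 0 2 (by decide)) (h 1 3 (by decide))

include hs in
lemma segreValue_X_mul (i : SegreIdx) :
    segreValue s k (X i) * aeval s (∏ v : Quad, crossDen k v) = aeval s (segreCoord k i) := by
  rw [segreValue, aeval_X, segreCoord, map_prod, map_prod, ← prod_mul_distrib]
  refine prod_congr rfl fun v _ => ?_
  have h : ∀ i j : Fin 4, i ≠ j → s (v i) - s (v j) ≠ 0 := fun i j hij h =>
    hij (v.injective (hs (sub_eq_zero.mp h)))
  have h1 := h 0 2 (by decide)
  have h2 := h 1 3 (by decide)
  split_ifs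
  · simp only [crossValue, crossDen, crossNum, map_mul, map_sub, aeval_X]; field_simp
  · rw [one_mul]

include hs in
lemma segreValue_mul_pow {n : ℕ} {b : Poly SegreIdx k} (hb : b.IsHomogeneous n) :
    segreValue s k b * aeval s (∏ v : Quad, crossDen k v) ^ n = aeval s (segreHom k b) := by
  rw [b.as_sum]
  simp only [map_sum, Finset.sum_mul]
  refine sum_congr rfl fun d hd => ?_
  have hdn : ∑ i ∈ d.support, d i = n := by
    have := hb (mem_support_iff.mp hd)
    rwa [Finsupp.weight_apply, Finsupp.sum, sum_congr rfl (g := fun i => d i)] at this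
    intro i _
    simp
  rw [monomial_eq, map_mul, map_mul, map_mul, Finsupp.prod, map_prod (segreValue s k),
    map_prod (segreHom k), map_prod (aeval s) (fun i => segreHom k (X i ^ d i)),
    ← hdn, ← Finset.prod_pow_eq_pow_sum, mul_assoc, ← prod_mul_distrib]
  refine congrArg₂ (· * ·) (by simp [segreValue, segreHom]) ?_
  refine prod_congr rfl fun i _ => ?_
  rw [map_pow, map_pow, ← mul_pow, segreValue_X_mul s hs]
  simp [segreHom]

end Specialization

lemma segreCoord_notMem (i : SegreIdx) : X i ∉ idl (Mbar06 k) := X_notMem_ker k i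

/-- The coordinate which is the product of the denominators. -/
abbrev denIdx : SegreIdx := fun _ => false

/-- The rational functions on `M̄_{0,6}` given by polynomials in the ratios of the coordinates. -/
abbrev ratHom (k : Type u) [Field k] : Poly SegreIdx k →ₐ[k] RatFun k :=
  dehom (Mbar06 k) (segreCoord_notMem denIdx)

lemma segreValue_denIdx {E : Type*} [Field E] [Algebra k E] (s : Fin 6 → E) :
    segreValue s k (X denIdx) = 1 := by simp [segreValue]

lemma segreValue_eq_zero {E : Type*} [Field E] [Algebra k E] (s : Fin 6 → E)
    (hs : Inj s) {a : Poly SegreIdx k} (ha : ratHom k a = 0) :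
    segreValue s k a = 0 := by
  have ⟨n, b, hb, h⟩ := exists_homogenization (X denIdx) a
  have h1 := h (RingHom.ker (segreValue s k)) (by
    rw [RingHom.mem_ker, map_sub, segreValue_denIdx, map_one, sub_self])
  have h2 := h (RingHom.ker (ratHom k)) (by
    rw [RingHom.mem_ker, map_sub, map_one, dehom_self, sub_self])
  rw [RingHom.mem_ker, map_sub, sub_eq_zero] at h1 h2
  rw [h2, dehom_eq_zero_iff _ _ hb] at ha
  have h3 := segreValue_mul_pow s hs hb
  have h4 : segreHom k b = 0 := ha
  rw [h4, map_zero] at h3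
  rw [h1]
  exact (mul_eq_zero.mp h3).resolve_right (pow_ne_zero _ (aeval_crossDen_ne_zero s hs))

/-- The field of rational functions in `t₁, …, t₆`. -/
abbrev TField (k : Type u) [Field k] : Type u := FractionRing (Poly (Fin 6) k)

/-- The variables of the field of rational functions. -/
def tvar (k : Type u) [Field k] (i : Fin 6) : TField k := algebraMap (Poly (Fin 6) k) _ (X i)

lemma tvar_injective : Inj (tvar k) := fun _ _ h =>
  X_injective (IsFractionRing.injective (Poly (Fin 6) k) (TField k) h)

lemma aeval_tvar (a : Poly (Fin 6) k) : aeval (tvar k) a = algebraMap _ (TField k) a := by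
  have : (aeval (tvar k) : Poly (Fin 6) k →ₐ[k] TField k) =
      IsScalarTower.toAlgHom k (Poly (Fin 6) k) (TField k) := by
    ext i
    simp [tvar]
  rw [this]
  rfl

lemma ratHom_eq_zero_iff (a : Poly SegreIdx k) : ratHom k a = 0 ↔ segreValue (tvar k) k a = 0 := by
  refine ⟨segreValue_eq_zero _ tvar_injective, fun ha => ?_⟩
  have ⟨n, b, hb, h⟩ := exists_homogenization (X denIdx) a
  have h1 := h (RingHom.ker (segreValue (tvar k) k)) (by
    rw [RingHom.mem_ker, map_sub, segreValue_denIdx, map_one, sub_self])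
  have h2 := h (RingHom.ker (ratHom k)) (by
    rw [RingHom.mem_ker, map_sub, map_one, dehom_self, sub_self])
  rw [RingHom.mem_ker, map_sub, sub_eq_zero] at h1 h2
  rw [h2, dehom_eq_zero_iff _ _ hb]
  have h3 := segreValue_mul_pow (tvar k) tvar_injective hb
  rw [← h1, ha, zero_mul, aeval_tvar] at h3
  exact IsFractionRing.injective (Poly (Fin 6) k) (TField k) (by rw [← h3, map_zero])

instance isFractionRing_ratHom : IsFractionRing (ratHom k).range (RatFun k) := by
  refine IsFractionRing.of_field _ _ fun g => ?_
  have ⟨a, b, hb, h⟩ := exists_dehom_eq (Mbar06 k)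
    (segreCoord_notMem denIdx) g
  exact ⟨⟨_, a, rfl⟩, ⟨_, b, rfl⟩, (eq_div_iff hb).mpr h⟩

/-- The homomorphism from the ring of polynomials in the ratios of coordinates to
`k(t₁, …, t₆)`. -/
def rangeToTField (k : Type u) [Field k] : (ratHom k).range →ₐ[k] TField k :=
  (Ideal.Quotient.liftₐ (RingHom.ker (ratHom k)) (segreValue (tvar k) k)
    fun _ ha => (ratHom_eq_zero_iff _).mp ha).comp
      (Ideal.quotientKerEquivRange (ratHom k)).symm.toAlgHom

lemma rangeToTField_apply (a : Poly SegreIdx k) :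
    rangeToTField k ⟨ratHom k a, a, rfl⟩ = segreValue (tvar k) k a := by
  have : (Ideal.quotientKerEquivRange (ratHom k)).symm ⟨ratHom k a, a, rfl⟩ =
      Ideal.Quotient.mk _ a := by
    rw [AlgEquiv.symm_apply_eq]
    rfl
  rw [rangeToTField, AlgHom.comp_apply]
  erw [this]
  rfl

lemma rangeToTField_injective : Inj (rangeToTField k) := by
  rw [injective_iff_map_eq_zero]
  rintro ⟨_, a, rfl⟩ h
  have h' := (rangeToTField_apply a).symm.trans h
  exact Subtype.ext ((ratHom_eq_zero_iff a).mpr h')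

/-- The embedding of the field of rational functions on `M̄_{0,6}` in `k(t₁, …, t₆)`. -/
def toTField (k : Type u) [Field k] : RatFun k →ₐ[k] TField k :=
  IsFractionRing.liftAlgHom (g := rangeToTField k) (K := RatFun k) rangeToTField_injective

lemma toTField_ratHom (a : Poly SegreIdx k) :
    toTField k (ratHom k a) = segreValue (tvar k) k a := by
  rw [← rangeToTField_apply]
  exact IsFractionRing.lift_algebraMap rangeToTField_injective ⟨ratHom k a, a, rfl⟩

lemma toTField_injective : Inj (toTField k) := (toTField k).toRingHom.injective

lemma crossRatio_eq (v : Quad) : CR v = ratHom k (X fun w => decide (w = v)) := by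
  rw [crossRatio, dif_pos v.injective, coordRatio]
  rw [ratHom, dehom_apply, dehomStalk, coe_eval₂Hom, eval₂_X]
  rfl

lemma toTField_crossRatio {v : Tup} (hv : Inj v) : toTField k (CR v) = crossValue (tvar k) v := by
  rw [show v = (⟨v, hv⟩ : Quad) from rfl, crossRatio_eq, toTField_ratHom, segreValue, aeval_X]
  simp

lemma const_eq (c : k) : const k c = algebraMap k (RatFun k) c := rfl

lemma ratHom_X (i : SegreIdx) : ratHom k (X i) = ∏ v : Quad, if i v then CR v else 1 := by
  apply toTField_injective
  rw [toTField_ratHom, segreValue, aeval_X, map_prod]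
  refine prod_congr rfl fun v _ => ?_
  split_ifs
  · rw [toTField_crossRatio v.injective]
  · rw [map_one]

end CrossRatios

section ProjectiveSpace

variable {σ : Type} {k : Type u} [Field k]

lemma valueAt_generic {δ : PS σ k} (g : RF δ) : valueAt (Pts.generic δ) g = g := by
  have ⟨t, ht⟩ := exists_X_notMem δ
  have ⟨a, b, hb, h⟩ := exists_dehom_eq δ ht g
  have := valueAt_eq (Pts.generic δ) ht g a b hb h
  exact mul_right_cancel₀ (M₀ := RF δ) hb (this.trans h.symm)

lemma mem_localRing_generic {δ : PS σ k} (g : RF δ) : g ∈ Loc (Pts.generic δ) := by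
  have ⟨t, ht⟩ := exists_X_notMem δ
  have ⟨a, b, hb, h⟩ := exists_dehom_eq δ ht g
  exact (mem_localRing_iff (Pts.generic δ) ht g).mpr ⟨a, b, hb, h⟩

lemma dehom_mem_of_X_mem {δ : PS σ k} {t : σ} (ht : X t ∉ idl δ)
    (O : Subring (RF δ)) (hk : ∀ c, algebraMap k _ c ∈ O)
    (hO : ∀ s, dehom δ ht (X s) ∈ O) (a : Poly σ k) :
    dehom δ ht a ∈ O := by
  induction a using MvPolynomial.induction_on with
  | C c => exact (AlgHom.commutes (dehom δ ht) c) ▸ hk c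
  | add a b ha hb => exact map_add (dehom δ ht) a b ▸ O.add_mem ha hb
  | mul_X a s ha => exact map_mul (dehom δ ht) a _ ▸ O.mul_mem ha (hO s)

end ProjectiveSpace

section CrossRatios

variable {k : Type u} [Field k]

lemma crossValue_ne_zero {E : Type*} [Field E] {s : Fin 6 → E} (hs : Inj s)
    {v : Tup} (hv : Inj v) : crossValue s v ≠ 0 := by
  have h : ∀ i j : Fin 4, i ≠ j → s (v i) - s (v j) ≠ 0 := fun i j hij h =>
    hij (hv (hs (sub_eq_zero.mp h)))
  exact div_ne_zero (mul_ne_zero (h 0 1 (by decide)) (h 2 3 (by decide)))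
    (mul_ne_zero (h 0 2 (by decide)) (h 1 3 (by decide)))

lemma crossRatio_ne_zero {v : Tup} (hv : Inj v) : crossRatio k v ≠ 0 := by
  intro h
  have := toTField_crossRatio (k := k) hv
  rw [h, map_zero] at this
  exact crossValue_ne_zero tvar_injective hv this.symm

lemma dehom_X_eq (s t : SegreIdx) : dehom (Mbar06 k) (segreCoord_notMem t) (X s) =
      ∏ v : Quad, (if s v then crossRatio k v else 1) / (if t v then crossRatio k v else 1) := by
  have h := dehom_change (Mbar06 k) (segreCoord_notMem denIdx) (segreCoord_notMem t) (isHomogeneous_X k s)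
  have hs := ratHom_X (k := k) s
  have ht := ratHom_X (k := k) t
  rw [ratHom] at hs ht
  rw [hs, ht, pow_one] at h
  rw [prod_div_distrib, h, mul_div_cancel_right₀]
  refine prod_ne_zero_iff.mpr fun v _ => ?_
  split_ifs
  · exact crossRatio_ne_zero v.injective
  · exact one_ne_zero

lemma crossRatio_mem_or (x : MPts k) {v : Tup} (hv : Inj v) : CR v ∈ Loc x ∨ (CR v)⁻¹ ∈ Loc x := by
  classical
  obtain ⟨t, ht⟩ := exists_X_notMem x.1
  let w : Quad := ⟨v, hv⟩
  have h := dehom_mem_localRing x ht (X (Function.update t w (!t w)))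
  rw [dehom_X_eq, Finset.prod_eq_single w] at h
  · rw [Function.update_self] at h
    cases htw : t w
    · left
      simp only [htw, Bool.not_false, if_true, Bool.false_eq_true, if_false, div_one] at h
      exact h
    · right
      simp only [htw, Bool.not_true, if_true, Bool.false_eq_true, if_false, one_div] at h
      exact h
  · intro b _ hb
    rw [Function.update_of_ne hb, div_self]
    split_ifs
    · exact crossRatio_ne_zero b.injective
    · exact one_ne_zero
  · simp

lemma exists_coord_of_ratios (δ : MPts k) (O : Subring (RF δ.1))
    (h : ∀ v : Quad, (CR v ∈ Loc δ ∧ valueAt δ (CR v) ∈ O) ∨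
      ((CR v)⁻¹ ∈ Loc δ ∧ valueAt δ (CR v)⁻¹ ∈ O)) :
    ∃ (t : SegreIdx) (ht : X t ∉ idl δ.1), ∀ s, dehom δ.1 ht (X s) ∈ O := by
  classical
  let t : SegreIdx := fun v => if CR v ∈ Loc δ ∧ valueAt δ (CR v) ∈ O then false else true
  have hf : ∀ (s : SegreIdx) (v : Quad),
      (if s v then CR v else 1) / (if t v then CR v else 1) ∈ Loc δ ∧
      valueAt δ ((if s v then CR v else 1) / (if t v then CR v else 1)) ∈ O := by
    intro s v
    by_cases hv : crossRatio k v ∈ Loc δ ∧ valueAt δ (crossRatio k v) ∈ O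
    · have htv : t v = false := if_pos hv
      rw [htv]
      cases s v
      · simp [valueAt_one, one_mem]
      · simpa using hv
    · have htv : t v = true := if_neg hv
      have hv' := (h v).resolve_left hv
      rw [htv]
      cases s v
      · simpa using hv'
      · simp [crossRatio_ne_zero v.injective, valueAt_one, one_mem]
  have hmem : ∀ s, dehom (Mbar06 k) (segreCoord_notMem t) (X s) ∈
      Loc δ := by
    intro s
    rw [dehom_X_eq]
    exact prod_mem fun v _ => (hf s v).1
  have hval : ∀ s, valueAt δ (dehom (Mbar06 k) (segreCoord_notMem t) (X s)) ∈
      O := by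
    intro s
    rw [dehom_X_eq, valueAt_prod _ fun v _ => (hf s v).1]
    exact prod_mem fun v _ => (hf s v).2
  have ht : X t ∉ idl δ.1 := by
    have ⟨t₀, ht₀⟩ := exists_X_notMem δ.1
    have h1 := dehom_mem_localRing δ ht₀ (X t)
    have h2 := dehom_X_mul_dehom_X (Mbar06 k) (segreCoord_notMem t₀) (segreCoord_notMem t)
    have h3 := hmem t₀
    intro h0
    have h4 := (dehom_eq_zero_iff δ.1 ht₀ (isHomogeneous_X k t)).mpr h0
    rw [← valueAt_dehom δ ht₀] at h4
    have h5 := valueAt_mul δ h1 h3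
    rw [h4, zero_mul, mul_comm] at h5
    have h6 : valueAt δ (1 : RatFun k) = 0 := by
      rw [← h5]
      congr 1
      first | exact h2.symm | (rw [mul_comm]; exact h2.symm)
    rw [valueAt_one] at h6
    exact one_ne_zero h6
  refine ⟨t, ht, fun s => ?_⟩
  rw [← valueAt_dehom δ ht]
  exact hval s

/-- A local ring in the function field of a subvariety of `M̄_{0,6}` has a center if it contains all
cross-ratios or their inverses. -/
lemma exists_center_of_ratios (δ : MPts k) (O : Subring (RF δ.1))
    [IsLocalRing O] (hk : ∀ c, algebraMap k _ c ∈ O)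
    (h : ∀ v : Quad, (CR v ∈ Loc δ ∧ valueAt δ (CR v) ∈ O) ∨
      ((CR v)⁻¹ ∈ Loc δ ∧ valueAt δ (CR v)⁻¹ ∈ O)) :
    ∃ x : Pts δ.1, Dominates x O := by
  have ⟨t, ht, hO⟩ := exists_coord_of_ratios δ O h
  have ⟨x, _, hx⟩ := exists_dominates O ht hO hk
  exact ⟨x, hx⟩

/-- The residue field of a point is generated by the values of cross-ratios. -/
lemma mem_of_ratios (δ : MPts k) (L : Subfield (RF δ.1)) (hk : ∀ c, algebraMap k _ c ∈ L)
    (h : ∀ v : Quad, (CR v ∈ Loc δ ∧ valueAt δ (CR v) ∈ L) ∨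
      ((CR v)⁻¹ ∈ Loc δ ∧ valueAt δ (CR v)⁻¹ ∈ L))
    (g : RF δ.1) : g ∈ L := by
  have ⟨t, ht, hO⟩ := exists_coord_of_ratios δ L.toSubring h
  have ⟨a, b, hb, hab⟩ := exists_dehom_eq δ.1 ht g
  have ha' := dehom_mem_of_X_mem ht L.toSubring hk hO a
  have hb' := dehom_mem_of_X_mem ht L.toSubring hk hO b
  rw [← eq_div_iff hb] at hab
  rw [hab]
  exact div_mem ha' hb'

lemma inj_of_nodup {p q r s : Fin 6} (h : [p, q, r, s].Nodup := by grind) : Inj ![p, q, r, s] := by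
  revert p q r s
  decide

/-- The cross-ratio of four marks. -/
abbrev cr (p q r s : Fin 6) : RatFun k := CR ![p, q, r, s]

lemma toTField_cr {p q r s : Fin 6} (h : [p, q, r, s].Nodup) :
    toTField k (cr p q r s) = ((tvar k p - tvar k q) * (tvar k r - tvar k s)) /
      ((tvar k p - tvar k r) * (tvar k q - tvar k s)) := toTField_crossRatio (inj_of_nodup h)

lemma tvar_sub_ne_zero {p q : Fin 6} (h : p ≠ q) : tvar k p - tvar k q ≠ 0 :=
  sub_ne_zero.mpr fun h' => h (tvar_injective h')

lemma tvar_ne (k : Type u) [Field k] (p q : Fin 6) (h : p ≠ q := by grind) :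
    tvar k p - tvar k q ≠ 0 := tvar_sub_ne_zero h

end CrossRatios

section CrossRatioIdentities

variable {k : Type u} [Field k]

lemma cr_inv {p q r s : Fin 6} (h : [p, q, r, s].Nodup) : (cr (k := k) p q r s)⁻¹ = cr p r q s := by
  apply toTField_injective
  rw [map_inv₀, toTField_cr h, toTField_cr (by grind), inv_div]

lemma cr_swap {p q r s : Fin 6} (h : [p, q, r, s].Nodup) : cr (k := k) p q r s = cr q p s r := by
  apply toTField_injective
  rw [toTField_cr h, toTField_cr (by grind)]
  congr 1 <;> ring

lemma cr_symm {p q r s : Fin 6} (h : [p, q, r, s].Nodup) : cr (k := k) p q r s = cr r s p q := by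
  apply toTField_injective
  rw [toTField_cr h, toTField_cr (by grind)]
  congr 1 <;> ring

lemma one_sub_cr {p q r s : Fin 6} (h : [p, q, r, s].Nodup) : 1 - cr (k := k) p q r s = cr p s r q := by
  apply toTField_injective
  rw [map_sub, map_one, toTField_cr h, toTField_cr (by grind)]
  have h1 := tvar_ne k p r
  have h2 := tvar_ne k q s
  have h3 := tvar_ne k s q
  field_simp
  ring

lemma cr_trans {a b x y r : Fin 6} (h : [a, b, x, y, r].Nodup) :
    cr (k := k) a b x y = cr a b x r + cr a b r y - cr a b x r * cr a b r y := by
  apply toTField_injective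
  rw [map_sub, map_add, map_mul, toTField_cr (by grind), toTField_cr (by grind),
    toTField_cr (by grind)]
  have h1 := tvar_ne k a x
  have h2 := tvar_ne k b y
  have h3 := tvar_ne k b r
  have h4 := tvar_ne k a r
  field_simp
  ring

lemma cr_mul {p p' q r s : Fin 6} (h : [p, p', q, r, s].Nodup) :
    cr p' q r s = cr (k := k) p q r s * cr p' q r p := by
  apply toTField_injective
  rw [map_mul, toTField_cr (by grind), toTField_cr (by grind), toTField_cr (by grind)]
  have h1 := tvar_ne k p' r
  have h2 := tvar_ne k q s
  have h3 := tvar_ne k p r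
  have h4 := tvar_ne k q p
  field_simp
  ring

end CrossRatioIdentities

section Close

variable {k : Type u} [Field k] {O : Subring (RatFun k)}

/-- The pairs of marks `p, q` and `r, s` are not further apart than they are from each other. -/
def Close (O : Subring (RatFun k)) (p q r s : Fin 6) : Prop := cr p q r s ∈ O ∧ cr p q s r ∈ O

lemma Close.swap_right {p q r s : Fin 6} (h : Close O p q r s) : Close O p q s r := ⟨h.2, h.1⟩

lemma Close.swap_left {p q r s : Fin 6} (hn : [p, q, r, s].Nodup) (h : Close O p q r s) :
    Close O q p r s :=
  ⟨by rw [cr_swap (by grind)]; exact h.2, by rw [cr_swap (by grind)]; exact h.1⟩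

lemma Close.symm {p q r s : Fin 6} (hn : [p, q, r, s].Nodup) (h : Close O p q r s) :
    Close O r s p q :=
  ⟨by rw [← cr_symm hn]; exact h.1, by rw [← cr_symm (by grind), cr_swap (by grind)]; exact h.2⟩

lemma Close.trans {a b x y r : Fin 6} (hn : [a, b, x, y, r].Nodup) (h : Close O a b x r)
    (h' : Close O a b y r) : Close O a b x y := by
  constructor
  · rw [cr_trans hn]; exact sub_mem (add_mem h.1 h'.2) (mul_mem h.1 h'.2)
  · rw [cr_trans (r := r) (by grind)]
    exact sub_mem (add_mem h'.1 h.2) (mul_mem h'.1 h.2)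

lemma Close.inv_one_sub_mem {p q r s : Fin 6} (hn : [p, q, r, s].Nodup) (h : Close O p q r s) :
    (1 - cr p q r s)⁻¹ ∈ O := by
  rw [one_sub_cr hn, cr_inv (by grind), ← sub_sub_cancel 1 (cr p r s q), one_sub_cr (by grind)]
  exact sub_mem (one_mem _) h.2

lemma Close.cr_mem {p p' q r : Fin 6} (hn : [p, p', q, r].Nodup) (h : Close O p p' q r) :
    cr p' q r p ∈ O := by
  rw [← sub_sub_cancel 1 (cr p' q r p), one_sub_cr (by grind), cr_swap (by grind)]
  exact sub_mem (one_mem _) h.1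

variable (hO : ∀ v : Tup, Inj v →
  CR v ∈ O ∨ (CR v)⁻¹ ∈ O)

include hO in
lemma close_or_close {p q r s : Fin 6} (hn : [p, q, r, s].Nodup) :
    Close O p q r s ∨ Close O p r q s ∨ Close O p s q r := by
  have key : ∀ {p q r s : Fin 6}, [p, q, r, s].Nodup → cr p q r s ∉ O → Close O p r q s := by
    intro p q r s hn h
    have h1 := (hO _ (inj_of_nodup hn)).resolve_left h
    rw [cr_inv hn] at h1
    refine ⟨h1, ?_⟩
    rcases hO _ (inj_of_nodup (p := p) (q := r) (r := s) (s := q) (by grind)) with h2 | h2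
    · exact h2
    · rw [cr_inv (by grind)] at h2
      exfalso
      apply h
      rw [← sub_sub_cancel 1 (cr p q r s), one_sub_cr hn]
      exact sub_mem (one_mem _) h2
  by_cases h1 : cr p q r s ∈ O
  · by_cases h2 : cr p q s r ∈ O
    · exact Or.inl ⟨h1, h2⟩
    · exact Or.inr (Or.inr (key (by grind) h2))
  · exact Or.inr (Or.inl (key hn h1))

/-- The difference of two marks after the last one `r` has been put at infinity. -/
def rootDiff (k : Type u) [Field k] (r i j : Fin 6) : TField k :=
  (tvar k i - tvar k j) / ((tvar k i - tvar k r) * (tvar k j - tvar k r))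

lemma rootDiff_ne_zero {r i j : Fin 6} (h : [i, j, r].Nodup) : rootDiff k r i j ≠ 0 :=
  div_ne_zero (tvar_sub_ne_zero (by grind))
    (mul_ne_zero (tvar_sub_ne_zero (by grind)) (tvar_sub_ne_zero (by grind)))

lemma toTField_cr_eq_rootDiff {i j l r : Fin 6} (h : [i, j, l, r].Nodup) :
    toTField k (cr i j l r) = rootDiff k r i j / rootDiff k r i l := by
  rw [toTField_cr h, rootDiff, rootDiff]
  have h1 := tvar_ne k i l
  have h2 := tvar_ne k i r
  have h3 := tvar_ne k j r
  have h4 := tvar_ne k l r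
  field_simp

lemma rootDiff_swap (r i j : Fin 6) : rootDiff k r j i = - rootDiff k r i j := by
  rw [rootDiff, rootDiff, mul_comm, ← neg_div, neg_sub]

lemma exists_minimal_of_trans {α : Type*} [Finite α] [Nonempty α] (R : α → α → Prop)
    (hrefl : ∀ x, R x x) (htrans : ∀ x y z, R x y → R y z → R x z) :
    ∃ x, ∀ y, R y x → R x y := by
  let _ : Preorder α := { le := R, le_refl := hrefl, le_trans := htrans }
  have ⟨x, _, hx⟩ := (Set.finite_univ (α := α)).exists_minimal Set.univ_nonempty
  exact ⟨x, fun y h => hx trivial h⟩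

include hO in
lemma exists_closest (M : Marks) (r : Fin 6) (hr : r ∉ M) (hM : 1 < M.card) :
    ∃ a ∈ M, ∃ b ∈ M, a ≠ b ∧ ∀ c ∈ M, c ≠ a → c ≠ b → Close O a b c r := by
  classical
  have hn : ∀ {i j l}, i ∈ M → j ∈ M → l ∈ M → i ≠ j → i ≠ l → j ≠ l → [i, j, l, r].Nodup := by
    intro i j l hi hj hl hij hil hjl
    have h1 : i ≠ r := fun h => hr (h ▸ hi)
    have h2 : j ≠ r := fun h => hr (h ▸ hj)
    have h3 : l ≠ r := fun h => hr (h ▸ hl)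
    simp [*]
  let T := {x : Fin 6 × Fin 6 // x.1 ∈ M ∧ x.2 ∈ M ∧ x.1 ≠ x.2}
  have hd : ∀ x : T, rootDiff k r x.1.1 x.1.2 ≠ 0 := fun x => rootDiff_ne_zero (by
    have h1 : x.1.1 ≠ r := fun h => hr (h ▸ x.2.1)
    have h2 : x.1.2 ≠ r := fun h => hr (h ▸ x.2.2.1)
    simp [h1, h2, x.2.2.2])
  let O' := O.map (toTField k).toRingHom
  obtain ⟨a, ha, b, hb, hab⟩ := Finset.one_lt_card.mp hM
  have : Nonempty T := ⟨⟨(a, b), ha, hb, hab⟩⟩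
  obtain ⟨⟨⟨a, b⟩, ha, hb, hab⟩, hmin⟩ := exists_minimal_of_trans
    (fun x y : T => rootDiff k r x.1.1 x.1.2 / rootDiff k r y.1.1 y.1.2 ∈ O')
    (fun x => by rw [div_self (hd x)]; exact one_mem _)
    (fun x y z hxy hyz => by
      have := mul_mem hxy hyz
      rwa [div_mul_div_cancel₀ (hd y)] at this)
  replace ha : a ∈ M := ha
  replace hb : b ∈ M := hb
  replace hab : a ≠ b := hab
  have hmem : ∀ {g : RatFun k}, toTField k g ∈ O' → g ∈ O := by
    rintro g ⟨g', hg', h⟩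
    rwa [← toTField_injective h]
  have hcr : ∀ {i j l : Fin 6}, [i, j, l, r].Nodup → [i, l, j, r].Nodup →
      rootDiff k r i j / rootDiff k r i l ∈ O' ∨ rootDiff k r i l / rootDiff k r i j ∈ O' := by
    intro i j l hn hn'
    rcases hO _ (inj_of_nodup hn) with h | h
    · left
      rw [← toTField_cr_eq_rootDiff hn]
      exact ⟨_, h, rfl⟩
    · right
      rw [cr_inv hn] at h
      rw [← toTField_cr_eq_rootDiff hn']
      exact ⟨_, h, rfl⟩
  refine ⟨a, ha, b, hb, hab, fun c hc hca hcb => ⟨?_, ?_⟩⟩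
  · apply hmem
    rw [toTField_cr_eq_rootDiff (hn ha hb hc hab hca.symm hcb.symm)]
    rcases hcr (hn ha hb hc hab hca.symm hcb.symm) (hn ha hc hb hca.symm hab hcb) with h | h
    · exact h
    · exact hmin ⟨(a, c), ha, hc, hca.symm⟩ h
  · have hbac := hn hb ha hc hab.symm hcb.symm hca.symm
    have habc := hn ha hb hc hab hca.symm hcb.symm
    have habrc : [a, b, r, c].Nodup := by clear hd this hmin hmem hcr hn; simp at habc ⊢; tauto
    apply hmem
    rw [cr_swap habrc, toTField_cr_eq_rootDiff hbac, rootDiff_swap, neg_div]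
    refine neg_mem ?_
    rcases hcr hbac (hn hb hc ha hcb.symm hab.symm hca) with h | h
    · rw [rootDiff_swap, neg_div, neg_mem_iff] at h; exact h
    · refine hmin ⟨(b, c), hb, hc, hcb.symm⟩ ?_
      rw [rootDiff_swap r a b, div_neg, neg_mem_iff] at h
      exact h

end Close

section SepExp

/-- The order of the cross-ratio of `v` along the boundary divisor of the set `S` of marks. -/
def sepExp (S : Marks) (v : Tup) : ℤ :=
  ((if v 0 ∈ S then 1 else 0) - (if v 3 ∈ S then 1 else 0)) *
    ((if v 1 ∈ S then 1 else 0) - (if v 2 ∈ S then 1 else 0))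

lemma sepExp_compl (S : Marks) (v : Tup) : sepExp Sᶜ v = sepExp S v := by
  simp only [sepExp, mem_compl]
  by_cases h0 : v 0 ∈ S <;> by_cases h1 : v 1 ∈ S <;> by_cases h2 : v 2 ∈ S <;>
    by_cases h3 : v 3 ∈ S <;> simp [h0, h1, h2, h3]

lemma sepExp_map (e : Equiv.Perm (Fin 6)) (S : Marks) (v : Tup) :
    sepExp (S.map e.toEmbedding) (e ∘ v) = sepExp S v := by simp [sepExp]

lemma sepExp_map' (e : Equiv.Perm (Fin 6)) (S : Marks) (v : Tup) :
    sepExp (S.map e.toEmbedding) v = sepExp S (e.symm ∘ v) := by simp [sepExp]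

end SepExp

section ChartAlgebra

/-- The sets of positions which come together on the coordinate planes of a chart.  There are two
combinatorial types of totally degenerate stable curves with six marks, and the charts are
neighbourhoods of these. -/
def chartPos : Bool → Fin 3 → Marks
  | false => ![{0, 1}, {0, 1, 2}, {0, 1, 2, 3}]
  | true => ![{0, 1}, {2, 3}, {0, 1, 2, 3}]

/-- The cross-ratios of positions that are the coordinates of a chart. -/
def chartQuad : Bool → Fin 3 → Tup
  | false => ![![0, 1, 2, 5], ![0, 2, 3, 5], ![0, 3, 4, 5]]
  | true => ![![0, 1, 2, 5], ![2, 3, 0, 5], ![0, 2, 4, 5]]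

variable (k : Type u) [Field k]

/-- The affine coordinates of the marks at the finite positions of a chart. -/
def chartPt : Bool → Fin 5 → Poly (Fin 3) k
  | false => ![0, X 0 * X 1 * X 2, X 1 * X 2, X 2, 1]
  | true => ![0, X 0 * X 2, X 2, X 2 * (1 - X 1), 1]

/-- The differences of coordinates, divided by the coordinate functions that divide them. -/
def chartUnit : Bool → Fin 6 → Fin 6 → Poly (Fin 3) k
  | false => ![
    ![0, -1, -1, -1, -1, 1],
    ![1, 0, X 0 - 1, X 0 * X 1 - 1, X 0 * X 1 * X 2 - 1, 1],
    ![1, 1 - X 0, 0, X 1 - 1, X 1 * X 2 - 1, 1],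
    ![1, 1 - X 0 * X 1, 1 - X 1, 0, X 2 - 1, 1],
    ![1, 1 - X 0 * X 1 * X 2, 1 - X 1 * X 2, 1 - X 2, 0, 1],
    ![-1, -1, -1, -1, -1, 0]]
  | true => ![
    ![0, -1, -1, X 1 - 1, -1, 1],
    ![1, 0, X 0 - 1, X 0 + X 1 - 1, X 0 * X 2 - 1, 1],
    ![1, 1 - X 0, 0, 1, X 2 - 1, 1],
    ![1 - X 1, 1 - X 0 - X 1, -1, 0, X 2 * (1 - X 1) - 1, 1],
    ![1, 1 - X 0 * X 2, 1 - X 2, 1 - X 2 * (1 - X 1), 0, 1],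
    ![-1, -1, -1, -1, -1, 0]]

/-- The differences of the coordinates of the marks; the mark at position `5` is at infinity. -/
def chartDiff (τ : Bool) (i j : Fin 6) : Poly (Fin 3) k :=
  chartUnit k τ i j * ∏ n, if i ∈ chartPos τ n ∧ j ∈ chartPos τ n then X n else 1

lemma chartDiff_castSucc (τ : Bool) (i j : Fin 5) :
    chartDiff k τ i.castSucc j.castSucc = chartPt k τ i - chartPt k τ j := by
  cases τ <;> fin_cases i <;> fin_cases j <;>
    simp [chartDiff, chartUnit, chartPt, chartPos, Fin.prod_univ_three] <;> ring

lemma chartDiff_last {τ : Bool} {i : Fin 6} (hi : i ≠ 5) : chartDiff k τ i 5 = 1 := by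
  cases τ <;> fin_cases i <;>
    simp [chartDiff, chartUnit, chartPos, Fin.prod_univ_three] at hi ⊢

lemma chartDiff_swap (τ : Bool) (i j : Fin 6) : chartDiff k τ j i = - chartDiff k τ i j := by
  have h : chartUnit k τ j i = - chartUnit k τ i j := by
    cases τ <;> fin_cases i <;> fin_cases j <;> simp [chartUnit] <;> ring
  simp only [chartDiff, h, neg_mul, and_comm]

/-- A chart: its combinatorial type and the marks at its six positions. -/
abbrev Chart : Type := Bool × Equiv.Perm (Fin 6)

/-- The sets of marks of the boundary divisors which meet the chart. -/
def Chart.set (T : Chart) (n : Fin 3) : Marks := (chartPos T.1 n).map T.2.toEmbedding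

variable {k}

lemma chartQuad_injective (τ : Bool) (n : Fin 3) : Inj (chartQuad τ n) := by
  cases τ <;> fin_cases n <;> simp only [chartQuad] <;> decide

/-- The coordinate functions of a chart. -/
def Chart.gen (k : Type u) [Field k] (T : Chart) (n : Fin 3) : RatFun k :=
  CR (T.2 ∘ chartQuad T.1 n)

/-- The homomorphism from the coordinate ring of a chart to the function field. -/
def Chart.hom (k : Type u) [Field k] (T : Chart) : Poly (Fin 3) k →ₐ[k] RatFun k := aeval (T.gen k)

notation:max T:max "♯" => AlgHom.toRingHom (Chart.hom _ T)

@[simp]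
lemma Chart.hom_X (T : Chart) (n : Fin 3) : T.hom k (X n) = T.gen k n := aeval_X _ _

lemma Chart.gen_ne_zero (T : Chart) (n : Fin 3) : T.gen k n ≠ 0 :=
  crossRatio_ne_zero (T.2.injective.comp (chartQuad_injective _ _))

lemma Chart.toTField_gen (T : Chart) (n : Fin 3) : toTField k (T.gen k n) =
    crossValue (tvar k ∘ T.2) (chartQuad T.1 n) :=
  toTField_crossRatio (T.2.injective.comp (chartQuad_injective _ _))

lemma Chart.toTField_hom_pt (T : Chart) (i : Fin 5) : toTField k (T.hom k (chartPt k T.1 i)) =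
    (tvar k (T.2 0) - tvar k (T.2 i.castSucc)) * (tvar k (T.2 4) - tvar k (T.2 5)) /
      ((tvar k (T.2 0) - tvar k (T.2 4)) * (tvar k (T.2 i.castSucc) - tvar k (T.2 5))) := by
  have hs : ∀ {i j : Fin 6}, i ≠ j → tvar k (T.2 i) - tvar k (T.2 j) ≠ 0 := fun h =>
    tvar_sub_ne_zero (T.2.injective.ne h)
  have h04 := hs (i := 0) (j := 4) (by decide)
  have h15 := hs (i := 1) (j := 5) (by decide)
  have h25 := hs (i := 2) (j := 5) (by decide)
  have h35 := hs (i := 3) (j := 5) (by decide)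
  have h45 := hs (i := 4) (j := 5) (by decide)
  have h02 := hs (i := 0) (j := 2) (by decide)
  have h20 := hs (i := 2) (j := 0) (by decide)
  have h03 := hs (i := 0) (j := 3) (by decide)
  have ⟨τ, e⟩ := T
  cases τ <;> fin_cases i <;>
    simp [chartPt, Chart.toTField_gen, crossValue, chartQuad] <;> field_simp <;> ring

lemma Chart.exists_toTField_hom_diff (k : Type u) [Field k] (T : Chart) :
    ∃ (μ : TField k) (ρ : Fin 6 → TField k), μ ≠ 0 ∧ (∀ i, ρ i ≠ 0) ∧
      ∀ i j, i ≠ j → toTField k (T.hom k (chartDiff k T.1 i j)) =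
        μ * ρ i * ρ j * (tvar k (T.2 i) - tvar k (T.2 j)) := by
  have hs : ∀ {i j : Fin 6}, i ≠ j → tvar k (T.2 i) - tvar k (T.2 j) ≠ 0 := fun h =>
    tvar_sub_ne_zero (T.2.injective.ne h)
  have h04 := hs (i := 0) (j := 4) (by decide)
  have h05 := hs (i := 0) (j := 5) (by decide)
  have h45 := hs (i := 4) (j := 5) (by decide)
  set μ := - ((tvar k (T.2 0) - tvar k (T.2 5)) * (tvar k (T.2 4) - tvar k (T.2 5)) /
    (tvar k (T.2 0) - tvar k (T.2 4))) with hμ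
  have hμ0 : μ ≠ 0 := neg_ne_zero.mpr (div_ne_zero (mul_ne_zero h05 h45) h04)
  refine ⟨μ, fun i => if i = 5 then μ⁻¹ else (tvar k (T.2 i) - tvar k (T.2 5))⁻¹, hμ0, ?_, ?_⟩
  · intro i
    dsimp only
    split_ifs with h
    · exact inv_ne_zero hμ0
    · exact inv_ne_zero (hs h)
  · intro i j hij
    have hlast : ∀ i : Fin 6, i ≠ 5 → toTField k (T.hom k (chartDiff k T.1 i 5)) =
        μ * (if i = 5 then μ⁻¹ else (tvar k (T.2 i) - tvar k (T.2 5))⁻¹) *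
          (if (5 : Fin 6) = 5 then μ⁻¹ else (tvar k (T.2 5) - tvar k (T.2 5))⁻¹) *
          (tvar k (T.2 i) - tvar k (T.2 5)) := by
      intro i hi
      have := hs hi
      rw [chartDiff_last k hi, map_one, map_one, if_neg hi, if_pos rfl]
      field_simp
    by_cases hj : j = 5
    · subst hj; exact hlast i hij
    · by_cases hi : i = 5
      · subst hi
        rw [chartDiff_swap, map_neg, map_neg, hlast j hj]
        ring
      · obtain ⟨i, rfl⟩ := Fin.exists_castSucc_eq.mpr hi
        obtain ⟨j, rfl⟩ := Fin.exists_castSucc_eq.mpr hj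
        have h1 := hs hi
        have h2 := hs hj
        replace h1 : tvar k (T.2 i.castSucc) - tvar k (T.2 5) ≠ 0 := h1
        replace h2 : tvar k (T.2 j.castSucc) - tvar k (T.2 5) ≠ 0 := h2
        rw [chartDiff_castSucc, map_sub, map_sub, Chart.toTField_hom_pt, Chart.toTField_hom_pt]
        simp only [if_neg hi, if_neg hj, hμ]
        field_simp
        ring

lemma Chart.crossRatio_mul (T : Chart) {w : Tup} (hw : Inj w) : CR (T.2 ∘ w) *
      (T.hom k (chartDiff k T.1 (w 0) (w 2)) * T.hom k (chartDiff k T.1 (w 1) (w 3))) =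
      T.hom k (chartDiff k T.1 (w 0) (w 1)) * T.hom k (chartDiff k T.1 (w 2) (w 3)) := by
  apply toTField_injective
  have ⟨μ, ρ, hμ, hρ, h⟩ := T.exists_toTField_hom_diff k
  have hs : ∀ {i j : Fin 4}, i ≠ j → tvar k (T.2 (w i)) - tvar k (T.2 (w j)) ≠ 0 := fun h =>
    tvar_sub_ne_zero (T.2.injective.ne (hw.ne h))
  have h02 := hs (i := 0) (j := 2) (by decide)
  have h13 := hs (i := 1) (j := 3) (by decide)
  simp only [map_mul, toTField_crossRatio (T.2.injective.comp hw), crossValue,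
    h _ _ (hw.ne (show (0 : Fin 4) ≠ 2 by decide)), h _ _ (hw.ne (show (1 : Fin 4) ≠ 3 by decide)),
    h _ _ (hw.ne (show (0 : Fin 4) ≠ 1 by decide)), h _ _ (hw.ne (show (2 : Fin 4) ≠ 3 by decide)),
    Function.comp]
  field_simp

lemma Chart.hom_diff_ne_zero (T : Chart) {i j : Fin 6} (h : i ≠ j) :
    T.hom k (chartDiff k T.1 i j) ≠ 0 := by
  intro h0
  have ⟨μ, ρ, hμ, hρ, hd⟩ := T.exists_toTField_hom_diff k
  have := hd i j h
  rw [h0, map_zero] at this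
  exact mul_ne_zero (mul_ne_zero (mul_ne_zero hμ (hρ i)) (hρ j))
    (tvar_sub_ne_zero (T.2.injective.ne h)) this.symm

lemma Chart.hom_diff (T : Chart) (i j : Fin 6) : T.hom k (chartDiff k T.1 i j) =
    T.hom k (chartUnit k T.1 i j) *
      ∏ n, if i ∈ chartPos T.1 n ∧ j ∈ chartPos T.1 n then T.gen k n else 1 := by
  rw [chartDiff, map_mul, map_prod]
  congr 1
  refine prod_congr rfl fun n _ => ?_
  split_ifs <;> simp

lemma Chart.hom_unit_ne_zero (T : Chart) {i j : Fin 6} (h : i ≠ j) :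
    T.hom k (chartUnit k T.1 i j) ≠ 0 := by
  intro h0
  apply T.hom_diff_ne_zero (k := k) h
  rw [Chart.hom_diff, h0, zero_mul]

/-- The factor of a cross-ratio that is invertible on the chart. -/
def Chart.unitPart (k : Type u) [Field k] (T : Chart) (w : Tup) : RatFun k :=
  T.hom k (chartUnit k T.1 (w 0) (w 1)) * T.hom k (chartUnit k T.1 (w 2) (w 3)) /
    (T.hom k (chartUnit k T.1 (w 0) (w 2)) * T.hom k (chartUnit k T.1 (w 1) (w 3)))

lemma Chart.crossRatio_eq_unitPart (T : Chart) {w : Tup} (hw : Inj w) : CR (T.2 ∘ w) =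
      T.unitPart k w * ∏ n, T.gen k n ^ sepExp (chartPos T.1 n) w := by
  have hne : ∀ {i j : Fin 4}, i ≠ j → T.hom k (chartDiff k T.1 (w i) (w j)) ≠ 0 := fun h =>
    T.hom_diff_ne_zero (hw.ne h)
  have h := T.crossRatio_mul (k := k) hw
  rw [← eq_div_iff (mul_ne_zero (hne (by decide)) (hne (by decide)))] at h
  rw [h]
  simp only [Chart.hom_diff, Chart.unitPart]
  rw [mul_mul_mul_comm, ← prod_mul_distrib, mul_mul_mul_comm (T.hom k _),
    ← prod_mul_distrib, mul_div_mul_comm, ← prod_div_distrib]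
  congr 1
  refine prod_congr rfl fun n _ => ?_
  have hg := T.gen_ne_zero (k := k) n
  by_cases h0 : w 0 ∈ chartPos T.1 n <;> by_cases h1 : w 1 ∈ chartPos T.1 n <;>
    by_cases h2 : w 2 ∈ chartPos T.1 n <;> by_cases h3 : w 3 ∈ chartPos T.1 n <;>
    simp [sepExp, h0, h1, h2, h3, hg]

lemma sepExp_chartPos_sign (τ : Bool) (w : Tup) :
    (∀ n, 0 ≤ sepExp (chartPos τ n) w) ∨ (∀ n, sepExp (chartPos τ n) w ≤ 0) := by
  have h : ∀ a b c d : Fin 6, (∀ n, 0 ≤ sepExp (chartPos τ n) ![a, b, c, d]) ∨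
      (∀ n, sepExp (chartPos τ n) ![a, b, c, d] ≤ 0) := by cases τ <;> decide +kernel
  have hw : w = ![w 0, w 1, w 2, w 3] := by ext i; fin_cases i <;> rfl
  rw [hw]
  exact h _ _ _ _

/-- The regular functions on the chart where all cross-ratios have their generic behaviour belong
to the subring `O`. -/
structure Chart.Valid (T : Chart) (O : Subring (RatFun k)) : Prop where
  gen_mem : ∀ n, T.gen k n ∈ O
  inv_unit_mem : ∀ i j, i ≠ j → (T.hom k (chartUnit k T.1 i j))⁻¹ ∈ O

lemma Chart.Valid.mono {T : Chart} {O O' : Subring (RatFun k)} (h : T.Valid O) (hO : O ≤ O') :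
    T.Valid O' := ⟨fun n => hO (h.1 n), fun i j hij => hO (h.2 i j hij)⟩

lemma Chart.Valid.hom_mem {T : Chart} {O : Subring (RatFun k)} (h : T.Valid O)
    (hk : ∀ c, algebraMap k (RatFun k) c ∈ O) (a : Poly (Fin 3) k) : T.hom k a ∈ O := by
  induction a using MvPolynomial.induction_on with
  | C c =>
    rw [← MvPolynomial.algebraMap_eq, AlgHom.commutes]
    exact hk c
  | add p q hp hq => rw [map_add]; exact add_mem hp hq
  | mul_X p n hp => rw [map_mul, Chart.hom_X]; exact mul_mem hp (h.1 n)

lemma Chart.Valid.unitPart_mem {T : Chart} {O : Subring (RatFun k)} (h : T.Valid O)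
    (hk : ∀ c, algebraMap k (RatFun k) c ∈ O) {w : Tup} (hw : Inj w) :
    T.unitPart k w ∈ O ∧ (T.unitPart k w)⁻¹ ∈ O := by
  have hne : ∀ {i j : Fin 4}, i ≠ j → w i ≠ w j := fun h => hw.ne h
  constructor
  · rw [Chart.unitPart, div_eq_mul_inv, mul_inv]
    exact mul_mem (mul_mem (h.hom_mem hk _) (h.hom_mem hk _))
      (mul_mem (h.2 _ _ (hne (by decide))) (h.2 _ _ (hne (by decide))))
  · rw [Chart.unitPart, inv_div, div_eq_mul_inv, mul_inv]
    exact mul_mem (mul_mem (h.hom_mem hk _) (h.hom_mem hk _))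
      (mul_mem (h.2 _ _ (hne (by decide))) (h.2 _ _ (hne (by decide))))

lemma Chart.unitPart_ne_zero (T : Chart) {w : Tup} (hw : Inj w) : T.unitPart k w ≠ 0 := by
  have hne : ∀ {i j : Fin 4}, i ≠ j → T.hom k (chartUnit k T.1 (w i) (w j)) ≠ 0 := fun h =>
    T.hom_unit_ne_zero (hw.ne h)
  exact div_ne_zero (mul_ne_zero (hne (by decide)) (hne (by decide)))
    (mul_ne_zero (hne (by decide)) (hne (by decide)))

/-- On a valid chart every cross-ratio is the product of a unit and a monomial. -/
lemma Chart.Valid.crossRatio_eq {T : Chart} {O : Subring (RatFun k)} (h : T.Valid O)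
    (hk : ∀ c, algebraMap k (RatFun k) c ∈ O) {v : Tup} (hv : Inj v) :
    ∃ u ∈ O, u⁻¹ ∈ O ∧ u ≠ 0 ∧ CR v = u * ∏ n, T.gen k n ^ sepExp (T.set n) v := by
  have hw : Inj (T.2.symm ∘ v) := T.2.symm.injective.comp hv
  refine ⟨T.unitPart k (T.2.symm ∘ v), (h.unitPart_mem hk hw).1, (h.unitPart_mem hk hw).2,
    T.unitPart_ne_zero hw, ?_⟩
  have h1 := T.crossRatio_eq_unitPart (k := k) hw
  have h2 : T.2 ∘ T.2.symm ∘ v = v := by ext i; simp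
  rw [h2] at h1
  rw [h1]
  simp only [Chart.set, sepExp_map']

lemma Chart.sepExp_sign (T : Chart) (v : Tup) :
    (∀ n, 0 ≤ sepExp (T.set n) v) ∨ (∀ n, sepExp (T.set n) v ≤ 0) := by
  simp only [Chart.set, sepExp_map']
  exact sepExp_chartPos_sign T.1 _

lemma Chart.Valid.crossRatio_mem_or {T : Chart} {O : Subring (RatFun k)} (h : T.Valid O)
    (hk : ∀ c, algebraMap k (RatFun k) c ∈ O) {v : Tup} (hv : Inj v) :
    CR v ∈ O ∨ (CR v)⁻¹ ∈ O := by
  have ⟨u, hu, hu', _, he⟩ := h.crossRatio_eq hk hv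
  rcases T.sepExp_sign v with hs | hs
  · left
    rw [he]
    refine mul_mem hu (prod_mem fun n _ => ?_)
    lift sepExp (T.set n) v to ℕ using hs n with m
    rw [zpow_natCast]
    exact pow_mem (h.1 n) m
  · right
    rw [he, mul_inv, ← Finset.prod_inv_distrib]
    refine mul_mem hu' (prod_mem fun n _ => ?_)
    rw [← zpow_neg]
    have := neg_nonneg.mpr (hs n)
    lift - sepExp (T.set n) v to ℕ using this with m
    rw [zpow_natCast]
    exact pow_mem (h.1 n) m

end ChartAlgebra

section ChartExistence

variable {k : Type u} [Field k] {O : Subring (RatFun k)}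

lemma cr_mul_cr {p q r s t : Fin 6} (h : [p, q, r, s, t].Nodup) :
    cr (k := k) p q r t * cr p r s t = cr p q s t := by
  apply toTField_injective
  rw [map_mul, toTField_cr (by grind), toTField_cr (by grind), toTField_cr (by grind)]
  have h1 := tvar_ne k p r
  have h2 := tvar_ne k q t
  have h3 := tvar_ne k p s
  have h4 := tvar_ne k r t
  field_simp

/-- The pairs of positions which have to be close for a chart to be valid. -/
def chartClose : Bool → List (Fin 6 × Fin 6 × Fin 6 × Fin 6)
  | false => [(0, 1, 2, 5), (0, 1, 3, 5), (0, 1, 4, 5), (0, 2, 3, 5), (0, 2, 4, 5), (0, 3, 4, 5)]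
  | true => [(0, 1, 2, 5), (0, 1, 3, 5), (0, 1, 4, 5), (2, 3, 0, 5), (0, 2, 4, 5), (0, 3, 4, 5)]

lemma Chart.gen_eq (T : Chart) {n : Fin 3} {p q r s : Fin 6} (h : chartQuad T.1 n = ![p, q, r, s]) :
    T.gen k n = cr (T.2 p) (T.2 q) (T.2 r) (T.2 s) := by
  rw [Chart.gen, h, cr]
  congr 1
  ext i
  fin_cases i <;> rfl

lemma Chart.hom_unit_swap (T : Chart) (i j : Fin 6) :
    T.hom k (chartUnit k T.1 j i) = - T.hom k (chartUnit k T.1 i j) := by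
  rw [← map_neg]
  congr 1
  have ⟨τ, e⟩ := T
  cases τ <;> fin_cases i <;> fin_cases j <;> simp [chartUnit] <;> ring

lemma Chart.valid_of_close (T : Chart) (h : ∀ q ∈ chartClose T.1,
    Close O (T.2 q.1) (T.2 q.2.1) (T.2 q.2.2.1) (T.2 q.2.2.2)) : T.Valid O := by
  suffices hs : (∀ n, T.gen k n ∈ O) ∧
      ∀ i j, i < j → (T.hom k (chartUnit k T.1 i j))⁻¹ ∈ O by
    refine ⟨hs.1, fun i j hij => ?_⟩
    rcases lt_or_gt_of_ne hij with h | h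
    · exact hs.2 i j h
    · rw [Chart.hom_unit_swap, inv_neg, neg_mem_iff]; exact hs.2 j i h
  have hnd : ∀ {l : List (Fin 6)}, l.Nodup → (l.map T.2).Nodup := fun h => h.map T.2.injective
  have ⟨τ, e⟩ := T
  have hnd4 : ∀ p q r s : Fin 6, [p, q, r, s].Nodup → [e p, e q, e r, e s].Nodup := fun _ _ _ _ h =>
    hnd h
  have hnd5 : ∀ p q r s t : Fin 6, [p, q, r, s, t].Nodup → [e p, e q, e r, e s, e t].Nodup :=
    fun _ _ _ _ _ h => hnd h
  have hgen : ∀ (n : Fin 3) {p q r s : Fin 6}, chartQuad τ n = ![p, q, r, s] →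
    Chart.gen k (τ, e) n = cr (e p) (e q) (e r) (e s) := fun n _ _ _ _ h => Chart.gen_eq (τ, e) h
  have hu : ∀ {p q r s : Fin 6} {g : RatFun k}, [p, q, r, s].Nodup →
      Close O (e p) (e q) (e r) (e s) → g = cr (e p) (e q) (e r) (e s) → (g - 1)⁻¹ ∈ O := by
    rintro p q r s g hn h rfl
    rw [← neg_sub, inv_neg]
    exact neg_mem (h.inv_one_sub_mem (hnd hn))
  cases τ
  · simp only [chartClose, List.forall_mem_cons, List.not_mem_nil, false_imp_iff, implies_true,
      and_true] at h
    have ⟨h1, h2, h3, h4, h5, h6⟩ := h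
    have g0 := hgen 0 (p := 0) (q := 1) (r := 2) (s := 5) rfl
    have g1 := hgen 1 (p := 0) (q := 2) (r := 3) (s := 5) rfl
    have g2 := hgen 2 (p := 0) (q := 3) (r := 4) (s := 5) rfl
    have g01 : Chart.gen k (false, e) 0 * Chart.gen k (false, e) 1 =
        cr (e 0) (e 1) (e 3) (e 5) := by rw [g0, g1]; exact cr_mul_cr (hnd5 0 1 2 3 5 (by decide))
    have g12 : Chart.gen k (false, e) 1 * Chart.gen k (false, e) 2 =
        cr (e 0) (e 2) (e 4) (e 5) := by rw [g1, g2]; exact cr_mul_cr (hnd5 0 2 3 4 5 (by decide))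
    have g012 : Chart.gen k (false, e) 0 * Chart.gen k (false, e) 1 * Chart.gen k (false, e) 2 =
        cr (e 0) (e 1) (e 4) (e 5) := by rw [g01, g2]; exact cr_mul_cr (hnd5 0 1 3 4 5 (by decide))
    refine ⟨?_, ?_⟩
    · intro n
      fin_cases n
      · exact g0 ▸ h1.1
      · exact g1 ▸ h4.1
      · exact g2 ▸ h6.1
    · have u1 := hu (by decide) h1 g0
      have u2 := hu (by decide) h2 g01
      have u3 := hu (by decide) h3 g012
      have u4 := hu (by decide) h4 g1
      have u5 := hu (by decide) h5 g12
      have u6 := hu (by decide) h6 g2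
      clear * - u1 u2 u3 u4 u5 u6
      intro i j hij
      fin_cases i <;> fin_cases j <;> first
        | (exfalso; revert hij; decide)
        | (simp [chartUnit]; done)
        | (simp only [chartUnit, Fin.isValue, Fin.mk_one, Fin.reduceFinMk, Matrix.cons_val,
            Matrix.cons_val_one, Matrix.cons_val_zero, map_sub, map_mul, map_one, Chart.hom_X]
           assumption)
  · simp only [chartClose, List.forall_mem_cons, List.not_mem_nil, false_imp_iff, implies_true,
      and_true] at h
    have ⟨h1, h2, h3, h4, h5, h6⟩ := h
    have g0 := hgen 0 (p := 0) (q := 1) (r := 2) (s := 5) rfl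
    have g1 := hgen 1 (p := 2) (q := 3) (r := 0) (s := 5) rfl
    have g2 := hgen 2 (p := 0) (q := 2) (r := 4) (s := 5) rfl
    have h032 : 1 - Chart.gen k (true, e) 1 = cr (e 0) (e 3) (e 2) (e 5) := by
      rw [g1, one_sub_cr (hnd4 2 3 0 5 (by decide)), cr_symm (hnd4 2 5 0 3 (by decide))]
    have h013 : cr (e 0) (e 1) (e 3) (e 5) * (1 - Chart.gen k (true, e) 1) =
        Chart.gen k (true, e) 0 := by rw [h032, g0]; exact cr_mul_cr (hnd5 0 1 3 2 5 (by decide))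
    have g02 : Chart.gen k (true, e) 0 * Chart.gen k (true, e) 2 =
        cr (e 0) (e 1) (e 4) (e 5) := by rw [g0, g2]; exact cr_mul_cr (hnd5 0 1 2 4 5 (by decide))
    have g12 : Chart.gen k (true, e) 2 * (1 - Chart.gen k (true, e) 1) =
        cr (e 0) (e 3) (e 4) (e 5) := by
      rw [h032, g2, mul_comm]; exact cr_mul_cr (hnd5 0 3 2 4 5 (by decide))
    refine ⟨?_, ?_⟩
    · intro n
      fin_cases n
      · exact g0 ▸ h1.1
      · exact g1 ▸ h4.1
      · exact g2 ▸ h5.1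
    · have u1 := hu (by decide) h1 g0
      have u3 := hu (by decide) h3 g02
      have u4 := hu (by decide) h4 g1
      have u5 := hu (by decide) h5 g2
      have u6 := hu (by decide) h6 g12
      have u2 : (Chart.gen k (true, e) 0 + Chart.gen k (true, e) 1 - 1)⁻¹ ∈ O := by
        have := mul_mem (h2.inv_one_sub_mem (hnd4 0 1 3 5 (by decide))) u4
        rw [← mul_inv] at this
        convert this using 2
        linear_combination - h013
      clear * - u1 u2 u3 u4 u5 u6
      intro i j hij
      fin_cases i <;> fin_cases j <;> first
        | (exfalso; revert hij; decide)
        | (simp [chartUnit]; done)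
        | (simp only [chartUnit, Fin.isValue, Fin.mk_one, Fin.reduceFinMk, Matrix.cons_val,
            Matrix.cons_val_one, Matrix.cons_val_zero, map_sub, map_add, map_mul, map_one,
            Chart.hom_X]
           assumption)

lemma Close.replace {p p' q r s : Fin 6} (hn : [p, p', q, r, s].Nodup) (h : Close O p q r s)
    (h1 : Close O p p' q r) (h2 : Close O p p' q s) : Close O p' q r s := by
  constructor
  · rw [cr_mul hn]; exact mul_mem h.1 (h1.cr_mem (by grind))
  · rw [cr_mul (p := p) (by grind)]
    exact mul_mem h.2 (h2.cr_mem (by grind))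

lemma close_of_close_root {a b r : Fin 6} (h : ∀ x, [a, b, x, r].Nodup → Close O a b x r)
    {x y : Fin 6} (hn : [a, b, x, y].Nodup) (hr : r ≠ a ∧ r ≠ b) : Close O a b x y := by
  by_cases hx : x = r
  · subst hx; exact (h y (by grind)).swap_right
  · by_cases hy : y = r
    · subst hy; exact h x hn
    · exact (h x (by grind)).trans (r := r) (by grind) (h y (by grind))

lemma exists_perm {a b c d e f : Fin 6} (h : [a, b, c, d, e, f].Nodup) :
    ∃ σ : Equiv.Perm (Fin 6), σ 0 = a ∧ σ 1 = b ∧ σ 2 = c ∧ σ 3 = d ∧ σ 4 = e ∧ σ 5 = f := by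
  have hinj : Inj ![a, b, c, d, e, f] := by rw [← List.nodup_ofFn]; simpa [List.ofFn_succ] using h
  exact ⟨Equiv.ofBijective _ (Finite.injective_iff_bijective.mp hinj), rfl, rfl, rfl, rfl, rfl, rfl⟩

lemma exists_rest {a b c d : Fin 6} (h : [a, b, c, d].Nodup) : ∃ e f, [a, b, c, d, e, f].Nodup := by
  revert a b c d
  decide

lemma exists_valid_cat {a b c d e f : Fin 6} (hn : [a, b, c, d, e, f].Nodup)
    (hAB : ∀ {x y : Fin 6}, [a, b, x, y].Nodup → Close O a b x y)
    (hCD : ∀ {x y : Fin 6}, [c, d, x, y].Nodup → Close O c d x y) (h : Close O b e c f) :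
    ∃ T : Chart, T.Valid O := by
  have ⟨σ, s0, s1, s2, s3, s4, s5⟩ := exists_perm (a := a) (b := b) (c := e) (d := f) (e := c)
    (f := d) (by clear hAB hCD h; grind)
  have h3 : Close O a e c f := h.replace (by clear hAB hCD h; grind)
    ((hAB (x := e) (y := c) (by clear hAB hCD; grind)).swap_left (by clear hAB hCD; grind))
    ((hAB (x := e) (y := f) (by clear hAB hCD; grind)).swap_left (by clear hAB hCD; grind))
  have h4 : Close O d f a e := (((h3.symm (by clear hAB hCD h; grind)).replace (p := c) (p' := d)
      (by clear hAB hCD h; grind) (hCD (by clear hAB hCD h; grind))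
      (hCD (by clear hAB hCD h; grind))))
  refine ⟨(false, σ), Chart.valid_of_close _ ?_⟩
  simp only [chartClose, List.forall_mem_cons, List.not_mem_nil, false_imp_iff, implies_true,
    and_true, s0, s1, s2, s3, s4, s5]
  clear s0 s1 s2 s3 s4 s5 h h3
  exact ⟨hAB (by clear hAB hCD; grind), hAB (by clear hAB hCD; grind),
    hAB (by clear hAB hCD; grind),
    (h4.symm (by clear hAB hCD; grind)).swap_right,
    (hCD (by clear hAB hCD; grind)).symm (by clear hAB hCD; grind),
    (hCD (by clear hAB hCD; grind)).symm (by clear hAB hCD; grind)⟩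

lemma exists_valid_snow {a b c d e f : Fin 6} (hn : [a, b, c, d, e, f].Nodup)
    (hAB : ∀ {x y : Fin 6}, [a, b, x, y].Nodup → Close O a b x y)
    (hCD : ∀ {x y : Fin 6}, [c, d, x, y].Nodup → Close O c d x y) (h : Close O b c e f) :
    ∃ T : Chart, T.Valid O := by
  have ⟨σ, s0, s1, s2, s3, s4, s5⟩ := exists_perm hn
  have h3 : Close O a c e f := h.replace (by clear hAB hCD; grind)
    ((hAB (x := c) (y := e) (by clear hAB hCD; grind)).swap_left (by clear hAB hCD; grind))
    ((hAB (x := c) (y := f) (by clear hAB hCD; grind)).swap_left (by clear hAB hCD; grind))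
  have h4 : Close O d a e f := (h3.swap_left (by clear hAB hCD; grind)).replace
    (by clear hAB hCD; grind) (hCD (by clear hAB hCD; grind)) (hCD (by clear hAB hCD; grind))
  refine ⟨(true, σ), Chart.valid_of_close _ ?_⟩
  simp only [chartClose, List.forall_mem_cons, List.not_mem_nil, false_imp_iff, implies_true,
    and_true, s0, s1, s2, s3, s4, s5]
  exact ⟨hAB (by clear hAB hCD; grind), hAB (by clear hAB hCD; grind),
    hAB (by clear hAB hCD; grind), hCD (by clear hAB hCD; grind), h3,
    h4.swap_left (by clear hAB hCD; grind)⟩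

variable (hO : ∀ v : Tup, Inj v →
  CR v ∈ O ∨ (CR v)⁻¹ ∈ O)

include hO in
lemma exists_two_close_pairs : ∃ a b c d : Fin 6, [a, b, c, d].Nodup ∧
    (∀ {x y : Fin 6}, [a, b, x, y].Nodup → Close O a b x y) ∧
    ∀ {x y : Fin 6}, [c, d, x, y].Nodup → Close O c d x y := by
  classical
  have ⟨a, ha, b, hb, hab, h1⟩ := exists_closest hO (Finset.univ.erase 0) 0 (by simp) (by decide)
  replace ha : 0 ≠ a := fun h => by simp [← h] at ha
  replace hb : 0 ≠ b := fun h => by simp [← h] at hb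
  have hAB : ∀ {x y : Fin 6}, [a, b, x, y].Nodup → Close O a b x y := fun hn =>
    close_of_close_root (r := 0) (fun x hx => h1 x (by simp; grind) (by grind) (by grind)) hn
      ⟨ha, hb⟩
  clear h1
  have hcard : 1 < (Finset.univ \ {a, b} : Marks).card := by
    rw [Finset.card_sdiff_of_subset (Finset.subset_univ _), Finset.card_pair hab]
    decide
  have ⟨c, hc, d, hd, hcd, h2⟩ := exists_closest hO (Finset.univ \ {a, b}) b (by simp) hcard
  simp only [Finset.mem_sdiff, Finset.mem_univ, mem_insert, mem_singleton, not_or,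
    true_and] at hc hd h2
  have hn : [a, b, c, d].Nodup := by simp; tauto
  refine ⟨a, b, c, d, hn, hAB, ?_⟩
  intro x y hxy
  refine close_of_close_root (r := b) (fun x hx => ?_) hxy ⟨Ne.symm hc.2, Ne.symm hd.2⟩
  by_cases hxa : x = a
  · subst hxa; exact (hAB hn).symm hn
  · exact h2 x ⟨hxa, by grind⟩ (by grind) (by grind)

include hO in
/-- Every point of the moduli space lies on some chart. -/
lemma exists_valid_chart : ∃ T : Chart, T.Valid O := by
  have ⟨a, b, c, d, hn, hAB, hCD⟩ := exists_two_close_pairs hO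
  have ⟨e, f, hn6⟩ := exists_rest hn
  rcases close_or_close hO (p := b) (q := c) (r := e) (s := f) (by clear hAB hCD; grind)
    with h | h | h
  · exact exists_valid_snow hn6 hAB hCD h
  · exact exists_valid_cat hn6 hAB hCD h
  · exact exists_valid_cat (e := f) (f := e) (by clear hAB hCD; grind) hAB hCD h

end ChartExistence

section General

variable {σ : Type} {k : Type u} [Field k] {δ : PS σ k}

lemma specializes_iff_localRing_le {x y : Pts δ} : y.1 ⤳ x.1 ↔ Loc x ≤ Loc y := by
  refine ⟨localRing_le_of_specializes, fun h => ?_⟩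
  have ⟨t, ht⟩ := exists_X_notMem x.1
  have : IsLocalRing (Loc y) := inferInstance
  have ⟨z, hz, hd⟩ := exists_dominates (Loc y) (x.2.notMem ht)
    (fun s => h (dehom_mem_localRing x ht (X s)))
    (fun c => cst_mem y c)
  have hzy : z = y := hd.eq (dominates_self y)
  subst hzy
  exact specializes_of_localRing_le h ht hz

lemma isUnitAt_of_inv_mem {x : Pts δ} {g : RF δ} (h0 : g ≠ 0)
    (h : g ∈ Loc x) (h' : g⁻¹ ∈ Loc x) : IsUnitAt x g := ⟨h0, h, h'⟩

lemma VanishesAt.mem {x : Pts δ} {g : RF δ} (h : VanishesAt x g) :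
    g ∈ Loc x := ((vanishesAt_iff_mem x g).mp h).1

lemma VanishesAt.not_isUnitAt {x : Pts δ} {g : RF δ} (h : VanishesAt x g) :
    ¬ IsUnitAt x g := ((vanishesAt_iff_mem x g).mp h).2

lemma isUnitAt_of_not {x : Pts δ} {g : RF δ} (hg : g ∈ Loc x)
    (h : ¬ VanishesAt x g) : IsUnitAt x g := by
  by_contra h'
  exact h ((vanishesAt_iff_mem x g).mpr ⟨hg, h'⟩)

lemma VanishesAt.mul_left {x : Pts δ} {g h : RF δ} (hh : h ∈ Loc x)
    (hg : VanishesAt x g) : VanishesAt x (h * g) := by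
  rw [← valueAt_eq_zero_iff x (mul_mem hh hg.mem), valueAt_mul x hh hg.mem,
    (valueAt_eq_zero_iff x hg.mem).mpr hg, mul_zero]

end General

section ChartPoints

variable {k : Type u} [Field k]

/-- The rational functions in the coordinates of a chart. -/
abbrev ChartField (k : Type u) [Field k] : Type u := FractionRing (Poly (Fin 3) k)

local notation "toCF" => algebraMap (Poly (Fin 3) k) (ChartField k)

/-- Distinct points in `k(y₀, y₁, y₂)` with the coordinates of the points of a chart. -/
def chartRoot (k : Type u) [Field k] (τ : Bool) : Fin 6 → ChartField k :=
  Fin.lastCases 0 fun i => (algebraMap (Poly (Fin 3) k) (ChartField k)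
    (chartPt k τ i - X 0))⁻¹

lemma chartPt_sub_ne_zero (τ : Bool) (i : Fin 5) : chartPt k τ i - X 0 ≠ 0 := by
  intro h
  have h1 := congrArg (eval ![(1 : k), 0, 0]) h
  have h2 := congrArg (eval ![(0 : k), 0, 0]) h
  cases τ <;> fin_cases i <;> simp [chartPt] at h1 h2

lemma chartRoot_castSucc (τ : Bool) (i : Fin 5) : chartRoot k τ i.castSucc =
    (toCF (chartPt k τ i - X 0))⁻¹ := by rw [chartRoot, Fin.lastCases_castSucc]

lemma chartRoot_injective (τ : Bool) : Inj (chartRoot k τ) := by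
  have hinj := IsFractionRing.injective (Poly (Fin 3) k) (ChartField k)
  have h0 : ∀ i : Fin 5, chartRoot k τ i.castSucc ≠ 0 := fun i => by
    rw [chartRoot_castSucc]
    exact inv_ne_zero fun h => chartPt_sub_ne_zero τ i (hinj (by rw [h, map_zero]))
  have hlast : chartRoot k τ (Fin.last 5) = 0 := by rw [chartRoot, Fin.lastCases_last]
  intro i j hij
  induction i using Fin.lastCases with
  | last =>
    induction j using Fin.lastCases with
    | last => rfl
    | cast j => rw [hlast] at hij; exact absurd hij.symm (h0 j)
  | cast i =>
    induction j using Fin.lastCases with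
    | last => rw [hlast] at hij; exact absurd hij (h0 i)
    | cast j =>
      by_contra hne
      rw [chartRoot_castSucc, chartRoot_castSucc, inv_inj] at hij
      have h1 : chartDiff k τ i.castSucc j.castSucc = 0 := by
        rw [chartDiff_castSucc]
        linear_combination hinj hij
      have h2 := Chart.hom_diff_ne_zero (k := k) (τ, 1) hne
      rw [h1, map_zero] at h2
      exact h2 rfl

lemma crossValue_chartRoot (τ : Bool) (n : Fin 3) : crossValue (chartRoot k τ) (chartQuad τ n) =
      toCF (X n : Poly (Fin 3) k) := by
  have hinj := IsFractionRing.injective (Poly (Fin 3) k) (ChartField k)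
  have hne : ∀ i : Fin 5, toCF
      (chartPt k τ i - X 0) ≠ 0 := fun i h => chartPt_sub_ne_zero τ i (hinj (by rw [h, map_zero]))
  have hr := chartRoot_castSucc (k := k) τ
  have hr5 : chartRoot k τ 5 = 0 := Fin.lastCases_last
  have hd : ∀ i j : Fin 5, i ≠ j → chartRoot k τ i.castSucc - chartRoot k τ j.castSucc ≠ 0 :=
    fun i j hij => sub_ne_zero.mpr ((chartRoot_injective τ).ne (by simpa using hij))
  have hp : ∀ i j : Fin 5, toCF (chartPt k τ i - chartPt k τ j) =
      toCF (chartPt k τ i - X 0) - toCF (chartPt k τ j - X 0) := fun i j => by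
    rw [← map_sub, sub_sub_sub_cancel_right]
  have key : ∀ i j l : Fin 5, i ≠ l →
      (chartRoot k τ i.castSucc - chartRoot k τ j.castSucc) *
        (chartRoot k τ l.castSucc - chartRoot k τ 5) /
      ((chartRoot k τ i.castSucc - chartRoot k τ l.castSucc) *
        (chartRoot k τ j.castSucc - chartRoot k τ 5)) =
      toCF (chartPt k τ i - chartPt k τ j) / toCF (chartPt k τ i - chartPt k τ l) := by
    intro i j l hil
    have h1 := hne i
    have h2 := hne j
    have h3 := hne l
    have h4 := hd i l hil
    simp only [hp, hr, hr5, sub_zero] at h4 ⊢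
    have h5 : toCF (chartPt k τ i - X 0) - toCF (chartPt k τ l - X 0) ≠ 0 := fun h0 =>
      h4 (by rw [sub_eq_zero.mp h0, sub_self])
    generalize toCF (chartPt k τ i - X 0) = a at *
    generalize toCF (chartPt k τ j - X 0) = b at *
    generalize toCF (chartPt k τ l - X 0) = c at *
    rw [div_eq_div_iff (mul_ne_zero h4 (inv_ne_zero h2)) h5]
    field_simp
    ring
  have hdiv : ∀ a b c : Poly (Fin 3) k, b ≠ 0 → a = c * b →
      toCF a / toCF b = algebraMap _ _ c := by
    intro a b c hb h
    rw [h, map_mul, mul_div_cancel_right₀]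
    exact fun h => hb (hinj (by rw [h, map_zero]))
  have hpt : ∀ i l : Fin 5, i ≠ l → chartPt k τ i - chartPt k τ l ≠ 0 := by
    intro i l hil h
    have h2 := Chart.hom_diff_ne_zero (k := k) (τ, 1) (i := i.castSucc) (j := l.castSucc)
      (by simpa using hil)
    rw [chartDiff_castSucc, h, map_zero] at h2
    exact h2 rfl
  cases τ <;> fin_cases n
  · exact (key 0 1 2 (by decide)).trans (hdiv _ _ _ (hpt _ _ (by decide)) (by simp [chartPt]; ring))
  · exact (key 0 2 3 (by decide)).trans (hdiv _ _ _ (hpt _ _ (by decide)) (by simp [chartPt]))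
  · exact (key 0 3 4 (by decide)).trans (hdiv _ _ _ (hpt _ _ (by decide)) (by simp [chartPt]))
  · exact (key 0 1 2 (by decide)).trans (hdiv _ _ _ (hpt _ _ (by decide)) (by simp [chartPt]))
  · exact (key 2 3 0 (by decide)).trans (hdiv _ _ _ (hpt _ _ (by decide)) (by simp [chartPt]; ring))
  · exact (key 0 2 4 (by decide)).trans (hdiv _ _ _ (hpt _ _ (by decide)) (by simp [chartPt]))

/-- The coordinates of a chart are algebraically independent. -/
lemma Chart.hom_injective (T : Chart) : Inj (T.hom k) := by
  rw [injective_iff_map_eq_zero]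
  intro p hp
  have hq : ∀ n, Inj (T.2 ∘ chartQuad T.1 n) := fun n =>
    T.2.injective.comp (chartQuad_injective _ _)
  let idx : Fin 3 → SegreIdx := fun n w => decide (w = ⟨_, hq n⟩)
  have h1 : ratHom k (aeval (fun n => X (idx n)) p) = T.hom k p := by
    have : (ratHom k).comp (aeval (fun n => X (idx n))) = T.hom k := by
      apply MvPolynomial.algHom_ext
      intro n
      rw [AlgHom.comp_apply, aeval_X, Chart.hom_X, Chart.gen]
      exact (crossRatio_eq (k := k) ⟨_, hq n⟩).symm
    rw [← this]
    rfl
  have hs : Inj (chartRoot k T.1 ∘ T.2.symm) := (chartRoot_injective T.1).comp T.2.symm.injective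
  have h2 := segreValue_eq_zero (k := k) _ hs (h1.trans hp)
  have h3 : (segreValue (chartRoot k T.1 ∘ T.2.symm) k).comp (aeval (fun n => X (idx n))) =
      IsScalarTower.toAlgHom k (Poly (Fin 3) k) (ChartField k) := by
    apply MvPolynomial.algHom_ext
    intro n
    rw [AlgHom.comp_apply, aeval_X, segreValue, aeval_X]
    refine Eq.trans ?_ (crossValue_chartRoot T.1 n)
    simp [idx, crossValue]
  have h4 := (DFunLike.congr_fun h3 p).symm.trans h2
  exact IsFractionRing.injective (Poly (Fin 3) k) (ChartField k) (h4.trans (map_zero _).symm)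

/-- The functions on a chart that vanish at a point form a prime ideal. -/
def Chart.Valid.ideal {T : Chart} {x : MPts k} (h : T.Valid (Loc x)) : Ideal (Poly (Fin 3) k) :=
  RingHom.ker ((valHom x).comp (T♯.codRestrict (Loc x)
    (h.hom_mem (cst_mem x))))

instance {T : Chart} {x : MPts k} (h : T.Valid (Loc x)) : h.ideal.IsPrime := RingHom.ker_isPrime _

lemma Chart.Valid.hom_mem_localRing {T : Chart} {x : MPts k} (h : T.Valid (Loc x))
    (a : Poly (Fin 3) k) : T.hom k a ∈ Loc x := h.hom_mem (cst_mem x) a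

lemma Chart.Valid.mem_ideal {T : Chart} {x : MPts k} (h : T.Valid (Loc x))
    (a : Poly (Fin 3) k) : a ∈ h.ideal ↔ VanishesAt x (T.hom k a) := by
  rw [← valueAt_eq_zero_iff x (h.hom_mem_localRing a)]
  rfl

lemma Chart.Valid.isUnitAt_iff {T : Chart} {x : MPts k} (h : T.Valid (Loc x))
    (a : Poly (Fin 3) k) : IsUnitAt x (T.hom k a) ↔ a ∉ h.ideal := by
  rw [h.mem_ideal]
  exact ⟨fun h1 h2 => h2.not_isUnitAt h1, isUnitAt_of_not (h.hom_mem_localRing a)⟩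

lemma Chart.Valid.unit_notMem {T : Chart} {x : MPts k} (h : T.Valid (Loc x)) {i j : Fin 6}
    (hij : i ≠ j) : chartUnit k T.1 i j ∉ h.ideal := by
  rw [← h.isUnitAt_iff]
  exact ⟨T.hom_unit_ne_zero hij, h.hom_mem_localRing _, h.2 i j hij⟩

lemma Chart.ker_le (T : Chart) (q : Ideal (Poly (Fin 3) k)) : RingHom.ker (T.hom k) ≤ q := by
  rw [(RingHom.injective_iff_ker_eq_bot _).mp T.hom_injective]
  exact bot_le

lemma Chart.valid_locAt (T : Chart) {q : Ideal (Poly (Fin 3) k)} [q.IsPrime]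
    (hq : ∀ i j, i ≠ j → chartUnit k T.1 i j ∉ q) : T.Valid (locAt T♯ q) :=
  ⟨fun n => T.hom_X (k := k) n ▸ map_mem_locAt T♯ q (X n),
    fun i j hij => inv_map_mem_locAt (T.ker_le q) (hq i j hij)⟩

lemma Chart.algebraMap_mem_locAt (T : Chart) (q : Ideal (Poly (Fin 3) k)) [q.IsPrime]
    (c : k) : algebraMap k (RatFun k) c ∈ locAt T♯ q := by
  rw [← (T.hom k).commutes]
  exact map_mem_locAt T♯ q _

lemma exists_dominates_of_ratios (O : Subring (RatFun k)) [IsLocalRing O]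
    (hk : ∀ c, algebraMap k (RatFun k) c ∈ O)
    (h : ∀ v : Tup, Inj v →
      CR v ∈ O ∨ (CR v)⁻¹ ∈ O) : ∃ x : MPts k, Dominates x O := by
  refine @exists_center_of_ratios _ _ (Pts.generic (Mbar06 k)) O ‹_› hk fun v => ?_
  rcases h v v.injective with h | h
  · exact Or.inl ⟨mem_localRing_generic _, by rwa [valueAt_generic]⟩
  · exact Or.inr ⟨mem_localRing_generic _, by rwa [valueAt_generic]⟩

lemma Dominates.crossRatio_mem {x : MPts k} {O : Subring (RatFun k)} (h : Dominates x O)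
    {v : Tup} (hv : Inj v) (hO : CR v ∈ O) :
    CR v ∈ Loc x := by
  rcases crossRatio_mem_or x hv with h1 | h1
  · exact h1
  · have := h.inv_mem _ h1 (by rwa [inv_inv])
    rwa [inv_inv] at this

/-- The points of a chart are the prime ideals of its coordinate ring. -/
lemma Chart.exists_point (T : Chart) (q : Ideal (Poly (Fin 3) k)) [q.IsPrime]
    (hq : ∀ i j, i ≠ j → chartUnit k T.1 i j ∉ q) :
    ∃ x : MPts k, Loc x = locAt T♯ q := by
  have hloc := isLocalRing_locAt (T.ker_le q)
  have hval := T.valid_locAt hq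
  have ⟨x, hx⟩ := exists_dominates_of_ratios (locAt T♯ q)
    (T.algebraMap_mem_locAt q) fun v hv => hval.crossRatio_mem_or (T.algebraMap_mem_locAt q) hv
  have hgen : ∀ a, T.hom k a ∈ Loc x := by
    intro a
    induction a using MvPolynomial.induction_on with
    | C c =>
      rw [← MvPolynomial.algebraMap_eq, AlgHom.commutes]
      exact cst_mem x c
    | add p q hp hq => rw [map_add]; exact add_mem hp hq
    | mul_X p n hp =>
      rw [map_mul, Chart.hom_X]
      exact mul_mem hp (hx.crossRatio_mem (T.2.injective.comp (chartQuad_injective _ _)) (hval.1 n))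
  refine ⟨x, hx.localRing_eq fun g hg => ?_⟩
  have ⟨a, b, hb, hb0, h⟩ := mem_locAt.mp hg
  exact ⟨_, hgen a, _, hgen b, hb0, inv_map_mem_locAt (T.ker_le q) hb, h⟩

lemma Chart.Valid.localRing_eq {T : Chart} {x : MPts k} (h : T.Valid (Loc x)) :
    Loc x = locAt T♯ h.ideal := by
  have ⟨y, hy⟩ := T.exists_point h.ideal fun i j hij => h.unit_notMem hij
  have hle : locAt T♯ h.ideal ≤ Loc x := by
    intro g hg
    have ⟨a, b, hb, hb0, hab⟩ := mem_locAt.mp hg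
    rw [(eq_div_iff hb0).mpr hab, div_eq_mul_inv]
    exact mul_mem (h.hom_mem_localRing a) ((h.isUnitAt_iff b).mpr hb).2.2
  have hd : Dominates y (Loc x) := by
    refine ⟨hy.le.trans hle, fun g hg hg' => ?_⟩
    by_cases hg0 : g = 0
    · rw [hg0, inv_zero]; exact zero_mem _
    rw [hy] at hg ⊢
    have ⟨a, b, hb, hb0, hab⟩ := mem_locAt.mp hg
    have ha : a ∉ h.ideal := by
      rw [← h.isUnitAt_iff]
      have : T.hom k a = g * T.hom k b := hab.symm
      rw [this]
      exact (isUnitAt_of_inv_mem hg0 (hle hg) hg').mul ((h.isUnitAt_iff b).mpr hb)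
    have ha0 : T.hom k a ≠ 0 := fun h0 => ha (T.ker_le _ h0)
    refine mem_locAt.mpr ⟨b, a, ha, ha0, ?_⟩
    change g⁻¹ * T.hom k a = T.hom k b
    rw [show T.hom k a = g * T.hom k b from hab.symm, inv_mul_cancel_left₀ hg0]
  exact (congrArg Loc (hd.eq (dominates_self x))).symm.trans hy

lemma Chart.Valid.mem_localRing {T : Chart} {x : MPts k} (h : T.Valid (Loc x))
    (g : RatFun k) : g ∈ Loc x ↔ ∃ a b, b ∉ h.ideal ∧ g * T.hom k b = T.hom k a := by
  rw [h.localRing_eq, mem_locAt]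
  constructor
  · rintro ⟨a, b, hb, -, hab⟩; exact ⟨a, b, hb, hab⟩
  · rintro ⟨a, b, hb, hab⟩; exact ⟨a, b, hb, fun h0 => hb (T.ker_le _ h0), hab⟩

lemma exists_valid_chart_localRing (x : MPts k) : ∃ T : Chart, T.Valid (Loc x) :=
  exists_valid_chart fun _ hv => crossRatio_mem_or x hv

end ChartPoints

section Combinatorics

/-- The sets of marks indexing the boundary divisors: one of each complementary pair of triples. -/
def bdrySets : Finset (Marks) := Finset.univ.filter fun S => S.card = 2 ∨ (S.card = 3 ∧ 0 ∈ S)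

lemma exists_bdrySet : ∀ P : Marks, 2 ≤ P.card → P.card ≤ 4 → ∃ S ∈ bdrySets,
    (P = S ∨ P = Sᶜ) ∧ ∀ S' ∈ bdrySets, (P = S' ∨ P = S'ᶜ) → S' = S := by decide +kernel

lemma card_bdry {S : Marks} (hS : S ∈ bdrySets) : 2 ≤ S.card ∧ S.card ≤ 4 := by
  simp only [bdrySets, mem_filter] at hS
  omega

lemma chartPos_injective : ∀ (τ : Bool) (n m : Fin 3),
    (chartPos τ n = chartPos τ m ∨ chartPos τ n = (chartPos τ m)ᶜ) → n = m := by decide +kernel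

lemma card_chartPos : ∀ (τ : Bool) (n : Fin 3), 2 ≤ (chartPos τ n).card ∧
    (chartPos τ n).card ≤ 4 := by decide +kernel

lemma exists_separating : ∀ (τ : Bool) (P : Marks), 2 ≤ P.card → P.card ≤ 4 →
    ∃ a ∈ P, ∃ b ∈ P, ∃ c ∈ Pᶜ, ∃ d ∈ Pᶜ, [a, b, c, d].Nodup ∧ ∀ n, chartPos τ n ≠ P →
      chartPos τ n ≠ Pᶜ → sepExp (chartPos τ n) ![a, b, c, d] ≤ 0 := by decide +kernel

lemma sepExp_chartClose : ∀ (τ : Bool), ∀ q ∈ chartClose τ, ∀ n,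
    0 ≤ sepExp (chartPos τ n) ![q.1, q.2.1, q.2.2.1, q.2.2.2] ∧
    0 ≤ sepExp (chartPos τ n) ![q.1, q.2.1, q.2.2.2, q.2.2.1] := by decide +kernel

lemma nodup_chartClose : ∀ (τ : Bool), ∀ q ∈ chartClose τ,
    [q.1, q.2.1, q.2.2.1, q.2.2.2].Nodup := by decide +kernel

lemma compl_map_perm (e : Equiv.Perm (Fin 6)) (S : Marks) :
    (S.map e.toEmbedding)ᶜ = Sᶜ.map e.toEmbedding := by
  ext i
  simp

lemma Chart.card_set (T : Chart) (n : Fin 3) : 2 ≤ (T.set n).card ∧ (T.set n).card ≤ 4 := by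
  rw [Chart.set, Finset.card_map]
  exact card_chartPos _ _

lemma Chart.set_injective (T : Chart) {n m : Fin 3} {S : Marks}
    (hn : T.set n = S ∨ T.set n = Sᶜ) (hm : T.set m = S ∨ T.set m = Sᶜ) : n = m := by
  have h : T.set n = T.set m ∨ T.set n = (T.set m)ᶜ := by
    rcases hn with hn | hn <;> rcases hm with hm | hm <;> simp [hn, hm]
  apply chartPos_injective T.1
  simp only [Chart.set, compl_map_perm, Finset.map_inj] at h
  exact h

lemma sepExp_of_match {S P : Marks} (h : P = S ∨ P = Sᶜ) (v : Tup) : sepExp P v = sepExp S v := by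
  rcases h with rfl | rfl
  · rfl
  · rw [sepExp_compl]

end Combinatorics

section Boundary

variable {k : Type u} [Field k] {T : Chart} {x : MPts k}

lemma Chart.Valid.isUnitAt_gen (h : T.Valid (Loc x)) {n : Fin 3}
    (hn : ¬ VanishesAt x (T.gen k n)) : IsUnitAt x (T.gen k n) := isUnitAt_of_not (h.1 n) hn

lemma Chart.Valid.monomial_mem (h : T.Valid (Loc x)) (e : Fin 3 → ℤ)
    (he : ∀ n, VanishesAt x (T.gen k n) → 0 ≤ e n) : ∏ n, T.gen k n ^ e n ∈ Loc x := by
  refine prod_mem fun n _ => ?_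
  by_cases hn : VanishesAt x (T.gen k n)
  · have ⟨m, hm⟩ := Int.eq_ofNat_of_zero_le (he n hn)
    rw [hm, zpow_natCast]
    exact pow_mem hn.mem m
  · exact ((h.isUnitAt_gen hn).zpow _).2.1

lemma Chart.Valid.crossRatio_mem (h : T.Valid (Loc x)) {v : Tup}
    (hv : Inj v) (hs : ∀ n, VanishesAt x (T.gen k n) → 0 ≤ sepExp (T.set n) v) :
    CR v ∈ Loc x := by
  have ⟨u, hu, _, _, he⟩ := h.crossRatio_eq (cst_mem x) hv
  rw [he]
  exact mul_mem hu (h.monomial_mem _ hs)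

lemma Chart.Valid.inv_crossRatio_mem (h : T.Valid (Loc x)) {v : Tup}
    (hv : Inj v) (hs : ∀ n, VanishesAt x (T.gen k n) → sepExp (T.set n) v ≤ 0) :
    (CR v)⁻¹ ∈ Loc x := by
  have ⟨u, _, hu, _, he⟩ := h.crossRatio_eq (cst_mem x) hv
  rw [he, mul_inv, ← Finset.prod_inv_distrib]
  simp only [← zpow_neg]
  exact mul_mem hu (h.monomial_mem _ fun n hn => neg_nonneg.mpr (hs n hn))

lemma Chart.Valid.vanishesAt_crossRatio (h : T.Valid (Loc x)) {v : Tup}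
    (hv : Inj v) (hs : ∀ n, 0 ≤ sepExp (T.set n) v) {n : Fin 3}
    (hn : VanishesAt x (T.gen k n)) (hn' : 0 < sepExp (T.set n) v) :
    VanishesAt x (CR v) := by
  have ⟨u, hu, _, _, he⟩ := h.crossRatio_eq (cst_mem x) hv
  rw [he]
  have h1 : ∏ m, T.gen k m ^ sepExp (T.set m) v =
      (∏ m, T.gen k m ^ (sepExp (T.set m) v - if m = n then 1 else 0)) * T.gen k n := by
    have : T.gen k n = ∏ m, T.gen k m ^ (if m = n then (1 : ℤ) else 0) := by
      rw [Finset.prod_eq_single n] <;> simp +contextual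
    conv_rhs => rw [this]
    rw [← prod_mul_distrib]
    refine prod_congr rfl fun m _ => ?_
    rw [← zpow_add₀ (T.gen_ne_zero m), sub_add_cancel]
  rw [h1, ← mul_assoc]
  refine VanishesAt.mul_left (mul_mem hu (h.monomial_mem _ fun m _ => ?_)) hn
  split_ifs with hm
  · subst hm; omega
  · simpa using hs m

lemma Chart.Valid.mem_boundary_iff (h : T.Valid (Loc x)) {S : Marks}
    (hS : 2 ≤ S.card) (hS' : S.card ≤ 4) : x ∈ boundary k S ↔
      ∃ n, (T.set n = S ∨ T.set n = Sᶜ) ∧ VanishesAt x (T.gen k n) := by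
  constructor
  · intro hx
    by_contra! hc
    have hcard : (S.map T.2.symm.toEmbedding).card = S.card := Finset.card_map _
    have ⟨a, ha, b, hb, c, hc', d, hd, hn, hv⟩ :=
      exists_separating T.1 (S.map T.2.symm.toEmbedding) (by omega) (by omega)
    have hw := inj_of_nodup hn
    rw [compl_map_perm] at hc' hd
    simp only [Finset.mem_map_equiv, Equiv.symm_symm, mem_compl] at ha hb hc' hd
    have hvan := hx (T.2 ∘ ![a, b, c, d]) (T.2.injective.comp hw) ha hb hc' hd
    refine hvan.not_isUnitAt ⟨crossRatio_ne_zero (T.2.injective.comp hw), hvan.mem, ?_⟩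
    refine h.inv_crossRatio_mem (T.2.injective.comp hw) fun n hn' => ?_
    rw [Chart.set, sepExp_map]
    refine hv n ?_ ?_
    · intro h1
      refine hc n (Or.inl ?_) hn'
      rw [Chart.set, h1]
      ext i
      simp
    · intro h1
      refine hc n (Or.inr ?_) hn'
      rw [Chart.set, h1]
      ext i
      simp
  · rintro ⟨n, hn, hvan⟩ v hv h0 h1 h2 h3
    have hexp : sepExp (T.set n) v = 1 := by rw [sepExp_of_match hn]; simp [sepExp, h0, h1, h2, h3]
    refine h.vanishesAt_crossRatio hv ?_ hvan (by omega)
    rcases T.sepExp_sign v with hs | hs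
    · exact hs
    · have := hs n; omega

/-- The local equation in a chart of the boundary divisor of `S`. -/
def Chart.eqn (k : Type u) [Field k] (T : Chart) (S : Marks) : RatFun k :=
  ∏ n, if T.set n = S ∨ T.set n = Sᶜ then T.gen k n else 1

lemma Chart.eqn_ne_zero (T : Chart) (S : Marks) : T.eqn k S ≠ 0 := by
  refine prod_ne_zero_iff.mpr fun n _ => ?_
  split_ifs
  · exact T.gen_ne_zero n
  · exact one_ne_zero

lemma Chart.eqn_of_match {S : Marks} {n : Fin 3} (hn : T.set n = S ∨ T.set n = Sᶜ) :
    T.eqn k S = T.gen k n := by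
  rw [Chart.eqn, Finset.prod_eq_single n, if_pos hn]
  · intro m _ hm
    rw [if_neg]
    exact fun h => hm (T.set_injective h hn)
  · simp

lemma Chart.eqn_of_not_match {S : Marks} (h : ∀ n, ¬ (T.set n = S ∨ T.set n = Sᶜ)) :
    T.eqn k S = 1 := Finset.prod_eq_one fun n _ => if_neg (h n)

lemma Chart.Valid.eqn_mem (h : T.Valid (Loc x)) (S : Marks) : T.eqn k S ∈ Loc x := by
  refine prod_mem fun n _ => ?_
  split_ifs
  · exact h.1 n
  · exact one_mem _

lemma Chart.Valid.vanishesAt_eqn_iff (h : T.Valid (Loc x)) {S : Marks}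
    (hS : 2 ≤ S.card) (hS' : S.card ≤ 4) : VanishesAt x (T.eqn k S) ↔ x ∈ boundary k S := by
  rw [h.mem_boundary_iff hS hS']
  constructor
  · intro hv
    by_cases hn : ∃ n, T.set n = S ∨ T.set n = Sᶜ
    · have ⟨n, hn⟩ := hn; exact ⟨n, hn, by rwa [Chart.eqn_of_match hn] at hv⟩
    · push Not at hn
      rw [Chart.eqn_of_not_match (by simpa using hn)] at hv
      exact absurd (isUnitAt_one x) hv.not_isUnitAt
  · rintro ⟨n, hn, hv⟩; rwa [Chart.eqn_of_match hn]

instance isPrime_span_X (n : Fin 3) : (span {(X n : Poly (Fin 3) k)}).IsPrime :=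
  (Ideal.span_singleton_prime (X_ne_zero n)).mpr X_prime

lemma Chart.Valid.X_mem_ideal (h : T.Valid (Loc x)) (n : Fin 3) :
    X n ∈ h.ideal ↔ VanishesAt x (T.gen k n) := by rw [h.mem_ideal, Chart.hom_X]

lemma Chart.Valid.exists_generic (h : T.Valid (Loc x)) {n : Fin 3}
    (hn : VanishesAt x (T.gen k n)) : ∃ z : MPts k, z.1 ⤳ x.1 ∧
      Loc z = locAt T♯ (span {X n}) := by
  have hle : span {(X n : Poly (Fin 3) k)} ≤ h.ideal := by
    rw [span_le, Set.singleton_subset_iff]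
    exact (h.X_mem_ideal n).mpr hn
  have ⟨z, hz⟩ := T.exists_point (span {X n}) fun i j hij hm => h.unit_notMem hij (hle hm)
  refine ⟨z, specializes_iff_localRing_le.mpr ?_, hz⟩
  rw [h.localRing_eq, hz]
  exact locAt_anti hle

/-- The local equations in a chart generate the ideals of the boundary divisors. -/
lemma Chart.Valid.isDivisorOf (h : T.Valid (Loc x)) {S : Marks}
    (hS : 2 ≤ S.card) (hS' : S.card ≤ 4) (g : RatFun k) :
    (g ∈ Loc x ∧ ∀ y ∈ boundary k S, y.1 ⤳ x.1 → VanishesAt y g) ↔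
      ∃ f ∈ Loc x, g = f * T.eqn k S := by
  constructor
  · rintro ⟨hg, hv⟩
    by_cases hx : x ∈ boundary k S
    · have ⟨n, hn, hgen⟩ := (h.mem_boundary_iff hS hS').mp hx
      have ⟨z, hzx, hz⟩ := h.exists_generic hgen
      have hzval : T.Valid (Loc z) := h.mono (localRing_le_of_specializes hzx)
      have hqz : ∀ a, VanishesAt z (T.hom k a) ↔ a ∈ span {X n} := by
        intro a
        by_cases ha0 : a = 0
        · subst ha0
          simp only [map_zero, zero_mem, iff_true]
          exact ⟨0, zero_mem _, map_zero _⟩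
        have ha : T.hom k a ≠ 0 := fun h0 => ha0 (T.hom_injective (h0.trans (map_zero _).symm))
        have h1 := inv_map_mem_locAt_iff (φ := T♯) (q := span {X n})
          (T.ker_le _) ha
        rw [← hz] at h1
        rw [vanishesAt_iff_mem, IsUnitAt]
        have h2 := hzval.hom_mem_localRing a
        constructor
        · rintro ⟨-, h3⟩
          by_contra h4
          exact h3 ⟨ha, h2, h1.mpr h4⟩
        · intro h3; exact ⟨h2, fun h4 => h1.mp h4.2.2 h3⟩
      have hzb : z ∈ boundary k S := (hzval.mem_boundary_iff hS hS').mpr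
        ⟨n, hn, by rw [← Chart.hom_X, hqz]; exact mem_span_singleton_self _⟩
      have hgz := hv z hzb hzx
      have ⟨a, b, hb, hab⟩ := (h.mem_localRing g).mp hg
      have ha : a ∈ span {X n} := by
        rw [← hqz, ← hab, mul_comm]
        exact hgz.mul_left (hzval.hom_mem_localRing b)
      obtain ⟨c, rfl⟩ := mem_span_singleton'.mp ha
      have hb0 : T.hom k b ≠ 0 := fun h0 => hb (T.ker_le _ h0)
      refine ⟨T.hom k c / T.hom k b, (h.mem_localRing _).mpr ⟨c, b, hb, div_mul_cancel₀ _ hb0⟩, ?_⟩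
      rw [Chart.eqn_of_match hn, div_mul_eq_mul_div, eq_div_iff hb0, hab, map_mul, Chart.hom_X]
    · have hu : IsUnitAt x (T.eqn k S) := isUnitAt_of_not (h.eqn_mem S) fun hv' =>
        hx ((h.vanishesAt_eqn_iff hS hS').mp hv')
      exact ⟨g / T.eqn k S, by rw [div_eq_mul_inv]; exact mul_mem hg hu.2.2,
        (div_mul_cancel₀ _ (T.eqn_ne_zero S)).symm⟩
  · rintro ⟨f, hf, rfl⟩
    refine ⟨mul_mem hf (h.eqn_mem S), fun y hy hyx => ?_⟩
    have hle := localRing_le_of_specializes hyx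
    exact (((h.mono hle).vanishesAt_eqn_iff hS hS').mpr hy).mul_left (hle hf)

lemma Chart.Valid.isUnitAt_eqn_div {T' : Chart} (h : T.Valid (Loc x))
    (h' : T'.Valid (Loc x)) (S : Marks) :
    IsUnitAt x (T.eqn k S / T'.eqn k S) := by
  by_cases hS : 2 ≤ S.card ∧ S.card ≤ 4
  · have key : ∀ {T T' : Chart}, T.Valid (Loc x) → T'.Valid (Loc x) →
        T.eqn k S / T'.eqn k S ∈ Loc x := by
      intro T T' h h'
      have ⟨f, hf, he⟩ := (h'.isDivisorOf hS.1 hS.2 (T.eqn k S)).mp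
        ((h.isDivisorOf hS.1 hS.2 (T.eqn k S)).mpr ⟨1, one_mem _, (one_mul _).symm⟩)
      rw [he, mul_div_cancel_right₀ _ (T'.eqn_ne_zero S)]
      exact hf
    exact ⟨div_ne_zero (T.eqn_ne_zero S) (T'.eqn_ne_zero S), key h h', by
      rw [inv_div]; exact key h' h⟩
  · have key : ∀ T : Chart, T.eqn k S = 1 := fun T => Chart.eqn_of_not_match fun n hn => hS (by
      have h1 := T.card_set n
      have h2 := Finset.card_compl_add_card S
      rw [Fintype.card_fin] at h2
      rcases hn with hn | hn
      · rwa [hn] at h1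
      · rw [hn] at h1
        omega)
    rw [key, key, div_one]
    exact isUnitAt_one x

lemma eventually_mem_localRing {σ : Type} {δ : PS σ k} (x : Pts δ) {g : RF δ} (hg : g ∈ Loc x) :
    ∀ᶠ y in nhds x.1, ∀ h : δ ⤳ y, g ∈ Loc (⟨y, h⟩ : Pts δ) := by
  have ⟨U, hU, hUg⟩ := exists_open_mem_localRing x hg
  filter_upwards [U.isOpen.mem_nhds hU] with y hy h using hUg ⟨y, h⟩ hy

lemma CartierDivisor.eventually {σ : Type} {δ : PS σ k} (D : CartierDivisor δ) (x : Pts δ) :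
    ∀ᶠ y in nhds x.1, ∀ h : δ ⤳ y, IsUnitAt (⟨y, h⟩ : Pts δ)
      ((D.eqn x / D.eqn ⟨y, h⟩ : (RF δ)ˣ) : RF δ) := by
  have ⟨U, hU, hUg⟩ := D.compatible x
  filter_upwards [U.isOpen.mem_nhds hU] with y hy h using hUg ⟨y, h⟩ hy

lemma exists_opens_of_eventually {σ : Type} {δ : PS σ k} (x : Pts δ) {p : Pts δ → Prop}
    (h : ∀ᶠ y in nhds x.1, ∀ h : δ ⤳ y, p ⟨y, h⟩) :
    ∃ U : (PS σ k).Opens, x.1 ∈ U ∧ ∀ y : Pts δ, y.1 ∈ U → p y := by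
  have ⟨U, hU, hUo, hx⟩ := eventually_nhds_iff.mp h
  exact ⟨⟨U, hUo⟩, hx, fun y hy => hU y.1 hy y.2⟩

lemma Chart.Valid.eventually (h : T.Valid (Loc x)) :
    ∀ᶠ y in nhds x.1, ∀ h : Mbar06 k ⤳ y, T.Valid (Loc (⟨y, h⟩ : MPts k)) := by
  have h1 : ∀ᶠ y in nhds x.1, ∀ n, ∀ h : Mbar06 k ⤳ y,
      T.gen k n ∈ Loc (⟨y, h⟩ : MPts k) :=
    Filter.eventually_all.mpr fun n => eventually_mem_localRing x (h.1 n)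
  have h2 : ∀ᶠ y in nhds x.1, ∀ i j, i ≠ j → ∀ h : Mbar06 k ⤳ y,
      (T.hom k (chartUnit k T.1 i j))⁻¹ ∈ Loc (⟨y, h⟩ : MPts k) :=
    Filter.eventually_all.mpr fun i => Filter.eventually_all.mpr fun j => by
      by_cases hij : i = j
      · exact Filter.Eventually.of_forall fun y hne => absurd hij hne
      · filter_upwards [eventually_mem_localRing x (h.2 i j hij)] with y hy _ using hy
  filter_upwards [h1, h2] with y hy1 hy2 h'
  exact ⟨fun n => hy1 n h', fun i j hij => hy2 i j hij h'⟩

/-- A chart around a point. -/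
def chartAt (x : MPts k) : Chart := (exists_valid_chart_localRing x).choose

lemma chartAt_valid (x : MPts k) : (chartAt x).Valid (Loc x) :=
  (exists_valid_chart_localRing x).choose_spec

/-- The boundary divisor of `S` as a Cartier divisor. -/
def bdryDiv (k : Type u) [Field k] (S : Marks) : CartierDivisor (Mbar06 k) where
  eqn x := Units.mk0 ((chartAt x).eqn k S) ((chartAt x).eqn_ne_zero S)
  compatible x := exists_opens_of_eventually x (by
    filter_upwards [(chartAt_valid x).eventually] with y hy h
    rw [Units.val_div_eq_div_val]
    exact (hy h).isUnitAt_eqn_div (chartAt_valid _) S)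

lemma bdryDiv_eqn (x : MPts k) (S : Marks) :
    ((bdryDiv k S).eqn x : RatFun k) = (chartAt x).eqn k S := rfl

lemma bdryDiv_isDivisorOf {S : Marks} (hS : S.card = 2 ∨ S.card = 3) :
    (bdryDiv k S).IsDivisorOf (boundary k S) := fun x g =>
  (chartAt_valid x).isDivisorOf (by omega) (by omega) g

lemma bdryDiv_eqn_mem (x : MPts k) (S : Marks) :
    ((bdryDiv k S).eqn x : RatFun k) ∈ Loc x := (chartAt_valid x).eqn_mem S

lemma isUnitAt_bdryDiv_eqn {S : Marks} (hS : 2 ≤ S.card) (hS' : S.card ≤ 4)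
    (hx : x ∉ boundary k S) : IsUnitAt x ((bdryDiv k S).eqn x : RatFun k) :=
  isUnitAt_of_not (bdryDiv_eqn_mem x S) fun h =>
    hx (((chartAt_valid x).vanishesAt_eqn_iff hS hS').mp h)

lemma Chart.prod_eqn_zpow (T : Chart) (e : Marks → ℤ) (he : ∀ S, e Sᶜ = e S) :
    ∏ S ∈ bdrySets, T.eqn k S ^ e S = ∏ n, T.gen k n ^ e (T.set n) := by
  simp only [Chart.eqn, ← Finset.prod_zpow]
  rw [Finset.prod_comm]
  refine prod_congr rfl fun n _ => ?_
  have ⟨S, hS, hm, hu⟩ := exists_bdrySet (T.set n) (T.card_set n).1 (T.card_set n).2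
  rw [Finset.prod_eq_single_of_mem S hS, if_pos hm]
  · rcases hm with hm | hm
    · rw [hm]
    · rw [hm, he]
  · intro S' hS' hne; rw [if_neg fun h => hne (hu S' hS' h), one_zpow]

/-- Keel's relations: the divisor of a cross-ratio. -/
lemma isUnitAt_crossRatio_div (x : MPts k) {v : Tup} (hv : Inj v) : IsUnitAt x (CR v /
      ∏ S ∈ bdrySets, ((bdryDiv k S).eqn x : RatFun k) ^ sepExp S v) := by
  have ⟨u, hu, hu', hu0, he⟩ := (chartAt_valid x).crossRatio_eq (cst_mem x) hv
  simp only [bdryDiv_eqn]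
  rw [(chartAt x).prod_eqn_zpow (fun S => sepExp S v) (fun S => sepExp_compl S v), he,
    mul_div_cancel_right₀]
  · exact ⟨hu0, hu, hu'⟩
  · exact prod_ne_zero_iff.mpr fun n _ => zpow_ne_zero _ ((chartAt x).gen_ne_zero n)

lemma Chart.Valid.mem_boundary_of_vanishesAt (h : T.Valid (Loc x)) {n : Fin 3}
    (hn : VanishesAt x (T.gen k n)) : ∃ S ∈ bdrySets, (T.set n = S ∨ T.set n = Sᶜ) ∧
      x ∈ boundary k S := by
  have ⟨S, hS, hm, _⟩ := exists_bdrySet (T.set n) (T.card_set n).1 (T.card_set n).2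
  exact ⟨S, hS, hm, (h.mem_boundary_iff (card_bdry hS).1 (card_bdry hS).2).mpr ⟨n, hm, hn⟩⟩

lemma crossRatio_mem_of_sepExp (x : MPts k) {v : Tup} (hv : Inj v)
    (h : ∀ S ∈ bdrySets, x ∈ boundary k S → 0 ≤ sepExp S v) : CR v ∈ Loc x := by
  refine (chartAt_valid x).crossRatio_mem hv fun n hn => ?_
  have ⟨S, hS, hm, hx⟩ := (chartAt_valid x).mem_boundary_of_vanishesAt hn
  rw [sepExp_of_match hm]
  exact h S hS hx

lemma sepExp_sign_of_mem_boundary (x : MPts k) (v : Tup) :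
    (∀ S ∈ bdrySets, x ∈ boundary k S → 0 ≤ sepExp S v) ∨
      ∀ S ∈ bdrySets, x ∈ boundary k S → sepExp S v ≤ 0 := by
  have key : ∀ S ∈ bdrySets, x ∈ boundary k S → ∃ n, sepExp S v = sepExp ((chartAt x).set n) v := by
    intro S hS hx
    have ⟨n, hn, _⟩ := ((chartAt_valid x).mem_boundary_iff (card_bdry hS).1 (card_bdry hS).2).mp hx
    exact ⟨n, (sepExp_of_match hn v).symm⟩
  rcases (chartAt x).sepExp_sign v with hs | hs
  · left
    intro S hS hx
    have ⟨n, hn⟩ := key S hS hx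
    exact hn ▸ hs n
  · right
    intro S hS hx
    have ⟨n, hn⟩ := key S hS hx
    exact hn ▸ hs n

lemma Chart.valid_of_boundary (T : Chart) (x : MPts k) (h : ∀ S ∈ bdrySets, x ∈ boundary k S →
    ∃ n, T.set n = S ∨ T.set n = Sᶜ) : T.Valid (Loc x) := by
  have key : ∀ p q r s : Fin 6, [p, q, r, s].Nodup →
      (∀ n, 0 ≤ sepExp (chartPos T.1 n) ![p, q, r, s]) →
      cr (T.2 p) (T.2 q) (T.2 r) (T.2 s) ∈ Loc x := by
    intro p q r s hn hs
    have hn' : [T.2 p, T.2 q, T.2 r, T.2 s].Nodup := hn.map T.2.injective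
    refine crossRatio_mem_of_sepExp x (inj_of_nodup hn') fun S hS hx => ?_
    have ⟨n, hm⟩ := h S hS hx
    have hv : ![T.2 p, T.2 q, T.2 r, T.2 s] = T.2 ∘ ![p, q, r, s] := by ext i; fin_cases i <;> rfl
    rw [← sepExp_of_match hm, hv, Chart.set, sepExp_map]
    exact hs n
  refine T.valid_of_close fun q hq => ?_
  have hn := nodup_chartClose T.1 q hq
  exact ⟨key _ _ _ _ hn fun n => (sepExp_chartClose T.1 q hq n).1,
    key _ _ _ _ (by clear key hq; grind) fun n => (sepExp_chartClose T.1 q hq n).2⟩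

end Boundary

section Hyperplane

variable {k : Type u} [Field k]

/-- A combination of Cartier divisors with integral coefficients. -/
def CartierDivisor.combination {σ : Type} {δ : PS σ k} {ι : Type*} (s : Finset ι)
    (E : ι → CartierDivisor δ) (n : ι → ℤ) : CartierDivisor δ where
  eqn x := ∏ i ∈ s, (E i).eqn x ^ n i
  compatible x := exists_opens_of_eventually x (by
    have h : ∀ᶠ y in nhds x.1, ∀ i ∈ s, ∀ h : δ ⤳ y, IsUnitAt (⟨y, h⟩ : Pts δ)
        (((E i).eqn x / (E i).eqn ⟨y, h⟩ : (RF δ)ˣ) :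
          RF δ) := (Filter.eventually_all_finset s).mpr fun i _ => (E i).eventually x
    filter_upwards [h] with y hy h'
    rw [← prod_div_distrib]
    simp only [← div_zpow]
    rw [Units.coe_prod]
    exact IsUnitAt.prod s fun i hi => by
      rw [Units.val_zpow_eq_zpow_val]
      exact (hy i hi h').zpow _)

/-- The multiplicities of the boundary divisors in the pull-back of the hyperplane `z₄ = 0`. -/
def hyperplaneExp (S : Marks) : ℤ :=
  if (4 ∈ S ∧ 5 ∈ S ∧ 6 ∉ S) ∨ (4 ∉ S ∧ 5 ∉ S ∧ 6 ∈ S) then 1 else 0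

lemma hyperplaneExp_compl (S : Marks) : hyperplaneExp Sᶜ = hyperplaneExp S := by
  simp only [hyperplaneExp, mem_compl, not_not]
  congr 1
  rw [or_comm]

/-- The pull-back of the hyperplane class under the blow-down to `ℙ³`. -/
def hyperplaneDiv (k : Type u) [Field k] : CartierDivisor (Mbar06 k) :=
  CartierDivisor.combination bdrySets (bdryDiv k) hyperplaneExp

lemma hyperplaneDiv_eqn (x : MPts k) : ((hyperplaneDiv k).eqn x : RatFun k) =
    ∏ n, (chartAt x).gen k n ^ hyperplaneExp ((chartAt x).set n) := by
  rw [← (chartAt x).prod_eqn_zpow _ hyperplaneExp_compl]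
  simp [hyperplaneDiv, CartierDivisor.combination, bdryDiv]

lemma exists_outer_pos : ∀ (τ : Bool) (p q : Fin 6), p ≠ q → ∃ r, r ≠ p ∧ r ≠ q ∧ ∀ n,
    (p ∈ chartPos τ n → q ∉ chartPos τ n → r ∉ chartPos τ n) ∧
    (p ∉ chartPos τ n → q ∈ chartPos τ n → r ∈ chartPos τ n) := by decide +kernel

lemma hyperplaneDiv_isHyperplanePullback : IsHyperplanePullback (hyperplaneDiv k) := by
  intro x
  have ⟨r, hr5, hr6, hr⟩ := exists_outer_pos (chartAt x).1 ((chartAt x).2.symm 5)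
    ((chartAt x).2.symm 6) ((chartAt x).2.symm.injective.ne (by decide))
  obtain ⟨m, rfl⟩ := (chartAt x).2.symm.surjective r
  replace hr5 : m ≠ 5 := fun h => hr5 (by rw [h])
  replace hr6 : m ≠ 6 := fun h => hr6 (by rw [h])
  have hr' : ∀ n, (5 ∈ (chartAt x).set n → 6 ∉ (chartAt x).set n → m ∉ (chartAt x).set n) ∧
      (5 ∉ (chartAt x).set n → 6 ∈ (chartAt x).set n → m ∈ (chartAt x).set n) := by
    simpa only [Chart.set, Finset.mem_map_equiv] using hr
  have hm : m ∈ ({1, 2, 3, 4} : Marks) := by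
    clear hr hr'
    revert hr5 hr6 m
    decide
  have hnd : ∀ i ∈ ({1, 2, 3, 4} : Marks), i ≠ m → [5, i, m, 6].Nodup := by
    clear hr hr'
    revert hr5 hr6 m
    decide
  have hexp : ∀ (i : Fin 6) n, sepExp ((chartAt x).set n) ![5, i, m, 6] =
      if (i ∈ (chartAt x).set n ∧ 5 ∈ (chartAt x).set n ∧ 6 ∉ (chartAt x).set n) ∨
        (i ∉ (chartAt x).set n ∧ 5 ∉ (chartAt x).set n ∧ 6 ∈ (chartAt x).set n) then 1 else 0 := by
    intro i n
    have := hr' n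
    simp only [sepExp, Matrix.cons_val]
    by_cases h5 : 5 ∈ (chartAt x).set n <;> by_cases h6 : 6 ∈ (chartAt x).set n <;>
      by_cases hi : i ∈ (chartAt x).set n <;> by_cases hmn : m ∈ (chartAt x).set n <;>
      simp_all
  refine ⟨m, hm, fun i hi => ?_, ?_⟩
  · rw [zRatio]
    split_ifs with him
    · exact one_mem _
    · refine (chartAt_valid x).crossRatio_mem (inj_of_nodup (hnd i hi him)) fun n _ => ?_
      rw [hexp]
      split_ifs <;> simp
  · rw [hyperplaneDiv_eqn, zRatio]
    split_ifs with h4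
    · have h0 : ∀ n, hyperplaneExp ((chartAt x).set n) = 0 := by
        intro n
        have := hr' n
        rw [hyperplaneExp, if_neg]
        rw [h4]
        tauto
      simp only [h0, zpow_zero, Finset.prod_const_one, div_one]
      exact isUnitAt_one x
    · have hinj := inj_of_nodup (hnd 4 (by decide) h4)
      have ⟨u, hu, hu', hu0, he⟩ := (chartAt_valid x).crossRatio_eq
        (cst_mem x) hinj
      have h0 : ∀ n, sepExp ((chartAt x).set n) ![5, 4, m, 6] =
          hyperplaneExp ((chartAt x).set n) := fun n => hexp 4 n
      have hne : ∏ n, (chartAt x).gen k n ^ hyperplaneExp ((chartAt x).set n) ≠ 0 :=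
        prod_ne_zero_iff.mpr fun n _ => zpow_ne_zero _ ((chartAt x).gen_ne_zero n)
      simp only [h0] at he
      rw [he, div_mul_cancel_right₀ hne]
      exact IsUnitAt.inv ⟨hu0, hu, hu'⟩

end Hyperplane

section UniqueFactorization

variable {A K : Type*} [CommRing A] [Field K]
  (φ : A →+* K)

/-- The element `u` of the fraction field is a unit at the prime `p`. -/
def IsUnitAlong (p : A) (u : K) : Prop := ∃ a b, ¬ p ∣ a ∧ ¬ p ∣ b ∧ u * φ b = φ a

variable {φ} (hφ : Inj φ) {p : A}

lemma isUnitAlong_map {a : A} (ha : ¬ p ∣ a) (hp : Prime p) : IsUnitAlong φ p (φ a) :=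
  ⟨a, 1, ha, hp.not_dvd_one, by simp⟩

lemma IsUnitAlong.mul (hp : Prime p) {u v : K} (hu : IsUnitAlong φ p u) (hv : IsUnitAlong φ p v) :
    IsUnitAlong φ p (u * v) := by
  have ⟨a, b, ha, hb, h⟩ := hu
  have ⟨c, d, hc, hd, h'⟩ := hv
  refine ⟨a * c, b * d, fun h => (hp.dvd_or_dvd h).elim ha hc,
    fun h => (hp.dvd_or_dvd h).elim hb hd, ?_⟩
  rw [map_mul, map_mul, ← h, ← h']
  ring

include hφ in
lemma IsUnitAlong.ne_zero {u : K} (hu : IsUnitAlong φ p u) : u ≠ 0 := by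
  rintro rfl
  have ⟨a, b, ha, hb, h⟩ := hu
  rw [zero_mul] at h
  rw [hφ (h.symm.trans (map_zero φ).symm)] at ha
  exact ha (dvd_zero p)

include hφ in
lemma IsUnitAlong.inv {u : K} (hu : IsUnitAlong φ p u) : IsUnitAlong φ p u⁻¹ := by
  have h0 := hu.ne_zero hφ
  have ⟨a, b, ha, hb, h⟩ := hu
  exact ⟨b, a, hb, ha, by rw [← h, inv_mul_cancel_left₀ h0]⟩

include hφ in
lemma IsUnitAlong.div (hp : Prime p) {u v : K} (hu : IsUnitAlong φ p u)
    (hv : IsUnitAlong φ p v) : IsUnitAlong φ p (u / v) := by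
  rw [div_eq_mul_inv]
  exact hu.mul hp (hv.inv hφ)

lemma IsUnitAlong.one (hp : Prime p) : IsUnitAlong φ p 1 := by
  simpa using isUnitAlong_map (φ := φ) hp.not_dvd_one hp

include hφ in
lemma IsUnitAlong.zpow (hp : Prime p) {u : K} (hu : IsUnitAlong φ p u) (n : ℤ) :
    IsUnitAlong φ p (u ^ n) := by
  have hnat : ∀ n : ℕ, IsUnitAlong φ p (u ^ n) := fun n => by
    induction n with
    | zero => simpa using IsUnitAlong.one hp
    | succ n ih => rw [pow_succ]; exact ih.mul hp hu
  cases n with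
  | ofNat n => simpa using hnat n
  | negSucc n => rw [zpow_negSucc]; exact (hnat _).inv hφ

lemma IsUnitAlong.of_associated {p' : A} (h : Associated p p') {u : K}
    (hu : IsUnitAlong φ p u) : IsUnitAlong φ p' u := by
  have ⟨a, b, ha, hb, hab⟩ := hu
  exact ⟨a, b, by rwa [← h.dvd_iff_dvd_left], by rwa [← h.dvd_iff_dvd_left], hab⟩

include hφ in
lemma IsUnitAlong.mem_locAt [(span {p}).IsPrime] {u : K} (hu : IsUnitAlong φ p u) :
    u ∈ locAt φ (span {p}) := by
  have ⟨a, b, ha, hb, h⟩ := hu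
  refine M06.mem_locAt.mpr ⟨a, b, by rwa [mem_span_singleton], fun h0 => hb ?_, h⟩
  rw [hφ (h0.trans (map_zero φ).symm)]
  exact dvd_zero p

lemma isUnitAlong_of_mem_locAt (hp : Prime p) [(span {p}).IsPrime] {u : K} (hu0 : u ≠ 0)
    (hu : u ∈ locAt φ (span {p})) (hu' : u⁻¹ ∈ locAt φ (span {p}))
    (hφ : Inj φ) : IsUnitAlong φ p u := by
  have ⟨a, b, hb, hb0, h⟩ := mem_locAt.mp hu
  have ⟨c, d, hd, hd0, h'⟩ := mem_locAt.mp hu'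
  rw [mem_span_singleton] at hb hd
  refine ⟨a, b, fun ha => ?_, hb, h⟩
  have : c * a = b * d := by
    apply hφ
    rw [map_mul, map_mul, ← h, ← h', mul_comm (φ b)]
    field_simp
  exact (hp.dvd_or_dvd (this ▸ ha.mul_left c)).elim hb hd

variable [IsDomain A] [UniqueFactorizationMonoid A]

variable (hsurj : ∀ g : K, ∃ a b, φ b ≠ 0 ∧ g * φ b = φ a)

include hsurj in
lemma exists_isUnitAlong_mul_zpow (hp : Prime p) {g : K} (hg : g ≠ 0) :
    ∃ (u : K) (n : ℤ), IsUnitAlong φ p u ∧ g = u * φ p ^ n := by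
  have ⟨a, b, hb, h⟩ := hsurj g
  have ha0 : a ≠ 0 := by
    rintro rfl
    rw [map_zero] at h
    exact (mul_ne_zero hg hb) h
  have hb0 : b ≠ 0 := fun h0 => hb (by rw [h0, map_zero])
  obtain ⟨n, a', ha', rfl⟩ := WfDvdMonoid.max_power_factor ha0 hp.irreducible
  obtain ⟨m, b', hb', rfl⟩ := WfDvdMonoid.max_power_factor hb0 hp.irreducible
  rw [map_mul, map_pow] at hb h
  rw [map_mul, map_pow] at h
  have hb1 := right_ne_zero_of_mul hb
  have hpm := left_ne_zero_of_mul hb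
  by_cases hp0 : φ p = 0
  · refine ⟨φ a' / φ b', (n : ℤ) - m, ⟨a', b', ha', hb', div_mul_cancel₀ _ hb1⟩, ?_⟩
    have hm : m = 0 := by
      by_contra hm
      exact hpm (by rw [hp0, zero_pow hm])
    have hn : n = 0 := by
      by_contra hn
      rw [hp0, zero_pow hn, zero_mul, hm, pow_zero, one_mul] at h
      exact mul_ne_zero hg hb1 h
    subst hm hn
    simp only [pow_zero, one_mul, Nat.cast_zero, sub_zero, zpow_zero, mul_one] at h ⊢
    exact (eq_div_iff hb1).mpr h
  · refine ⟨φ a' / φ b', (n : ℤ) - m, ⟨a', b', ha', hb', div_mul_cancel₀ _ hb1⟩, ?_⟩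
    rw [zpow_sub₀ hp0, zpow_natCast, zpow_natCast]
    field_simp
    linear_combination h

include hsurj hφ in
/-- The localization at a prime element is a maximal subring. -/
lemma eq_locAt_of_le (hp : Prime p) [(span {p}).IsPrime] {O : Subring K}
    (hO : locAt φ (span {p}) ≤ O) {g : K} (hg : g ∉ O) : O = locAt φ (span {p}) := by
  refine le_antisymm (fun f hf => ?_) hO
  by_contra hf'
  have hp0 : φ p ≠ 0 := fun h0 => hp.ne_zero (hφ (h0.trans (map_zero φ).symm))
  have hf0 : f ≠ 0 := fun h0 => hf' (h0 ▸ zero_mem _)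
  have hg0 : g ≠ 0 := fun h0 => hg (h0 ▸ zero_mem _)
  obtain ⟨u, n, hu, rfl⟩ := exists_isUnitAlong_mul_zpow hsurj hp hf0
  obtain ⟨v, m, hv, rfl⟩ := exists_isUnitAlong_mul_zpow hsurj hp hg0
  have hpl : ∀ n : ℤ, 0 ≤ n → φ p ^ n ∈ locAt φ (span {p}) := by
    intro n hn
    lift n to ℕ using hn
    rw [zpow_natCast]
    exact pow_mem (map_mem_locAt φ _ p) n
  have hn : n < 0 := by
    by_contra! hn
    exact hf' (mul_mem (hu.mem_locAt hφ) (hpl n hn))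
  have h1 : (φ p)⁻¹ ∈ O := by
    have h2 := mul_mem (mul_mem (hO ((hu.inv hφ).mem_locAt hφ)) hf) (hO (hpl (-n - 1) (by omega)))
    rw [inv_mul_cancel_left₀ (hu.ne_zero hφ), ← zpow_add₀ hp0] at h2
    rwa [show n + (-n - 1) = -1 by ring, zpow_neg_one] at h2
  refine hg (mul_mem (hO (hv.mem_locAt hφ)) ?_)
  rcases le_or_gt 0 m with hm | hm
  · exact hO (hpl m hm)
  · have ⟨j, hj⟩ := Int.eq_ofNat_of_zero_le (show 0 ≤ -m by omega)
    rw [show m = -(j : ℤ) by omega, zpow_neg, zpow_natCast, ← inv_pow]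
    exact pow_mem h1 j

include hsurj hφ in
lemma mem_locAt_of_prime {q : Ideal A} [q.IsPrime] {h : K}
    (hh : ∀ p ∈ q, Prime p → ∃ a b, ¬ p ∣ b ∧ h * φ b = φ a) : h ∈ locAt φ q := by
  have ⟨a, b, hb, hab⟩ := hsurj h
  have hb0 : b ≠ 0 := fun h0 => hb (by rw [h0, map_zero])
  obtain ⟨b', a', c, hrel, rfl, rfl⟩ := UniqueFactorizationMonoid.exists_reduced_factors b hb0 a
  rw [map_mul] at hb
  have hc := left_ne_zero_of_mul hb
  have hb' := right_ne_zero_of_mul hb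
  have hab' : h * φ b' = φ a' := by
    rw [map_mul, map_mul] at hab
    apply mul_left_cancel₀ hc
    linear_combination hab
  refine mem_locAt.mpr ⟨a', b', fun hq => ?_, hb', hab'⟩
  have hb'0 : b' ≠ 0 := fun h0 => hb' (by rw [h0, map_zero])
  have ⟨p, hpf, hpq⟩ : ∃ p ∈ UniqueFactorizationMonoid.factors b', p ∈ q := by
    have h1 : (UniqueFactorizationMonoid.factors b').prod ∈ q := by
      have ⟨u, hu⟩ := UniqueFactorizationMonoid.factors_prod hb'0
      rw [← hu] at hq
      exact (Ideal.IsPrime.mem_or_mem ‹_› hq).resolve_right fun hu' =>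
        Ideal.IsPrime.ne_top ‹q.IsPrime› (Ideal.eq_top_of_isUnit_mem _ hu' u.isUnit)
    exact (Ideal.IsPrime.multiset_prod_mem_iff_exists_mem ‹_› _).mp h1
  have hp := UniqueFactorizationMonoid.prime_of_factor p hpf
  have hpb := UniqueFactorizationMonoid.dvd_of_mem_factors hpf
  have ⟨e, d, hd, hed⟩ := hh p hpq hp
  have : a' * d = e * b' := by
    apply hφ
    rw [map_mul, map_mul, ← hed, ← hab']
    ring
  have hpa : p ∣ a' := (hp.dvd_or_dvd (this ▸ hpb.mul_left e)).resolve_right hd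
  exact hp.not_isUnit (hrel hpb hpa)

include hsurj hφ in
/-- An element of the fraction field with prescribed orders at the primes dividing `f`. -/
lemma exists_prescribed_orders (c : Ideal A → K) (hc : ∀ I, c I ≠ 0) (f : A) (hf : f ≠ 0) :
    ∃ g : K, g ≠ 0 ∧ ∀ p, Prime p → (p ∣ f → IsUnitAlong φ p (c (span {p}) / g)) ∧
      (¬ p ∣ f → IsUnitAlong φ p g) := by
  induction f using UniqueFactorizationMonoid.induction_on_prime with
  | h₁ => exact absurd rfl hf
  | h₂ x hx =>
    exact ⟨1, one_ne_zero, fun p hp => ⟨fun h => absurd (isUnit_of_dvd_unit h hx) hp.not_isUnit,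
      fun _ => IsUnitAlong.one hp⟩⟩
  | h₃ a p ha hp ih =>
    have ⟨g, hg, ih⟩ := ih ha
    by_cases hpa : p ∣ a
    · refine ⟨g, hg, fun p' hp' => ⟨fun h => (ih p' hp').1 ?_, fun h => (ih p' hp').2 fun h' =>
        h (h'.mul_left p)⟩⟩
      rcases hp'.dvd_or_dvd h with h | h
      · exact h.trans hpa
      · exact h
    · have ⟨u, n, hu, he⟩ := exists_isUnitAlong_mul_zpow hsurj hp (hc (span {p}))
      have hp0 : φ p ≠ 0 := fun h0 => hp.ne_zero (hφ (h0.trans (map_zero φ).symm))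
      refine ⟨g * φ p ^ n, mul_ne_zero hg (zpow_ne_zero _ hp0), fun p' hp' => ?_⟩
      by_cases hpp : p' ∣ p
      · have hass : Associated p' p := hp'.associated_of_dvd hp hpp
        refine ⟨fun _ => ?_, fun h => absurd (hpp.mul_right a) h⟩
        rw [Ideal.span_singleton_eq_span_singleton.mpr hass, he, mul_div_mul_right _ _
          (zpow_ne_zero _ hp0)]
        exact (hu.div hφ hp ((ih p hp).2 hpa)).of_associated hass.symm
      · have hpu : IsUnitAlong φ p' (φ p ^ n) := (isUnitAlong_map hpp hp').zpow hφ hp' n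
        refine ⟨fun h => ?_, fun h => ((ih p' hp').2 fun h' => h (h'.mul_left p)).mul hp' hpu⟩
        rw [← div_div]
        exact ((ih p' hp').1 ((hp'.dvd_or_dvd h).resolve_left hpp)).div hφ hp' hpu

end UniqueFactorization

section BoundaryPoints

variable {k : Type u} [Field k] {S : Marks} {δ : MPts k}

lemma Chart.hom_surj (T : Chart) (g : RatFun k) :
    ∃ a b, T.hom k b ≠ 0 ∧ g * T.hom k b = T.hom k a := by
  have h : T.Valid (Loc (Pts.generic (Mbar06 k))) :=
    ⟨fun _ => mem_localRing_generic _, fun _ _ _ => mem_localRing_generic _⟩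
  have ⟨a, b, hb, hab⟩ := (h.mem_localRing g).mp (mem_localRing_generic g)
  exact ⟨a, b, fun h0 => hb (T.ker_le _ h0), hab⟩

lemma chartUnit_notMem_span_X (τ : Bool) (n : Fin 3) {i j : Fin 6} (hij : i ≠ j) :
    chartUnit k τ i j ∉ span {(X n : Poly (Fin 3) k)} := by
  intro h
  have ⟨c, hc⟩ := mem_span_singleton'.mp h
  have h1 := congrArg (eval (0 : Fin 3 → k)) hc
  rw [map_mul, eval_X, Pi.zero_apply, mul_zero] at h1
  cases τ <;> fin_cases i <;> fin_cases j <;> simp [chartUnit] at h1 hij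

/-- The point `δ` is the generic point of the boundary divisor of `S`. -/
def IsBdryPoint (S : Marks) (δ : MPts k) : Prop :=
  ∃ (T : Chart) (n : Fin 3), (T.set n = S ∨ T.set n = Sᶜ) ∧
    Loc δ = locAt T♯ (span {X n})

lemma Chart.exists_isBdryPoint (k : Type u) [Field k] (T : Chart) (n : Fin 3) :
    ∃ δ : MPts k, IsBdryPoint (T.set n) δ := by
  have ⟨δ, hδ⟩ := T.exists_point (k := k) (span {X n}) fun i j hij =>
    chartUnit_notMem_span_X T.1 n hij
  exact ⟨δ, T, n, Or.inl rfl, hδ⟩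

lemma Chart.vanishesAt_iff_mem_span {T : Chart} {p : Poly (Fin 3) k}
    [(span {p}).IsPrime] {δ : MPts k}
    (hδ : Loc δ = locAt T♯ (span {p})) (a : Poly (Fin 3) k) :
    VanishesAt δ (T.hom k a) ↔ a ∈ span {p} := by
  have hmem : T.hom k a ∈ Loc δ := hδ ▸ map_mem_locAt T♯ _ a
  by_cases ha0 : a = 0
  · subst ha0
    simp only [map_zero, zero_mem, iff_true]
    exact ⟨0, zero_mem _, map_zero _⟩
  have ha : T.hom k a ≠ 0 := fun h0 => ha0 (T.hom_injective (h0.trans (map_zero _).symm))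
  have h1 := inv_map_mem_locAt_iff (φ := T♯) (q := span {p})
    (T.ker_le _) ha
  rw [← hδ] at h1
  rw [vanishesAt_iff_mem, IsUnitAt]
  constructor
  · rintro ⟨-, h3⟩
    by_contra h4
    exact h3 ⟨ha, hmem, h1.mpr h4⟩
  · intro h3; exact ⟨hmem, fun h4 => h1.mp h4.2.2 h3⟩

lemma Chart.valid_of_eq_locAt {T : Chart} {q : Ideal (Poly (Fin 3) k)} [q.IsPrime]
    {δ : MPts k} (hδ : Loc δ = locAt T♯ q)
    (hq : ∀ i j, i ≠ j → chartUnit k T.1 i j ∉ q) : T.Valid (Loc δ) := hδ ▸ T.valid_locAt hq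

lemma X_mem_span_X_iff {n m : Fin 3} :
    (X m : Poly (Fin 3) k) ∈ span {(X n : Poly (Fin 3) k)} ↔ m = n := by
  rw [mem_span_singleton]
  refine ⟨fun h => ?_, fun h => h ▸ dvd_rfl⟩
  by_contra hne
  have ⟨c, hc⟩ := h
  have h1 := congrArg (eval (Pi.single m (1 : k))) hc
  rw [map_mul, eval_X, eval_X, Pi.single_eq_same, Pi.single_eq_of_ne (Ne.symm hne), zero_mul] at h1
  exact one_ne_zero h1

lemma IsBdryPoint.mem_boundary_iff (h : IsBdryPoint S δ)
    {S' : Marks} (hS : 2 ≤ S'.card) (hS' : S'.card ≤ 4) :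
    δ ∈ boundary k S' ↔ (S = S' ∨ S = S'ᶜ) := by
  have ⟨T, n, hn, hδ⟩ := h
  have hval : T.Valid (Loc δ) := Chart.valid_of_eq_locAt hδ fun i j hij =>
    chartUnit_notMem_span_X T.1 n hij
  rw [hval.mem_boundary_iff hS hS']
  have hiff : ∀ m, VanishesAt δ (T.gen k m) ↔ m = n := fun m => by
    rw [← Chart.hom_X, Chart.vanishesAt_iff_mem_span hδ, X_mem_span_X_iff]
  simp only [hiff, exists_eq_right]
  constructor
  · rintro (rfl | h1) <;> rcases hn with rfl | h2 <;> simp_all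
  · rintro (rfl | rfl)
    · exact hn
    · rwa [compl_compl, or_comm] at hn

lemma IsBdryPoint.card (h : IsBdryPoint S δ) : 2 ≤ S.card ∧ S.card ≤ 4 := by
  have ⟨T, n, hn, _⟩ := h
  have h1 := T.card_set n
  have h2 := Finset.card_compl_add_card S
  rw [Fintype.card_fin] at h2
  rcases hn with hn | hn
  · rwa [hn] at h1
  · rw [hn] at h1; omega

lemma IsBdryPoint.mem_boundary (h : IsBdryPoint S δ) :
    δ ∈ boundary k S := (h.mem_boundary_iff h.card.1 h.card.2).mpr (Or.inl rfl)

lemma IsBdryPoint.localRing_eq (h : IsBdryPoint S δ)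
    {T : Chart} {n : Fin 3} (hn : T.set n = S ∨ T.set n = Sᶜ) :
    Loc δ = locAt T♯ (span {X n}) := by
  have hval : T.Valid (Loc δ) := T.valid_of_boundary δ fun S' hS' hδ =>
    ⟨n, by
      rcases (h.mem_boundary_iff (card_bdry hS').1 (card_bdry hS').2).mp hδ with h1 | h1
      · rwa [← h1]
      · rw [h1, compl_compl] at hn; exact hn.symm⟩
  have hv : VanishesAt δ (T.gen k n) := by
    have ⟨m, hm, hv⟩ := (hval.mem_boundary_iff h.card.1 h.card.2).mp h.mem_boundary
    rwa [T.set_injective hn hm]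
  have ⟨z, hz, hzR⟩ := hval.exists_generic hv
  rw [← hzR]
  have ⟨T', n', hn', hδ⟩ := h
  have hle := localRing_le_of_specializes hz
  have hnot : (T.gen k n)⁻¹ ∉ Loc z := by
    intro hi
    rw [hzR, ← Chart.hom_X] at hi
    exact (inv_map_mem_locAt_iff (φ := T♯) (T.ker_le _)
      (by rw [show T♯ (X n) = T.gen k n from T.hom_X n]; exact T.gen_ne_zero n)).mp
      hi (mem_span_singleton_self _)
  rw [hδ] at hle ⊢
  exact (eq_locAt_of_le (φ := T'♯) T'.hom_injective T'.hom_surj X_prime hle hnot).symm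

lemma IsBdryPoint.eq {δ' : MPts k} (h : IsBdryPoint S δ) (h' : IsBdryPoint S δ') : δ = δ' := by
  have ⟨T, n, hn, hδ⟩ := h'
  exact eq_of_localRing_eq ((h.localRing_eq hn).trans hδ.symm)

/-- A boundary divisor is the closure of its generic point. -/
lemma IsBdryPoint.mem_boundary_iff_specializes (h : IsBdryPoint S δ) (x : MPts k) : x ∈ boundary k S ↔ δ.1 ⤳ x.1 := by
  have hval := chartAt_valid x
  constructor
  · intro hx
    have ⟨n, hn, hv⟩ := (hval.mem_boundary_iff h.card.1 h.card.2).mp hx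
    have ⟨z, hz, hzR⟩ := hval.exists_generic hv
    have hzb : IsBdryPoint S z := ⟨_, n, hn, hzR⟩
    rwa [h.eq hzb]
  · intro hx
    have hle := localRing_le_of_specializes hx
    have ⟨n, hn, hv⟩ := ((hval.mono hle).mem_boundary_iff h.card.1 h.card.2).mp h.mem_boundary
    refine (hval.mem_boundary_iff h.card.1 h.card.2).mpr ⟨n, hn, ?_⟩
    by_contra hv'
    exact hv.not_isUnitAt ((hval.isUnitAt_gen hv').of_specializes hx)

lemma exists_chart_of_nodup {a b c d e f : Fin 6} (h : [a, b, c, d, e, f].Nodup) (τ : Bool) :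
    ∃ T : Chart, T.1 = τ ∧ T.2 0 = a ∧ T.2 1 = b ∧ T.2 2 = c ∧ T.2 3 = d ∧ T.2 4 = e ∧
      T.2 5 = f := by
  have ⟨σ, hσ⟩ := exists_perm h
  exact ⟨(τ, σ), rfl, hσ⟩

lemma exists_nodup_of_card {S : Marks} (hS : S.card = 2 ∨ S.card = 3) :
    ∃ a b c d e f : Fin 6, [a, b, c, d, e, f].Nodup ∧ (S = {a, b} ∨ S = {a, b, c}) := by
  have h2 : ∀ a b : Fin 6, a ≠ b → ∃ c d, [a, b, c, d].Nodup := by decide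
  have h3 : ∀ a b c : Fin 6, a ≠ b → a ≠ c → b ≠ c → ∃ d, [a, b, c, d].Nodup := by decide
  rcases hS with hS | hS
  · obtain ⟨a, b, hab, rfl⟩ := Finset.card_eq_two.mp hS
    have ⟨c, d, hn⟩ := h2 a b hab
    have ⟨e, f, hn⟩ := exists_rest hn
    exact ⟨a, b, c, d, e, f, hn, Or.inl rfl⟩
  · obtain ⟨a, b, c, hab, hac, hbc, rfl⟩ := Finset.card_eq_three.mp hS
    have ⟨d, hn⟩ := h3 a b c hab hac hbc
    have ⟨e, f, hn⟩ := exists_rest hn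
    exact ⟨a, b, c, d, e, f, hn, Or.inr rfl⟩

lemma exists_isBdryPoint (k : Type u) [Field k]
    (hS : S.card = 2 ∨ S.card = 3) : ∃ δ : MPts k, IsBdryPoint S δ := by
  have ⟨a, b, c, d, e, f, hn, hS⟩ := exists_nodup_of_card hS
  have ⟨T, hT, h0, h1, h2, _⟩ := exists_chart_of_nodup hn false
  rcases hS with rfl | rfl
  · convert T.exists_isBdryPoint k 0
    rw [Chart.set, hT]
    simp [chartPos, Finset.map_insert, h0, h1]
  · convert T.exists_isBdryPoint k 1
    rw [Chart.set, hT]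
    simp [chartPos, Finset.map_insert, h0, h1, h2]

end BoundaryPoints

section Picard

variable {k : Type u} [Field k]

lemma Chart.exists_of_opens (T : Chart) (U : (SegreSpace k).Opens) (hU : Mbar06 k ∈ U) :
    ∃ f : Poly (Fin 3) k, f ≠ 0 ∧ ∀ (y : MPts k), T.Valid (Loc y) →
      IsUnitAt y (T.hom k f) → y.1 ∈ U := by
  have ⟨n, h, hh, hhx, hy⟩ := exists_form_of_mem_opens hU
  have hne : ∀ t : SegreIdx, dehom (Mbar06 k) (segreCoord_notMem t) h ≠ 0 :=
    fun t h0 => hhx ((dehom_eq_zero_iff _ _ hh).mp h0)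
  choose a b hb hab using fun t : SegreIdx => T.hom_surj (dehom (Mbar06 k) (segreCoord_notMem t) h)
  have ha : ∀ t, T.hom k (a t) ≠ 0 := fun t h0 => mul_ne_zero (hne t) (hb t) ((hab t).trans h0)
  refine ⟨∏ t : SegreIdx, a t * b t, ?_, fun y hval hf => ?_⟩
  · refine prod_ne_zero_iff.mpr fun t _ => mul_ne_zero ?_ ?_
    · exact fun h0 => ha t (by rw [h0, map_zero])
    · exact fun h0 => hb t (by rw [h0, map_zero])
  · have ⟨t, ht⟩ := exists_X_notMem y.1
    rw [hval.isUnitAt_iff] at hf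
    have hat : a t * b t ∉ hval.ideal := fun hm =>
      hf (Ideal.mem_of_dvd _ (Finset.dvd_prod_of_mem _ (Finset.mem_univ t)) hm)
    have hat1 : a t ∉ hval.ideal := fun hm => hat (Ideal.mul_mem_right _ _ hm)
    have hat2 : b t ∉ hval.ideal := fun hm => hat (Ideal.mul_mem_left _ _ hm)
    have hu : IsUnitAt y (dehom (Mbar06 k) (segreCoord_notMem t) h) := by
      rw [(eq_div_iff (hb t)).mpr (hab t)]
      exact ((hval.isUnitAt_iff _).mpr hat1).div ((hval.isUnitAt_iff _).mpr hat2)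
    have h2 := hu.valueAt_ne_zero
    rw [valueAt_dehom y ht h] at h2
    exact hy y.1 fun hm => h2 ((dehom_eq_zero_iff _ _ hh).mpr hm)

lemma isUnitAt_iff_isUnitAlong {T : Chart} {p : Poly (Fin 3) k} (hp : Prime p)
    [(span {p}).IsPrime] {δ : MPts k}
    (hδ : Loc δ = locAt T♯ (span {p})) (g : RatFun k) :
    IsUnitAt δ g ↔ IsUnitAlong T♯ p g := by
  have hinj : Inj (T.hom k).toRingHom := T.hom_injective
  constructor
  · rintro ⟨h0, h1, h2⟩
    rw [hδ] at h1 h2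
    exact isUnitAlong_of_mem_locAt hp h0 h1 h2 hinj
  · intro h
    refine ⟨h.ne_zero hinj, ?_, ?_⟩
    · rw [hδ]; exact h.mem_locAt hinj
    · rw [hδ]; exact (h.inv hinj).mem_locAt hinj

open Classical in
/-- On the complement of the boundary every Cartier divisor is principal. -/
lemma CartierDivisor.exists_principal_interior (G : CartierDivisor (Mbar06 k)) (T : Chart) :
    ∃ g : RatFun k, g ≠ 0 ∧ ∀ (p : Poly (Fin 3) k) (_ : Prime p)
      (_ : (span {p}).IsPrime) (y : MPts k), T.Valid (Loc y) →
      Loc y = locAt T♯ (span {p}) →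
        IsUnitAt y ((G.eqn y : RatFun k) / g) := by
  have hinj : Inj (T.hom k).toRingHom := T.hom_injective
  let e₀ : RatFun k := Units.val (G.eqn (Pts.generic (Mbar06 k)))
  have he0 : e₀ ≠ 0 := G.eqn_ne_zero _
  have ⟨U, hU, hUG⟩ := G.compatible (Pts.generic (Mbar06 k))
  have ⟨f, hf, hfU⟩ := T.exists_of_opens U hU
  let c : Ideal (Poly (Fin 3) k) → RatFun k := fun I =>
    if h : ∃ (_ : I.IsPrime) (y : MPts k), Loc y = locAt T♯ I then
      (G.eqn h.choose_spec.choose : RatFun k) / e₀ else 1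
  have hc : ∀ I, c I ≠ 0 := by
    intro I
    dsimp only [c]
    split_ifs
    · exact div_ne_zero (G.eqn_ne_zero _) he0
    · exact one_ne_zero
  have ⟨g, hg, hgp⟩ := exists_prescribed_orders (φ := T♯) hinj T.hom_surj c hc
    f hf
  refine ⟨e₀ * g, mul_ne_zero he0 hg, fun p hp hpI y hval hy => ?_⟩
  rw [← div_div]
  by_cases hpf : p ∣ f
  · have h1 := (hgp p hp).1 hpf
    have hex : ∃ (_ : (span {p}).IsPrime) (y : MPts k),
        Loc y = locAt T♯ (span {p}) := ⟨hpI, y, hy⟩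
    have hcp : c (span {p}) = (G.eqn y : RatFun k) / e₀ := by
      dsimp only [c]
      rw [dif_pos hex]
      congr 3
      exact eq_of_localRing_eq (hex.choose_spec.choose_spec.trans hy.symm)
    rw [hcp] at h1
    exact (isUnitAt_iff_isUnitAlong hp hy _).mpr h1
  · have h1 := (isUnitAt_iff_isUnitAlong hp hy _).mpr ((hgp p hp).2 hpf)
    have hfy : IsUnitAt y (T.hom k f) :=
      (isUnitAt_iff_isUnitAlong hp hy _).mpr (isUnitAlong_map hpf hp)
    have h2 := hUG y (hfU y hval hfy)
    rw [Units.val_div_eq_div_val] at h2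
    have h3 := h2.inv
    rw [inv_div] at h3
    exact h3.div h1

/-- Every Cartier divisor is linearly equivalent to a combination of boundary divisors. -/
theorem CartierDivisor.exists_combination (G : CartierDivisor (Mbar06 k)) :
    ∃ (g : RatFun k) (n : Marks → ℤ), g ≠ 0 ∧ ∀ x : MPts k,
      IsUnitAt x ((G.eqn x : RatFun k) /
        (g * ∏ S ∈ bdrySets, ((bdryDiv k S).eqn x : RatFun k) ^ n S)) := by
  classical
  have ⟨g, hg, hgp⟩ := G.exists_principal_interior (false, 1)
  have hdiv : ∀ S : Marks, ∃ n : ℤ, S ∈ bdrySets → ∀ δ : MPts k, IsBdryPoint S δ →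
      IsUnitAt δ ((G.eqn δ : RatFun k) / g / ((bdryDiv k S).eqn δ : RatFun k) ^ n) := by
    intro S
    by_cases hS : S ∈ bdrySets
    · have ⟨δ, hδ⟩ := exists_isBdryPoint k (S := S) (by simp [bdrySets] at hS; omega)
      have ⟨n, hn, hv⟩ := ((chartAt_valid δ).mem_boundary_iff hδ.card.1 hδ.card.2).mp
        hδ.mem_boundary
      have hR := hδ.localRing_eq hn
      have ⟨u, m, hu, he⟩ := exists_isUnitAlong_mul_zpow (φ := (chartAt δ)♯)
        (chartAt δ).hom_surj (X_prime (i := n)) (div_ne_zero (G.eqn_ne_zero δ) hg)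
      refine ⟨m, fun _ δ' hδ' => ?_⟩
      obtain rfl := hδ.eq hδ'
      have hgen : (chartAt δ)♯ (X n) = (chartAt δ).gen k n := (chartAt δ).hom_X n
      rw [he, hgen, bdryDiv_eqn, Chart.eqn_of_match hn, mul_div_cancel_right₀ _
        (zpow_ne_zero _ ((chartAt δ).gen_ne_zero n))]
      exact (isUnitAt_iff_isUnitAlong X_prime hR _).mpr hu
    · exact ⟨0, fun h => absurd h hS⟩
  choose n hn using hdiv
  have hprod : ∀ x : MPts k, g * ∏ S ∈ bdrySets, ((bdryDiv k S).eqn x : RatFun k) ^ n S ≠ 0 :=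
    fun x => mul_ne_zero hg (prod_ne_zero_iff.mpr fun S _ =>
      zpow_ne_zero _ ((bdryDiv k S).eqn_ne_zero x))
  refine ⟨g, n, hg, fun x => ?_⟩
  have hval := chartAt_valid x
  set T := chartAt x
  have hinj : Inj (T.hom k).toRingHom := T.hom_injective
  have key : ∀ p ∈ hval.ideal, Prime p → IsUnitAlong T♯ p ((G.eqn x : RatFun k) /
      (g * ∏ S ∈ bdrySets, ((bdryDiv k S).eqn x : RatFun k) ^ n S)) := fun p hpx hp => by
    have hpI : (span {p}).IsPrime := (Ideal.span_singleton_prime hp.ne_zero).mpr hp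
    have hle : span {p} ≤ hval.ideal := by rwa [span_le, Set.singleton_subset_iff]
    have ⟨z, hz⟩ := T.exists_point (span {p}) fun i j hij hm => hval.unit_notMem hij (hle hm)
    have hzx : z.1 ⤳ x.1 := by
      rw [specializes_iff_localRing_le, hval.localRing_eq, hz]
      exact locAt_anti hle
    have hzval : T.Valid (Loc z) := hval.mono (localRing_le_of_specializes hzx)
    have hz0 : VanishesAt z (T.hom k p) :=
      (Chart.vanishesAt_iff_mem_span hz p).mpr (mem_span_singleton_self p)
    rw [← isUnitAt_iff_isUnitAlong hp hz]
    suffices h : IsUnitAt z ((G.eqn z : RatFun k) / g /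
        ∏ S ∈ bdrySets, ((bdryDiv k S).eqn z : RatFun k) ^ n S) by
      have h1 := (G.isUnitAt hzx).mul h
      have h2 : IsUnitAt z (∏ S ∈ bdrySets, (((bdryDiv k S).eqn x : RatFun k) /
          (bdryDiv k S).eqn z) ^ n S) :=
        IsUnitAt.prod _ fun S _ => ((bdryDiv k S).isUnitAt hzx).zpow _
      have h3 := h1.div h2
      simp only [div_zpow, prod_div_distrib] at h3
      convert h3 using 1
      have e1 := G.eqn_ne_zero z
      have e2 := right_ne_zero_of_mul (hprod x)
      have e3 := right_ne_zero_of_mul (hprod z)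
      field_simp
    by_cases hzb : ∃ S ∈ bdrySets, z ∈ boundary k S
    · have ⟨S, hS, hzS⟩ := hzb
      have ⟨m, hm, hv⟩ := (hzval.mem_boundary_iff (card_bdry hS).1 (card_bdry hS).2).mp hzS
      rw [← Chart.hom_X, Chart.vanishesAt_iff_mem_span hz, mem_span_singleton] at hv
      have hass := hp.associated_of_dvd X_prime hv
      have hzδ : IsBdryPoint S z := by
        refine ⟨T, m, hm, hz.trans ?_⟩
        congr 1
        exact Ideal.span_singleton_eq_span_singleton.mpr hass
      rw [← Finset.mul_prod_erase _ _ hS, ← div_div]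
      refine (hn S hS z hzδ).div (IsUnitAt.prod _ fun S' hS' => IsUnitAt.zpow ?_ _)
      have hS'' := Finset.mem_of_mem_erase hS'
      have ⟨c, c'⟩ := card_bdry hS''
      refine isUnitAt_bdryDiv_eqn c c' fun hz' => ?_
      have hmatch := (hzδ.mem_boundary_iff c c').mp hz'
      have ⟨S₀, _, _, hu⟩ := exists_bdrySet S hzδ.card.1 hzδ.card.2
      exact (Finset.ne_of_mem_erase hS') ((hu S' hS'' hmatch).trans (hu S hS (Or.inl rfl)).symm)
    · push Not at hzb
      refine IsUnitAt.div ?_ (IsUnitAt.prod _ fun S hS => (isUnitAt_bdryDiv_eqn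
        (card_bdry hS).1 (card_bdry hS).2 (hzb S hS)).zpow _)
      have hval₀ : Chart.Valid (false, 1) (Loc z) :=
        Chart.valid_of_boundary _ z fun S hS h => absurd h (hzb S hS)
      have hnot : (T.hom k p)⁻¹ ∉ Loc z := fun hi => hz0.not_isUnitAt
        ⟨fun h0 => hp.ne_zero (hinj (h0.trans (map_zero _).symm)), hz0.mem, hi⟩
      have hbot : hval₀.ideal ≠ ⊥ := fun hbot => hnot <| by
        have ⟨a, b, hb, hab⟩ := Chart.hom_surj (k := k) (false, 1) (T.hom k p)⁻¹
        exact (hval₀.mem_localRing _).mpr ⟨a, b, by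
          rw [hbot, Ideal.mem_bot]
          exact fun h0 => hb (by rw [h0, map_zero]), hab⟩
      have ⟨p₀, hp₀, hp₀p⟩ := Ideal.IsPrime.exists_mem_prime_of_ne_bot inferInstance hbot
      have hp₀I : (span {p₀}).IsPrime := (Ideal.span_singleton_prime hp₀p.ne_zero).mpr hp₀p
      refine hgp p₀ hp₀p hp₀I z hval₀ ?_
      have hle₀ : Loc z ≤ locAt (false, 1)♯ (span {p₀}) := by
        rw [hval₀.localRing_eq]
        exact locAt_anti (by rwa [span_le, Set.singleton_subset_iff])
      have hp₀0 : Chart.hom k (false, 1) p₀ ≠ 0 := fun h0 =>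
        hp₀p.ne_zero (Chart.hom_injective _ (h0.trans (map_zero _).symm))
      rw [hz] at hle₀ ⊢
      refine (eq_locAt_of_le (φ := T♯) hinj T.hom_surj hp hle₀
        (g := (Chart.hom k (false, 1) p₀)⁻¹) fun hi => ?_).symm
      exact (inv_map_mem_locAt_iff (φ := (false, 1)♯) (Chart.ker_le _ _)
        hp₀0).mp hi (mem_span_singleton_self _)
  refine ⟨div_ne_zero (G.eqn_ne_zero x) (hprod x), ?_, ?_⟩
  all_goals
    rw [hval.localRing_eq]
    refine mem_locAt_of_prime hinj T.hom_surj fun p hpq hp => ?_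
  · have ⟨a, b, _, h⟩ := key p hpq hp; exact ⟨a, b, h⟩
  · have ⟨a, b, _, h⟩ := (key p hpq hp).inv hinj; exact ⟨a, b, h⟩

/-- The class of a one-cycle is determined by its intersection numbers with the boundary
divisors. -/
theorem cls_eq_of_bdryDiv [IsAlgClosed k] {c d : Cycle (Mbar06 k)}
    (h : ∀ S ∈ bdrySets, (bdryDiv k S).degCycle c = (bdryDiv k S).degCycle d) : cls c = cls d := by
  rw [cls_eq_iff]
  intro G
  have ⟨g, n, _, hG⟩ := G.exists_combination
  rw [G.degCycle_eq_sum bdrySets (bdryDiv k) n g hG, G.degCycle_eq_sum bdrySets (bdryDiv k) n g hG]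
  exact sum_congr rfl fun S hS => by rw [h S hS]

end Picard

section Parameters
variable {σ : Type} {k : Type u} [Field k] {η : PS σ k}

/-- The function field of `closure {η}` is the field of rational functions in the variable `y`. -/
structure IsParameter (y : RF η) : Prop where
  mem : ∀ L : Subfield (RF η), (∀ c, algebraMap k _ c ∈ L) → y ∈ L → ∀ g, g ∈ L
  transcendental : Transcendental k y

/-- The homomorphism that sends the variable to `y`. -/
abbrev polyHom (y : RF η) : Polynomial k →+* RF η := (Polynomial.aeval (R := k) y).toRingHom

variable {y : RF η}

lemma IsParameter.inv (h : IsParameter y) : IsParameter y⁻¹ where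
  mem L hk hL := h.mem L hk (inv_mem_iff.mp hL)
  transcendental h' := h.transcendental (by simpa using h'.inv)

lemma IsParameter.injective (h : IsParameter y) : Inj (polyHom y) :=
  transcendental_iff_injective.mp h.transcendental

lemma IsParameter.surj (h : IsParameter y) (g : RF η) : ∃ a b, polyHom y b ≠ 0 ∧
      g * polyHom y b = polyHom y a := by
  have hg := h.mem (IntermediateField.adjoin k {y}).toSubfield
    (fun c => (IntermediateField.adjoin k {y}).algebraMap_mem c)
    (IntermediateField.mem_adjoin_simple_self k y) g
  have ⟨a, b, hab⟩ := IntermediateField.mem_adjoin_simple_iff k g |>.mp hg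
  by_cases hb : Polynomial.aeval y b = 0
  · refine ⟨0, 1, by simp, ?_⟩
    rw [hab, hb]
    simp
  · refine ⟨a, b, hb, ?_⟩
    change g * Polynomial.aeval y b = Polynomial.aeval y a
    rw [hab, div_mul_cancel₀ _ hb]

instance isPrime_span_X_sub_C (c : k) : (span {Polynomial.X - Polynomial.C c}).IsPrime :=
  (Ideal.span_singleton_prime (Polynomial.X_sub_C_ne_zero c)).mpr (Polynomial.prime_X_sub_C c)

lemma mem_span_X_sub_C {c : k} {a : Polynomial k} :
    a ∈ span {Polynomial.X - Polynomial.C c} ↔ a.eval c = 0 := by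
  rw [mem_span_singleton, Polynomial.dvd_iff_isRoot]; rfl

lemma aeval_mem_localRing {z : Pts η} (hz : y ∈ Loc z) (a : Polynomial k) :
    Polynomial.aeval y a ∈ Loc z := by
  rw [Polynomial.aeval_eq_sum_range]
  refine sum_mem fun i _ => ?_
  rw [Algebra.smul_def]
  exact mul_mem (cst_mem z _) (pow_mem hz i)

lemma mem_localRing_of_sub {z : Pts η} {c : k} (hz : VanishesAt z (y - cst c)) : y ∈ Loc z := by
  have := add_mem hz.mem (cst_mem z c)
  rwa [sub_add_cancel] at this

lemma valueAt_of_sub {z : Pts η} {c : k} (hz : VanishesAt z (y - cst c)) : valueAt z y = cst c := by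
  have h := (valueAt_eq_zero_iff z hz.mem).mpr hz
  rw [← sub_add_cancel y (cst c), valueAt_add z hz.mem (cst_mem z c),
    h, zero_add, valueAt_algebraMap]

lemma valueAt_aeval {z : Pts η} {c : k} (hz : VanishesAt z (y - cst c))
    (a : Polynomial k) : valueAt z (Polynomial.aeval y a) = cst (a.eval c) := by
  have hy := mem_localRing_of_sub hz
  have h0 := valueAt_of_sub hz
  induction a using Polynomial.induction_on' with
  | add p q hp hq =>
    rw [map_add, valueAt_add z (aeval_mem_localRing hy _) (aeval_mem_localRing hy _), hp, hq,
      Polynomial.eval_add, map_add]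
  | monomial n r =>
    have hpow : ∀ n : ℕ, valueAt z (y ^ n) = algebraMap k _ (c ^ n) := fun n => by
      induction n with
      | zero => simp [valueAt_one]
      | succ n ih => rw [pow_succ, valueAt_mul z (pow_mem hy n) hy, ih, h0, pow_succ, map_mul]
    rw [Polynomial.aeval_monomial, valueAt_mul z (cst_mem z r) (pow_mem hy n),
      valueAt_algebraMap, hpow, Polynomial.eval_monomial, map_mul]

lemma IsParameter.localRing_eq (h : IsParameter y) {z : Pts η} {c : k}
    (hz : VanishesAt z (y - cst c)) : Loc z =
      locAt (polyHom y)
        (span {Polynomial.X - Polynomial.C c}) := by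
  have hy := mem_localRing_of_sub hz
  refine eq_locAt_of_le h.injective h.surj (Polynomial.prime_X_sub_C c) (fun g hg => ?_)
    (g := (y - cst c)⁻¹) fun hinv => ?_
  · obtain ⟨a, b, hb, hb0, hab⟩ := mem_locAt.mp hg
    rw [mem_span_X_sub_C] at hb
    have hu : IsUnitAt z (Polynomial.aeval y b) := by
      rw [isUnitAt_iff_valueAt (aeval_mem_localRing hy b), valueAt_aeval hz]
      simpa using hb
    rw [(eq_mul_inv_iff_mul_eq₀ hb0).mpr hab]
    exact mul_mem (aeval_mem_localRing hy a) hu.2.2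
  · refine hz.not_isUnitAt ⟨fun h0 => ?_, hz.mem, hinv⟩
    refine h.transcendental ⟨Polynomial.X - Polynomial.C c, Polynomial.X_sub_C_ne_zero c, ?_⟩
    simpa using h0

lemma IsParameter.isClosed (h : IsParameter y) {z : Pts η} {c : k}
    (hz : VanishesAt z (y - algebraMap k _ c)) : IsClosed ({z.1} : Set (PS σ k)) := by
  refine isClosed_singleton_of_surjective fun g => ?_
  obtain ⟨⟨f, hf⟩, rfl⟩ := valHom_surjective z g
  have hf' := hf
  rw [h.localRing_eq hz, mem_locAt] at hf'
  obtain ⟨a, b, hb, hb0, hab⟩ := hf'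
  rw [mem_span_X_sub_C] at hb
  have hy := mem_localRing_of_sub hz
  have h1 := congrArg (valueAt z) hab
  change valueAt z (f * Polynomial.aeval y b) = valueAt z (Polynomial.aeval y a) at h1
  rw [valueAt_mul z hf (aeval_mem_localRing hy b), valueAt_aeval hz, valueAt_aeval hz] at h1
  refine ⟨a.eval c / b.eval c, ?_⟩
  change _ = valueAt z f
  rw [map_div₀, ← h1, mul_div_cancel_right₀]
  simpa using hb

lemma IsParameter.ne_zero (h : IsParameter y) : y ≠ 0 := by
  rintro rfl
  exact h.transcendental isAlgebraic_zero

lemma IsParameter.exists_point [Finite σ] (h : IsParameter y)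
    (hy : ∀ z : Pts η, y ∈ Loc z ∨ y⁻¹ ∈ Loc z) :
    ∃ z : Pts η, z.1 ≠ η ∧ VanishesAt z y := by
  have hp := Polynomial.prime_X_sub_C (0 : k)
  set O := locAt (polyHom y)
    (span {Polynomial.X - Polynomial.C (0 : k)}) with hO
  have hval : ∀ g, g ∈ O ∨ g⁻¹ ∈ O := fun g => by
    by_cases hg : g = 0
    · exact Or.inl (hg ▸ zero_mem _)
    obtain ⟨u, n, hu, rfl⟩ := exists_isUnitAlong_mul_zpow h.surj hp hg
    rcases Int.le_total 0 n with hn | hn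
    · left
      lift n to ℕ using hn
      exact mul_mem (hu.mem_locAt h.injective) (by
        rw [zpow_natCast]; exact pow_mem (map_mem_locAt _ _ _) n)
    · right
      obtain ⟨m, hm⟩ := Int.eq_ofNat_of_zero_le (show 0 ≤ -n by omega)
      rw [mul_inv, ← zpow_neg, hm]
      exact mul_mem ((hu.inv h.injective).mem_locAt h.injective) (by
        rw [zpow_natCast]; exact pow_mem (map_mem_locAt _ _ _) m)
  have hyO : y ∈ O := by
    have := map_mem_locAt (polyHom y)
      (span {Polynomial.X - Polynomial.C (0 : k)}) Polynomial.X
    rwa [show polyHom y Polynomial.X = y from Polynomial.aeval_X y] at this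
  have hyO' : y⁻¹ ∉ O := fun h' => by
    have := (inv_map_mem_locAt_iff (φ := (polyHom y))
      (q := span {Polynomial.X - Polynomial.C (0 : k)}) (a := Polynomial.X) (by
        rw [(RingHom.injective_iff_ker_eq_bot _).mp h.injective]; exact bot_le)
      (by simpa using h.ne_zero)).mp (by
        rwa [show polyHom y Polynomial.X = y from Polynomial.aeval_X y])
    exact this (mem_span_X_sub_C.mpr (by simp))
  have ⟨z, hz⟩ := exists_center O hval fun c => by
    have := map_mem_locAt (polyHom y)
      (span {Polynomial.X - Polynomial.C (0 : k)}) (Polynomial.C c)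
    rwa [show polyHom y (Polynomial.C c) = cst c from Polynomial.aeval_C y c] at this
  have hyz : y ∈ Loc z := (hy z).elim id fun h' => by
    have := hz.inv_mem _ h' (by rwa [inv_inv])
    rwa [inv_inv] at this
  refine ⟨z, ?_, (hz.vanishesAt_iff hyz h.ne_zero).mpr hyO'⟩
  intro h'
  apply hyO'
  refine hz.le ?_
  have : z = Pts.generic η := Subtype.ext h'
  rw [this]
  exact mem_localRing_generic y⁻¹

lemma eq_generic_of_forall_mem {z : Pts η} (h : ∀ g, g ∈ Loc z) : z.1 = η := by
  have : z = Pts.generic η := by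
    apply eq_of_localRing_eq
    ext g
    exact ⟨fun _ => mem_localRing_generic g, fun _ => h g⟩
  rw [this]; rfl

lemma isUnitAt_aeval [IsAlgClosed k] {z : Pts η}
    (h : ∀ c, IsUnitAt z (y - algebraMap k _ c)) {b : Polynomial k} (hb : b ≠ 0) :
    IsUnitAt z (Polynomial.aeval y b) := by
  rw [(IsAlgClosed.splits b).eq_prod_roots, map_mul, Polynomial.aeval_C, map_multiset_prod,
    Multiset.map_map]
  refine (isUnitAt_algebraMap z (Polynomial.leadingCoeff_ne_zero.mpr hb)).mul ?_
  refine Multiset.prod_induction (IsUnitAt z) _ (fun a b ha hb => ha.mul hb) (isUnitAt_one z) ?_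
  intro a ha
  obtain ⟨c, -, rfl⟩ := Multiset.mem_map.mp ha
  simpa using h c

lemma IsParameter.exists_const [IsAlgClosed k] (h : IsParameter y) {z : Pts η} (hz : z.1 ≠ η)
    (hy : y ∈ Loc z) : ∃ c : k, VanishesAt z (y - cst c) := by
  by_contra! hc
  have hlin : ∀ c, IsUnitAt z (y - cst c) := fun c =>
    isUnitAt_of_not (sub_mem hy (cst_mem z c)) (hc c)
  refine hz (eq_generic_of_forall_mem fun g => ?_)
  obtain ⟨a, b, hb, hab⟩ := h.surj g
  have hb0 : b ≠ 0 := by rintro rfl; simp at hb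
  rw [(eq_mul_inv_iff_mul_eq₀ hb).mpr hab]
  exact mul_mem (aeval_mem_localRing hy a) (isUnitAt_aeval hlin hb0).2.2

lemma IsParameter.isCurvePoint [Finite σ] [IsAlgClosed k] (h : IsParameter y)
    (hy : ∀ z : Pts η, y ∈ Loc z ∨ y⁻¹ ∈ Loc z) : IsCurvePoint η := by
  refine ⟨fun hcl => ?_, fun z hηz hz => ?_⟩
  · obtain ⟨z, hz, -⟩ := h.exists_point hy; exact hz (eq_of_isClosed hcl z.2)
  · have hz' : (⟨z, hηz⟩ : Pts η).1 ≠ η := hz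
    rcases hy ⟨z, hηz⟩ with hm | hm
    · obtain ⟨c, hc⟩ := h.exists_const hz' hm; exact h.isClosed hc
    · obtain ⟨c, hc⟩ := h.inv.exists_const hz' hm; exact h.inv.isClosed hc

lemma IsParameter.eq_of_vanishesAt (h : IsParameter y) {z z' : Pts η} (hz : VanishesAt z y)
    (hz' : VanishesAt z' y) : z = z' := by
  apply eq_of_localRing_eq
  rw [h.localRing_eq (c := 0) (by simpa using hz), h.localRing_eq (c := 0) (by simpa using hz')]

lemma IsParameter.ordAt_eq_one [Finite σ] [IsAlgClosed k] (h : IsParameter y)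
    (hη : IsCurvePoint η) {z : Pts η} (hz : VanishesAt z y) : ordAt (Loc z) y = 1 := by
  have hR := h.localRing_eq (z := z) (c := 0) (by simpa using hz)
  have hne : (⟨y, hz.mem⟩ : Loc z) ≠ 0 := fun h0 => h.ne_zero (congrArg Subtype.val h0)
  have := (hasFiniteOrders hη z).ordAt_coe hne
  change ordAt (Loc z) y = _ at this
  rw [this]
  suffices hs : Ring.ord (Loc z) (⟨y, hz.mem⟩ : Loc z) = 1 by rw [hs]; rfl
  rw [Ring.ord, Module.length_eq_one_iff]
  have hmax : maximalIdeal (Loc z) = span {⟨y, hz.mem⟩} := by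
    ext g
    rw [mem_maximalIdeal_localRing, mem_span_singleton]
    constructor
    · have ⟨g, hg'⟩ := g
      intro hg
      change VanishesAt z g at hg
      have hg'' := hg'
      rw [hR] at hg''
      have ⟨a, b, hb, hb0, hab⟩ := mem_locAt.mp hg''
      have ha : Polynomial.X ∣ a := by
        by_contra ha
        refine hg.not_isUnitAt ⟨?_, hg', ?_⟩
        · intro h0
          rw [h0, zero_mul] at hab
          rw [h.injective (hab.symm.trans (map_zero _).symm)] at ha
          exact ha (dvd_zero _)
        · rw [hR]
          have ha0 : polyHom y a ≠ 0 := fun h0 => by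
            rw [h.injective (h0.trans (map_zero _).symm)] at ha
            exact ha (dvd_zero _)
          refine mem_locAt.mpr ⟨b, a, fun ha' => ha ?_, ha0, ?_⟩
          · rw [mem_span_singleton] at ha'; simpa using ha'
          · rw [← hab, inv_mul_cancel_left₀]
            rintro h0
            rw [h0, zero_mul] at hab
            exact ha0 hab.symm
      obtain ⟨a', rfl⟩ := ha
      have hq : Polynomial.aeval y a' * (Polynomial.aeval y b)⁻¹ ∈ Loc z := by
        rw [hR]
        exact mem_locAt.mpr ⟨a', b, hb, hb0, inv_mul_cancel_right₀ hb0 _⟩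
      refine ⟨⟨_, hq⟩, Subtype.ext ?_⟩
      refine ((eq_mul_inv_iff_mul_eq₀ hb0).mpr hab).trans ?_
      simp [mul_assoc]
    · rintro ⟨f, rfl⟩
      change VanishesAt z (y * (f : RF η))
      rw [mul_comm]
      exact VanishesAt.mul_left f.2 hz
  rw [← hmax, isSimpleModule_iff_isCoatom]
  exact (IsLocalRing.maximalIdeal.isMaximal _).out

/-- A parameter has exactly one zero, which is simple. -/
lemma IsParameter.finsum_max_ordAt [Finite σ] [IsAlgClosed k] (h : IsParameter y)
    (hη : IsCurvePoint η) (hy : ∀ z : Pts η, y ∈ Loc z ∨ y⁻¹ ∈ Loc z) :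
    ∑ᶠ z : {z : Pts η // z.1 ≠ η}, max (ordAt (Loc z.1) y) 0 = 1 := by
  obtain ⟨z, hz, hzy⟩ := h.exists_point hy
  rw [finsum_eq_single _ ⟨z, hz⟩, h.ordAt_eq_one hη hzy]
  · rfl
  · rintro ⟨z', hz'⟩ hne
    refine max_eq_right ?_
    have hR := hasFiniteOrders hη z'
    have hv : ¬ VanishesAt z' y := fun h' => hne (Subtype.ext (h.eq_of_vanishesAt h' hzy))
    have : y⁻¹ ∈ Loc z' := (hy z').elim
      (fun h' => (isUnitAt_of_not h' hv).2.2) id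
    have := hR.ordAt_nonneg this (inv_ne_zero h.ne_zero)
    rw [hR.ordAt_inv h.ne_zero] at this
    change ordAt (Loc z') y ≤ 0
    omega

end Parameters

section Pencils
variable {σ : Type} {k : Type u} [Field k] {δ : PS σ k}

instance isPrime_span_X_zero : (span {(X 0 : Poly (Fin 2) k)}).IsPrime :=
  (Ideal.span_singleton_prime (X_ne_zero 0)).mpr (X_prime (R := k) (i := (0 : Fin 2)))

/-- The homomorphism from the polynomial ring in two variables with values `u` and `w`. -/
abbrev pencilHom (u w : RF δ) : Poly (Fin 2) k →+* RF δ := (aeval (R := k) ![u, w]).toRingHom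

variable {u w : RF δ}

@[simp] lemma pencilHom_C (c : k) : pencilHom u w (C c) = cst c := aeval_C _ c
@[simp] lemma pencilHom_X_zero : pencilHom u w (X 0) = u := aeval_X _ 0
@[simp] lemma pencilHom_X_one : pencilHom u w (X 1) = w := aeval_X _ 1

/-- The functions `u` and `w` are coordinates on the surface near the part of the curve `u = 0`
where `w` is regular. -/
structure IsPencilChart (u w : RF δ) : Prop where
  injective : Inj (pencilHom u w)
  surj : ∀ g, ∃ a b, pencilHom u w b ≠ 0 ∧ g * pencilHom u w b = pencilHom u w a
  point : ∀ (q : Ideal (Poly (Fin 2) k)) [q.IsPrime], X 0 ∈ q →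
    ∃ z : Pts δ, Loc z = locAt (pencilHom u w) q

lemma pencilHom_mem {R : Subring (RF δ)} (hk : ∀ c, algebraMap k _ c ∈ R)
    (hu : u ∈ R) (hw : w ∈ R) (a : Poly (Fin 2) k) : pencilHom u w a ∈ R := by
  induction a using MvPolynomial.induction_on with
  | C c => rw [pencilHom_C]; exact hk c
  | add p q hp hq => rw [map_add]; exact add_mem hp hq
  | mul_X p i hp =>
    rw [map_mul]
    refine mul_mem hp ?_
    fin_cases i
    · simpa using hu
    · simpa using hw

lemma pencilHom_mem_localRing {z : Pts δ} (hu : u ∈ Loc z) (hw : w ∈ Loc z)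
    (a : Poly (Fin 2) k) : pencilHom u w a ∈ Loc z := pencilHom_mem (cst_mem z) hu hw a

lemma valueAt_pencilHom {z : Pts δ} (hu : VanishesAt z u) (hw : w ∈ Loc z)
    (a : Poly (Fin 2) k) : valueAt z (pencilHom u w a) =
      Polynomial.aeval (valueAt z w) (aeval ![(0 : Polynomial k), Polynomial.X] a) := by
  have hm := pencilHom_mem_localRing hu.mem hw
  induction a using MvPolynomial.induction_on with
  | C c => simp [valueAt_algebraMap]
  | add p q hp hq => rw [map_add, valueAt_add z (hm p) (hm q), hp, hq, map_add, map_add]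
  | mul_X p i hp =>
    rw [map_mul, valueAt_mul z (hm p) (hm _), hp, map_mul, map_mul]
    congr 1
    fin_cases i
    · simpa using (valueAt_eq_zero_iff z hu.mem).mpr hu
    · simp

lemma restrict_eq_zero_iff (a : Poly (Fin 2) k) : aeval ![(0 : Polynomial k), Polynomial.X] a = 0 ↔
      a ∈ span {(X 0 : Poly (Fin 2) k)} := by
  constructor
  · intro h
    have key : ∀ a : Poly (Fin 2) k, a - Polynomial.aeval (X 1 : Poly (Fin 2) k)
        (aeval ![(0 : Polynomial k), Polynomial.X] a) ∈
          span {(X 0 : Poly (Fin 2) k)} := by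
      intro a
      induction a using MvPolynomial.induction_on with
      | C c => simp [MvPolynomial.algebraMap_eq]
      | add p q hp hq =>
        rw [map_add, map_add, add_sub_add_comm]
        exact add_mem hp hq
      | mul_X p i hp =>
        fin_cases i
        · simpa using Ideal.mul_mem_left _ p (mem_span_singleton_self (X 0))
        · simpa [← sub_mul] using Ideal.mul_mem_right (X 1) _ hp
    simpa [h] using key a
  · intro h
    obtain ⟨b, rfl⟩ := mem_span_singleton.mp h
    simp

lemma restrict_aeval_X_one (p : Polynomial k) : aeval ![(0 : Polynomial k), Polynomial.X]
    (Polynomial.aeval (X 1 : Poly (Fin 2) k) p) = p := by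
  rw [← Polynomial.aeval_algHom_apply, aeval_X]
  exact Polynomial.aeval_X_left_apply p

lemma pencilHom_aeval_X_one (p : Polynomial k) :
    pencilHom u w (Polynomial.aeval (X 1) p) = Polynomial.aeval w p := by
  change aeval ![u, w] _ = _
  rw [← Polynomial.aeval_algHom_apply, aeval_X]
  rfl

namespace IsPencilChart

variable (h : IsPencilChart u w)
include h

lemma ker_le (q : Ideal (Poly (Fin 2) k)) : RingHom.ker (pencilHom u w) ≤ q := by
  rw [(RingHom.injective_iff_ker_eq_bot _).mp h.injective]
  exact bot_le

lemma map_ne_zero {a : Poly (Fin 2) k} (ha : a ≠ 0) : pencilHom u w a ≠ 0 := fun h0 =>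
  ha (h.injective (h0.trans (map_zero _).symm))

lemma ne_zero : u ≠ 0 := by simpa using h.map_ne_zero (X_ne_zero 0)

omit h in
lemma mem_localRing {q : Ideal (Poly (Fin 2) k)} [q.IsPrime] {z : Pts δ}
    (hz : Loc z = locAt (pencilHom u w) q) (a : Poly (Fin 2) k) :
    pencilHom u w a ∈ Loc z := hz ▸ map_mem_locAt _ q a

lemma vanishesAt_iff {q : Ideal (Poly (Fin 2) k)} [q.IsPrime] {z : Pts δ}
    (hz : Loc z = locAt (pencilHom u w) q) (a : Poly (Fin 2) k) :
    VanishesAt z (pencilHom u w a) ↔ a ∈ q := by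
  by_cases ha : a = 0
  · subst ha
    rw [map_zero, ← valueAt_eq_zero_iff z (zero_mem _), valueAt_zero]
    simp
  · rw [(dominates_self z).vanishesAt_iff (mem_localRing hz a) (h.map_ne_zero ha), hz,
      inv_map_mem_locAt_iff (h.ker_le q) (h.map_ne_zero ha), not_not]

lemma exists_localRing_eq {z : Pts δ} (hu : VanishesAt z u) (hw : w ∈ Loc z) :
    ∃ (q : Ideal (Poly (Fin 2) k)) (_ : q.IsPrime), X 0 ∈ q ∧
      Loc z = locAt (pencilHom u w) q := by
  have hm := pencilHom_mem_localRing hu.mem hw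
  let f : Poly (Fin 2) k →+* RF z.1 := (valHom z).comp ((pencilHom u w).codRestrict (Loc z) hm)
  let q := RingHom.ker f
  have hq : ∀ a, a ∈ q ↔ VanishesAt z (pencilHom u w a) := fun a => valueAt_eq_zero_iff z (hm a)
  have hp : q.IsPrime := RingHom.ker_isPrime f
  have hX : X 0 ∈ q := (hq _).mpr (by simpa using hu)
  have ⟨z', hz'⟩ := h.point q hX
  refine ⟨q, hp, hX, ?_⟩
  have hunit : ∀ b, b ∉ q → IsUnitAt z (pencilHom u w b) := fun b hb =>
    isUnitAt_of_not (hm b) (fun h' => hb ((hq b).mpr h'))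
  have hdom : Dominates z' (Loc z) := by
    refine ⟨fun g hg => ?_, fun g hg hg' => ?_⟩
    · rw [hz'] at hg
      have ⟨a, b, hb, hb0, hab⟩ := mem_locAt.mp hg
      rw [(eq_mul_inv_iff_mul_eq₀ hb0).mpr hab]
      exact mul_mem (hm a) (hunit b hb).2.2
    · by_cases hg0 : g = 0
      · rw [hg0, inv_zero]; exact zero_mem _
      rw [hz'] at hg ⊢
      have ⟨a, b, hb, hb0, hab⟩ := mem_locAt.mp hg
      have ha0 : pencilHom u w a ≠ 0 := hab ▸ mul_ne_zero hg0 hb0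
      refine mem_locAt.mpr ⟨b, a, fun ha => (hunit b hb).1 ?_, ha0, ?_⟩
      · have h2 := VanishesAt.mul_left hg' ((hq a).mp ha)
        rw [← hab, inv_mul_cancel_left₀ hg0] at h2
        exact absurd (hunit b hb) h2.not_isUnitAt
      · rw [← hab, inv_mul_cancel_left₀ hg0]
  rw [hdom.eq (dominates_self z)] at hz'
  exact hz'

lemma isClosed {z : Pts δ} (hu : VanishesAt z u) {c : k}
    (hw : VanishesAt z (w - cst c)) : IsClosed ({z.1} : Set (PS σ k)) := by
  have hw' := mem_localRing_of_sub hw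
  have ⟨q, hq, _, hz⟩ := h.exists_localRing_eq hu hw'
  have hm := mem_localRing hz
  have hconst : ∀ a, ∃ c : k, valueAt z (pencilHom u w a) = cst c := fun a =>
    ⟨_, by rw [valueAt_pencilHom hu hw', valueAt_of_sub hw, Polynomial.aeval_algebraMap_apply]⟩
  refine isClosed_singleton_of_surjective fun g => ?_
  obtain ⟨⟨f, hf⟩, rfl⟩ := valHom_surjective z g
  have hf' := hf
  rw [hz] at hf'
  have ⟨a, b, hb, hb0, hab⟩ := mem_locAt.mp hf'
  have ⟨ca, hca⟩ := hconst a
  have ⟨cb, hcb⟩ := hconst b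
  have hv : valueAt z (pencilHom u w b) ≠ 0 := fun h0 =>
    hb ((h.vanishesAt_iff hz b).mp ((valueAt_eq_zero_iff z (hm b)).mp h0))
  refine ⟨ca / cb, ?_⟩
  change _ = valueAt z f
  rw [map_div₀, ← hca, ← hcb, ← hab, valueAt_mul z hf (hm b), mul_div_cancel_right₀ _ hv]

lemma eq_or_exists_const [IsAlgClosed k] {z : Pts δ} (hu : VanishesAt z u)
    (hw : w ∈ Loc z) : Loc z = locAt (pencilHom u w) (span {X 0}) ∨
      ∃ c : k, VanishesAt z (w - cst c) := by
  by_contra! hc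
  have ⟨hne, hc⟩ := hc
  refine hne (eq_locAt_of_le h.injective h.surj X_prime (fun g hg => ?_) (g := u⁻¹) fun hinv =>
    hu.not_isUnitAt ⟨h.ne_zero, hu.mem, hinv⟩)
  have ⟨a, b, hb, hb0, hab⟩ := mem_locAt.mp hg
  have hm := pencilHom_mem_localRing hu.mem hw
  have hlin : ∀ c, IsUnitAt z (w - cst c) := fun c =>
    isUnitAt_of_not (sub_mem hw (cst_mem z c)) (hc c)
  have hbu : IsUnitAt z (pencilHom u w b) := by
    rw [isUnitAt_iff_valueAt (hm b), valueAt_pencilHom hu hw]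
    have hr := mt (restrict_eq_zero_iff b).mp hb
    have h2 := (isUnitAt_aeval hlin hr).valueAt_ne_zero
    have h3 := valueAt_pencilHom hu hw (Polynomial.aeval (X 1 : Poly (Fin 2) k)
      (aeval ![(0 : Polynomial k), Polynomial.X] b))
    rw [restrict_aeval_X_one, pencilHom_aeval_X_one] at h3
    rwa [← h3]
  rw [(eq_mul_inv_iff_mul_eq₀ hb0).mpr hab]
  exact mul_mem (hm a) hbu.2.2

lemma isParameter {η : Pts δ} (hη : Loc η = locAt (pencilHom u w) (span {X 0})) :
    VanishesAt η u ∧ w ∈ Loc η ∧ IsParameter (valueAt η w) := by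
  have hm := mem_localRing hη
  have hv := h.vanishesAt_iff hη
  have hu : VanishesAt η u := by simpa using (hv (X 0)).mpr (mem_span_singleton_self _)
  have hw : w ∈ Loc η := by simpa using hm (X 1)
  refine ⟨hu, hw, fun L hk hL g => ?_, ?_⟩
  · obtain ⟨⟨f, hf⟩, rfl⟩ := valHom_surjective η g
    have hf' := hf
    rw [hη] at hf'
    have ⟨a, b, hb, hb0, hab⟩ := mem_locAt.mp hf'
    have hL' : ∀ a, valueAt η (pencilHom u w a) ∈ L := fun a => by
      rw [valueAt_pencilHom hu hw, Polynomial.aeval_eq_sum_range]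
      refine sum_mem fun i _ => ?_
      rw [Algebra.smul_def]
      exact mul_mem (hk _) (pow_mem hL i)
    have hvb : valueAt η (pencilHom u w b) ≠ 0 := fun h0 =>
      hb ((hv b).mp ((valueAt_eq_zero_iff η (hm b)).mp h0))
    change valueAt η f ∈ L
    have h1 := congrArg (valueAt η) hab
    rw [valueAt_mul η hf (hm b)] at h1
    rw [(eq_mul_inv_iff_mul_eq₀ hvb).mpr h1]
    exact mul_mem (hL' a) (inv_mem (hL' b))
  · rw [transcendental_iff]
    intro p hp
    have h3 := valueAt_pencilHom hu hw (Polynomial.aeval (X 1 : Poly (Fin 2) k) p)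
    rw [restrict_aeval_X_one, hp, valueAt_eq_zero_iff η (hm _), hv, ← restrict_eq_zero_iff, restrict_aeval_X_one] at h3
    exact h3

end IsPencilChart

/-- An effective divisor has non-negative degree on the curve `u = 0` of a pencil. -/
lemma degOn_nonneg_of_pencil [Finite σ] [IsAlgClosed k] (F : Curve δ) (h0 : IsPencilChart u w)
    (hF0 : Loc F.1 = locAt (pencilHom u w) (span {X 0}))
    (h : ∀ z : Pts F.1.1, ∃ u' w', IsPencilChart u' w' ∧
      Loc F.1 = locAt (pencilHom u' w') (span {X 0}) ∧
      VanishesAt (F.1.incl z) u' ∧ w' ∈ Loc (F.1.incl z) ∧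
      IsUnitAt (F.1.incl z) (u' / u)) (D : CartierDivisor δ) (hD : D.IsEffective) :
    0 ≤ D.degOn F := by
  have hp : Prime (X 0 : Poly (Fin 2) k) := X_prime
  obtain ⟨n, v, hv, hDv⟩ : ∃ (n : ℕ) (v : RF δ), IsUnitAt F.1 v ∧
      (D.eqn F.1 : RF δ) = v * u ^ n := by
    have hm := hD F.1
    rw [hF0] at hm
    have ⟨a, b, hb, hb0, hab⟩ := mem_locAt.mp hm
    have ha0 : a ≠ 0 := by
      rintro rfl
      rw [map_zero] at hab
      exact mul_ne_zero (D.eqn_ne_zero F.1) hb0 hab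
    obtain ⟨n, a', ha', rfl⟩ := WfDvdMonoid.max_power_factor ha0 hp.irreducible
    rw [map_mul, map_pow, pencilHom_X_zero] at hab
    have hu : ∀ c, c ∉ span {(X 0 : Poly (Fin 2) k)} →
        IsUnitAt F.1 (pencilHom u w c) := fun c hc =>
      isUnitAt_of_not (IsPencilChart.mem_localRing hF0 c) (mt (h0.vanishesAt_iff hF0 c).mp hc)
    refine ⟨n, pencilHom u w a' / pencilHom u w b,
      (hu a' (by rwa [mem_span_singleton])).div (hu b hb), ?_⟩
    rw [(eq_mul_inv_iff_mul_eq₀ hb0).mpr hab]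
    ring
  have hu0 := h0.ne_zero
  have hz : ∀ z : Pts F.1.1, D.resEqn F.1 z * valueAt F.1 v ∈ Loc z := by
    intro z
    have ⟨u', w', h', hF', hu', hw', hunit⟩ := h z
    have ⟨q, hq, hXq, hzq⟩ := h'.exists_localRing_eq hu' hw'
    have hu'0 := h'.ne_zero
    have hmem := hD (F.1.incl z)
    rw [hzq] at hmem
    have ⟨a, b, hb, hb0, hab⟩ := mem_locAt.mp hmem
    have hq' : ∀ c, (X 0 : Poly (Fin 2) k) ∣ c → c ∈ q := fun c ⟨e, he⟩ =>
      he ▸ q.mul_mem_right e hXq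
    have hspec : F.1.1 ⤳ (F.1.incl z).1 := z.2
    have huF := hunit.of_specializes hspec
    have hU : IsUnitAt F.1 ((D.eqn (F.1.incl z) : RF δ) / u' ^ n) := by
      have h1 := ((D.isUnitAt hspec).mul hv).div (huF.zpow n)
      rw [zpow_natCast] at h1
      convert h1 using 1
      rw [hDv, div_pow]
      field_simp [hv.1]
    have hdiv : (X 0 : Poly (Fin 2) k) ^ n ∣ a := by
      have h2 := hU.2.2
      rw [hF'] at h2
      have ⟨c, d, hd, hd0, hcd⟩ := mem_locAt.mp h2
      have h3 : a * c = X 0 ^ n * (d * b) := by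
        apply h'.injective
        have hne := D.eqn_ne_zero (F.1.incl z)
        rw [map_mul, map_mul, map_mul, map_pow, pencilHom_X_zero, ← hab, ← hcd]
        field_simp
      refine hp.pow_dvd_of_dvd_mul_right n (fun hc => ?_) ⟨_, h3⟩
      obtain ⟨e, rfl⟩ := hc
      have h4 : (X 0 : Poly (Fin 2) k) ∈ span {X 0} := mem_span_singleton_self _
      have h5 := (h'.vanishesAt_iff hF' (X 0 * e)).mpr (Ideal.mul_mem_right e _ h4)
      rw [← hcd] at h5
      have hdu : IsUnitAt F.1 (pencilHom u' w' d) := isUnitAt_of_not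
        (IsPencilChart.mem_localRing hF' d) (mt (h'.vanishesAt_iff hF' d).mp hd)
      exact h5.not_isUnitAt (hU.inv.mul hdu)
    obtain ⟨a', rfl⟩ := hdiv
    have hmem2 : (D.eqn (F.1.incl z) : RF δ) / u' ^ n ∈
        Loc (F.1.incl z) := by
      rw [hzq]
      refine mem_locAt.mpr ⟨a', b, hb, hb0, ?_⟩
      rw [map_mul, map_pow, pencilHom_X_zero] at hab
      rw [div_mul_eq_mul_div, hab, mul_div_cancel_left₀ _ (pow_ne_zero n hu'0)]
    have hmem3 : (D.eqn (F.1.incl z) : RF δ) / u ^ n ∈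
        Loc (F.1.incl z) := by
      have := mul_mem hmem2 (hunit.zpow n).2.1
      rw [zpow_natCast, div_pow] at this
      convert this using 1
      field_simp
    refine (mem_localRing_sub_iff F.1 z _).mpr ⟨_, hmem3, ?_⟩
    have h6 : (D.eqn (F.1.incl z) : RF δ) / u ^ n =
        ((D.eqn (F.1.incl z) : RF δ) / D.eqn F.1) * v := by
      rw [hDv]
      field_simp [hv.1]
    rw [h6, valueAt_mul F.1 (D.isUnitAt hspec).2.1 hv.2.1]
    simp only [CartierDivisor.resEqn]
  have hg0 := hv.valueAt_ne_zero
  have ⟨hfin, hsum⟩ := exists_finset_ordAt F.2 hg0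
  have e := finsum_add_distrib (D.finite_support F) (hfin.subset fun z hz hu => hz
      ((hasFiniteOrders F.2 z.1).ordAt_unit hu.1 hu.2.1 hu.2.2))
  rw [hsum, add_zero, ← D.degOn_eq_resEqn F] at e
  rw [← e]
  refine finsum_nonneg fun z => ?_
  have hR := hasFiniteOrders F.2 z.1
  rw [← hR.ordAt_mul (D.resEqn_ne_zero F.1 z.1) hg0]
  exact hR.ordAt_nonneg (hz z.1) (mul_ne_zero (D.resEqn_ne_zero F.1 z.1) hg0)

end Pencils

section Degrees
variable {k : Type u} [Field k]

lemma sepExp_cases (S : Marks) (v : Tup) : sepExp S v = 0 ∨ sepExp S v = 1 ∨ sepExp S v = -1 := by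
  unfold sepExp
  split_ifs <;> simp

/-- The restriction to the subvariety `closure {η}` of the local equation of a boundary divisor. -/
def bdryValue (S : Marks) (η : MPts k) (z : Pts η.1) : RF η.1 :=
  valueAt η ((bdryDiv k S).eqn (η.incl z) : RatFun k)

variable {S : Marks} {η : MPts k}

lemma isUnitAt_bdryDiv_eqn_incl (hS : S ∈ bdrySets) (hη : η ∉ boundary k S) (z : Pts η.1) :
    IsUnitAt η ((bdryDiv k S).eqn (η.incl z) : RatFun k) := by
  have h1 := (bdryDiv k S).isUnitAt (x := η.incl z) (y := η) z.2
  have hc := card_bdry hS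
  have h2 := h1.mul (isUnitAt_bdryDiv_eqn hc.1 hc.2 hη)
  rwa [div_mul_cancel₀ _ ((bdryDiv k S).eqn_ne_zero η)] at h2

lemma bdryValue_ne_zero (hS : S ∈ bdrySets) (hη : η ∉ boundary k S) (z : Pts η.1) :
    bdryValue S η z ≠ 0 := (isUnitAt_bdryDiv_eqn_incl hS hη z).valueAt_ne_zero

lemma bdryValue_mem (S : Marks) (η : MPts k) (z : Pts η.1) : bdryValue S η z ∈ Loc z :=
  (mem_localRing_sub_iff η z _).mpr ⟨_, bdryDiv_eqn_mem _ S, rfl⟩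

lemma isUnitAt_bdryValue (hS : S ∈ bdrySets) {z : Pts η.1} (hz : η.incl z ∉ boundary k S) :
    IsUnitAt z (bdryValue S η z) :=
  (isUnitAt_bdryDiv_eqn (card_bdry hS).1 (card_bdry hS).2 hz).restrict

lemma crossRatio_value_mem_or (z : Pts η.1) {v : Tup} (hv : Inj v)
    (hu : IsUnitAt η (CR v)) : valueAt η (CR v) ∈ Loc z ∨
      (valueAt η (CR v))⁻¹ ∈ Loc z := by
  refine (crossRatio_mem_or (η.incl z) hv).imp (fun h => ?_) fun h => ?_
  · exact (mem_localRing_sub_iff η z _).mpr ⟨_, h, rfl⟩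
  · exact (mem_localRing_sub_iff η z _).mpr ⟨_, h, hu.valueAt_inv⟩

lemma isUnitAt_crossRatio {v : Tup} (hv : Inj v)
    (h : ∀ S ∈ bdrySets, η ∈ boundary k S → sepExp S v = 0) : IsUnitAt η (CR v) := by
  have h1 := isUnitAt_crossRatio_div η hv
  have h2 : IsUnitAt η (∏ S ∈ bdrySets, ((bdryDiv k S).eqn η : RatFun k) ^ sepExp S v) := by
    refine IsUnitAt.prod _ fun S hS => ?_
    by_cases hη : η ∈ boundary k S
    · rw [h S hS hη, zpow_zero]; exact isUnitAt_one η
    · exact (isUnitAt_bdryDiv_eqn (card_bdry hS).1 (card_bdry hS).2 hη).zpow _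
  have := h1.mul h2
  rwa [div_mul_cancel₀ _ h2.1] at this

variable [IsAlgClosed k]

lemma ordAt_crossRatio (hη : IsCurvePoint η.1) (z : Pts η.1) {v : Tup}
    (hv : Inj v) (h : ∀ S ∈ bdrySets, η ∈ boundary k S → sepExp S v = 0) :
    ordAt (Loc z) (valueAt η (CR v)) =
      ∑ S ∈ bdrySets, sepExp S v * ordAt (Loc z) (bdryValue S η z) := by
  have hR := hasFiniteOrders hη z
  set B := bdrySets.filter fun S => sepExp S v ≠ 0 with hB
  have hBη : ∀ S ∈ B, S ∈ bdrySets ∧ η ∉ boundary k S := fun S hS => by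
    rw [hB, mem_filter] at hS
    exact ⟨hS.1, fun h' => hS.2 (h S hS.1 h')⟩
  have e1 : ∏ S ∈ bdrySets, ((bdryDiv k S).eqn (η.incl z) : RatFun k) ^ sepExp S v =
      ∏ S ∈ B, ((bdryDiv k S).eqn (η.incl z) : RatFun k) ^ sepExp S v := by
    refine (Finset.prod_filter_of_ne fun S _ h' => mt (fun h0 => ?_) h').symm
    rw [h0, zpow_zero]
  have e2 : ∑ S ∈ bdrySets, sepExp S v * ordAt (Loc z) (bdryValue S η z) =
      ∑ S ∈ B, sepExp S v * ordAt (Loc z) (bdryValue S η z) := by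
    refine (Finset.sum_filter_of_ne fun S _ h' => mt (fun h0 => ?_) h').symm
    rw [h0, zero_mul]
  have hu := isUnitAt_crossRatio_div (η.incl z) hv
  rw [e1] at hu
  have hP : ∀ S ∈ B, IsUnitAt η (((bdryDiv k S).eqn (η.incl z) : RatFun k) ^ sepExp S v) :=
    fun S hS => (isUnitAt_bdryDiv_eqn_incl (hBη S hS).1 (hBη S hS).2 z).zpow _
  have hval : valueAt η (∏ S ∈ B, ((bdryDiv k S).eqn (η.incl z) : RatFun k) ^ sepExp S v) =
      ∏ S ∈ B, bdryValue S η z ^ sepExp S v := by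
    rw [valueAt_prod _ fun S hS => (hP S hS).2.1]
    exact prod_congr rfl fun S hS =>
      (isUnitAt_bdryDiv_eqn_incl (hBη S hS).1 (hBη S hS).2 z).valueAt_zpow _
  have hcr := isUnitAt_crossRatio hv h
  have hr := hu.restrict
  rw [(IsUnitAt.prod B hP).valueAt_div hcr.2.1, hval] at hr
  have hne : ∀ S ∈ B, bdryValue S η z ^ sepExp S v ≠ 0 := fun S hS =>
    zpow_ne_zero _ (bdryValue_ne_zero (hBη S hS).1 (hBη S hS).2 z)
  have h0 := hR.ordAt_unit hr.1 hr.2.1 hr.2.2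
  rw [hR.ordAt_div hcr.valueAt_ne_zero (prod_ne_zero_iff.mpr hne), hR.ordAt_prod _ _ hne,
    sub_eq_zero] at h0
  rw [h0, e2]
  exact sum_congr rfl fun S hS => hR.ordAt_zpow (bdryValue_ne_zero (hBη S hS).1 (hBη S hS).2 z) _

variable (F : Curve (Mbar06 k))

lemma degOn_bdryDiv (hS : S ∈ bdrySets) (hF : F.1 ∉ boundary k S) :
    (Function.support fun z : {z : Pts F.1.1 // z.1 ≠ F.1.1} =>
      ordAt (Loc z.1) (bdryValue S F.1 z.1)).Finite ∧
    (bdryDiv k S).degOn F = ∑ᶠ z : {z : Pts F.1.1 // z.1 ≠ F.1.1},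
      ordAt (Loc z.1) (bdryValue S F.1 z.1) := by
  have hu := isUnitAt_bdryDiv_eqn (card_bdry hS).1 (card_bdry hS).2 hF
  have hg := hu.valueAt_ne_zero
  have ⟨hfin, hsum⟩ := exists_finset_ordAt F.2 hg
  have hfin' : (Function.support fun z : {z : Pts F.1.1 // z.1 ≠ F.1.1} =>
      ordAt (Loc z.1) (valueAt F.1 ((bdryDiv k S).eqn F.1 : RatFun k))).Finite :=
    hfin.subset fun z hz h => hz
      ((hasFiniteOrders F.2 z.1).ordAt_unit h.1 h.2.1 h.2.2)
  have hD := (bdryDiv k S).finite_support F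
  have key : ∀ z : {z : Pts F.1.1 // z.1 ≠ F.1.1}, ordAt (Loc z.1) (bdryValue S F.1 z.1) =
      ordAt (Loc z.1) ((bdryDiv k S).resEqn F.1 z.1) +
      ordAt (Loc z.1) (valueAt F.1 ((bdryDiv k S).eqn F.1 : RatFun k)) := fun z => by
    rw [← (hasFiniteOrders F.2 z.1).ordAt_mul
      ((bdryDiv k S).resEqn_ne_zero F.1 z.1) hg, CartierDivisor.resEqn,
      hu.valueAt_div (isUnitAt_bdryDiv_eqn_incl hS hF z.1).2.1, div_mul_cancel₀ _ hg]
    rfl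
  simp only [key]
  refine ⟨(hD.union hfin').subset (Function.support_add _ _), ?_⟩
  rw [finsum_add_distrib hD hfin', hsum, add_zero, CartierDivisor.degOn_eq_resEqn]

lemma degOn_bdryDiv_nonneg (hS : S ∈ bdrySets) (hF : F.1 ∉ boundary k S) :
    0 ≤ (bdryDiv k S).degOn F := by
  rw [(degOn_bdryDiv F hS hF).2]
  exact finsum_nonneg fun z => (hasFiniteOrders F.2 z.1).ordAt_nonneg
    (bdryValue_mem S F.1 z.1) (bdryValue_ne_zero hS hF z.1)

lemma degOn_bdryDiv_eq_zero (hS : S ∈ bdrySets)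
    (h : ∀ z : Pts F.1.1, F.1.incl z ∉ boundary k S) : (bdryDiv k S).degOn F = 0 := by
  rw [(degOn_bdryDiv F hS (h (Pts.generic _))).2]
  refine finsum_eq_zero_of_forall_eq_zero fun z => ?_
  have hu := isUnitAt_bdryValue hS (h z.1)
  exact (hasFiniteOrders F.2 z.1).ordAt_unit hu.1 hu.2.1 hu.2.2

/-- The number of zeros of a cross-ratio on a curve. -/
lemma sum_degOn_bdryDiv {v : Tup} (hv : Inj v)
    (h : ∀ S ∈ bdrySets, F.1 ∈ boundary k S → sepExp S v = 0) :
    ∑ S ∈ bdrySets with sepExp S v = 1, (bdryDiv k S).degOn F =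
      ∑ᶠ z : {z : Pts F.1.1 // z.1 ≠ F.1.1},
        max (ordAt (Loc z.1) (valueAt F.1 (CR v))) 0 := by
  have hF : ∀ S ∈ bdrySets, sepExp S v ≠ 0 → F.1 ∉ boundary k S := fun S hS h1 h2 => h1 (h S hS h2)
  have hB : ∀ S ∈ bdrySets.filter fun S => sepExp S v = 1, S ∈ bdrySets ∧ F.1 ∉ boundary k S :=
    fun S hS => by rw [mem_filter] at hS; exact ⟨hS.1, hF S hS.1 (by omega)⟩
  rw [sum_congr rfl fun S hS => (degOn_bdryDiv F (hB S hS).1 (hB S hS).2).2,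
    ← finsum_sum_comm _ _ fun S hS => (degOn_bdryDiv F (hB S hS).1 (hB S hS).2).1]
  refine finsum_congr fun z => ?_
  have hR := hasFiniteOrders F.2 z.1
  rw [ordAt_crossRatio F.2 z.1 hv h, Finset.sum_filter]
  have hn : ∀ S ∈ bdrySets, sepExp S v ≠ 0 → 0 ≤ ordAt (Loc z.1) (bdryValue S F.1 z.1) :=
    fun S hS h1 => hR.ordAt_nonneg (bdryValue_mem S F.1 z.1) (bdryValue_ne_zero hS (hF S hS h1) z.1)
  have h0 : ∀ S ∈ bdrySets, F.1.incl z.1 ∉ boundary k S →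
      ordAt (Loc z.1) (bdryValue S F.1 z.1) = 0 := fun S hS h1 => by
    have hu := isUnitAt_bdryValue hS h1
    exact hR.ordAt_unit hu.1 hu.2.1 hu.2.2
  rcases sepExp_sign_of_mem_boundary (F.1.incl z.1) v with hs | hs
  · have e : ∀ S ∈ bdrySets, (if sepExp S v = 1 then
        ordAt (Loc z.1) (bdryValue S F.1 z.1) else 0) =
        sepExp S v * ordAt (Loc z.1) (bdryValue S F.1 z.1) := fun S hS => by
      by_cases hz : F.1.incl z.1 ∈ boundary k S
      · have := hs S hS hz
        rcases sepExp_cases S v with h' | h' | h' <;> simp [h']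
        omega
      · simp [h0 S hS hz]
    rw [sum_congr rfl e, max_eq_left]
    rw [← sum_congr rfl e]
    refine Finset.sum_nonneg fun S hS => ?_
    split_ifs with h1
    · exact hn S hS (by omega)
    · exact le_rfl
  · rw [Finset.sum_eq_zero, max_eq_right]
    · refine Finset.sum_nonpos fun S hS => ?_
      by_cases hz : F.1.incl z.1 ∈ boundary k S
      · have := hs S hS hz
        by_cases h1 : sepExp S v = 0
        · rw [h1, zero_mul]
        · exact mul_nonpos_of_nonpos_of_nonneg this (hn S hS h1)
      · rw [h0 S hS hz, mul_zero]
    · intro S hS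
      split_ifs with h1
      · by_cases hz : F.1.incl z.1 ∈ boundary k S
        · have := hs S hS hz; omega
        · exact h0 S hS hz
      · rfl

lemma degOn_eq_zero_of_const {v : Tup} (hv : Inj v)
    (h : ∀ S ∈ bdrySets, F.1 ∈ boundary k S → sepExp S v = 0) {c : k}
    (hc : valueAt F.1 (CR v) = cst c) (hS : S ∈ bdrySets)
    (hSv : sepExp S v = 1) : (bdryDiv k S).degOn F = 0 := by
  have hs := sum_degOn_bdryDiv F hv h
  rw [finsum_eq_zero_of_forall_eq_zero fun z => ?_] at hs
  · refine (Finset.sum_eq_zero_iff_of_nonneg fun S' hS' => ?_).mp hs S (by simp [hS, hSv])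
    rw [mem_filter] at hS'
    exact degOn_bdryDiv_nonneg F hS'.1 fun h' => by have := h S' hS'.1 h'; omega
  · have hne := (isUnitAt_crossRatio hv h).valueAt_ne_zero
    rw [hc] at hne ⊢
    have hu := isUnitAt_algebraMap z.1 (c := c) (by rintro rfl; simp at hne)
    rw [(hasFiniteOrders F.2 z.1).ordAt_unit hu.1 hu.2.1 hu.2.2]
    rfl

lemma sum_degOn_eq_one {v : Tup} (hv : Inj v)
    (h : ∀ S ∈ bdrySets, F.1 ∈ boundary k S → sepExp S v = 0)
    (hp : IsParameter (valueAt F.1 (CR v))) :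
    ∑ S ∈ bdrySets with sepExp S v = 1, (bdryDiv k S).degOn F = 1 := by
  rw [sum_degOn_bdryDiv F hv h]
  exact hp.finsum_max_ordAt F.2 fun z => crossRatio_value_mem_or z hv (isUnitAt_crossRatio hv h)

lemma sum_sepExp_degCycle (c : Cycle (Mbar06 k)) {v : Tup} (hv : Inj v) :
    ∑ S ∈ bdrySets, (sepExp S v : ℝ) * (bdryDiv k S).degCycle c = 0 := by
  let D : CartierDivisor (Mbar06 k) := CartierDivisor.combination ∅ (bdryDiv k) fun _ => 0
  have hD : ∀ x, (D.eqn x : RatFun k) = 1 := fun x => by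
    change ((∏ i ∈ ∅, (bdryDiv k i).eqn x ^ (0 : ℤ) : (RatFun k)ˣ) : RatFun k) = 1
    rw [Finset.prod_empty, Units.val_one]
  have h1 := D.degCycle_eq_sum bdrySets (bdryDiv k) (fun S => sepExp S v) (CR v)⁻¹
    (fun x => by
      rw [hD]
      convert isUnitAt_crossRatio_div x hv using 1
      rw [inv_mul_eq_div, one_div_div]) c
  have h2 := D.degCycle_eq_sum ∅ (bdryDiv k) (fun S => sepExp S v) 1
    (fun x => by
      rw [hD]
      simpa using isUnitAt_one x) c
  rw [← h1, h2, Finset.sum_empty]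

end Degrees

section Decided
variable {k : Type u} [Field k] {O : Subring (RatFun k)}

/-- The cross-ratio of four marks is a point of the projective line over `O`. -/
def Decided (O : Subring (RatFun k)) (p q r s : Fin 6) : Prop := cr p q r s ∈ O ∨ (cr p q r s)⁻¹ ∈ O

lemma Decided.swap_mid {p q r s : Fin 6} (hn : [p, q, r, s].Nodup) (h : Decided O p q r s) :
    Decided O p r q s := by
  rw [Decided, ← cr_inv hn, inv_inv]
  exact h.symm

lemma Decided.swap_pairs {p q r s : Fin 6} (hn : [p, q, r, s].Nodup) (h : Decided O p q r s) :
    Decided O q p s r := by rwa [Decided, ← cr_swap hn]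

lemma Decided.symm {p q r s : Fin 6} (hn : [p, q, r, s].Nodup) (h : Decided O p q r s) :
    Decided O r s p q := by rwa [Decided, ← cr_symm hn]

lemma Decided.swap_outer [IsLocalRing O] {p q r s : Fin 6} (hn : [p, q, r, s].Nodup)
    (h : Decided O p q r s) : Decided O p s r q := by
  rw [Decided, ← one_sub_cr hn]
  by_cases h1 : cr p q r s ∈ O
  · exact Or.inl (sub_mem (one_mem _) h1)
  · have h2 := h.resolve_left h1
    have h0 : cr (k := k) p q r s ≠ 0 := crossRatio_ne_zero (inj_of_nodup hn)
    right
    rcases IsLocalRing.isUnit_or_isUnit_one_sub_self (⟨_, h2⟩ : O) with hu | hu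
    · rw [isUnit_subring_iff] at hu; exact absurd (by simpa using hu.2) h1
    · rw [isUnit_subring_iff] at hu
      have hm := mul_mem (neg_mem h2) hu.2
      have hne : 1 - (cr p q r s)⁻¹ ≠ 0 := hu.1
      convert hm using 1
      change (1 - cr p q r s)⁻¹ = -(cr p q r s)⁻¹ * (1 - (cr p q r s)⁻¹)⁻¹
      rw [← inv_neg, ← mul_inv]
      congr 1
      field_simp
      ring

lemma Decided.perm_last [IsLocalRing O] {p q r s q' r' s' : Fin 6} (hn : [p, q, r, s].Nodup)
    (hn' : [q', r', s'].Nodup) (hq : q' ∈ [q, r, s]) (hr : r' ∈ [q, r, s]) (hs : s' ∈ [q, r, s])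
    (h : Decided O p q r s) : Decided O p q' r' s' := by
  have h1 := h.swap_mid hn
  have h2 := h.swap_outer hn
  have h3 := h1.swap_outer (by grind)
  have h4 := h2.swap_mid (by grind)
  have h5 := h3.swap_mid (by grind)
  simp only [List.mem_cons, List.not_mem_nil, or_false] at hq hr hs
  rcases hq with rfl | rfl | rfl <;> rcases hr with rfl | rfl | rfl <;>
    rcases hs with rfl | rfl | rfl <;> first | assumption | (exfalso; simp at hn')

lemma Decided.perm [IsLocalRing O] {p q r s p' q' r' s' : Fin 6} (hn : [p, q, r, s].Nodup)
    (hn' : [p', q', r', s'].Nodup) (hs : ∀ x ∈ [p', q', r', s'], x ∈ [p, q, r, s])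
    (h : Decided O p q r s) : Decided O p' q' r' s' := by
  have hp := hs p' (by simp)
  have hq := hs q' (by simp)
  have hr := hs r' (by simp)
  have hs := hs s' (by simp)
  simp only [List.mem_cons, List.not_mem_nil, or_false] at hp
  rcases hp with rfl | rfl | rfl | rfl
  · exact h.perm_last hn (by grind) (by grind) (by grind) (by grind)
  · exact (h.swap_pairs hn).perm_last (by grind) (by grind) (by grind) (by grind) (by grind)
  · exact (h.symm hn).perm_last (by grind) (by grind) (by grind) (by grind) (by grind)
  · exact ((h.symm hn).swap_pairs (by grind)).perm_last (by grind) (by grind) (by grind)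
      (by grind) (by grind)

lemma Decided.replace {p p' q r s : Fin 6} (hn : [p, p', q, r, s].Nodup)
    (hc : Close O p p' q r) (h : Decided O p q r s) : Decided O p' q r s := by
  have h1 := hc.cr_mem (by grind)
  have h2 := hc.swap_right.cr_mem (by grind)
  rw [Decided, cr_mul hn, mul_inv, cr_inv (p := p') (by grind)]
  exact h.imp (fun h => mul_mem h h1) fun h => mul_mem h h2

lemma decided_of_div {a b c : RatFun k} (ha : a ∈ O) (hb : b ∈ O) (h : a⁻¹ ∈ O ∨ b⁻¹ ∈ O)
    (hb0 : b ≠ 0) (hc : c * b = a) : c ∈ O ∨ c⁻¹ ∈ O := by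
  rw [(eq_mul_inv_iff_mul_eq₀ hb0).mpr hc, mul_inv, inv_inv, or_comm]
  exact h.imp (fun h => mul_mem h hb) fun h => mul_mem ha h

lemma mem_of_nodup {a b c d e f : Fin 6} (h : [a, b, c, d, e, f].Nodup) (x : Fin 6) :
    x ∈ [a, b, c, d, e, f] := by
  have ⟨σ, h0, h1, h2, h3, h4, h5⟩ := exists_perm h
  rw [← σ.apply_symm_apply x]
  generalize σ.symm x = y
  fin_cases y <;> simp [h0, h1, h2, h3, h4, h5]

lemma Decided.of_omitted [IsLocalRing O] {p₀ p₁ p₂ p₃ p₄ o : Fin 6}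
    (hn : [p₀, p₁, p₂, p₃, p₄, o].Nodup) (d₀ : Decided O p₁ p₂ p₃ p₄) (d₁ : Decided O p₀ p₂ p₃ p₄)
    (d₂ : Decided O p₀ p₁ p₃ p₄) (d₃ : Decided O p₀ p₁ p₂ p₄) (d₄ : Decided O p₀ p₁ p₂ p₃)
    {p q r s : Fin 6} (hv : [p, q, r, s, o].Nodup) : Decided O p q r s := by
  have hv4 : [p, q, r, s].Nodup := by clear * - hv; grind
  have ⟨z, hz⟩ : ∃ z, [p, q, r, s, o, z].Nodup := by
    have ⟨x, y, hxy⟩ := exists_rest hv4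
    rcases eq_or_ne x o with rfl | hx
    · exact ⟨y, hxy⟩
    · exact ⟨x, by clear * - hx hxy hv; grind⟩
  have hmem : ∀ x ∈ [p, q, r, s], x = p₀ ∨ x = p₁ ∨ x = p₂ ∨ x = p₃ ∨ x = p₄ := fun x hx => by
    have h1 := mem_of_nodup hn x
    have h2 : x ≠ o := by clear * - hx hv; grind
    simpa [h2] using h1
  have hne : ∀ x ∈ [p, q, r, s], x ≠ z := fun x hx => by clear * - hx hz; grind
  have hzz : z = p₀ ∨ z = p₁ ∨ z = p₂ ∨ z = p₃ ∨ z = p₄ := by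
    have h1 := mem_of_nodup hn z
    have h2 : z ≠ o := by rintro rfl; simp at hz
    simpa [h2] using h1
  clear hz
  rcases hzz with rfl | rfl | rfl | rfl | rfl <;>
    [apply d₀.perm; apply d₁.perm; apply d₂.perm; apply d₃.perm; apply d₄.perm]
  all_goals first
    | exact hv4
    | exact fun x hx => by simpa [hne x hx] using hmem x hx
    | (clear * - hn; grind)

lemma Decided.of_close_pair [IsLocalRing O] {e o : Fin 6} (he : e ≠ o)
    (hclose : ∀ r s, [e, o, r, s].Nodup → Close O e o r s)
    (five : ∀ {p q r s : Fin 6}, [p, q, r, s, o].Nodup → Decided O p q r s)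
    {p q r s : Fin 6} (hv : [p, q, r, s].Nodup) : Decided O p q r s := by
  have both : ∀ {r s : Fin 6}, [e, o, r, s].Nodup → Decided O e o r s := fun h =>
    Or.inl (hclose _ _ h).1
  have six : ∀ {q r s : Fin 6}, [o, q, r, s].Nodup → Decided O o q r s := by
    clear hv p q r s
    intro q r s hv
    by_cases hq : q = e
    · subst hq
      exact (both (r := r) (s := s) (by grind)).swap_pairs (by grind) |>.perm_last
        (by grind) (by grind) (by grind) (by grind) (by grind)
    by_cases hr : r = e
    · subst hr; exact (both (r := q) (s := s) (by grind)).perm (by grind) (by grind) (by grind)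
    by_cases hs : s = e
    · subst hs; exact (both (r := q) (s := r) (by grind)).perm (by grind) (by grind) (by grind)
    have hn5 : [e, o, q, r, s].Nodup := by grind
    exact (five (p := e) (q := q) (r := r) (s := s) (by grind)).replace hn5
      (hclose q r (by grind))
  clear hclose both
  by_cases hp : p = o
  · subst hp; exact six hv
  by_cases hq : q = o
  · subst hq; exact (six (q := p) (r := r) (s := s) (by grind)).perm (by grind) hv (by grind)
  by_cases hr : r = o
  · subst hr; exact (six (q := p) (r := q) (s := s) (by grind)).perm (by grind) hv (by grind)
  by_cases hs : s = o
  · subst hs; exact (six (q := p) (r := q) (s := r) (by grind)).perm (by grind) hv (by grind)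
  exact five (by grind)

lemma decided_of_five [IsLocalRing O] {p₀ p₁ p₂ p₃ p₄ o e : Fin 6}
    (hn : [p₀, p₁, p₂, p₃, p₄, o].Nodup) (he : e ≠ o)
    (hclose : ∀ r s, [e, o, r, s].Nodup → Close O e o r s)
    (h1 : cr p₀ p₁ p₃ p₄ ∈ O) (h2 : cr p₀ p₂ p₃ p₄ ∈ O)
    (h0 : (cr p₀ p₁ p₃ p₄)⁻¹ ∈ O ∨ (cr p₀ p₂ p₃ p₄)⁻¹ ∈ O)
    (h3 : (1 - cr p₀ p₁ p₃ p₄)⁻¹ ∈ O ∨ (1 - cr p₀ p₂ p₃ p₄)⁻¹ ∈ O)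
    {p q r s : Fin 6} (hv : [p, q, r, s].Nodup) : Decided O p q r s := by
  have hne : ∀ {p q r s : Fin 6}, [p, q, r, s].Nodup → cr (k := k) p q r s ≠ 0 := fun h =>
    crossRatio_ne_zero (inj_of_nodup h)
  have n1 : [p₀, p₁, p₃, p₄].Nodup := by clear * - hn; grind
  have n2 : [p₀, p₂, p₃, p₄].Nodup := by clear * - hn; grind
  have h1' := sub_mem (one_mem O) h1
  have h2' := sub_mem (one_mem O) h2
  have hd : ∀ {p q : Fin 6}, p ≠ q → tvar k p - tvar k q ≠ 0 := tvar_sub_ne_zero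
  have d0 : Decided O p₃ p₁ p₂ p₄ := by
    refine decided_of_div h1' h2' h3 (by rw [one_sub_cr n2]; exact hne (by clear * - hn; grind)) ?_
    rw [one_sub_cr n1, one_sub_cr n2]
    apply toTField_injective
    rw [map_mul, toTField_cr (by clear * - hn; grind), toTField_cr (by clear * - hn; grind), toTField_cr (by clear * - hn; grind)]
    have := hd (show p₃ ≠ p₂ by clear * - hn; grind)
    have := hd (show p₁ ≠ p₄ by clear * - hn; grind)
    have := hd (show p₀ ≠ p₃ by clear * - hn; grind)
    have := hd (show p₄ ≠ p₂ by clear * - hn; grind)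
    have := hd (show p₄ ≠ p₁ by clear * - hn; grind)
    field_simp
    ring
  have d3 : Decided O p₀ p₁ p₂ p₄ := by
    refine decided_of_div h1 h2 h0 (hne n2) ?_
    rw [mul_comm]
    rw [mul_comm]
    exact cr_mul_cr (by clear * - hn; grind)
  have d4 : Decided O p₀ p₁ p₂ p₃ := by
    refine decided_of_div (mul_mem h1 h2') (mul_mem h2 h1') ?_
      (by rw [one_sub_cr n1]; exact mul_ne_zero (hne n2) (hne (by clear * - hn; grind))) ?_
    · have key : ∀ x y : RatFun k, x ∈ O → x⁻¹ ∈ O ∨ (1 - x)⁻¹ ∈ O := fun x _ hx => by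
        rcases IsLocalRing.isUnit_or_isUnit_one_sub_self (⟨x, hx⟩ : O) with hu | hu
        · exact Or.inl (((isUnit_subring_iff _).mp hu).2)
        · exact Or.inr (((isUnit_subring_iff _).mp hu).2)
      rw [mul_inv, mul_inv]
      rcases h0 with h0 | h0 <;> rcases h3 with h3 | h3
      · rcases key _ 0 h2 with h4 | h4
        · exact Or.inr (mul_mem h4 h3)
        · exact Or.inl (mul_mem h0 h4)
      · exact Or.inl (mul_mem h0 h3)
      · exact Or.inr (mul_mem h0 h3)
      · rcases key _ 0 h1 with h4 | h4
        · exact Or.inl (mul_mem h4 h3)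
        · exact Or.inr (mul_mem h0 h4)
    · rw [one_sub_cr n1, one_sub_cr n2]
      apply toTField_injective
      rw [map_mul, map_mul, map_mul, toTField_cr (by clear * - hn; grind), toTField_cr (by clear * - hn; grind),
        toTField_cr (by clear * - hn; grind), toTField_cr (by clear * - hn; grind), toTField_cr (by clear * - hn; grind)]
      have := hd (show p₀ ≠ p₂ by clear * - hn; grind)
      have := hd (show p₁ ≠ p₃ by clear * - hn; grind)
      have := hd (show p₀ ≠ p₃ by clear * - hn; grind)
      have := hd (show p₂ ≠ p₄ by clear * - hn; grind)
      have := hd (show p₁ ≠ p₄ by clear * - hn; grind)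
      have := hd (show p₄ ≠ p₁ by clear * - hn; grind)
      have := hd (show p₄ ≠ p₂ by clear * - hn; grind)
      field_simp
      ring
  have d0' : Decided O p₁ p₂ p₃ p₄ := d0.perm (by clear * - hn; grind) (by clear * - hn; grind)
    (by clear * - hn; grind)
  exact Decided.of_close_pair he hclose
    (fun h => Decided.of_omitted hn d0' (Or.inl h2) (Or.inl h1) d3 d4 h) hv

lemma Decided.of_split [IsLocalRing O] {i j l m a b : Fin 6}
    (hd : ∀ x, x ∈ [i, j, l] ∨ x ∈ [m, a, b]) (three : ∀ x ∈ [m, a, b], Decided O x i j l)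
    (three' : ∀ x ∈ [i, j, l], Decided O x m a b)
    (two : ∀ {p q r s : Fin 6}, [p, q, r, s].Nodup → p ∈ [i, j, l] → q ∈ [i, j, l] →
      r ∈ [m, a, b] → s ∈ [m, a, b] → Decided O p q r s)
    (hn : [i, j, l, m, a, b].Nodup)
    {p q r s : Fin 6} (hv : [p, q, r, s].Nodup) : Decided O p q r s := by
  have key : ∀ {x y z w : Fin 6}, [p, q, r, s] ⊆ [x, y, z, w] → [x, y, z, w].Nodup := fun h =>
    ((hv.subperm h).perm_of_length_le (by simp)).nodup_iff.mp hv
  have h1 : ∀ {x y z w : Fin 6}, x ∈ [m, a, b] → y ∈ [i, j, l] → z ∈ [i, j, l] → w ∈ [i, j, l] →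
      (_ : [p, q, r, s] ⊆ [x, y, z, w] := by simp) → Decided O p q r s := fun hx hy hz hw h =>
    ((three _ hx).perm_last (by clear * - hx hn; grind) (key h).of_cons hy hz hw).perm (key h) hv h
  have h2 : ∀ {x y z w : Fin 6}, x ∈ [i, j, l] → y ∈ [m, a, b] → z ∈ [m, a, b] → w ∈ [m, a, b] →
      (_ : [p, q, r, s] ⊆ [x, y, z, w] := by simp) → Decided O p q r s := fun hx hy hz hw h =>
    ((three' _ hx).perm_last (by clear * - hx hn; grind) (key h).of_cons hy hz hw).perm (key h) hv h
  have h3 : ∀ {x y z w : Fin 6}, x ∈ [i, j, l] → y ∈ [i, j, l] → z ∈ [m, a, b] → w ∈ [m, a, b] →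
      (_ : [p, q, r, s] ⊆ [x, y, z, w] := by simp) → Decided O p q r s := fun hx hy hz hw h =>
    (two (key h) hx hy hz hw).perm (key h) hv h
  have four : ∀ {c d e : Fin 6}, ¬ ([p, q, r, s] ⊆ [c, d, e]) := fun h => by
    have := (hv.subperm h).length_le
    simp at this
  rcases hd p with hp | hp <;> rcases hd q with hq | hq <;> rcases hd r with hr | hr <;>
    rcases hd s with hs | hs
  · exact absurd (by simp [List.cons_subset, hp, hq, hr, hs]) (four (c := i) (d := j) (e := l))
  · exact h1 hs hp hq hr
  · exact h1 hr hp hq hs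
  · exact h3 hp hq hr hs
  · exact h1 hq hp hr hs
  · exact h3 hp hr hq hs
  · exact h3 hp hs hq hr
  · exact h2 hp hq hr hs
  · exact h1 hp hq hr hs
  · exact h3 hq hr hp hs
  · exact h3 hq hs hp hr
  · exact h2 hq hp hr hs
  · exact h3 hr hs hp hq
  · exact h2 hr hp hq hs
  · exact h2 hs hp hq hr
  · exact absurd (by simp [List.cons_subset, hp, hq, hr, hs]) (four (c := m) (d := a) (e := b))

lemma decided_of_three [IsLocalRing O] {i j l m a b : Fin 6} (hn : [i, j, l, m, a, b].Nodup)
    (hclose : ∀ p ∈ [i, j, l], ∀ q ∈ [i, j, l], ∀ r ∈ [m, a, b], ∀ s ∈ [m, a, b],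
      p ≠ q → r ≠ s → Close O p q r s)
    (h1 : Decided O i j l m) (h2 : Decided O i a b m)
    {p q r s : Fin 6} (hv : [p, q, r, s].Nodup) : Decided O p q r s := by
  have hmem := mem_of_nodup hn
  have cl : ∀ {p q r s : Fin 6}, [p, q, r, s].Nodup → p ∈ [i, j, l] → q ∈ [i, j, l] →
      r ∈ [m, a, b] → s ∈ [m, a, b] → Close O p q r s := fun h hp hq hr hs =>
    hclose _ hp _ hq _ hr _ hs (by grind) (by grind)
  have three : ∀ x ∈ [m, a, b], Decided O x i j l := by
    intro x hx
    have h3 : Decided O m i j l := h1.perm (by clear * - hn; grind) (by clear * - hn; grind)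
      (by clear * - hn; grind)
    rcases eq_or_ne x m with rfl | hne
    · exact h3
    · have h5 : [m, x, i, j, l].Nodup := by clear * - hn hx hne; grind
      have h4 : [i, j, m, x].Nodup := by clear * - h5; grind
      exact h3.replace h5 (Close.symm h4 (cl h4 (by simp) (by simp) (by simp) hx))
  have three' : ∀ x ∈ [i, j, l], Decided O x m a b := by
    intro x hx
    have h3 : Decided O i m a b := h2.perm (by clear * - hn; grind) (by clear * - hn; grind)
      (by clear * - hn; grind)
    rcases eq_or_ne x i with rfl | hne
    · exact h3
    · have h5 : [i, x, m, a, b].Nodup := by clear * - hn hx hne; grind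
      exact h3.replace h5 (cl (by clear * - h5; grind) (by simp) hx (by simp) (by simp))
  have hd : ∀ x : Fin 6, x ∈ [i, j, l] ∨ x ∈ [m, a, b] := fun x => by
    have := hmem x
    simp only [List.mem_cons, List.not_mem_nil, or_false] at this ⊢
    tauto
  have two : ∀ {p q r s : Fin 6}, [p, q, r, s].Nodup → p ∈ [i, j, l] → q ∈ [i, j, l] →
      r ∈ [m, a, b] → s ∈ [m, a, b] → Decided O p q r s := fun h hp hq hr hs =>
    Or.inl (cl h hp hq hr hs).1
  exact Decided.of_split hd three three' two hn hv

end Decided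

section Charts
variable {k : Type u} [Field k]

/-- The functions which are regular at `x` with value in `B`. -/
def compositeRing (x : MPts k) (B : Subring (RF x.1)) :
    Subring (RatFun k) := (B.comap (valHom x)).map (Loc x).subtype

variable {x : MPts k} {B : Subring (RF x.1)}

lemma mem_compositeRing {g : RatFun k} : g ∈ compositeRing x B ↔ g ∈ Loc x ∧ valueAt x g ∈ B := by
  constructor
  · rintro ⟨h, hB, rfl⟩; exact ⟨h.2, hB⟩
  · rintro ⟨h, hB⟩; exact ⟨⟨g, h⟩, hB, rfl⟩

instance isLocalRing_compositeRing [IsLocalRing B] : IsLocalRing (compositeRing x B) := by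
  let f : compositeRing x B →+* B :=
    { toFun := fun g => ⟨valueAt x g.1, (mem_compositeRing.mp g.2).2⟩
      map_one' := Subtype.ext (valueAt_one x)
      map_zero' := Subtype.ext (valueAt_zero x)
      map_add' := fun a b => Subtype.ext
        (valueAt_add x (mem_compositeRing.mp a.2).1 (mem_compositeRing.mp b.2).1)
      map_mul' := fun a b => Subtype.ext
        (valueAt_mul x (mem_compositeRing.mp a.2).1 (mem_compositeRing.mp b.2).1) }
  have : IsLocalHom f := ⟨fun a ha => by
    rw [isUnit_subring_iff] at ha ⊢
    have hu : IsUnitAt x a.1 := (isUnitAt_iff_valueAt (mem_compositeRing.mp a.2).1).mpr ha.1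
    refine ⟨hu.1, mem_compositeRing.mpr ⟨hu.2.2, ?_⟩⟩
    rw [hu.valueAt_inv]
    exact ha.2⟩
  exact f.domain_isLocalRing

lemma close_compositeRing {S : Marks} (hx : x ∈ boundary k S) {p q r s : Fin 6}
    (hn : [p, q, r, s].Nodup) (hp : p ∈ S) (hq : q ∈ S) (hr : r ∉ S) (hs : s ∉ S) :
    Close (compositeRing x B) p q r s := by
  have key : ∀ {r s}, [p, q, r, s].Nodup → r ∉ S → s ∉ S → cr p q r s ∈ compositeRing x B :=
    fun {r s} hn hr hs => by
      have h := hx ![p, q, r, s] (inj_of_nodup hn) (by simpa) (by simpa) (by simpa)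
        (by simpa)
      refine mem_compositeRing.mpr ⟨h.mem, ?_⟩
      rw [(valueAt_eq_zero_iff x h.mem).mpr h]
      exact zero_mem B
  exact ⟨key hn hr hs, key (by grind) hs hr⟩

lemma IsBdryPoint.two_le_trdeg {S : Marks} {δ : MPts k} (h : IsBdryPoint S δ) :
    2 ≤ Algebra.trdeg k (RF δ.1) := by
  have ⟨T, n, _, hδ⟩ := h
  have hval : T.Valid (Loc δ) := Chart.valid_of_eq_locAt hδ fun i j hij =>
    chartUnit_notMem_span_X T.1 n hij
  have hmem := hval.hom_mem_localRing
  let y : {m : Fin 3 // m ≠ n} → RF δ.1 := fun m => valueAt δ (T.gen k m.1)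
  have hval' : ∀ Q : Poly {m : Fin 3 // m ≠ n} k,
      aeval y Q = valueAt δ (T.hom k (rename Subtype.val Q)) := fun Q => by
    induction Q using MvPolynomial.induction_on with
    | C c =>
      rw [rename_C, aeval_C, ← MvPolynomial.algebraMap_eq, AlgHom.commutes, valueAt_algebraMap]
    | add p q hp hq => rw [map_add, map_add, map_add, valueAt_add δ (hmem _) (hmem _), hp, hq]
    | mul_X p i hp =>
      rw [map_mul, map_mul, map_mul, valueAt_mul δ (hmem _) (hmem _), hp, aeval_X, rename_X,
        Chart.hom_X]
  have hind : AlgebraicIndependent k y := by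
    rw [AlgebraicIndependent, injective_iff_map_eq_zero]
    intro Q hQ
    rw [hval', valueAt_eq_zero_iff δ (hmem _), Chart.vanishesAt_iff_mem_span hδ,
      mem_span_singleton] at hQ
    have ⟨R, hR⟩ := hQ
    have h1 := congrArg (aeval (R := k) fun m : Fin 3 => if h : m ≠ n then
      (X ⟨m, h⟩ : Poly {m : Fin 3 // m ≠ n} k) else 0) hR
    rw [map_mul, aeval_X, dif_neg (by simp), zero_mul, aeval_rename] at h1
    rw [← h1]
    conv_lhs => rw [← aeval_X_left_apply (R := k) Q]
    congr 2
    funext m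
    simp [m.2]
  have hcard := hind.lift_cardinalMk_le_trdeg
  have : Cardinal.mk {m : Fin 3 // m ≠ n} = 2 := by
    rw [Cardinal.mk_fintype, Fintype.card_subtype_compl]
    simp
  rw [this] at hcard
  simpa using hcard

/-- The functions `r y₁ + s y₂ + t` and `y₂` are coordinates on the surface, if the cross-ratios
`y₁` and `y₂` decide all cross-ratios. -/
lemma isPencilChart_of_decided {δ : MPts k} (hδ : 2 ≤ Algebra.trdeg k (RF δ.1)) {v₁ v₂ : Tup}
    (hv₁ : Inj v₁) (hv₂ : Inj v₂) (hu₁ : IsUnitAt δ (CR v₁)) (hu₂ : IsUnitAt δ (CR v₂))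
    {r s t : k} (hr : r ≠ 0)
    (hdec : ∀ (B : Subring (RF δ.1)) [IsLocalRing B], (∀ c, algebraMap k _ c ∈ B) →
      valueAt δ (crossRatio k v₁) ∈ B → valueAt δ (CR v₂) ∈ B →
      ((∀ g ∈ B, g⁻¹ ∈ B) ∨
        (cst r * valueAt δ (CR v₁) + cst s * valueAt δ (CR v₂) + cst t)⁻¹ ∉ B) →
      ∀ p q a b : Fin 6, [p, q, a, b].Nodup → Decided (compositeRing δ B) p q a b) :
    IsPencilChart (cst r * valueAt δ (CR v₁) + cst s * valueAt δ (CR v₂) + cst t)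
      (valueAt δ (CR v₂)) := by
  set y₁ := valueAt δ (CR v₁)
  set y₂ := valueAt δ (CR v₂)
  set u := cst r * y₁ + cst s * y₂ + cst t with hu
  have hy₁ : y₁ = cst r⁻¹ * (u - cst s * y₂ - cst t) := by
    rw [hu, map_inv₀]
    have : algebraMap k (RF δ.1) r ≠ 0 := by simpa using hr
    field_simp
    ring
  have hmem₁ : ∀ B : Subring (RF δ.1), (∀ c, algebraMap k _ c ∈ B) → u ∈ B → y₂ ∈ B → y₁ ∈ B := fun B hk h1 h2 => by
    rw [hy₁]
    exact mul_mem (hk _) (sub_mem (sub_mem h1 (mul_mem (hk _) h2)) (hk _))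
  have hratio : ∀ (B : Subring (RF δ.1)) [IsLocalRing B],
      (∀ c, algebraMap k _ c ∈ B) → u ∈ B → y₂ ∈ B → ((∀ g ∈ B, g⁻¹ ∈ B) ∨ u⁻¹ ∉ B) →
      ∀ v : Quad, (CR v ∈ Loc δ ∧ valueAt δ (CR v) ∈ B) ∨
      ((CR v)⁻¹ ∈ Loc δ ∧ valueAt δ (CR v)⁻¹ ∈ B) := by
    intro B _ hk h1 h2 h3 v
    have e : (v : Tup) = ![v 0, v 1, v 2, v 3] := by funext n; fin_cases n <;> rfl
    have hn : [v 0, v 1, v 2, v 3].Nodup := by have := v.injective; simp [this.eq_iff]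
    have := hdec B hk (hmem₁ B hk h1 h2) h2 h3 _ _ _ _ hn
    rw [Decided, cr, ← e] at this
    exact this.imp mem_compositeRing.mp mem_compositeRing.mp
  have hfrac : ∀ g, g ∈ IntermediateField.adjoin k (Set.range ![u, y₂]) := by
    let E := IntermediateField.adjoin k (Set.range ![u, y₂])
    have : IsLocalRing E.toSubfield.toSubring := inferInstanceAs (IsLocalRing E)
    exact mem_of_ratios δ E.toSubfield E.algebraMap_mem (hratio E.toSubfield.toSubring
      E.algebraMap_mem (IntermediateField.subset_adjoin k _ ⟨0, rfl⟩)
      (IntermediateField.subset_adjoin k _ ⟨1, rfl⟩) (Or.inl fun _ => E.inv_mem))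
  have hinj : Inj (pencilHom u y₂) := by
    have : Algebra.IsAlgebraic (Algebra.adjoin k (Set.range ![u, y₂])) (RF δ.1) := ⟨fun g => by
      have ⟨a, ha, b, hb, hab⟩ := IntermediateField.mem_adjoin_iff_div.mp (hfrac g)
      have h := fun c : Algebra.adjoin k (Set.range ![u, y₂]) =>
        isAlgebraic_algebraMap (A := RF δ.1) c
      rw [hab, div_eq_mul_inv]
      exact (h ⟨a, ha⟩).mul (h ⟨b, hb⟩).inv⟩
    exact (Algebra.IsAlgebraic.isTranscendenceBasis_of_lift_le_trdeg_of_finite k ![u, y₂]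
      (by simpa using hδ)).1
  set P := pencilHom u y₂ with hP
  refine ⟨hinj, fun g => ?_, fun q hq hX => ?_⟩
  · have ⟨a, b, hab⟩ := (IntermediateField.mem_adjoin_range_iff k _ g).mp (hfrac g)
    by_cases hb : aeval ![u, y₂] b = 0
    · exact ⟨0, 1, by simp, by simp [hab, hb]⟩
    · exact ⟨a, b, hb, hab ▸ div_mul_cancel₀ _ hb⟩
  · have hker : RingHom.ker P ≤ q := by
      rw [(RingHom.injective_iff_ker_eq_bot _).mp hinj]
      exact bot_le
    have := isLocalRing_locAt hker
    set R := locAt P q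
    have hk : ∀ c, cst c ∈ R := fun c => by have := map_mem_locAt P q (C c); rwa [pencilHom_C] at this
    have hmu : u ∈ R := by have := map_mem_locAt P q (X 0); rwa [pencilHom_X_zero] at this
    have hmy : y₂ ∈ R := by have := map_mem_locAt P q (X 1); rwa [pencilHom_X_one] at this
    have hu0 : P (X 0) ≠ 0 := fun h0 =>
      X_ne_zero (R := k) (0 : Fin 2) (hinj (h0.trans (map_zero _).symm))
    have hinv : u⁻¹ ∉ R := fun h' => by
      have := (inv_map_mem_locAt_iff hker hu0).mp (by rwa [pencilHom_X_zero])
      exact this hX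
    have ⟨z, hz⟩ := exists_center_of_ratios δ _ hk (hratio _ hk hmu hmy (Or.inr hinv))
    have hreg : ∀ {v : Tup}, Inj v → IsUnitAt δ (CR v) → valueAt δ (CR v) ∈ R →
        valueAt δ (CR v) ∈ Loc z := fun hv hvu h' =>
      (crossRatio_value_mem_or z hv hvu).elim id fun h'' => by
        have := hz.inv_mem _ h'' (by rwa [inv_inv])
        rwa [inv_inv] at this
    have hz₂ := hreg hv₂ hu₂ hmy
    have hz₁ := hreg hv₁ hu₁ (hmem₁ _ hk hmu hmy)
    have hzu : u ∈ Loc z := add_mem (add_mem (mul_mem (cst_mem z _) hz₁)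
      (mul_mem (cst_mem z _) hz₂)) (cst_mem z _)
    have hza := pencilHom_mem_localRing hzu hz₂
    refine ⟨z, hz.localRing_eq fun g hg => ?_⟩
    have ⟨a, b, hb, hb0, hab⟩ := mem_locAt.mp hg
    exact ⟨_, hza a, _, hza b, hb0, inv_map_mem_locAt hker hb, hab⟩

end Charts

section PencilCurves
variable {σ : Type} {k : Type u} [Field k] {δ : PS σ k} {y u w : RF δ}

lemma mem_sub_of_mem_incl {F : Pts δ} {z : Pts F.1} {g : RF δ}
    (hg : g ∈ Loc (F.incl z)) : valueAt F g ∈ Loc z :=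
  (mem_localRing_sub_iff F z _).mpr ⟨g, hg, rfl⟩

lemma classOf_eq_of_unique {Z : Set (Pts δ)} (F : Curve δ) (hF : F.1 ∈ Z)
    (h : ∀ C : Curve δ, C.1 ∈ Z → C = F) : classOf Z = cls (Finsupp.single F 1) := by
  let _ : Unique {C : Curve δ // C.1 ∈ Z} :=
    { default := ⟨F, hF⟩, uniq := fun C => Subtype.ext (h C.1 C.2) }
  rw [classOf, finsum_unique]
  rfl

lemma IsParameter.of_mem {η : PS σ k} {y w : RF η} (h : IsParameter w)
    (hy : ∀ L : Subfield (RF η), (∀ c, algebraMap k _ c ∈ L) → y ∈ L → w ∈ L) :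
    IsParameter y where
  mem L hk hL := h.mem L hk (hy L hk hL)
  transcendental hal := by
    refine h.transcendental (mem_algebraicClosure_iff.mp ?_)
    exact hy (algebraicClosure k (RF η)).toSubfield
      (fun c => (algebraicClosure k _).algebraMap_mem c) (mem_algebraicClosure_iff.mpr hal)

variable [Finite σ] [IsAlgClosed k]

omit [Finite σ] [IsAlgClosed k] in
lemma value_mem_or {F : Pts δ} (hw : ∀ z : Pts δ, w ∈ Loc z ∨ w⁻¹ ∈ Loc z)
    (hF : IsUnitAt F w) (z : Pts F.1) :
    valueAt F w ∈ Loc z ∨ (valueAt F w)⁻¹ ∈ Loc z := by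
  rw [← hF.valueAt_inv]
  exact (hw (F.incl z)).imp mem_sub_of_mem_incl mem_sub_of_mem_incl

lemma exists_curve_of_pencil (h : IsPencilChart u w) (hw : ∀ z : Pts δ, w ∈ Loc z ∨ w⁻¹ ∈ Loc z) :
    ∃ F : Curve δ, Loc F.1 = locAt (pencilHom u w) (span {X 0}) ∧
      VanishesAt F.1 u ∧ IsUnitAt F.1 w ∧ IsParameter (valueAt F.1 w) ∧
      ∀ C : Curve δ, VanishesAt C.1 u → w ∈ Loc C.1 → C = F := by
  have ⟨η, hη⟩ := h.point (span {X 0}) (mem_span_singleton_self _)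
  have ⟨hu, hwη, hp⟩ := h.isParameter hη
  have hunit : IsUnitAt η w := (isUnitAt_iff_valueAt hwη).mpr hp.ne_zero
  refine ⟨⟨η, hp.isCurvePoint (value_mem_or hw hunit)⟩, hη, hu, hunit, hp, fun C hC hwC => ?_⟩
  rcases h.eq_or_exists_const hC hwC with h' | ⟨c, hc⟩
  · exact Subtype.ext (eq_of_localRing_eq (h'.trans hη.symm))
  · exact absurd (h.isClosed hC hc) C.2.1

/-- The fibre `y = c` of a pencil, which is covered by two charts. -/
lemma exists_fibre_of_pencil {c : k} (hc : c ≠ 0) (h : IsPencilChart (y - cst c) w)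
    (h' : IsPencilChart (y⁻¹ - cst c⁻¹) w⁻¹)
    (hy : ∀ z : Pts δ, y ∈ Loc z ∨ y⁻¹ ∈ Loc z)
    (hw : ∀ z : Pts δ, w ∈ Loc z ∨ w⁻¹ ∈ Loc z) :
    ∃ F : Curve δ, VanishesAt F.1 (y - cst c) ∧ IsUnitAt F.1 w ∧
      IsParameter (valueAt F.1 w) ∧
      (∀ C : Curve δ, VanishesAt C.1 (y - cst c) → C = F) ∧
      ∀ D : CartierDivisor δ, D.IsEffective → 0 ≤ D.degOn F := by
  have ⟨F, hF, hu, hwF, hp, huniq⟩ := exists_curve_of_pencil h hw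
  have hcK : algebraMap k (RF δ) c ≠ 0 := by simpa using hc
  have hunit : ∀ z : Pts δ, VanishesAt z (y - cst c) →
      IsUnitAt z ((y⁻¹ - cst c⁻¹) / (y - cst c)) := by
    intro z hz
    have hyz : IsUnitAt z y := by
      rw [isUnitAt_iff_valueAt (mem_localRing_of_sub hz), valueAt_of_sub hz]
      simpa using hc
    have h1 := (isUnitAt_algebraMap z (neg_ne_zero.mpr (inv_ne_zero hc))).mul hyz.inv
    convert h1 using 1
    rw [div_eq_iff h.ne_zero, map_neg, map_inv₀]
    have := hyz.1
    field_simp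
    ring
  have hvan : ∀ z : Pts δ, VanishesAt z (y - cst c) →
      VanishesAt z (y⁻¹ - cst c⁻¹) := fun z hz => by
    have := VanishesAt.mul_left (hunit z hz).2.1 hz
    rwa [div_mul_cancel₀ _ h.ne_zero] at this
  have hF' : Loc F.1 = locAt (pencilHom (y⁻¹ - cst c⁻¹) w⁻¹)
      (span {X 0}) := by
    rcases h'.eq_or_exists_const (hvan _ hu) hwF.2.2 with h1 | ⟨c', hc'⟩
    · exact h1
    · exact absurd (h'.isClosed (hvan _ hu) hc') F.2.1
  refine ⟨F, hu, hwF, hp, fun C hC => ?_, fun D hD => ?_⟩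
  · by_cases hwC : w ∈ Loc C.1
    · exact huniq C hC hwC
    · have h1 := (hw C.1).resolve_left hwC
      have h2 : VanishesAt C.1 w⁻¹ := by
        by_contra h3
        exact hwC (by simpa using (isUnitAt_of_not h1 h3).2.2)
      exact absurd (h'.isClosed (c := 0) (hvan _ hC) (by simpa using h2)) C.2.1
  · refine degOn_nonneg_of_pencil F h hF (fun z => ?_) D hD
    have hyF := valueAt_of_sub hu
    have hz : VanishesAt (F.1.incl z) (y - cst c) := by
      have hym : y ∈ Loc (F.1.incl z) := by
        rcases hy (F.1.incl z) with h1 | h1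
        · exact h1
        · have hyu : IsUnitAt F.1 y := by
            rw [isUnitAt_iff_valueAt (mem_localRing_of_sub hu), hyF]
            simpa using hc
          have h2 := valueAt_valueAt F.1 z h1
          rw [hyu.valueAt_inv, hyF, ← map_inv₀, valueAt_algebraMap] at h2
          have h3 : IsUnitAt (F.1.incl z) y⁻¹ := by
            rw [isUnitAt_iff_valueAt h1, ← h2]
            simpa using hc
          simpa using h3.2.2
      have hm : y - cst c ∈ Loc (F.1.incl z) := sub_mem hym (cst_mem _ c)
      rw [← valueAt_eq_zero_iff _ hm, ← valueAt_valueAt F.1 z hm,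
        (valueAt_eq_zero_iff _ hu.mem).mpr hu, valueAt_zero]
    rcases hw (F.1.incl z) with h1 | h1
    · exact ⟨_, w, h, hF, hz, h1, by rw [div_self h.ne_zero]; exact isUnitAt_one _⟩
    · exact ⟨_, w⁻¹, h', hF', hvan _ hz, h1, hunit _ hz⟩

end PencilCurves

section BoundaryCurves
variable {k : Type u} [Field k] {δ : MPts k}

lemma value_mem_localRing_iff {v : Tup} (hv : Inj v) (hu : IsUnitAt δ (CR v)) (z : Pts δ.1) :
    valueAt δ (CR v) ∈ Loc z ↔ CR v ∈ Loc (δ.incl z) := by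
  refine ⟨fun h => ?_, mem_sub_of_mem_incl⟩
  by_contra h1
  have h2 := (crossRatio_mem_or (δ.incl z) hv).resolve_left h1
  have h3 : VanishesAt (δ.incl z) (CR v)⁻¹ := by
    by_contra h3
    exact h1 (by simpa using (isUnitAt_of_not h2 h3).2.2)
  have h4 := valueAt_valueAt δ z h2
  rw [(valueAt_eq_zero_iff _ h2).mpr h3] at h4
  have h5 := valueAt_mul z h (mem_sub_of_mem_incl h2)
  rw [h4, hu.valueAt_inv, mul_inv_cancel₀ hu.valueAt_ne_zero, valueAt_one, mul_zero] at h5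
  exact one_ne_zero h5

lemma sepExp_pair_eq_zero {e o p q r s : Fin 6} (hn : [p, q, r, s, o].Nodup) :
    sepExp {e, o} ![p, q, r, s] = 0 := by
  have h1 : p ≠ o ∧ q ≠ o ∧ r ≠ o ∧ s ≠ o ∧ p ≠ q ∧ p ≠ r ∧ s ≠ q ∧ s ≠ r := by simp at hn; grind
  simp only [sepExp, mem_insert, mem_singleton, Matrix.cons_val]
  split_ifs <;> simp_all

lemma IsBdryPoint.isUnitAt_crossRatio {S : Marks} (h : IsBdryPoint S δ) {v : Tup} (hv : Inj v)
    (hS : sepExp S v = 0) : IsUnitAt δ (CR v) :=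
  M06.isUnitAt_crossRatio hv fun S' hS' hδ => by
    rwa [sepExp_of_match ((h.mem_boundary_iff (card_bdry hS').1 (card_bdry hS').2).mp hδ)] at hS

lemma IsBdryPoint.unit {e o p q r s : Fin 6} (hδ : IsBdryPoint {e, o} δ)
    (h : [p, q, r, s, o].Nodup) : IsUnitAt δ (cr p q r s) :=
  hδ.isUnitAt_crossRatio inj_of_nodup (sepExp_pair_eq_zero h)

lemma mem_compositeRing_iff {B : Subring (RF δ.1)} {g : RatFun k}
    (hg : IsUnitAt δ g) : (g ∈ compositeRing δ B ↔ valueAt δ g ∈ B) ∧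
      (g⁻¹ ∈ compositeRing δ B ↔ (valueAt δ g)⁻¹ ∈ B) := by
  rw [mem_compositeRing, mem_compositeRing, hg.valueAt_inv]
  exact ⟨and_iff_right hg.2.1, and_iff_right hg.2.2⟩

lemma inv_mem_or_inv_mem {L : Type*} [Field L] [Algebra k L] {B : Subring L} [IsLocalRing B]
    (hk : ∀ c, algebraMap k _ c ∈ B) {y z : L} (hy : y ∈ B) (hz : z ∈ B) {r s t : k} (ht : t ≠ 0)
    (h : (∀ g ∈ B, g⁻¹ ∈ B) ∨ (cst r * y + cst s * z + cst t)⁻¹ ∉ B) :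
    y⁻¹ ∈ B ∨ z⁻¹ ∈ B := by
  rcases h with h | h
  · exact Or.inl (h _ hy)
  by_contra! h4
  have hmax : ∀ {g} (hg : g ∈ B), g⁻¹ ∉ B → (⟨g, hg⟩ : B) ∈ maximalIdeal B := by
    intro g hg h4
    rw [mem_maximalIdeal, mem_nonunits_iff, isUnit_subring_iff]
    exact fun h5 => h4 h5.2
  have hm := hmax (add_mem (add_mem (mul_mem (hk r) hy) (mul_mem (hk s) hz)) (hk t)) h
  have h5 : (⟨_, hk t⟩ : B) ∈ maximalIdeal B := by
    convert sub_mem (sub_mem hm (Ideal.mul_mem_left _ ⟨_, hk r⟩ (hmax hy h4.1)))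
      (Ideal.mul_mem_left _ ⟨_, hk s⟩ (hmax hz h4.2)) using 1
    refine Subtype.ext ?_
    change _ = _ - _ * _ - _ * _
    ring
  rw [mem_maximalIdeal, mem_nonunits_iff, isUnit_subring_iff] at h5
  exact h5 ⟨by simpa using ht, by rw [← map_inv₀]; exact hk _⟩

/-- Coordinates on `D_{eo}`, near the curve `r y₁ + s y₂ + t = 0`. -/
lemma isPencilChart_five {p₀ p₁ p₂ p₃ p₄ o e : Fin 6} (hn : [p₀, p₁, p₂, p₃, p₄, o].Nodup)
    (he : e ≠ o) (hδ : IsBdryPoint {e, o} δ) {r s t : k} (hr : r ≠ 0) (ht : t ≠ 0)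
    (hrst : r + s + t ≠ 0) :
    IsPencilChart (cst r * valueAt δ (cr p₀ p₁ p₃ p₄) +
      cst s * valueAt δ (cr p₀ p₂ p₃ p₄) + cst t)
      (valueAt δ (cr p₀ p₂ p₃ p₄)) := by
  have n1 : [p₀, p₁, p₃, p₄, o].Nodup := by grind
  have n2 : [p₀, p₂, p₃, p₄, o].Nodup := by grind
  have u1 := hδ.unit n1
  have u2 := hδ.unit n2
  have u1' : IsUnitAt δ (1 - cr p₀ p₁ p₃ p₄) := by rw [one_sub_cr (by grind)]; exact hδ.unit (by grind)
  have u2' : IsUnitAt δ (1 - cr p₀ p₂ p₃ p₄) := by rw [one_sub_cr (by grind)]; exact hδ.unit (by grind)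
  refine isPencilChart_of_decided hδ.two_le_trdeg inj_of_nodup
    inj_of_nodup u1 u2 hr ?_
  intro B _ hk h1 h2 h3 p q a b hpq
  have hone : ∀ {g : RatFun k}, g ∈ Loc δ → valueAt δ (1 - g) = 1 - valueAt δ g := by
    intro g hg
    have h4 := valueAt_add δ (sub_mem (one_mem _) hg) hg
    rw [sub_add_cancel, valueAt_one] at h4
    rw [h4, add_sub_cancel_right]
  have hclose : ∀ r s, [e, o, r, s].Nodup → Close (compositeRing δ B) e o r s := fun r s h =>
    close_compositeRing hδ.mem_boundary h (by simp) (by simp) (by simp; grind) (by simp; grind)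
  refine decided_of_five hn he hclose ((mem_compositeRing_iff u1).1.mpr h1)
    ((mem_compositeRing_iff u2).1.mpr h2) ?_ ?_ hpq
  · rw [(mem_compositeRing_iff u1).2, (mem_compositeRing_iff u2).2]
    exact inv_mem_or_inv_mem hk h1 h2 ht h3
  · rw [(mem_compositeRing_iff u1').2, (mem_compositeRing_iff u2').2, hone u1.2.1, hone u2.2.1]
    refine inv_mem_or_inv_mem hk (sub_mem (one_mem _) h1) (sub_mem (one_mem _) h2) hrst
      (r := -r) (s := -s) ?_
    convert h3 using 4
    simp only [map_neg, map_add]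
    ring

lemma isPencilChart_three {i j l m a b : Fin 6} (hn : [i, j, l, m, a, b].Nodup)
    (hδ : IsBdryPoint {i, j, l} δ) (c : k) :
    IsPencilChart (valueAt δ (cr i j l m) - cst c) (valueAt δ (cr i a b m)) := by
  have n1 : [i, j, l, m].Nodup := by grind
  have n2 : [i, a, b, m].Nodup := by grind
  have hne : i ≠ m ∧ j ≠ m ∧ l ≠ m ∧ i ≠ a ∧ j ≠ a ∧ l ≠ a ∧ i ≠ b ∧ j ≠ b ∧ l ≠ b := by
    simp at hn; grind
  have u1 : IsUnitAt δ (cr i j l m) := hδ.isUnitAt_crossRatio (inj_of_nodup n1)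
    (by simp [sepExp])
  have u2 : IsUnitAt δ (cr i a b m) := hδ.isUnitAt_crossRatio (inj_of_nodup n2) (by
    simp [sepExp, hne.1.symm, hne.2.1.symm, hne.2.2.1.symm, hne.2.2.2.1.symm,
      hne.2.2.2.2.1.symm, hne.2.2.2.2.2.1.symm, hne.2.2.2.2.2.2.1.symm, hne.2.2.2.2.2.2.2.1.symm,
      hne.2.2.2.2.2.2.2.2.symm])
  have := isPencilChart_of_decided hδ.two_le_trdeg (inj_of_nodup n1)
    (inj_of_nodup n2) u1 u2 (r := 1) (s := 0) (t := -c) one_ne_zero ?_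
  · simpa [sub_eq_add_neg] using this
  intro B _ hk h1 h2 h3 p q r s hpq
  refine decided_of_three hn (fun p hp q hq r hr s hs hpq hrs => ?_)
    (Or.inl ((mem_compositeRing_iff u1).1.mpr h1))
    (Or.inl ((mem_compositeRing_iff u2).1.mpr h2)) hpq
  have hr' : ∀ r ∈ [m, a, b], r ∉ ({i, j, l} : Marks) := fun r hr => by
    simp at hr ⊢; clear * - hne hr; grind
  have hp' : ∀ p ∈ [i, j, l], p ∈ ({i, j, l} : Marks) := fun p hp => by simpa using hp
  refine close_compositeRing hδ.mem_boundary ?_ (hp' p hp) (hp' q hq) (hr' r hr) (hr' s hs)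
  have h5 := hp' p hp
  have h6 := hp' q hq
  have h7 := hr' r hr
  have h8 := hr' s hs
  simp only [List.nodup_cons, List.mem_cons, List.not_mem_nil, or_false, not_or]
  exact ⟨⟨hpq, fun h => h7 (h ▸ h5), fun h => h8 (h ▸ h5)⟩,
    ⟨fun h => h7 (h ▸ h6), fun h => h8 (h ▸ h6)⟩, hrs, by simp⟩

end BoundaryCurves

section ModuliCurves

lemma vanishesAt_sub_iff {σ : Type} {k : Type u} [Field k] {δ : PS σ k} (x : Pts δ)
    (g : RF δ) (c : k) : VanishesAt x (g - cst c) ↔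
      g ∈ Loc x ∧ valueAt x g = cst c := by
  refine ⟨fun h => ⟨mem_localRing_of_sub h, valueAt_of_sub h⟩, fun ⟨h, h'⟩ => ?_⟩
  have hm := sub_mem h (cst_mem x c)
  have h1 := valueAt_add x hm (cst_mem x c)
  rw [sub_add_cancel, h', valueAt_algebraMap, right_eq_add] at h1
  exact (valueAt_eq_zero_iff x hm).mp h1

variable {k : Type u} [Field k] {δ : MPts k}

lemma vanishesAt_iff_valueAt (z : Pts δ.1) {g : RatFun k} (hg : g ∈ Loc (δ.incl z)) :
    VanishesAt (δ.incl z) g ↔ VanishesAt z (valueAt δ g) := by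
  rw [← valueAt_eq_zero_iff _ hg, ← valueAt_valueAt δ z hg,
    valueAt_eq_zero_iff _ (mem_sub_of_mem_incl hg)]

lemma isUnitAt_push {v : Tup} (hv : Inj v)
    (hu : IsUnitAt δ (CR v)) {z : Pts δ.1} (hz : IsUnitAt z (valueAt δ (CR v))) :
    IsUnitAt (δ.incl z) (CR v) ∧
      valueAt (δ.incl z) (CR v) = valueAt z (valueAt δ (CR v)) := by
  have h1 := (value_mem_localRing_iff hv hu z).mp hz.2.1
  refine ⟨?_, (valueAt_valueAt δ z h1).symm⟩
  rw [isUnitAt_iff_valueAt h1, ← valueAt_valueAt δ z h1]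
  exact hz.valueAt_ne_zero

lemma pushCycle_single (F : Curve δ.1) (r : ℝ) :
    pushCycle δ (Finsupp.single F r) = Finsupp.single (Curve.push δ F) r := by
  simp [pushCycle, Finsupp.lmapDomain_apply]

lemma IsBdryPoint.exists_curve {S : Marks} (hδ : IsBdryPoint S δ) {C : Curve (Mbar06 k)}
    (hC : C.1 ∈ boundary k S) : ∃ C' : Curve δ.1, Curve.push δ C' = C :=
  ⟨⟨⟨C.1.1, (hδ.mem_boundary_iff_specializes _).mp hC⟩, C.2⟩, rfl⟩

/-- The equation of a line, in terms of two cross-ratios. -/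
abbrev lineEqn (k : Type u) [Field k] (p₀ p₁ p₂ p₃ p₄ : Fin 6) (r s t : k) : RatFun k :=
  const k r * cr p₀ p₁ p₃ p₄ + const k s * cr p₀ p₂ p₃ p₄ + const k t

lemma valueAt_lineEqn {p₀ p₁ p₂ p₃ p₄ : Fin 6} {r s t : k} (h₁ : cr p₀ p₁ p₃ p₄ ∈ Loc δ)
    (h₂ : cr p₀ p₂ p₃ p₄ ∈ Loc δ) : lineEqn k p₀ p₁ p₂ p₃ p₄ r s t ∈ Loc δ ∧
      valueAt δ (lineEqn k p₀ p₁ p₂ p₃ p₄ r s t) =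
        cst r * valueAt δ (cr p₀ p₁ p₃ p₄) +
        cst s * valueAt δ (cr p₀ p₂ p₃ p₄) + cst t := by
  have hk : ∀ c : k, cst c ∈ Loc δ := cst_mem δ
  have h3 := mul_mem (hk r) h₁
  have h4 := mul_mem (hk s) h₂
  simp only [lineEqn, const_eq]
  exact ⟨add_mem (add_mem h3 h4) (hk t), by
    rw [valueAt_add _ (add_mem h3 h4) (hk t), valueAt_add _ h3 h4, valueAt_mul _ (hk r) h₁,
      valueAt_mul _ (hk s) h₂, valueAt_algebraMap, valueAt_algebraMap, valueAt_algebraMap]⟩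

lemma notMem_boundary_of_line {p₀ p₁ p₂ p₃ p₄ o : Fin 6} (hn : [p₀, p₁, p₂, p₃, p₄, o].Nodup)
    {r s t : k} (h : VanishesAt δ (lineEqn k p₀ p₁ p₂ p₃ p₄ r s t)) (ht : t ≠ 0)
    (hrst : r + s + t ≠ 0) {S : Marks} (hp₁ : p₁ ∉ S) (hp₂ : p₂ ∉ S) (hp₄ : p₄ ∈ S)
    (hS : p₃ ∈ S ↔ p₀ ∉ S) (z : Pts δ.1) : δ.incl z ∉ boundary k S := by
  have m1 : [p₀, p₁, p₃, p₄].Nodup := by grind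
  have m2 : [p₀, p₂, p₃, p₄].Nodup := by grind
  have hz : ∀ a b : k, VanishesAt (δ.incl z) (cr p₀ p₁ p₃ p₄ - cst a) →
      VanishesAt (δ.incl z) (cr p₀ p₂ p₃ p₄ - cst b) → r * a + s * b + t = 0 := by
    intro a b ha hb
    have ⟨ha, ha'⟩ := (vanishesAt_sub_iff _ _ _).mp ha
    have ⟨hb, hb'⟩ := (vanishesAt_sub_iff _ _ _).mp hb
    have ⟨h4, h5⟩ := valueAt_lineEqn (r := r) (s := s) (t := t) ha hb
    rw [← valueAt_valueAt δ z h4, (valueAt_eq_zero_iff _ h.mem).mpr h, valueAt_zero, ha',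
      hb', ← map_mul, ← map_mul, ← map_add, ← map_add] at h5
    exact (map_eq_zero_iff _ (algebraMap k _).injective).mp h5.symm
  intro hb
  by_cases hp₃ : p₃ ∈ S
  · have h0 : ∀ q ∉ S, [p₀, q, p₃, p₄].Nodup →
        VanishesAt (δ.incl z) (cr p₀ q p₃ p₄ - algebraMap k _ 0) := fun q hqS hq => by
      rw [map_zero, sub_zero, cr_symm hq]
      exact hb _ inj_of_nodup hp₃ hp₄ (hS.mp hp₃) hqS
    exact ht (by simpa using hz 0 0 (h0 _ hp₁ m1) (h0 _ hp₂ m2))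
  · have h1 : ∀ q ∉ S, [p₀, q, p₃, p₄].Nodup →
        VanishesAt (δ.incl z) (cr p₀ q p₃ p₄ - algebraMap k _ 1) := fun q hqS hq => by
      have h6 : VanishesAt (δ.incl z) (cr p₀ p₄ p₃ q) :=
        hb _ inj_of_nodup (by simpa using mt hS.mpr hp₃) hp₄ hp₃ hqS
      rw [← one_sub_cr hq] at h6
      have h7 := h6.mul_left (neg_mem (one_mem (Loc (δ.incl z))))
      rw [map_one]
      convert h7 using 1
      ring
    exact hrst (by simpa using hz 1 1 (h1 _ hp₁ m1) (h1 _ hp₂ m2))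

variable [IsAlgClosed k]

/-- A fibre of a boundary divisor over a point of a line. -/
lemma exists_fibre {S : Marks} (hδ : IsBdryPoint S δ) {v w : Tup} (hv : Inj v) (hw : Inj w)
    (hvS : IsUnitAt δ (CR v)) (hwS : IsUnitAt δ (CR w)) {c : k} (hc : c ≠ 0)
    (h : IsPencilChart (valueAt δ (CR v) - cst c) (valueAt δ (CR w)))
    (h' : IsPencilChart (valueAt δ (CR v)⁻¹ - cst c⁻¹)
      (valueAt δ (CR w)⁻¹)) :
    ∃ F : Curve (Mbar06 k), F.1 ∈ boundary k S ∧ IsUnitAt F.1 (CR v) ∧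
      IsUnitAt F.1 (CR w) ∧ valueAt F.1 (CR v) = cst c ∧
      IsParameter (valueAt F.1 (CR w)) ∧
      fibreClass k (boundary k S) v c = cls (Finsupp.single F 1) ∧
      cls (Finsupp.single F 1) ∈ imageNM1 δ := by
  rw [hvS.valueAt_inv, hwS.valueAt_inv] at h'
  have ⟨G, hG, hwG, hp, huniq, hNM⟩ := exists_fibre_of_pencil hc h h'
    (fun z => crossRatio_value_mem_or z hv hvS) (fun z => crossRatio_value_mem_or z hw hwS)
  have ⟨hG1, hG2⟩ := (vanishesAt_sub_iff _ _ _).mp hG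
  have hvG : IsUnitAt G.1 (valueAt δ (CR v)) := by
    rw [isUnitAt_iff_valueAt hG1, hG2]
    simpa using hc
  have ⟨h1, h2⟩ := isUnitAt_push hv hvS hvG
  have ⟨h3, h4⟩ := isUnitAt_push hw hwS hwG
  have key : ∀ z : Pts δ.1, VanishesAt (δ.incl z) (CR v - const k c) ↔
      VanishesAt z (valueAt δ (CR v) - cst c) := by
    intro z
    rw [const_eq, vanishesAt_sub_iff, vanishesAt_sub_iff, value_mem_localRing_iff hv hvS]
    exact and_congr_right fun hm => by rw [valueAt_valueAt δ z hm]
  have hm : (Curve.push δ G).1 ∈ boundary k S := (hδ.mem_boundary_iff_specializes _).mpr G.1.2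
  refine ⟨Curve.push δ G, hm, h1, h3, h2.trans hG2, ?_, ?_, Finsupp.single G 1, ?_, ?_⟩
  · have : valueAt (Curve.push δ G).1 (CR w) = _ := h4; rwa [this]
  · refine classOf_eq_of_unique _ ⟨hm, (key _).mpr hG⟩ fun C hC => ?_
    obtain ⟨C', rfl⟩ := hδ.exists_curve hC.1
    rw [huniq C' ((key _).mp hC.2)]
  · rw [cls_mem_NM1_iff]
    intro D hD
    rw [D.degCycle_single, one_mul]
    exact_mod_cast hNM D hD
  · rw [pushCycle_single]

/-- The fibres of the maps of `D_{eo}` that forget a mark. -/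
lemma exists_fibre_five {p₀ p₁ p₂ p₃ p₄ o e : Fin 6} (hn : [p₀, p₁, p₂, p₃, p₄, o].Nodup)
    (he : e ≠ o) (hδ : IsBdryPoint {e, o} δ) {c : k} (hc : c ≠ 0) (hc1 : c ≠ 1) :
    ∃ F : Curve (Mbar06 k), F.1 ∈ boundary k {e, o} ∧ IsUnitAt F.1 (cr p₀ p₁ p₃ p₄) ∧
      IsUnitAt F.1 (cr p₀ p₂ p₃ p₄) ∧ valueAt F.1 (cr p₀ p₁ p₃ p₄) = cst c ∧
      IsParameter (valueAt F.1 (cr p₀ p₂ p₃ p₄)) ∧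
      fibreClass k (boundary k {e, o}) ![p₀, p₁, p₃, p₄] c = cls (Finsupp.single F 1) ∧
      cls (Finsupp.single F 1) ∈ imageNM1 δ := by
  have n1 : [p₀, p₁, p₃, p₄, o].Nodup := by grind
  have n2 : [p₀, p₂, p₃, p₄, o].Nodup := by grind
  refine exists_fibre hδ inj_of_nodup inj_of_nodup
    (hδ.unit n1) (hδ.unit n2) hc ?_ ?_
  · have := isPencilChart_five hn he hδ (r := (1 : k)) (s := 0) (t := -c) one_ne_zero
      (neg_ne_zero.mpr hc) (by simpa [← sub_eq_add_neg, sub_eq_zero] using hc1.symm)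
    simpa [sub_eq_add_neg] using this
  · have inv : ∀ q, [p₀, q, p₃, p₄].Nodup → (cr (k := k) p₀ q p₃ p₄)⁻¹ = cr p₄ q p₃ p₀ := fun q h => by
      rw [cr_inv h, cr_symm (by grind), cr_swap (by grind)]
    rw [inv _ (by grind), inv _ (by grind)]
    have := isPencilChart_five (p₀ := p₄) (p₁ := p₁) (p₂ := p₂) (p₃ := p₃) (p₄ := p₀) (by grind)
      he hδ (r := (1 : k)) (s := 0) (t := -c⁻¹) one_ne_zero (neg_ne_zero.mpr (inv_ne_zero hc))
      (by
        rw [add_zero, ← sub_eq_add_neg, sub_ne_zero]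
        exact fun h => hc1 (inv_eq_one.mp h.symm))
    simpa [sub_eq_add_neg] using this

/-- The fibres of the projections of `D_{ijl}`. -/
lemma exists_fibre_three {i j l m a b : Fin 6} (hn : [i, j, l, m, a, b].Nodup)
    (hδ : IsBdryPoint {i, j, l} δ) {c : k} (hc : c ≠ 0) :
    ∃ F : Curve (Mbar06 k), F.1 ∈ boundary k {i, j, l} ∧ IsUnitAt F.1 (cr i j l m) ∧
      IsUnitAt F.1 (cr i a b m) ∧ valueAt F.1 (cr i j l m) = cst c ∧
      IsParameter (valueAt F.1 (cr i a b m)) ∧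
      fibreClass k (boundary k {i, j, l}) ![i, j, l, m] c = cls (Finsupp.single F 1) ∧
      cls (Finsupp.single F 1) ∈ imageNM1 δ := by
  have h := isPencilChart_three hn hδ c
  have hδ' : IsBdryPoint {i, l, j} δ := by rwa [Finset.pair_comm l j]
  have h' := isPencilChart_three (i := i) (j := l) (l := j) (m := m) (a := b) (b := a) (by grind)
    hδ' c⁻¹
  have hne : i ≠ m ∧ j ≠ m ∧ l ≠ m ∧ i ≠ a ∧ j ≠ a ∧ l ≠ a ∧ i ≠ b ∧ j ≠ b ∧ l ≠ b := by
    simp at hn; grind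
  refine exists_fibre hδ inj_of_nodup inj_of_nodup
    (hδ.isUnitAt_crossRatio inj_of_nodup ?_)
    (hδ.isUnitAt_crossRatio inj_of_nodup ?_) hc h ?_
  · simp [sepExp]
  · simp only [sepExp, mem_insert, mem_singleton, Matrix.cons_val]; grind
  · rwa [cr_inv (by grind), cr_inv (by grind)]

/-- The lines of the plane to which `D_{eo}` is blown down. -/
lemma exists_line {p₀ p₁ p₂ p₃ p₄ o e : Fin 6} (hn : [p₀, p₁, p₂, p₃, p₄, o].Nodup)
    (he : e ≠ o) (hδ : IsBdryPoint {e, o} δ) {r s t : k} (hr : r ≠ 0) (hs : s ≠ 0) (ht : t ≠ 0)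
    (hrst : r + s + t ≠ 0) :
    ∃ F : Curve (Mbar06 k), F.1 ∈ boundary k {e, o} ∧
      (IsUnitAt F.1 (cr p₀ p₁ p₃ p₄) ∧ IsParameter (valueAt F.1 (cr p₀ p₁ p₃ p₄))) ∧
      (IsUnitAt F.1 (cr p₀ p₂ p₃ p₄) ∧ IsParameter (valueAt F.1 (cr p₀ p₂ p₃ p₄))) ∧
      (IsUnitAt F.1 (cr p₀ p₁ p₂ p₄) ∧ IsParameter (valueAt F.1 (cr p₀ p₁ p₂ p₄))) ∧
      (∀ S : Marks, p₁ ∉ S → p₂ ∉ S → p₄ ∈ S → (p₃ ∈ S ↔ p₀ ∉ S) →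
        ∀ z : Pts F.1.1, F.1.incl z ∉ boundary k S) ∧
      lineClass k (boundary k {e, o}) p₄ p₀ p₁ p₂ p₃ r s t = cls (Finsupp.single F 1) := by
  have n1 : [p₀, p₁, p₃, p₄, o].Nodup := by grind
  have n2 : [p₀, p₂, p₃, p₄, o].Nodup := by grind
  have m1 : [p₀, p₁, p₃, p₄].Nodup := by grind
  have m2 : [p₀, p₂, p₃, p₄].Nodup := by grind
  have hC := isPencilChart_five hn he hδ hr ht hrst
  have ⟨G, _, hG, hwG, hp, huniq⟩ := exists_curve_of_pencil hC
    (fun z => crossRatio_value_mem_or z inj_of_nodup (hδ.unit n2))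
  set Y₁ := valueAt δ (cr p₀ p₁ p₃ p₄)
  set Y₂ := valueAt δ (cr p₀ p₂ p₃ p₄)
  have hrK : algebraMap k (RF δ.1) r ≠ 0 := by simpa using hr
  have hY₁ : Y₁ ∈ Loc G.1 := by
    have h1 := mul_mem (cst_mem G.1 r⁻¹) (sub_mem (sub_mem hG.mem (mul_mem (cst_mem G.1 s) hwG.2.1)) (cst_mem G.1 t))
    convert h1 using 1
    rw [map_inv₀]
    field_simp
    ring
  have hc1 := (value_mem_localRing_iff inj_of_nodup (hδ.unit n1) G.1).mp hY₁
  have hc2 := (value_mem_localRing_iff inj_of_nodup (hδ.unit n2) G.1).mp hwG.2.1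
  have ⟨h2, hv2⟩ := isUnitAt_push inj_of_nodup (hδ.unit n2) hwG
  have hu : ∀ z : Pts δ.1, cr p₀ p₁ p₃ p₄ ∈ Loc (δ.incl z) →
      cr p₀ p₂ p₃ p₄ ∈ Loc (δ.incl z) → (VanishesAt (δ.incl z)
      (lineEqn k p₀ p₁ p₂ p₃ p₄ r s t) ↔
      VanishesAt z (cst r * Y₁ + cst s * Y₂ + cst t)) := by
    intro z h1 h2
    rw [vanishesAt_iff_valueAt z (valueAt_lineEqn h1 h2).1,
      (valueAt_lineEqn (hδ.unit n1).2.1 (hδ.unit n2).2.1).2]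
  have hFu := (hu G.1 hc1 hc2).mpr hG
  let F := Curve.push δ G
  have hm : F.1 ∈ boundary k {e, o} := (hδ.mem_boundary_iff_specializes _).mpr G.1.2
  have hp2 : IsParameter (valueAt F.1 (cr p₀ p₂ p₃ p₄)) := by
    have : valueAt F.1 (cr p₀ p₂ p₃ p₄) = _ := hv2
    rwa [this]
  have hrel : cst r * valueAt F.1 (cr p₀ p₁ p₃ p₄) +
      cst s * valueAt F.1 (cr p₀ p₂ p₃ p₄) + cst t = 0 :=
    (valueAt_lineEqn (δ := F.1) hc1 hc2).2.symm.trans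
      ((valueAt_eq_zero_iff F.1 hFu.mem).mpr hFu)
  have hkF : ∀ {c : k}, c ≠ 0 → algebraMap k (RF F.1.1) c ≠ 0 := fun h => by simpa using h
  have hp1 : IsParameter (valueAt F.1 (cr p₀ p₁ p₃ p₄)) := hp2.of_mem fun L hL hy => by
    have h1 := neg_mem (mul_mem (inv_mem (hL s)) (add_mem (mul_mem (hL r) hy) (hL t)))
    convert h1 using 1
    have := hkF hs
    field_simp
    linear_combination hrel
  have h1 : IsUnitAt F.1 (cr p₀ p₁ p₃ p₄) := (isUnitAt_iff_valueAt hc1).mpr hp1.ne_zero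
  have hcr : cr (k := k) p₀ p₁ p₃ p₄ = cr p₀ p₁ p₂ p₄ * cr p₀ p₂ p₃ p₄ := by
    apply toTField_injective
    rw [map_mul, toTField_cr m1, toTField_cr m2, toTField_cr (by grind)]
    have e1 := tvar_ne k p₀ p₂
    have e2 := tvar_ne k p₂ p₄
    field_simp
  have h3 : IsUnitAt F.1 (cr p₀ p₁ p₂ p₄) := by
    rw [← mul_div_cancel_right₀ (cr p₀ p₁ p₂ p₄) h2.1, ← hcr]; exact h1.div h2
  have hv3 : valueAt F.1 (cr p₀ p₁ p₃ p₄) =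
      valueAt F.1 (cr p₀ p₁ p₂ p₄) * valueAt F.1 (cr p₀ p₂ p₃ p₄) := by
    rw [← valueAt_mul _ h3.2.1 h2.2.1, ← hcr]
  refine ⟨F, hm, ⟨h1, hp1⟩, ⟨h2, hp2⟩, ⟨h3, hp2.of_mem fun L hL hy => ?_⟩,
    fun S a b c d => notMem_boundary_of_line hn hFu ht hrst a b c d, ?_⟩
  · rw [hv3] at hrel
    have hne : cst r * valueAt F.1 (cr p₀ p₁ p₂ p₄) + cst s ≠ 0 := by
      intro h0
      refine hkF ht ?_
      linear_combination hrel - valueAt F.1 (cr p₀ p₂ p₃ p₄) * h0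
    have := neg_mem (mul_mem (hL t) (inv_mem (add_mem (mul_mem (hL r) hy) (hL s))))
    convert this using 1
    field_simp
    linear_combination hrel
  · refine classOf_eq_of_unique _ ⟨hm, hc1, hc2, hFu⟩ fun C hCC => ?_
    obtain ⟨C', rfl⟩ := hδ.exists_curve hCC.1
    rw [huniq C' ((hu _ hCC.2.1 hCC.2.2.1).mp hCC.2.2.2) (mem_sub_of_mem_incl hCC.2.2.1)]

end ModuliCurves

section Vectors

/-- The number of marks on the same side of the node as `i`. -/
def sideCard (S : Marks) (i : Fin 6) : ℕ := if i ∈ S then S.card else 6 - S.card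

/-- The intersection numbers of `A_{ij}` with the boundary divisors. -/
def vecA (i j : Fin 6) (S : Marks) : ℤ :=
  if i ∈ S ↔ j ∈ S then if sideCard S i = 2 then -2 else if sideCard S i = 3 then 1 else 0 else 0

/-- The intersection numbers of `A_{ij;l}` with the boundary divisors. -/
def vecA' (i j l : Fin 6) (S : Marks) : ℤ :=
  if i ∈ S ↔ j ∈ S then
    if sideCard S i = 2 then -1 else
    if i ∈ S ↔ l ∈ S then if sideCard S i = 3 then 1 else 0 else
    if sideCard S l = 2 then 1 else 0
  else 0

/-- The intersection numbers of `B_{ijl}` with the boundary divisors. -/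
def vecB (i j l : Fin 6) (S : Marks) : ℤ :=
  if (i ∈ S ↔ j ∈ S) ∧ (i ∈ S ↔ l ∈ S) then
    if sideCard S i = 3 then -1 else if sideCard S i = 4 then 1 else 0
  else 0

/-- The intersection numbers of `C_{ij}` with the boundary divisors. -/
def vecC (i j : Fin 6) (S : Marks) : ℤ :=
  if i ∈ S ↔ j ∈ S then if sideCard S i = 2 then -1 else if sideCard S i = 4 then 1 else 0 else 0

/-- The intersection numbers of `C_{ij;l}` with the boundary divisors. -/
def vecC' (i j l : Fin 6) (S : Marks) : ℤ :=
  if i ∈ S ↔ j ∈ S then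
    if sideCard S i = 2 then -2 else
    if i ∈ S ↔ l ∈ S then if sideCard S i = 4 then 1 else 0 else
    if sideCard S i = 3 then 1 else 0
  else 0

lemma sideCard_compl (S : Marks) (i : Fin 6) : sideCard Sᶜ i = sideCard S i := by
  have : S.card ≤ 6 := by simpa using S.card_le_univ
  simp only [sideCard, mem_compl, Finset.card_compl, Fintype.card_fin]
  split_ifs <;> omega

lemma sideCard_map (σ : Equiv.Perm (Fin 6)) (S : Marks) (i : Fin 6) :
    sideCard (S.map σ.toEmbedding) (σ i) = sideCard S i := by simp [sideCard]

lemma vec_compl (i j l : Fin 6) (S : Marks) : vecA i j Sᶜ = vecA i j S ∧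
    vecA' i j l Sᶜ = vecA' i j l S ∧ vecB i j l Sᶜ = vecB i j l S ∧ vecC i j Sᶜ = vecC i j S ∧
    vecC' i j l Sᶜ = vecC' i j l S := by
  simp only [vecA, vecA', vecB, vecC, vecC', sideCard_compl, mem_compl, not_iff_not, and_self]

lemma vec_map (σ : Equiv.Perm (Fin 6)) (i j l : Fin 6) (S : Marks) :
    vecA (σ i) (σ j) (S.map σ.toEmbedding) = vecA i j S ∧
    vecA' (σ i) (σ j) (σ l) (S.map σ.toEmbedding) = vecA' i j l S ∧
    vecB (σ i) (σ j) (σ l) (S.map σ.toEmbedding) = vecB i j l S ∧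
    vecC (σ i) (σ j) (S.map σ.toEmbedding) = vecC i j S ∧
    vecC' (σ i) (σ j) (σ l) (S.map σ.toEmbedding) = vecC' i j l S := by
  have h : ∀ i, σ i ∈ S.map σ.toEmbedding ↔ i ∈ S := by simp
  simp only [vecA, vecA', vecB, vecC, vecC', sideCard_map, h, and_self]

lemma vec_swap (i j l : Fin 6) (S : Marks) : vecA' i j l S = vecA' j i l S ∧
    vecC i j S = vecC j i S ∧ vecC' i j l S = vecC' j i l S := by
  by_cases hi : i ∈ S <;> by_cases hj : j ∈ S <;> simp [vecA', vecC, vecC', sideCard, hi, hj]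

lemma map_compl (σ : Equiv.Perm (Fin 6)) (S : Marks) :
    Sᶜ.map σ.toEmbedding = (S.map σ.toEmbedding)ᶜ := by
  ext i
  simp [Finset.mem_map_equiv]

lemma forall_of_bdrySets {p : Marks → Prop} (σ : Equiv.Perm (Fin 6))
    (hc : ∀ S, p S → p Sᶜ) (h : ∀ T ∈ bdrySets, p (T.map σ.toEmbedding)) {S : Marks}
    (hS : 2 ≤ S.card) (hS' : S.card ≤ 4) : p S := by
  have ⟨T, hT, h1, _⟩ := exists_bdrySet (S.map σ.symm.toEmbedding) (by simpa) (by simpa)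
  have e : S = (S.map σ.symm.toEmbedding).map σ.toEmbedding := by ext; simp
  rw [e]
  rcases h1 with h1 | h1 <;> rw [h1]
  · exact h T hT
  · exact map_compl σ T ▸ hc _ (h T hT)

lemma sum_bdrySets_map {f : Marks → ℝ} (hf : ∀ S, f Sᶜ = f S) (σ : Equiv.Perm (Fin 6)) :
    ∑ S ∈ bdrySets, f (S.map σ.toEmbedding) = ∑ S ∈ bdrySets, f S := by
  have two : ∀ g : Marks → ℝ, (∀ S, g Sᶜ = g S) →
      ∑ S with 2 ≤ S.card ∧ S.card ≤ 4, g S = 2 * ∑ S ∈ bdrySets, g S := by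
    intro g hg
    have e : (Finset.univ.filter fun S : Marks => 2 ≤ S.card ∧ S.card ≤ 4) =
        bdrySets ∪ bdrySets.map ⟨compl, compl_injective⟩ := by decide +kernel
    rw [e, Finset.sum_union (by decide +kernel), Finset.sum_map, two_mul]
    simp [hg]
  have h1 := two f hf
  rw [← Finset.sum_equiv (Equiv.finsetCongr σ) (s := Finset.univ.filter fun S : Marks =>
    2 ≤ S.card ∧ S.card ≤ 4) (f := fun S => f (S.map σ.toEmbedding)) (by simp) (by simp),
    two _ fun S => by rw [map_compl, hf]] at h1
  linarith

/-- None of the four parts into which `S` and `T` divide the marks is empty. -/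
def Crosses (S T : Marks) : Prop :=
  ∃ a ∈ S, a ∈ T ∧ ∃ b ∈ S, b ∉ T ∧ ∃ c ∈ T, c ∉ S ∧ ∃ d, d ∉ S ∧ d ∉ T

instance (S T : Marks) : Decidable (Crosses S T) := by unfold Crosses; infer_instance

lemma Crosses.map {S T : Marks} (h : Crosses S T) (σ : Equiv.Perm (Fin 6)) :
    Crosses (S.map σ.toEmbedding) (T.map σ.toEmbedding) := by
  have ⟨a, h1, h2, b, h3, h4, c, h5, h6, d, h7, h8⟩ := h
  exact ⟨σ a, by simpa, by simpa, σ b, by simpa, by simpa, σ c, by simpa, by simpa, σ d, by simpa,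
    by simpa⟩

/-- The intersection numbers of a one-cycle on the boundary divisor of `T` with the boundary
divisors: they are invariant under complements, they vanish on the divisors that do not meet it,
and they satisfy the linear equivalences given by the cross-ratios. -/
structure IsBdryVec (T : Marks) (g : Marks → ℝ) : Prop where
  rel : ∀ v : Tup, Inj v → ∑ S ∈ bdrySets, (sepExp S v : ℝ) * g S = 0
  zero : ∀ S ∈ bdrySets, Crosses S T → g S = 0

lemma sum_eq_list {T : Marks} {g : Marks → ℝ} (hg : IsBdryVec T g) {L : List (Marks)} (hn : L.Nodup)
    (hL : L.toFinset = bdrySets.filter fun S => ¬ Crosses S T) (m : Marks → ℝ) :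
    ∑ S ∈ bdrySets, m S * g S = (L.map fun S => m S * g S).sum := by
  rw [← List.sum_toFinset _ hn, hL]
  refine (Finset.sum_filter_of_ne (p := fun S => ¬ Crosses S T) fun S hS h h' => h ?_).symm
  rw [hg.zero S hS h', mul_zero]

/-- The boundary divisors that meet `D_{01}`. -/
abbrev pairList : List (Marks) := [{0, 1}, {0, 1, 2}, {0, 1, 3}, {0, 1, 4}, {0, 1, 5},
  {2, 3}, {2, 4}, {2, 5}, {3, 4}, {3, 5}, {4, 5}]

/-- The boundary divisors that meet `D_{012}`. -/
abbrev tripleList : List (Marks) := [{0, 1, 2}, {0, 1}, {0, 2}, {1, 2},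
  {3, 4}, {3, 5}, {4, 5}]

lemma nodup_pairList : pairList.Nodup := by decide

lemma nodup_tripleList : tripleList.Nodup := by decide

lemma toFinset_pairList : pairList.toFinset = bdrySets.filter fun S => ¬ Crosses S {0, 1} := by
  decide +kernel

lemma toFinset_tripleList :
    tripleList.toFinset = bdrySets.filter fun S => ¬ Crosses S {0, 1, 2} := by decide +kernel

lemma IsBdryVec.pair {g : Marks → ℝ} (hg : IsBdryVec {0, 1} g) :
    ∃ x y₂ y₃ y₄ y₅ : ℝ, pairList.map g = [-(x + x) - y₂ - y₃ - y₄ - y₅, x + y₂, x + y₃, x + y₄, x + y₅,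
      y₂ + y₃, y₂ + y₄, y₂ + y₅, y₃ + y₄, y₃ + y₅, y₄ + y₅] := by
  have rel : ∀ p q r s : Fin 6, [p, q, r, s].Nodup →
      (pairList.map fun S => (sepExp S ![p, q, r, s] : ℝ) * g S).sum = 0 := fun p q r s h => by
    rw [← sum_eq_list hg nodup_pairList toFinset_pairList]
    exact hg.rel _ (inj_of_nodup h)
  have h1 := rel 0 1 2 3 (by decide)
  have h2 := rel 2 3 4 5 (by decide)
  have h3 := rel 2 3 5 4 (by decide)
  have h4 := rel 0 3 4 5 (by decide)
  have h5 := rel 0 3 5 4 (by decide)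
  have h6 := rel 0 2 4 5 (by decide)
  have h7 := rel 0 2 5 4 (by decide)
  simp [sepExp] at h1 h2 h3 h4 h5 h6 h7
  refine ⟨(g {0, 1, 2} + g {0, 1, 3} - g {2, 3}) / 2, (g {0, 1, 2} + g {2, 3} - g {0, 1, 3}) / 2,
    (g {0, 1, 3} + g {2, 3} - g {0, 1, 2}) / 2, (g {2, 4} + g {3, 4} - g {2, 3}) / 2,
    (g {2, 5} + g {3, 5} - g {2, 3}) / 2, ?_⟩
  simp only [List.map_cons, List.map_nil, List.cons.injEq, and_true]
  refine ⟨?_, ?_, ?_, ?_, ?_, ?_, ?_, ?_, ?_, ?_, ?_⟩ <;> linarith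

lemma IsBdryVec.triple {g : Marks → ℝ} (hg : IsBdryVec {0, 1, 2} g) :
    ∃ x y : ℝ, tripleList.map g = [-x - y, x, x, x, y, y, y] := by
  have rel : ∀ p q r s : Fin 6, [p, q, r, s].Nodup →
      (tripleList.map fun S => (sepExp S ![p, q, r, s] : ℝ) * g S).sum = 0 := fun p q r s h => by
    rw [← sum_eq_list hg nodup_tripleList toFinset_tripleList]
    exact hg.rel _ (inj_of_nodup h)
  have h1 := rel 0 1 2 3 (by decide)
  have h2 := rel 0 1 3 2 (by decide)
  have h3 := rel 0 3 4 5 (by decide)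
  have h4 := rel 0 3 5 4 (by decide)
  have h5 := rel 0 1 3 4 (by decide)
  simp [sepExp] at h1 h2 h3 h4 h5
  refine ⟨g {0, 1}, g {3, 4}, ?_⟩
  simp only [List.map_cons, List.map_nil, List.cons.injEq, and_true]
  refine ⟨?_, trivial, ?_, ?_, trivial, ?_, ?_⟩ <;> linarith

lemma IsBdryVec.ext {T : Marks} {g : Marks → ℝ} (hg : IsBdryVec T g)
    {L : List (Marks)} (hL : L.toFinset = bdrySets.filter fun S => ¬ Crosses S T)
    {f : Marks → ℝ} (hf : ∀ S ∈ bdrySets, Crosses S T → f S = 0)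
    (h : L.map g = L.map f) : ∀ S ∈ bdrySets, g S = f S := by
  intro S hS
  by_cases hc : Crosses S T
  · rw [hg.zero S hS hc, hf S hS hc]
  · refine List.map_inj_left.mp h S ?_
    rw [← List.mem_toFinset, hL]
    simp [hS, hc]

end Vectors

section BoundaryNumbers
variable {k : Type u} [Field k]

lemma exists_eq_vec {v : Tup} (hv : Inj v) : ∃ p q r s, v = ![p, q, r, s] ∧ [p, q, r, s].Nodup :=
  ⟨v 0, v 1, v 2, v 3, by ext i; fin_cases i <;> rfl, by simp [hv.eq_iff]⟩

lemma boundary_compl (S : Marks) : boundary k Sᶜ = boundary k S := by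
  have h : ∀ S : Marks, boundary k S ⊆ boundary k Sᶜ := by
    intro S x hx v hv h0 h1 h2 h3
    obtain ⟨p, q, r, s, rfl, hn⟩ := exists_eq_vec hv
    simp only [mem_compl, not_not] at h0 h1 h2 h3
    change VanishesAt x (cr p q r s)
    rw [cr_symm hn]
    exact hx _ inj_of_nodup h2 h3 h0 h1
  exact (((h Sᶜ).trans_eq (by rw [compl_compl])).antisymm (h S))

lemma bdryDiv_compl (S : Marks) : bdryDiv k Sᶜ = bdryDiv k S := by
  have h : ∀ x, (bdryDiv k Sᶜ).eqn x = (bdryDiv k S).eqn x := fun x => Units.ext (by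
    rw [bdryDiv_eqn, bdryDiv_eqn, Chart.eqn, Chart.eqn]
    simp only [compl_compl, or_comm])
  simp only [bdryDiv, CartierDivisor.mk.injEq] at h ⊢
  exact funext h

/-- The intersection numbers of a one-cycle with the boundary divisors. -/
abbrev bdryNum (σ : Equiv.Perm (Fin 6)) (c : Cycle (Mbar06 k)) (S : Marks) : ℝ :=
  (bdryDiv k (S.map σ.toEmbedding)).degCycle c

lemma bdryNum_single (σ : Equiv.Perm (Fin 6)) (F : Curve (Mbar06 k)) (S : Marks) :
    bdryNum σ (Finsupp.single F 1) S = (bdryDiv k (S.map σ.toEmbedding)).degOn F := by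
  rw [bdryNum, CartierDivisor.degCycle_single, one_mul]

lemma sepExp_eq_zero {η : MPts k} {v : Tup} (hv : Inj v)
    (hu : IsUnitAt η (CR v)) {S : Marks} (h : η ∈ boundary k S) :
    sepExp S v = 0 := by
  obtain ⟨p, q, r, s, rfl, hn⟩ := exists_eq_vec hv
  have hn' : [p, r, q, s].Nodup := by clear * - hn; grind
  have h' := h
  rw [← boundary_compl] at h'
  have hu' := hu.inv
  rw [cr_inv hn] at hu'
  have h1 : ∀ S : Marks, η ∈ boundary k S → ∀ {p q r s}, [p, q, r, s].Nodup →
      IsUnitAt η (cr p q r s) → ¬ (p ∈ S ∧ q ∈ S ∧ r ∉ S ∧ s ∉ S) := fun S hS p q r s hn hu h =>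
    (hS _ (inj_of_nodup hn) h.1 h.2.1 h.2.2.1 h.2.2.2).not_isUnitAt hu
  have a1 := h1 S h hn hu
  have a2 := h1 Sᶜ h' hn hu
  have a3 := h1 S h hn' hu'
  have a4 := h1 Sᶜ h' hn' hu'
  simp only [mem_compl, not_not] at a2 a4
  clear * - a1 a2 a3 a4
  simp only [sepExp, Matrix.cons_val]
  grind

variable [IsAlgClosed k]

lemma degOn_eq_zero_of_forall {F : Curve (Mbar06 k)} {S : Marks} (hS : 2 ≤ S.card)
    (hS' : S.card ≤ 4) (h : ∀ z : Pts F.1.1, F.1.incl z ∉ boundary k S) :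
    (bdryDiv k S).degOn F = 0 := by
  revert h
  refine forall_of_bdrySets (p := fun S => (∀ z : Pts F.1.1, F.1.incl z ∉ boundary k S) →
    (bdryDiv k S).degOn F = 0) (Equiv.refl _) (fun S h => ?_) (fun T hT h => ?_) hS hS'
  · rwa [bdryDiv_compl, boundary_compl]
  · rw [Equiv.refl_toEmbedding, Finset.map_refl] at h ⊢; exact degOn_bdryDiv_eq_zero F hT h

lemma degOn_eq_zero_of_crosses {S S₀ : Marks} {δ : MPts k} (hδ : IsBdryPoint S₀ δ)
    {F : Curve (Mbar06 k)} (hF : F.1 ∈ boundary k S₀) (hS : 2 ≤ S.card) (hS' : S.card ≤ 4)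
    (h : Crosses S S₀) : (bdryDiv k S).degOn F = 0 := by
  refine degOn_eq_zero_of_forall hS hS' fun z hz => ?_
  have hz' : F.1.incl z ∈ boundary k S₀ := (hδ.mem_boundary_iff_specializes _).mpr
    (((hδ.mem_boundary_iff_specializes _).mp hF).trans z.2)
  have ⟨a, h1, h2, b, h3, h4, c, h5, h6, d, h7, h8⟩ := h
  have hn : [a, b, c, d].Nodup := by
    simp only [List.nodup_cons, List.mem_cons, List.not_mem_nil, not_or, or_false]
    grind
  have v1 := hz ![a, b, c, d] (inj_of_nodup hn) h1 h3 h6 h7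
  have v2 := hz' ![a, c, b, d] inj_of_nodup h2 h5 h4 h8
  refine v1.not_isUnitAt ⟨crossRatio_ne_zero (inj_of_nodup hn), v1.mem, ?_⟩
  rw [cr_inv hn]
  exact v2.mem

lemma isBdryVec_pushCycle {σ : Equiv.Perm (Fin 6)} {T : Marks} {δ : MPts k}
    (hδ : IsBdryPoint (T.map σ.toEmbedding) δ) (c : Cycle δ.1) :
    IsBdryVec T (bdryNum σ (pushCycle δ c)) where
  rel v hv := by
    have h := sum_sepExp_degCycle (pushCycle δ c) (v := σ ∘ v) (σ.injective.comp hv)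
    rw [← sum_bdrySets_map (fun S => by rw [sepExp_compl, bdryDiv_compl]) σ] at h
    simpa only [sepExp_map] using h
  zero S hS h := by
    have hc := card_bdry hS
    rw [bdryNum, ← CartierDivisor.degCycle_restrict, CartierDivisor.degCycle,
      Finsupp.linearCombination_apply]
    refine Finset.sum_eq_zero fun F _ => ?_
    dsimp only
    rw [CartierDivisor.degOn_restrict, degOn_eq_zero_of_crosses hδ (F := Curve.push δ F)
      ((hδ.mem_boundary_iff_specializes _).mpr F.1.2) (by simpa using hc.1) (by simpa using hc.2)
      (h.map σ), Int.cast_zero, smul_zero]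

variable {σ : Equiv.Perm (Fin 6)} {T : Marks} {δ : MPts k} {F : Curve (Mbar06 k)}

lemma isBdryVec_single (hδ : IsBdryPoint (T.map σ.toEmbedding) δ)
    (hF : F.1 ∈ boundary k (T.map σ.toEmbedding)) :
    IsBdryVec T (bdryNum σ (Finsupp.single F 1)) := by
  obtain ⟨G, rfl⟩ := hδ.exists_curve hF
  rw [← pushCycle_single]
  exact isBdryVec_pushCycle hδ _

lemma sum_bdryNum_eq_one {L : List (Marks)}
    (hg : IsBdryVec T (bdryNum σ (Finsupp.single F 1))) (hn : L.Nodup)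
    (hL : L.toFinset = bdrySets.filter fun S => ¬ Crosses S T) {p q r s : Fin 6}
    (h : [p, q, r, s].Nodup) (hu : IsUnitAt F.1 (cr (σ p) (σ q) (σ r) (σ s)))
    (hp : IsParameter (valueAt F.1 (cr (σ p) (σ q) (σ r) (σ s)))) :
    (L.map fun S => (if sepExp S ![p, q, r, s] = 1 then 1 else 0) *
      bdryNum σ (Finsupp.single F 1) S).sum = 1 := by
  have hinj : Inj ![σ p, σ q, σ r, σ s] := inj_of_nodup (h.map σ.injective)
  have e : ![σ p, σ q, σ r, σ s] = σ ∘ ![p, q, r, s] := by ext i; fin_cases i <;> rfl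
  have h1 := congrArg (Int.cast : ℤ → ℝ)
    (sum_degOn_eq_one F hinj (fun S _ hS => sepExp_eq_zero hinj hu hS) hp)
  rw [Finset.sum_filter, Int.cast_sum, Int.cast_one, e,
    ← sum_bdrySets_map (fun S => by rw [sepExp_compl, bdryDiv_compl]) σ] at h1
  rw [← sum_eq_list hg hn hL]
  refine (sum_congr rfl fun S _ => ?_).trans h1
  rw [sepExp_map, bdryNum_single]
  split_ifs <;> simp

lemma bdryNum_eq_zero {p q r s : Fin 6} (h : [p, q, r, s].Nodup)
    (hu : IsUnitAt F.1 (cr (σ p) (σ q) (σ r) (σ s))) {c : k}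
    (hc : valueAt F.1 (cr (σ p) (σ q) (σ r) (σ s)) = cst c) {S : Marks}
    (hS : 2 ≤ S.card) (hS' : S.card ≤ 4) (hv : sepExp S ![p, q, r, s] = 1) :
    bdryNum σ (Finsupp.single F 1) S = 0 := by
  have hinj : Inj ![σ p, σ q, σ r, σ s] := inj_of_nodup (h.map σ.injective)
  have e : ![σ p, σ q, σ r, σ s] = σ ∘ ![p, q, r, s] := by ext i; fin_cases i <;> rfl
  rw [bdryNum_single, Int.cast_eq_zero]
  rw [← sepExp_map σ, ← e] at hv
  revert hv
  refine forall_of_bdrySets (p := fun S => sepExp S ![σ p, σ q, σ r, σ s] = 1 →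
    (bdryDiv k S).degOn F = 0) (Equiv.refl _) (fun S h => ?_) (fun T hT h => ?_)
    (S := S.map σ.toEmbedding) (by simpa) (by simpa)
  · rwa [bdryDiv_compl, sepExp_compl]
  · rw [Equiv.refl_toEmbedding, Finset.map_refl] at h ⊢
    exact degOn_eq_zero_of_const F hinj (fun S _ hS => sepExp_eq_zero hinj hu hS) hc hT h

lemma bdryNum_eq_zero_of_const {p q r s : Fin 6} (h : [p, q, r, s].Nodup)
    (hu : IsUnitAt F.1 (cr (σ p) (σ q) (σ r) (σ s))) {c : k} (hc1 : c ≠ 1)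
    (hc : valueAt F.1 (cr (σ p) (σ q) (σ r) (σ s)) = cst c) {S : Marks}
    (hS : 2 ≤ S.card) (hS' : S.card ≤ 4) (hv : sepExp S ![p, q, r, s] = 1 ∨
      sepExp S ![p, r, q, s] = 1 ∨ sepExp S ![p, s, r, q] = 1) :
    bdryNum σ (Finsupp.single F 1) S = 0 := by
  have hn : [σ p, σ q, σ r, σ s].Nodup := h.map σ.injective
  rcases hv with hv | hv | hv
  · exact bdryNum_eq_zero h hu hc hS hS' hv
  · have hu' := hu.inv
    have hc' := hu.valueAt_inv
    rw [hc, ← map_inv₀] at hc'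
    rw [cr_inv hn] at hu' hc'
    exact bdryNum_eq_zero (by grind) hu' hc' hS hS' hv
  · have hm := sub_mem (one_mem (Loc F.1)) hu.2.1
    have hc' := valueAt_add F.1 hm hu.2.1
    rw [sub_add_cancel, valueAt_one, hc] at hc'
    replace hc' := (eq_sub_of_add_eq hc'.symm).trans
      (show 1 - cst c = cst (1 - c) by rw [map_sub, map_one])
    have hu' : IsUnitAt F.1 (1 - cr (σ p) (σ q) (σ r) (σ s)) := by
      rw [isUnitAt_iff_valueAt hm, hc']
      exact (map_ne_zero _).mpr (sub_ne_zero.mpr hc1.symm)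
    rw [one_sub_cr hn] at hu' hc'
    exact bdryNum_eq_zero (by grind) hu' hc' hS hS' hv

end BoundaryNumbers

section BoundaryClasses
variable {k : Type u} [Field k]

/-- The class has the given intersection numbers with the boundary divisors. -/
def HasVec (γ : N1 (Mbar06 k)) (x : Marks → ℤ) : Prop :=
  ∀ S : Marks, 2 ≤ S.card → S.card ≤ 4 → (bdryDiv k S).pairing γ = x S

/-- A class with given intersection numbers that comes from a moving curve on a boundary divisor. -/
def Carries (S : Marks) (γ : N1 (Mbar06 k)) (x : Marks → ℤ) : Prop :=
  (∃ δ : MPts k, IsBdryPoint S δ ∧ γ ∈ imageNM1 δ) ∧ HasVec γ x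

lemma hasVec_cls {σ : Equiv.Perm (Fin 6)} {c : Cycle (Mbar06 k)} {x y : Marks → ℤ}
    (hx : ∀ S, x Sᶜ = x S) (hy : ∀ S, x (S.map σ.toEmbedding) = y S)
    {T : Marks} (hg : IsBdryVec T (bdryNum σ c)) {L : List (Marks)}
    (hL : L.toFinset = bdrySets.filter fun S => ¬ Crosses S T)
    (hT : ∀ S ∈ bdrySets, Crosses S T → y S = 0)
    (h : L.map (bdryNum σ c) = (L.map y).map Int.cast) : HasVec (cls c) x := by
  intro S hS hS'
  refine forall_of_bdrySets (p := fun S => (bdryDiv k S).pairing (cls c) = x S) σ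
    (fun S h => by rwa [bdryDiv_compl, hx]) (fun S hS => ?_) hS hS'
  rw [hy, CartierDivisor.pairing_cls]
  refine hg.ext hL (f := fun S => (y S : ℝ)) (fun S hS h => by rw [hT S hS h, Int.cast_zero]) ?_ S hS
  rw [h, List.map_map]
  rfl

variable [IsAlgClosed k] (σ : Equiv.Perm (Fin 6))

lemma map_pair : ({0, 1} : Marks).map σ.toEmbedding = {σ 0, σ 1} := by simp

lemma map_triple : ({0, 1, 2} : Marks).map σ.toEmbedding = {σ 0, σ 1, σ 2} := by simp

lemma exists_pairPoint (k : Type u) [Field k] :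
    ∃ δ : MPts k, IsBdryPoint (({0, 1} : Marks).map σ.toEmbedding) δ :=
  exists_isBdryPoint k (Or.inl (by simp))

lemma exists_A {t : k} (ht : t ≠ 0) (ht1 : t ≠ 1) :
    ∃ γ : N1 (Mbar06 k), fibreClass k (boundary k {σ 0, σ 1}) ![σ 2, σ 3, σ 4, σ 5] t = γ ∧
      Carries {σ 0, σ 1} γ (vecA (σ 0) (σ 1)) := by
  have ⟨δ, hδ⟩ := exists_pairPoint σ k
  have hδ' := hδ
  rw [map_pair] at hδ'
  have ⟨F, hF, hu, hu', hc, hp, hcls, hNM⟩ := exists_fibre_five (p₀ := σ 2) (p₁ := σ 3)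
    (p₂ := σ 0) (p₃ := σ 4) (p₄ := σ 5) (by simp) (by simp) hδ' ht ht1
  have hg := isBdryVec_single hδ (F := F) (by rwa [map_pair])
  refine ⟨_, hcls, ⟨δ, hδ', hNM⟩, hasVec_cls (fun S => (vec_compl _ _ 0 S).1)
    (fun S => (vec_map σ 0 1 0 S).1) hg toFinset_pairList (by decide +kernel) ?_⟩
  rw [show pairList.map (vecA 0 1) = [-2, 1, 1, 1, 1, 0, 0, 0, 0, 0, 0] by decide +kernel]
  have hs := sum_bdryNum_eq_one hg nodup_pairList toFinset_pairList (by decide) hu' hp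
  have hz := fun S => bdryNum_eq_zero_of_const (S := S) (by decide) hu ht1 hc
  have z1 := hz {2, 3} (by decide) (by decide) (by decide)
  have z2 := hz {2, 4} (by decide) (by decide) (by decide)
  have z3 := hz {3, 4} (by decide) (by decide) (by decide)
  have z4 := hz {4, 5} (by decide) (by decide) (by decide)
  have ⟨x, y₂, y₃, y₄, y₅, h⟩ := hg.pair
  simp only [sepExp, pairList, List.map_cons, List.map_nil, List.cons.injEq] at h hs ⊢
  simp [h] at hs z1 z2 z3 z4
  norm_num [h]
  constructorm* _ ∧ _ <;> linarith

lemma exists_A' {t : k} (ht : t ≠ 0) (ht1 : t ≠ 1) :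
    ∃ γ : N1 (Mbar06 k), fibreClass k (boundary k {σ 0, σ 1}) ![σ 0, σ 3, σ 4, σ 5] t = γ ∧
      Carries {σ 0, σ 1} γ (vecA' (σ 0) (σ 1) (σ 2)) := by
  have ⟨δ, hδ⟩ := exists_pairPoint σ k
  have hδ' := hδ
  rw [map_pair] at hδ'
  have ⟨F, hF, hu, hu', hc, hp, hcls, hNM⟩ := exists_fibre_five (p₀ := σ 0) (p₁ := σ 3)
    (p₂ := σ 2) (p₃ := σ 4) (p₄ := σ 5) (by simp) (by simp) hδ' ht ht1
  have hg := isBdryVec_single hδ (F := F) (by rwa [map_pair])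
  refine ⟨_, hcls, ⟨δ, hδ', hNM⟩, hasVec_cls (fun S => (vec_compl _ _ _ S).2.1)
    (fun S => (vec_map σ 0 1 2 S).2.1) hg toFinset_pairList (by decide +kernel) ?_⟩
  rw [show pairList.map (vecA' 0 1 2) = [-1, 1, 0, 0, 0, 1, 1, 1, 0, 0, 0] by decide +kernel]
  have hs := sum_bdryNum_eq_one hg nodup_pairList toFinset_pairList (by decide) hu' hp
  have hz := fun S => bdryNum_eq_zero_of_const (S := S) (by decide) hu ht1 hc
  have z1 := hz {0, 1, 3} (by decide) (by decide) (by decide)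
  have z2 := hz {0, 1, 4} (by decide) (by decide) (by decide)
  have z3 := hz {3, 4} (by decide) (by decide) (by decide)
  have z4 := hz {4, 5} (by decide) (by decide) (by decide)
  have ⟨x, y₂, y₃, y₄, y₅, h⟩ := hg.pair
  simp only [sepExp, pairList, List.map_cons, List.map_nil, List.cons.injEq] at h hs ⊢
  simp [h] at hs z1 z2 z3 z4
  norm_num [h]
  constructorm* _ ∧ _ <;> linarith

lemma exists_B {t : k} (ht : t ≠ 0) (ht1 : t ≠ 1) :
    ∃ γ : N1 (Mbar06 k), fibreClass k (boundary k {σ 0, σ 1, σ 2}) ![σ 0, σ 1, σ 2, σ 3] t = γ ∧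
      Carries {σ 0, σ 1, σ 2} γ (vecB (σ 0) (σ 1) (σ 2)) := by
  have ⟨δ, hδ⟩ := exists_isBdryPoint k (S := ({0, 1, 2} : Marks).map σ.toEmbedding)
    (Or.inr (by simp))
  have hδ' := hδ
  rw [map_triple] at hδ'
  have ⟨F, hF, hu, hu', hc, hp, hcls, hNM⟩ := exists_fibre_three (i := σ 0) (j := σ 1)
    (l := σ 2) (m := σ 3) (a := σ 4) (b := σ 5) (by simp) hδ' ht
  have hg := isBdryVec_single hδ (F := F) (by rwa [map_triple])
  refine ⟨_, hcls, ⟨δ, hδ', hNM⟩, hasVec_cls (fun S => (vec_compl _ _ _ S).2.2.1)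
    (fun S => (vec_map σ 0 1 2 S).2.2.1) hg toFinset_tripleList (by decide +kernel) ?_⟩
  rw [show tripleList.map (vecB 0 1 2) = [-1, 0, 0, 0, 1, 1, 1] by decide +kernel]
  have hs := sum_bdryNum_eq_one hg nodup_tripleList toFinset_tripleList (by decide) hu' hp
  have z1 := bdryNum_eq_zero_of_const (S := {0, 1}) (by decide) hu ht1 hc (by decide) (by decide)
    (by decide)
  have ⟨x, y, h⟩ := hg.triple
  simp only [sepExp, tripleList, List.map_cons, List.map_nil, List.cons.injEq] at h hs ⊢
  simp [h] at hs z1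
  norm_num [h, hs, z1]

lemma exists_C {r s t : k} (hr : r ≠ 0) (hs : s ≠ 0) (ht : t ≠ 0) (hrst : r + s + t ≠ 0) :
    ∃ γ : N1 (Mbar06 k), lineClass k (boundary k {σ 0, σ 1}) (σ 0) (σ 2) (σ 3) (σ 4) (σ 5) r s t = γ ∧
      HasVec γ (vecC (σ 0) (σ 1)) := by
  have ⟨δ, hδ⟩ := exists_pairPoint σ k
  have hδ' := hδ
  rw [map_pair] at hδ'
  have ⟨F, hF, h1, h2, h3, hd, hcls⟩ := exists_line (p₀ := σ 2) (p₁ := σ 3)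
    (p₂ := σ 4) (p₃ := σ 5) (p₄ := σ 0) (by simp) (by simp) hδ' hr hs ht hrst
  have hg := isBdryVec_single hδ (F := F) (by rwa [map_pair])
  refine ⟨_, hcls, hasVec_cls (fun S => (vec_compl _ _ 0 S).2.2.2.1)
    (fun S => (vec_map σ 0 1 0 S).2.2.2.1) hg toFinset_pairList (by decide +kernel) ?_⟩
  rw [show pairList.map (vecC 0 1) = [-1, 0, 0, 0, 0, 1, 1, 1, 1, 1, 1] by decide +kernel]
  have hsum := fun p q r s h (h' : IsUnitAt F.1 (cr (σ p) (σ q) (σ r) (σ s)) ∧ _) =>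
    sum_bdryNum_eq_one hg nodup_pairList toFinset_pairList h h'.1 h'.2
  have s1 := hsum 2 3 5 0 (by decide) h1
  have s2 := hsum 2 4 5 0 (by decide) h2
  have s3 := hsum 2 3 4 0 (by decide) h3
  have z1 := bdryNum_single σ F {0, 1, 5}
  have z2 := bdryNum_single σ F {0, 1, 2}
  rw [degOn_eq_zero_of_forall (by simp) (by simp)
    (hd _ (by simp) (by simp) (by simp) (by simp))] at z1 z2
  have ⟨x, y₂, y₃, y₄, y₅, h⟩ := hg.pair
  simp only [sepExp, pairList, List.map_cons, List.map_nil, List.cons.injEq] at h s1 s2 s3 ⊢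
  simp [h] at s1 s2 s3 z1 z2
  norm_num [h]
  constructorm* _ ∧ _ <;> linarith

lemma exists_C' {r s t : k} (hr : r ≠ 0) (hs : s ≠ 0) (ht : t ≠ 0) (hrst : r + s + t ≠ 0) :
    ∃ γ : N1 (Mbar06 k), lineClass k (boundary k {σ 0, σ 1}) (σ 2) (σ 0) (σ 3) (σ 4) (σ 5) r s t = γ ∧
      HasVec γ (vecC' (σ 0) (σ 1) (σ 2)) := by
  have ⟨δ, hδ⟩ := exists_pairPoint σ k
  have hδ' := hδ
  rw [map_pair] at hδ'
  have ⟨F, hF, h1, h2, h3, hd, hcls⟩ := exists_line (p₀ := σ 0) (p₁ := σ 3)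
    (p₂ := σ 4) (p₃ := σ 5) (p₄ := σ 2) (by simp) (by simp) hδ' hr hs ht hrst
  have hg := isBdryVec_single hδ (F := F) (by rwa [map_pair])
  refine ⟨_, hcls, hasVec_cls (fun S => (vec_compl _ _ _ S).2.2.2.2)
    (fun S => (vec_map σ 0 1 2 S).2.2.2.2) hg toFinset_pairList (by decide +kernel) ?_⟩
  rw [show pairList.map (vecC' 0 1 2) = [-2, 0, 1, 1, 1, 0, 0, 0, 1, 1, 1] by decide +kernel]
  have hsum := fun p q r s h (h' : IsUnitAt F.1 (cr (σ p) (σ q) (σ r) (σ s)) ∧ _) =>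
    sum_bdryNum_eq_one hg nodup_pairList toFinset_pairList h h'.1 h'.2
  have s1 := hsum 0 3 5 2 (by decide) h1
  have s2 := hsum 0 4 5 2 (by decide) h2
  have s3 := hsum 0 3 4 2 (by decide) h3
  have z1 := bdryNum_single σ F {2, 5}
  have z2 := bdryNum_single σ F {0, 1, 2}
  rw [degOn_eq_zero_of_forall (by simp) (by simp)
    (hd _ (by simp) (by simp) (by simp) (by simp))] at z1 z2
  have ⟨x, y₂, y₃, y₄, y₅, h⟩ := hg.pair
  simp only [sepExp, pairList, List.map_cons, List.map_nil, List.cons.injEq] at h s1 s2 s3 ⊢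
  simp [h] at s1 s2 s3 z1 z2
  norm_num [h]
  constructorm* _ ∧ _ <;> linarith

end BoundaryClasses

section MainTheorem
variable {k : Type u} [Field k]

open Classical in
/-- The class with the given intersection numbers with the boundary divisors, if there is one. -/
def classOfVec (k : Type u) [Field k] (x : Marks → ℤ) : N1 (Mbar06 k) :=
  if h : ∃ γ : N1 (Mbar06 k), HasVec γ x then h.choose else 0

/-- The classes in the theorem. -/
def bdryClasses (k : Type u) [Field k] : BoundaryClasses k where
  A i j := classOfVec k (vecA i j)
  A' i j l := classOfVec k (vecA' i j l)
  B i j l := classOfVec k (vecB i j l)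
  C i j := classOfVec k (vecC i j)
  C' i j l := classOfVec k (vecC' i j l)

lemma exists_perm_triple {i j l : Fin 6} (h : [i, j, l].Nodup) :
    ∃ σ : Equiv.Perm (Fin 6), σ 0 = i ∧ σ 1 = j ∧ σ 2 = l := by
  have ⟨m, a, b, h'⟩ : ∃ m a b, [i, j, l, m, a, b].Nodup := by
    revert i j l
    decide +kernel
  have ⟨σ, h0, h1, h2, _⟩ := exists_perm h'
  exact ⟨σ, h0, h1, h2⟩

lemma exists_perm_pair {i j : Fin 6} (h : [i, j].Nodup) :
    ∃ σ : Equiv.Perm (Fin 6), σ 0 = i ∧ σ 1 = j := by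
  have ⟨l, h'⟩ : ∃ l, [i, j, l].Nodup := by
    revert i j
    decide +kernel
  have ⟨σ, h0, h1, _⟩ := exists_perm_triple h'
  exact ⟨σ, h0, h1⟩

variable [IsAlgClosed k]

lemma N1_ext {γ γ' : N1 (Mbar06 k)}
    (h : ∀ S ∈ bdrySets, (bdryDiv k S).pairing γ = (bdryDiv k S).pairing γ') : γ = γ' := by
  obtain ⟨c, rfl⟩ := Submodule.mkQ_surjective _ γ
  obtain ⟨d, rfl⟩ := Submodule.mkQ_surjective _ γ'
  exact cls_eq_of_bdryDiv h

lemma HasVec.classOfVec_eq {γ : N1 (Mbar06 k)} {x : Marks → ℤ} (h : HasVec γ x) :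
    classOfVec k x = γ := by
  have h' : ∃ γ : N1 (Mbar06 k), HasVec γ x := ⟨γ, h⟩
  rw [classOfVec, dif_pos h']
  refine N1_ext fun S hS => ?_
  have ⟨h1, h2⟩ := card_bdry hS
  rw [h'.choose_spec S h1 h2, h S h1 h2]

lemma exists_ne_zero_ne_one : ∃ t : k, t ≠ 0 ∧ t ≠ 1 := by
  classical
  have := IsAlgClosed.instInfinite (K := k)
  have ⟨t, ht⟩ := Infinite.exists_notMem_finset ({0, 1} : Finset k)
  exact ⟨t, by simpa using ht⟩

lemma bdryClasses_isGeometric : (bdryClasses k).IsGeometric where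
  A_eq i j l m a b h t ht ht1 := by
    obtain ⟨σ, rfl, rfl, rfl, rfl, rfl, rfl⟩ := exists_perm h
    obtain ⟨γ, rfl, -, h⟩ := exists_A σ ht ht1
    exact h.classOfVec_eq
  A'_eq i j l m a b h t ht ht1 ν hν := by
    rw [mem_insert, mem_singleton] at hν
    rcases hν with rfl | rfl
    · obtain ⟨σ, rfl, rfl, rfl, rfl, rfl, rfl⟩ := exists_perm h
      obtain ⟨γ, rfl, -, h⟩ := exists_A' σ ht ht1
      exact h.classOfVec_eq
    · obtain ⟨σ, rfl, rfl, rfl, rfl, rfl, rfl⟩ := exists_perm ((List.Perm.swap _ _ _).nodup h)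
      obtain ⟨γ, rfl, -, h⟩ := exists_A' σ ht ht1
      rw [Finset.pair_comm, ← h.classOfVec_eq]
      exact congrArg (classOfVec k) (funext fun S => (vec_swap _ _ _ S).1)
  B_eq i j l m a b h t ht ht1 := by
    obtain ⟨σ, rfl, rfl, rfl, rfl, rfl, rfl⟩ := exists_perm h
    obtain ⟨γ, rfl, -, h⟩ := exists_B σ ht ht1
    exact h.classOfVec_eq
  C_eq i j l m a b h r s t hr hs ht hrst ν hν := by
    rw [mem_insert, mem_singleton] at hν
    rcases hν with rfl | rfl
    · obtain ⟨σ, rfl, rfl, rfl, rfl, rfl, rfl⟩ := exists_perm h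
      obtain ⟨γ, rfl, h⟩ := exists_C σ hr hs ht hrst
      exact h.classOfVec_eq
    · obtain ⟨σ, rfl, rfl, rfl, rfl, rfl, rfl⟩ := exists_perm ((List.Perm.swap _ _ _).nodup h)
      obtain ⟨γ, rfl, h⟩ := exists_C σ hr hs ht hrst
      rw [Finset.pair_comm, ← h.classOfVec_eq]
      exact congrArg (classOfVec k) (funext fun S => (vec_swap _ _ 0 S).2.1)
  C'_eq i j l m a b h r s t hr hs ht hrst ν hν := by
    rw [mem_insert, mem_singleton] at hν
    rcases hν with rfl | rfl
    · obtain ⟨σ, rfl, rfl, rfl, rfl, rfl, rfl⟩ := exists_perm h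
      obtain ⟨γ, rfl, h⟩ := exists_C' σ hr hs ht hrst
      exact h.classOfVec_eq
    · obtain ⟨σ, rfl, rfl, rfl, rfl, rfl, rfl⟩ := exists_perm ((List.Perm.swap _ _ _).nodup h)
      obtain ⟨γ, rfl, h⟩ := exists_C' σ hr hs ht hrst
      rw [Finset.pair_comm, ← h.classOfVec_eq]
      exact congrArg (classOfVec k) (funext fun S => (vec_swap _ _ _ S).2.2)

lemma Carries.classOfVec {S : Marks} {γ : N1 (Mbar06 k)} {x : Marks → ℤ} (h : Carries S γ x) :
    Carries S (classOfVec k x) x := by rwa [h.2.classOfVec_eq]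

lemma bdryClasses_A {i j : Fin 6} (h : [i, j].Nodup) :
    Carries {i, j} ((bdryClasses k).A i j) (vecA i j) := by
  obtain ⟨σ, rfl, rfl⟩ := exists_perm_pair h
  have ⟨t, ht, ht1⟩ := exists_ne_zero_ne_one (k := k)
  have ⟨γ, _, h⟩ := exists_A σ ht ht1
  exact h.classOfVec

lemma bdryClasses_A' {i j l : Fin 6} (h : [i, j, l].Nodup) :
    Carries {i, j} ((bdryClasses k).A' i j l) (vecA' i j l) := by
  obtain ⟨σ, rfl, rfl, rfl⟩ := exists_perm_triple h
  have ⟨t, ht, ht1⟩ := exists_ne_zero_ne_one (k := k)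
  have ⟨γ, _, h⟩ := exists_A' σ ht ht1
  exact h.classOfVec

lemma bdryClasses_B {i j l : Fin 6} (h : [i, j, l].Nodup) :
    Carries {i, j, l} ((bdryClasses k).B i j l) (vecB i j l) := by
  obtain ⟨σ, rfl, rfl, rfl⟩ := exists_perm_triple h
  have ⟨t, ht, ht1⟩ := exists_ne_zero_ne_one (k := k)
  have ⟨γ, _, h⟩ := exists_B σ ht ht1
  exact h.classOfVec

omit [IsAlgClosed k] in
lemma HasVec.add {γ γ' : N1 (Mbar06 k)} {x x' y : Marks → ℤ} (h : HasVec γ x)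
    (h' : HasVec γ' x') (hy : ∀ S, 2 ≤ S.card → S.card ≤ 4 → y S = x S + x' S) :
    HasVec (γ + γ') y := fun S hS hS' => by
  rw [map_add, h S hS hS', h' S hS hS', hy S hS hS', Int.cast_add]

lemma bdryClasses_C {i j l : Fin 6} (h : [i, j, l].Nodup) :
    (bdryClasses k).C i j = (bdryClasses k).A' i j l + (bdryClasses k).B i j l ∧
    (bdryClasses k).C' i j l = (bdryClasses k).A i j + (bdryClasses k).B i j l := by
  have key : ∀ S : Marks, 2 ≤ S.card → S.card ≤ 4 →
      vecC i j S = vecA' i j l S + vecB i j l S ∧ vecC' i j l S = vecA i j S + vecB i j l S := by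
    obtain ⟨σ, rfl, rfl, rfl⟩ := exists_perm_triple h
    intro S hS hS'
    refine forall_of_bdrySets (p := fun S => vecC (σ 0) (σ 1) S = vecA' (σ 0) (σ 1) (σ 2) S +
      vecB (σ 0) (σ 1) (σ 2) S ∧ vecC' (σ 0) (σ 1) (σ 2) S = vecA (σ 0) (σ 1) S +
      vecB (σ 0) (σ 1) (σ 2) S) σ (fun S h => ?_) (fun S => ?_) hS hS'
    · have ⟨h1, h2, h3, h4, h5⟩ := vec_compl (σ 0) (σ 1) (σ 2) S; rwa [h1, h2, h3, h4, h5]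
    · have ⟨h1, h2, h3, h4, h5⟩ := vec_map σ 0 1 2 S
      rw [h1, h2, h3, h4, h5]
      clear h1 h2 h3 h4 h5
      revert S
      decide +kernel
  exact ⟨((bdryClasses_A' h).2.add (bdryClasses_B h).2 fun S hS hS' => (key S hS hS').1).classOfVec_eq,
    ((bdryClasses_A (by grind)).2.add (bdryClasses_B h).2 fun S hS hS' => (key S hS hS').2).classOfVec_eq⟩

/-- The coordinates of the tables, from the intersection numbers with the boundary divisors. -/
def basisVec (x : Marks → ℤ) : Fin 16 → ℤ :=
  ![∑ S ∈ bdrySets, hyperplaneExp S * x S, x {1, 6}, x {2, 6}, x {3, 6}, x {4, 6}, x {5, 6},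
    x {1, 2, 6}, x {1, 3, 6}, x {1, 4, 6}, x {1, 5, 6}, x {2, 3, 6},
    x {2, 4, 6}, x {2, 5, 6}, x {3, 4, 6}, x {3, 5, 6}, x {4, 5, 6}]

lemma HasVec.basisVec {γ : N1 (Mbar06 k)} {x : Marks → ℤ} (h : HasVec γ x) (n : Fin 16) :
    (basisDivisors (hyperplaneDiv k) (bdryDiv k) n).pairing γ = M06.basisVec x n := by
  have hL : (hyperplaneDiv k).pairing γ = ((∑ S ∈ bdrySets, hyperplaneExp S * x S : ℤ) : ℝ) := by
    obtain ⟨c, rfl⟩ := Submodule.mkQ_surjective _ γ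
    refine ((hyperplaneDiv k).degCycle_eq_sum bdrySets (bdryDiv k) hyperplaneExp 1
      (fun x => ?_) c).trans ?_
    · have e : ((hyperplaneDiv k).eqn x : RatFun k) =
          1 * ∏ S ∈ bdrySets, ((bdryDiv k S).eqn x : RatFun k) ^ hyperplaneExp S := by
        simp [hyperplaneDiv, CartierDivisor.combination]
      rw [← e, div_self (Units.ne_zero _)]
      exact isUnitAt_one x
    · rw [Int.cast_sum]
      refine sum_congr rfl fun S hS => ?_
      have ⟨h1, h2⟩ := card_bdry hS
      rw [Int.cast_mul, ← h S h1 h2]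
      rfl
  fin_cases n
  · exact hL
  all_goals exact h _ (by decide) (by decide)

omit [IsAlgClosed k] in
lemma mem_boundaryDivisors_iff {δ : MPts k} : {x : MPts k | δ.1 ⤳ x.1} ∈ boundaryDivisors k ↔
    ∃ S : Marks, (S.card = 2 ∨ S.card = 3) ∧ IsBdryPoint S δ := by
  constructor
  · rintro ⟨S, hS, h⟩
    have ⟨δ', hδ'⟩ := exists_isBdryPoint k hS
    refine ⟨S, hS, ?_⟩
    have h1 : δ'.1 ⤳ δ.1 := (hδ'.mem_boundary_iff_specializes δ).mp (h ▸ specializes_rfl)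
    have h2 : δ.1 ⤳ δ'.1 := by have := hδ'.mem_boundary; rwa [← h] at this
    rwa [Subtype.ext (h2.antisymm h1).eq]
  · rintro ⟨S, hS, h⟩; exact ⟨S, hS, Set.ext fun x => (h.mem_boundary_iff_specializes x).symm⟩

variable {σ : Equiv.Perm (Fin 6)} {T : Marks} {δ : MPts k}

lemma bdryNum_nonneg (hδ : IsBdryPoint (T.map σ.toEmbedding) δ) {c : Cycle δ.1}
    (hc : cls c ∈ NM1 δ.1) {S : Marks} (hS : 2 ≤ S.card) (hS' : S.card ≤ 4) (h1 : T ≠ S)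
    (h2 : T ≠ Sᶜ) : 0 ≤ bdryNum σ (pushCycle δ c) S := by
  set D := bdryDiv k (S.map σ.toEmbedding)
  have hu : IsUnitAt δ (D.eqn δ : RatFun k) := by
    refine isUnitAt_bdryDiv_eqn (by simpa) (by simpa) fun h => ?_
    rw [hδ.mem_boundary_iff (by simpa) (by simpa), ← map_compl] at h
    exact h.elim (fun h => h1 (Finset.map_injective _ h)) fun h => h2 (Finset.map_injective _ h)
  rw [bdryNum, ← CartierDivisor.degCycle_restrict]
  refine degCycle_nonneg_of_mem_NM1 hc _ (valueAt δ (D.eqn δ : RatFun k)) hu.valueAt_ne_zero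
    fun z => ?_
  have hm : (D.eqn (δ.incl z) : RatFun k) ∈ Loc (δ.incl z) := bdryDiv_eqn_mem _ _
  have h3 := D.isUnitAt (x := δ.incl z) (y := δ) z.2
  rw [CartierDivisor.restrict_eqn, CartierDivisor.resEqn, ← valueAt_mul δ h3.2.1 hu.2.1,
    div_mul_cancel₀ _ hu.1]
  exact mem_sub_of_mem_incl hm

/-- The cone of the theorem. -/
abbrev tableCone (k : Type u) [Field k] : PointedCone ℝ (N1 (Mbar06 k)) :=
  PointedCone.hull ℝ
    ({γ | ∃ i j : Fin 6, [i, j].Nodup ∧ γ = (bdryClasses k).A i j} ∪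
      {γ | ∃ i j l : Fin 6, [i, j, l].Nodup ∧ γ = (bdryClasses k).A' i j l} ∪
      {γ | ∃ i j l : Fin 6, [i, j, l].Nodup ∧ γ = (bdryClasses k).B i j l})

omit [IsAlgClosed k] in
lemma mem_A {i j : Fin 6} (h : [i, j].Nodup) : (bdryClasses k).A i j ∈ tableCone k :=
  Submodule.subset_span (Or.inl (Or.inl ⟨i, j, h, rfl⟩))

omit [IsAlgClosed k] in
lemma mem_A' {i j l : Fin 6} (h : [i, j, l].Nodup) : (bdryClasses k).A' i j l ∈ tableCone k :=
  Submodule.subset_span (Or.inl (Or.inr ⟨i, j, l, h, rfl⟩))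

omit [IsAlgClosed k] in
lemma mem_B {i j l : Fin 6} (h : [i, j, l].Nodup) : (bdryClasses k).B i j l ∈ tableCone k :=
  Submodule.subset_span (Or.inr ⟨i, j, l, h, rfl⟩)

omit [IsAlgClosed k] in
lemma pairing_map {S : Marks} (hS : 2 ≤ S.card) (hS' : S.card ≤ 4) {γ : N1 (Mbar06 k)}
    {x : Marks → ℤ} (h : HasVec γ x) :
    (bdryDiv k (S.map σ.toEmbedding)).pairing γ = x (S.map σ.toEmbedding) :=
  h _ (by simpa) (by simpa)

lemma cls_eq_of_bdryNum {c : Cycle (Mbar06 k)} (hg : IsBdryVec T (bdryNum σ c))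
    {L : List (Marks)} (hL : L.toFinset = bdrySets.filter fun S => ¬ Crosses S T)
    {f : Marks → ℝ} (hf : ∀ S ∈ bdrySets, Crosses S T → f S = 0)
    (h : L.map (bdryNum σ c) = L.map f) {γ : N1 (Mbar06 k)} (hγ : ∀ S, 2 ≤ S.card → S.card ≤ 4 →
      (bdryDiv k (S.map σ.toEmbedding)).pairing γ = f S) : cls c = γ := by
  refine N1_ext fun S hS => ?_
  have ⟨h1, h2⟩ := card_bdry hS
  refine forall_of_bdrySets (p := fun S => (bdryDiv k S).pairing (cls c) = (bdryDiv k S).pairing γ) σ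
    (fun S h => by rwa [bdryDiv_compl]) (fun S hS => ?_) h1 h2
  have ⟨h1, h2⟩ := card_bdry hS
  rw [hγ S h1 h2, ← hg.ext hL hf h S hS]
  rfl

lemma mem_tableCone_of_pair {c : Cycle (Mbar06 k)} (hg : IsBdryVec {0, 1} (bdryNum σ c))
    (a b₂ b₃ b₄ b₅ d₂ d₃ d₄ d₅ : ℝ) (ha : 0 ≤ a) (hb₂ : 0 ≤ b₂) (hb₃ : 0 ≤ b₃) (hb₄ : 0 ≤ b₄)
    (hb₅ : 0 ≤ b₅) (hd₂ : 0 ≤ d₂) (hd₃ : 0 ≤ d₃) (hd₄ : 0 ≤ d₄) (hd₅ : 0 ≤ d₅)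
    (h : pairList.map (bdryNum σ c) = [-(a + a) - b₂ - b₃ - b₄ - b₅, a + b₂ - d₂, a + b₃ - d₃,
      a + b₄ - d₄, a + b₅ - d₅, b₂ + b₃ + d₄ + d₅, b₂ + b₄ + d₃ + d₅, b₂ + b₅ + d₃ + d₄,
      b₃ + b₄ + d₂ + d₅, b₃ + b₅ + d₂ + d₄, b₄ + b₅ + d₂ + d₃]) : cls c ∈ tableCone k := by
  have hA : [σ 0, σ 1].Nodup := by simp
  have nd : ∀ l : Fin 6, 2 ≤ l → [σ 0, σ 1, σ l].Nodup := fun l hl => by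
    have : (0 : Fin 6) ≠ l ∧ (1 : Fin 6) ≠ l := by grind
    simpa using this
  have n2 := nd 2 (by decide)
  have n3 := nd 3 (by decide)
  have n4 := nd 4 (by decide)
  have n5 := nd 5 (by decide)
  have e : cls c = a • (bdryClasses k).A (σ 0) (σ 1) +
      (b₂ • (bdryClasses k).A' (σ 0) (σ 1) (σ 2) + d₂ • (bdryClasses k).B (σ 0) (σ 1) (σ 2)) +
      (b₃ • (bdryClasses k).A' (σ 0) (σ 1) (σ 3) + d₃ • (bdryClasses k).B (σ 0) (σ 1) (σ 3)) +
      (b₄ • (bdryClasses k).A' (σ 0) (σ 1) (σ 4) + d₄ • (bdryClasses k).B (σ 0) (σ 1) (σ 4)) +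
      (b₅ • (bdryClasses k).A' (σ 0) (σ 1) (σ 5) + d₅ • (bdryClasses k).B (σ 0) (σ 1) (σ 5)) := by
    refine cls_eq_of_bdryNum hg toFinset_pairList (f := fun T => a * vecA 0 1 T +
      (b₂ * vecA' 0 1 2 T + d₂ * vecB 0 1 2 T) + (b₃ * vecA' 0 1 3 T + d₃ * vecB 0 1 3 T) +
      (b₄ * vecA' 0 1 4 T + d₄ * vecB 0 1 4 T) + (b₅ * vecA' 0 1 5 T + d₅ * vecB 0 1 5 T))
      (fun S hS h => ?_) ?_ (fun S hS hS' => ?_)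
    · have hz : ∀ l ∈ ({2, 3, 4, 5} : Marks), ∀ S ∈ bdrySets, Crosses S {0, 1} →
          vecA 0 1 S = 0 ∧ vecA' 0 1 l S = 0 ∧ vecB 0 1 l S = 0 := by decide +kernel
      simp [hz 2 (by simp) S hS h, hz 3 (by simp) S hS h, hz 4 (by simp) S hS h,
        hz 5 (by simp) S hS h]
    · rw [h]
      simp only [pairList, List.map_cons, List.map_nil, List.cons.injEq, and_true]
      refine ⟨?_, ?_, ?_, ?_, ?_, ?_, ?_, ?_, ?_, ?_, ?_⟩ <;>
        simp [vecA, vecA', vecB, sideCard] <;> ring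
    · simp only [map_add, map_smul, smul_eq_mul, pairing_map hS hS' (bdryClasses_A hA).2,
        pairing_map hS hS' (bdryClasses_A' n2).2, pairing_map hS hS' (bdryClasses_A' n3).2,
        pairing_map hS hS' (bdryClasses_A' n4).2, pairing_map hS hS' (bdryClasses_A' n5).2,
        pairing_map hS hS' (bdryClasses_B n2).2, pairing_map hS hS' (bdryClasses_B n3).2,
        pairing_map hS hS' (bdryClasses_B n4).2, pairing_map hS hS' (bdryClasses_B n5).2,
        (vec_map σ _ _ 0 S).1, (vec_map σ _ _ _ S).2.1, (vec_map σ _ _ _ S).2.2.1]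
  have mA := (tableCone k).smul_mem ha (mem_A hA (k := k))
  have mem : ∀ {l : Fin 6} {b d : ℝ}, 0 ≤ b → 0 ≤ d → [σ 0, σ 1, l].Nodup →
      b • (bdryClasses k).A' (σ 0) (σ 1) l + d • (bdryClasses k).B (σ 0) (σ 1) l ∈ tableCone k :=
    fun hb hd hn => add_mem ((tableCone k).smul_mem hb (mem_A' hn)) ((tableCone k).smul_mem hd (mem_B hn))
  rw [e]
  exact add_mem (add_mem (add_mem (add_mem mA (mem hb₂ hd₂ n2)) (mem hb₃ hd₃ n3)) (mem hb₄ hd₄ n4))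
    (mem hb₅ hd₅ n5)

lemma mem_tableCone_of_isBdryPoint_pair (hδ : IsBdryPoint {σ 0, σ 1} δ) {c : Cycle δ.1}
    (hc : cls c ∈ NM1 δ.1) : cls (pushCycle δ c) ∈ tableCone k := by
  rw [← map_pair] at hδ
  have hg := isBdryVec_pushCycle hδ c
  have hn : ∀ S ∈ pairList.tail, 0 ≤ bdryNum σ (pushCycle δ c) S := fun S hS => by
    have h : ∀ S ∈ pairList.tail, 2 ≤ S.card ∧ S.card ≤ 4 ∧ ({0, 1} : Marks) ≠ S ∧
        ({0, 1} : Marks) ≠ Sᶜ := by decide +kernel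
    have ⟨h1, h2, h3, h4⟩ := h S hS
    exact bdryNum_nonneg hδ hc h1 h2 h3 h4
  have ⟨x, y₂, y₃, y₄, y₅, h⟩ := hg.pair
  have h' := h
  simp only [pairList, List.map_cons, List.map_nil, List.cons.injEq, and_true] at h'
  simp only [pairList, List.tail_cons, List.forall_mem_cons, h'] at hn
  have ⟨p2, p3, p4, p5, q1, q2, q3, q4, q5, q6, _⟩ := hn
  rcases le_total x 0 with hx | hx
  · apply mem_tableCone_of_pair hg 0 (y₂ - x) (y₃ + x) (y₄ + x) (y₅ + x) (-2 * x) 0 0 0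
    <;> first | linarith | (rw [h]; ring_nf)
  rcases le_total y₂ 0 with h2 | h2
  · apply mem_tableCone_of_pair hg (x - y₂) 0 (y₃ + y₂) (y₄ + y₂) (y₅ + y₂) (-2 * y₂) 0 0 0
    <;> first | linarith | (rw [h]; ring_nf)
  rcases le_total y₃ 0 with h3 | h3
  · apply mem_tableCone_of_pair hg (x - y₃) (y₂ + y₃) 0 (y₄ + y₃) (y₅ + y₃) 0 (-2 * y₃) 0 0
    <;> first | linarith | (rw [h]; ring_nf)
  rcases le_total y₄ 0 with h4 | h4
  · apply mem_tableCone_of_pair hg (x - y₄) (y₂ + y₄) (y₃ + y₄) 0 (y₅ + y₄) 0 0 (-2 * y₄) 0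
    <;> first | linarith | (rw [h]; ring_nf)
  rcases le_total y₅ 0 with h5 | h5
  · apply mem_tableCone_of_pair hg (x - y₅) (y₂ + y₅) (y₃ + y₅) (y₄ + y₅) 0 0 0 0 (-2 * y₅)
    <;> first | linarith | (rw [h]; ring_nf)
  apply mem_tableCone_of_pair hg x y₂ y₃ y₄ y₅ 0 0 0 0
    <;> first | linarith | (rw [h]; ring_nf)

lemma mem_tableCone_of_isBdryPoint_triple (hδ : IsBdryPoint {σ 0, σ 1, σ 2} δ) {c : Cycle δ.1}
    (hc : cls c ∈ NM1 δ.1) : cls (pushCycle δ c) ∈ tableCone k := by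
  rw [← map_triple] at hδ
  have hg := isBdryVec_pushCycle hδ c
  have hn : ∀ S ∈ ({{0, 1}, {3, 4}} : Finset (Marks)),
      0 ≤ bdryNum σ (pushCycle δ c) S := fun S hS => by
    have h : ∀ S ∈ ({{0, 1}, {3, 4}} : Finset (Marks)), 2 ≤ S.card ∧ S.card ≤ 4 ∧
        ({0, 1, 2} : Marks) ≠ S ∧ ({0, 1, 2} : Marks) ≠ Sᶜ := by decide +kernel
    have ⟨h1, h2, h3, h4⟩ := h S hS
    exact bdryNum_nonneg hδ hc h1 h2 h3 h4
  have ⟨x, y, h⟩ := hg.triple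
  have h' := h
  simp only [tripleList, List.map_cons, List.map_nil, List.cons.injEq, and_true] at h'
  have hx : 0 ≤ x := h'.2.1 ▸ hn {0, 1} (by simp)
  have hy : 0 ≤ y := h'.2.2.2.2.1 ▸ hn {3, 4} (by simp)
  have n1 : [σ 0, σ 1, σ 2].Nodup := by simp
  have n2 : [σ 3, σ 4, σ 5].Nodup := by simp
  have e : cls (pushCycle δ c) = x • (bdryClasses k).B (σ 3) (σ 4) (σ 5) +
      y • (bdryClasses k).B (σ 0) (σ 1) (σ 2) := by
    refine cls_eq_of_bdryNum hg toFinset_tripleList (f := fun T => x * vecB 3 4 5 T +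
      y * vecB 0 1 2 T) (fun S hS h => ?_) ?_ (fun S hS hS' => ?_)
    · have hz : ∀ S ∈ bdrySets, Crosses S {0, 1, 2} → vecB 3 4 5 S = 0 ∧ vecB 0 1 2 S = 0 := by
        decide +kernel
      simp [hz S hS h]
    · rw [h]
      simp only [tripleList, List.map_cons, List.map_nil, List.cons.injEq, and_true]
      refine ⟨?_, ?_, ?_, ?_, ?_, ?_, ?_⟩ <;> (simp [vecB, sideCard]; try ring)
    · simp only [map_add, map_smul, smul_eq_mul, pairing_map hS hS' (bdryClasses_B n1).2,
        pairing_map hS hS' (bdryClasses_B n2).2, (vec_map σ _ _ _ S).2.2.1]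
  rw [e]
  exact add_mem ((tableCone k).smul_mem hx (mem_B n2)) ((tableCone k).smul_mem hy (mem_B n1))

lemma relNM1_eq_tableCone : relNM1 (Mbar06 k) (boundaryDivisors k) = tableCone k := by
  refine le_antisymm (Submodule.span_le.mpr ?_) (Submodule.span_le.mpr ?_)
  · rintro _ ⟨δ, hδ, c, hc, rfl⟩
    have ⟨S, hS, h⟩ := mem_boundaryDivisors_iff.mp hδ
    obtain ⟨i, j, l, m, a, b, hn, rfl | rfl⟩ := exists_nodup_of_card hS
    · obtain ⟨σ, rfl, rfl, -⟩ := exists_perm hn; exact mem_tableCone_of_isBdryPoint_pair h hc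
    · obtain ⟨σ, rfl, rfl, rfl, -⟩ := exists_perm hn; exact mem_tableCone_of_isBdryPoint_triple h hc
  · rintro _ ((⟨i, j, hn, rfl⟩ | ⟨i, j, l, hn, rfl⟩) | ⟨i, j, l, hn, rfl⟩)
    · have ⟨⟨δ, hδ, h⟩, _⟩ := bdryClasses_A (k := k) hn
      exact Submodule.subset_span ⟨δ, mem_boundaryDivisors_iff.mpr ⟨_, Or.inl (Finset.card_pair
        (by simpa using hn)), hδ⟩, h⟩
    · have ⟨⟨δ, hδ, h⟩, _⟩ := bdryClasses_A' (k := k) hn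
      exact Submodule.subset_span ⟨δ, mem_boundaryDivisors_iff.mpr ⟨_, Or.inl (Finset.card_pair
        (by grind)), hδ⟩, h⟩
    · have ⟨⟨δ, hδ, h⟩, _⟩ := bdryClasses_B (k := k) hn
      exact Submodule.subset_span ⟨δ, mem_boundaryDivisors_iff.mpr
        ⟨_, Or.inr (Finset.card_eq_three.mpr ⟨_, _, _, by grind, by grind, by grind, rfl⟩), hδ⟩, h⟩

lemma tableA_eq : ∀ row ∈ tableA, [row.1, row.2.1].Nodup ∧
    ∀ n, M06.basisVec (vecA row.1 row.2.1) n = row.2.2 n := by decide +kernel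

lemma tableA'_eq : ∀ row ∈ tableA', [row.1, row.2.1, row.2.2.1].Nodup ∧
    ∀ n, M06.basisVec (vecA' row.1 row.2.1 row.2.2.1) n = row.2.2.2 n := by decide +kernel

lemma tableB_eq : ∀ row ∈ tableB, [row.1, row.2.1, row.2.2.1].Nodup ∧
    ∀ n, M06.basisVec (vecB row.1 row.2.1 row.2.2.1) n = row.2.2.2 n := by decide +kernel

end MainTheorem
end
end M06

theorem mainTheorem4 (k : Type u) [Field k] [IsAlgClosed k] :
    ∃ (c : BoundaryClasses k) (L : CartierDivisor (Mbar06 k))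
      (E : Finset (Fin 6) → CartierDivisor (Mbar06 k)),
      -- the classes are those of the general fibres and of the pull-backs of general lines
      c.IsGeometric ∧
      -- the divisors `L`, `E_i`, `E_{ij}`
      IsHyperplanePullback L ∧
      (∀ S : Finset (Fin 6), S.card = 2 ∨ S.card = 3 → (E S).IsDivisorOf (boundary k S)) ∧
      -- the classes are the ones in the tables
      (∀ row ∈ tableA, ∀ n : Fin 16,
        (basisDivisors L E n).pairing (c.A row.1 row.2.1) = (row.2.2 n : ℝ)) ∧
      (∀ row ∈ tableA', ∀ n : Fin 16,
        (basisDivisors L E n).pairing (c.A' row.1 row.2.1 row.2.2.1) = (row.2.2.2 n : ℝ)) ∧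
      (∀ row ∈ tableB, ∀ n : Fin 16,
        (basisDivisors L E n).pairing (c.B row.1 row.2.1 row.2.2.1) = (row.2.2.2 n : ℝ)) ∧
      -- generation of the cone
      relNM1 (Mbar06 k) (boundaryDivisors k) =
        PointedCone.hull ℝ
          ({γ | ∃ i j : Fin 6, [i, j].Nodup ∧ γ = c.A i j} ∪
            {γ | ∃ i j l : Fin 6, [i, j, l].Nodup ∧ γ = c.A' i j l} ∪
            {γ | ∃ i j l : Fin 6, [i, j, l].Nodup ∧ γ = c.B i j l}) ∧
      -- redundancy of the remaining classes
      (∀ i j l : Fin 6, [i, j, l].Nodup →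
        c.C i j = c.A' i j l + c.B i j l ∧ c.C' i j l = c.A i j + c.B i j l) := by
  refine ⟨bdryClasses k, hyperplaneDiv k, bdryDiv k, bdryClasses_isGeometric,
    hyperplaneDiv_isHyperplanePullback, fun S hS => bdryDiv_isDivisorOf hS, fun row hr n => ?_,
    fun row hr n => ?_, fun row hr n => ?_, relNM1_eq_tableCone, fun i j l h => bdryClasses_C h⟩
  · rw [(bdryClasses_A (tableA_eq row hr).1).2.basisVec, (tableA_eq row hr).2]
  · rw [(bdryClasses_A' (tableA'_eq row hr).1).2.basisVec, (tableA'_eq row hr).2]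
  · rw [(bdryClasses_B (tableB_eq row hr).1).2.basisVec, (tableB_eq row hr).2]
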